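/- **Poics.** A *poic* is a pair $(\sigma,N)$, with $N$ a free abelian group of finite rank and $\sigma\subseteq N_{\mathbb R}$ a non-empty finite intersection of open and closed half-spaces $\{f>0\}$, $\{f\ge 0\}$ with $f\in N^\vee$, which spans $N_{\mathbb R}$; write $N^\sigma=N$ and $d(\sigma)=\dim \sigma$. A *face* of $\sigma$ is a non-empty set $\tau=\sigma\cap\{f\ge 0\}$ with $f\in N^\vee$, $f\le 0$ on $\sigma$, taken with the lattice $N\cap \mathrm{Lin}(\tau)$; the relative interior $\sigma^0$ is the set of points of $\sigma$ in no proper face. A morphism of poics is an integral linear map that maps one cone into the other; it is a *face-embedding* if it identifies its source with a face of its target. **Poic-complexes and poic-spaces.** A *poic-space* is a functor $\mathcal X\colon C_{\mathcal X}\to\mathrm{POIC}$, with $C_{\mathcal X}$ essentially finite with finite hom-sets, which maps every morphism to a face-embedding and such that every face of $\mathcal X(x)$ comes from a morphism $w\to x$, unique up to isomorphism over $x$. It is a *poic-complex* if $C_{\mathcal X}$ is thin. The objects are called cones, $[\mathcal X](k)$ is the set of isomorphism classes of $k$-dimensional cones, and $\mathcal X$ is *pure of dimension $n$* if every cone has a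 morphism to an $n$-dimensional cone. A *morphism* $F\colon\mathcal X\to\mathcal Y$ is a functor $F\colon C_{\mathcal X}\to C_{\mathcal Y}$ with a natural transformation $F_x\colon\mathcal X(x)\to\mathcal Y(F(x))$ such that no image $F_x(\mathcal X(x))$ lies in a proper face of $\mathcal Y(F(x))$. A *linear structure* on a poic-complex $\Phi$ is a morphism $X\colon\Phi\to\underline{(N_X)_{\mathbb R}}$ to the poic-complex consisting of the single cone $((N_X)_{\mathbb R},N_X)$. **Minkowski weights.** A $k$-weight on $\Phi$ is a function $\omega\colon[\Phi](k)\to\mathbb Z$. It belongs to the group $M_k(\Phi_X)$ of Minkowski weights if, for every cone $s$ of dimension $k-1$, $\sum_{[s\to t]}\omega([t])\,u_{[s\to t]}=0$ in $N_X/X_s(N^s)$, where the sum is over the isomorphism classes of morphisms $s\to t$ with $d(t)=k$, and $u_{[s\to t]}$ is the image under $X_t$ of the generator of $N^t/N^s$ that lies in the projection of $N^t\cap\Phi(t)$. **Subdivisions.** A *subdivision* $S\colon\Upsilon\to\Phi$ of poic-complexes is a morphism such that: (i) the functor is essentially surjective, all lattice maps $S_t$ are injective, and $S_t$ is an isomorphism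 of lattices if $d(t)=d(S(t))$; (ii) for every cone $s$ of $\Phi$, $\Phi(s)^0$ is the disjoint union of the images of the relative interiors of the cones $t$ of $\Upsilon$ with $S(t)\cong s$, and such cones with the same image are isomorphic; (iii) for every cone $t$ of $\Upsilon$ and every morphism $s\to S(t)$ there is $q\to t$ in $\Upsilon$ with $S(q\to t)\cong (s\to S(t))$. For $S(t)\cong s$ put $S^0(t)=S_t(\Upsilon(t))\cap\Phi(s)^0$, and let $S^{-1}(s)$ be the set of all these cones. The pullback $S^*\omega$ of a $k$-weight is $[t]\mapsto\omega([S(t)])$ if $d(S(t))=k$ and $0$ otherwise. **Poic-fibrations and their cycles.** A *poic-fibration* $\pi\colon\Phi\to\mathcal X$ is a morphism from a poic-complex to a poic-space such that: the functor is essentially surjective; every $\pi_p$ induces an isomorphism (of lattices and) of the relative interiors of $\Phi(p)$ and $\mathcal X(\pi(p))$; and for every morphism $f\colon\pi(p)\to x$ there are $h\colon p\to q$ and an isomorphism $e\colon\pi(q)\to x$ with $f=e\circ\pi(h)$, and $(h,e)$ is unique up to isomorphism. Let $X$ be a linear structure on $\Phi$. A subdivision $S\colon\Upsilon\to\Phi$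 is *$\pi$-compatible* if, for all cones $p,q$ of $\Phi$, every isomorphism $f\colon\pi(p)\to\pi(q)$ carries $\pi_p(S^{-1}(p))$ onto $\pi_q(S^{-1}(q))$. A Minkowski weight $\omega\in M_k(\Upsilon_{X\circ S})$ is *$\pi$-equivariant* if it takes the same value at any two $k$-dimensional cones $t,t'$ for which such an $f$ carries $\pi_p(S^0(t))$ to $\pi_q(S^0(t'))$. The group $Z_k(\mathcal X_{\pi,X})$ of tropical $k$-cycles of $\pi$ is the colimit, along the pullback maps, of the groups of $\pi$-equivariant Minkowski weights over the opposite of the category of all $\pi$-compatible subdivisions $S$ (whose morphisms $S'\to S$ are the subdivisions $Q$ with $S\circ Q=S'$). If $\Phi$ is pure of dimension $n$, the poic-fibration $\pi$ is *irreducible* if $Z_n(\mathcal X_{\pi,X})$ is a free abelian group of rank $1$. **Graphs.** A discrete graph $G$ is a finite set $F(G)$ with an idempotent map $r$ and an involution $\iota$ with $\iota r=r$; the vertices are the elements of the image of $r$, the edges and the legs are the $\iota$-orbits of size $2$ and $1$ in the complement, the genus of a connected graph is $\#E-\#V+1$, a tree is a connected graph of genus $0$, and the valency of $v$ is $\#r^{-1}(v)-1$.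 For a finite set $A$ and $g\ge 0$ with $2g+\#A>2$, the objects of $\mathbb G_{g,A}$ are the connected graphs of genus $g$, with vertices of valency at least $3$ and with a bijection $a\mapsto\ell_a$ from $A$ to the legs. Its morphisms are the contractions compatible with the markings, that is, the maps commuting with $r$, $\iota$ and the markings such that the inverse image of every vertex is a legless tree, and that of every edge or leg is a single edge or leg. Let $\sigma_G$ be the poic of all $(x_e)\in\mathbb R_{\ge0}^{E(G)}$ for which the edges with $x_e=0$ form a forest, with lattice $\mathbb Z^{E(G)}$. A contraction $G\to H$ gives a face-embedding $\sigma_H\to\sigma_G$ (length $0$ on contracted edges), and $G\mapsto\sigma_G$ defines the poic-space $\mathrm M^{\mathrm{trop}}_{g,A}\colon\mathbb G_{g,A}^{\mathrm{op}}\to\mathrm{POIC}$. **The spanning tree fibration.** Let $B=A\sqcup\{1,\dots,g,1^*,\dots,g^*\}$. Let $\mathrm{ST}_{g,A}\colon\mathbb G_{0,B}^{\mathrm{op}}\to\mathrm{POIC}$ be the functor $T\mapsto\sigma_T\times\mathbb R_{>0}^g$ (lattice $\mathbb Z^{E(T)}\times\mathbb Z^g$). Let $Q_B$ be the cokernel of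 $\mathbb R^B\to\mathbb R^{\binom B2}$, $(x_i)\mapsto(x_i+x_j)_{\{i,j\}}$, and let $N_{\mathrm{dist}}\subset Q_B$ be the lattice generated by the classes $v_I$, $1<\#I<\#B-1$, of the vectors with entry $1$ at $\{i,j\}$ if exactly one of $i,j$ lies in $I$, and $0$ otherwise. The linear structure $D_{g,A}\colon\mathrm{ST}_{g,A}\to\underline{(N_{\mathrm{dist}})_{\mathbb R}}$ is the projection to $\sigma_T$ followed by the distance map, which sends a metric tree to the class of the vector of distances between the legs $\ell_i$, $\ell_j$. For a tree $T$ in $\mathbb G_{0,B}$ let $\mathrm{st}_{g,A}(T)\in\mathbb G_{g,A}$ be the graph obtained by joining, for $1\le i\le g$, the legs $\ell_i,\ell_{i^*}$ to an edge $e_i$. This functor, with the maps $\sigma_T\times\mathbb R^g_{>0}\to\sigma_{\mathrm{st}_{g,A}(T)}$ that take the $i$-th coordinate of $\mathbb R^g_{>0}$ as length of $e_i$ and keep the other lengths, is a morphism $\mathrm{st}_{g,A}\colon\mathrm{ST}_{g,A}\to\mathrm M^{\mathrm{trop}}_{g,A}$. **Proposition.** Let $A$ be a finite set and $g\ge0$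 an integer with $2g+\#A-2>0$. Then $\mathrm{ST}_{g,A}$ is a poic-complex, pure of dimension $3g+\#A-3$; and $\mathrm{st}_{g,A}$, with the linear structure $D_{g,A}$ on $\mathrm{ST}_{g,A}$, is a poic-fibration which is irreducible: the group $Z_{3g+\#A-3}\big((\mathrm M^{\mathrm{trop}}_{g,A})_{\mathrm{st}_{g,A},D_{g,A}}\big)$ of its top-dimensional tropical cycles is a free abelian group of rank $1$. -/

import Mathlib

open CategoryTheory
open scoped TensorProduct DirectSum

noncomputable section
namespace Trop

/-! ### Partially open integral cones -/

/-- The real linear functional on `N_ℝ = ℝ ⊗ N` induced by an integral functional on `N`. -/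
def realFunctional {N : Type} [AddCommGroup N] (f : N →ₗ[ℤ] ℤ) : (ℝ ⊗[ℤ] N) →ₗ[ℝ] ℝ :=
  (TensorProduct.AlgebraTensorModule.rid ℤ ℝ ℝ).toLinearMap ∘ₗ f.baseChange ℝ

@[simp] lemma realFunctional_tmul {N : Type} [AddCommGroup N] (f : N →ₗ[ℤ] ℤ) (a : ℝ) (n : N) :
    realFunctional f (a ⊗ₜ n) = f n * a := by
  simp [realFunctional]

lemma realFunctional_comp {N M : Type} [AddCommGroup N] [AddCommGroup M]
    (f : M →ₗ[ℤ] ℤ) (φ : N →ₗ[ℤ] M) (x : ℝ ⊗[ℤ] N) :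
    realFunctional (f ∘ₗ φ) x = realFunctional f (φ.baseChange ℝ x) := by
  induction x using TensorProduct.induction_on with
  | zero => simp
  | tmul a n => simp
  | add x y hx hy => simp [hx, hy]

/-- A poic: a free abelian group `N` of finite rank together with a non-empty full-dimensional
finite intersection of closed and open integral half-spaces of `N_ℝ`. -/
structure Poic where
  N : Type
  [grp : AddCommGroup N]
  [free : Module.Free ℤ N]
  [fin : Module.Finite ℤ N]
  carrier : Set (ℝ ⊗[ℤ] N)
  nonempty : carrier.Nonempty
  polyhedral : ∃ P Q : Set (N →ₗ[ℤ] ℤ), P.Finite ∧ Q.Finite ∧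
    carrier = {x | (∀ f ∈ P, 0 ≤ realFunctional f x) ∧ ∀ f ∈ Q, 0 < realFunctional f x}
  full : Submodule.span ℝ carrier = ⊤

attribute [instance] Poic.grp Poic.free Poic.fin

namespace Poic

/-- A morphism of poics: an integral linear map whose real extension maps one cone into the
other. -/
@[ext] structure Hom (σ ξ : Poic) where
  lin : σ.N →ₗ[ℤ] ξ.N
  maps : ∀ x ∈ σ.carrier, lin.baseChange ℝ x ∈ ξ.carrier

instance : Category Poic where
  Hom := Hom
  id σ := ⟨LinearMap.id, fun x hx => by simpa using hx⟩
  comp φ ψ := ⟨ψ.lin ∘ₗ φ.lin, fun x hx => by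
    rw [LinearMap.baseChange_comp]; exact ψ.maps _ (φ.maps _ hx)⟩

@[ext] lemma hom_ext {σ ξ : Poic} {φ ψ : σ ⟶ ξ} (h : φ.lin = ψ.lin) : φ = ψ := Hom.ext h

@[simp] lemma id_lin (σ : Poic) : (𝟙 σ : σ ⟶ σ).lin = LinearMap.id := rfl
@[simp] lemma comp_lin {σ ξ ζ : Poic} (φ : σ ⟶ ξ) (ψ : ξ ⟶ ζ) :
    (φ ≫ ψ).lin = ψ.lin ∘ₗ φ.lin := rfl

/-- The real linear map underlying a morphism of poics. -/
def real {σ ξ : Poic} (φ : σ ⟶ ξ) : (ℝ ⊗[ℤ] σ.N) →ₗ[ℝ] (ℝ ⊗[ℤ] ξ.N) := φ.lin.baseChange ℝ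

lemma real_comp_app {σ ξ ζ : Poic} (φ : σ ⟶ ξ) (ψ : ξ ⟶ ζ) (x : ℝ ⊗[ℤ] σ.N) :
    real (φ ≫ ψ) x = real ψ (real φ x) := by
  simp [real, LinearMap.baseChange_comp]

/-- `d(σ)`, the dimension of the linear span of the cone. -/
def dim (σ : Poic) : ℕ := Module.finrank ℝ (Submodule.span ℝ σ.carrier)

/-- `τ` is a face of `σ`: a non-empty set of the form `σ ∩ H_f`, where `σ ⊆ H_{-f}`. -/
def IsFace (σ : Poic) (τ : Set (ℝ ⊗[ℤ] σ.N)) : Prop :=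
  τ.Nonempty ∧ ∃ f : σ.N →ₗ[ℤ] ℤ, (∀ x ∈ σ.carrier, realFunctional f x ≤ 0) ∧
    τ = {x ∈ σ.carrier | 0 ≤ realFunctional f x}

/-- The relative interior of `σ`: the points that lie in no proper face. -/
def relint (σ : Poic) : Set (ℝ ⊗[ℤ] σ.N) :=
  {x ∈ σ.carrier | ∀ τ, σ.IsFace τ → x ∈ τ → τ = σ.carrier}

/-- `φ` identifies `σ` with a face `(τ, N^ξ ∩ Lin τ)` of `ξ`. -/
def IsFaceEmbedding {σ ξ : Poic} (φ : σ ⟶ ξ) : Prop :=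
  Function.Injective (real φ) ∧ ξ.IsFace (real φ '' σ.carrier) ∧
    ∀ n : ξ.N, (1 : ℝ) ⊗ₜ[ℤ] n ∈ Submodule.span ℝ (real φ '' σ.carrier) →
      n ∈ LinearMap.range φ.lin

lemma smul_mem (σ : Poic) {x} (hx : x ∈ σ.carrier) {a : ℝ} (ha : 0 < a) :
    a • x ∈ σ.carrier := by
  obtain ⟨P, Q, -, -, h⟩ := σ.polyhedral
  rw [h] at hx ⊢
  refine ⟨fun f hf => ?_, fun f hf => ?_⟩
  · rw [map_smul]; exact mul_nonneg ha.le (hx.1 f hf)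
  · rw [map_smul]; exact mul_pos ha (hx.2 f hf)

/-- The poic `(N_ℝ, N)`. -/
abbrev whole (N : Type) [AddCommGroup N] [Module.Free ℤ N] [Module.Finite ℤ N] : Poic where
  N := N
  carrier := Set.univ
  nonempty := Set.univ_nonempty
  polyhedral := ⟨∅, ∅, Set.finite_empty, Set.finite_empty, by simp⟩
  full := by simp

/-- The product of two poics. -/
abbrev prod (σ ξ : Poic) : Poic where
  N := σ.N × ξ.N
  carrier := {x | (LinearMap.fst ℤ σ.N ξ.N).baseChange ℝ x ∈ σ.carrier ∧
    (LinearMap.snd ℤ σ.N ξ.N).baseChange ℝ x ∈ ξ.carrier}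
  nonempty := by
    obtain ⟨x, hx⟩ := σ.nonempty
    obtain ⟨y, hy⟩ := ξ.nonempty
    refine ⟨(LinearMap.inl ℤ σ.N ξ.N).baseChange ℝ x + (LinearMap.inr ℤ σ.N ξ.N).baseChange ℝ y,
      ?_, ?_⟩ <;>
    simpa [← LinearMap.comp_apply, ← LinearMap.baseChange_comp]
  polyhedral := by
    obtain ⟨P, Q, hP, hQ, h⟩ := σ.polyhedral
    obtain ⟨P', Q', hP', hQ', h'⟩ := ξ.polyhedral
    refine ⟨(fun f => f ∘ₗ LinearMap.fst ℤ σ.N ξ.N) '' P ∪ (fun f => f ∘ₗ LinearMap.snd ℤ σ.N ξ.N) '' P',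
      (fun f => f ∘ₗ LinearMap.fst ℤ σ.N ξ.N) '' Q ∪ (fun f => f ∘ₗ LinearMap.snd ℤ σ.N ξ.N) '' Q',
      (hP.image _).union (hP'.image _), (hQ.image _).union (hQ'.image _), ?_⟩
    ext x
    rw [h, h']
    simp only [Set.mem_ofPred_eq, Set.mem_union, Set.mem_image, or_imp, forall_and,
      forall_exists_index, and_imp, forall_apply_eq_imp_iff₂, realFunctional_comp]
    tauto
  full := by
    set C := {x : ℝ ⊗[ℤ] (σ.N × ξ.N) | (LinearMap.fst ℤ σ.N ξ.N).baseChange ℝ x ∈ σ.carrier ∧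
      (LinearMap.snd ℤ σ.N ξ.N).baseChange ℝ x ∈ ξ.carrier} with hC
    have key : ∀ x ∈ σ.carrier, ∀ y ∈ ξ.carrier, (LinearMap.inl ℤ σ.N ξ.N).baseChange ℝ x +
        (LinearMap.inr ℤ σ.N ξ.N).baseChange ℝ y ∈ Submodule.span ℝ C := by
      intro x hx y hy
      apply Submodule.subset_span
      constructor <;> simpa [← LinearMap.comp_apply, ← LinearMap.baseChange_comp]
    have h1 : (⊤ : Submodule ℝ _) ≤
        (Submodule.span ℝ C).comap ((LinearMap.inl ℤ σ.N ξ.N).baseChange ℝ) := by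
      rw [← σ.full, Submodule.span_le]
      intro x hx
      obtain ⟨y, hy⟩ := ξ.nonempty
      have := Submodule.sub_mem _ (key _ (σ.smul_mem hx two_pos) y hy) (key x hx y hy)
      simpa [two_smul] using this
    have h2 : (⊤ : Submodule ℝ _) ≤
        (Submodule.span ℝ C).comap ((LinearMap.inr ℤ σ.N ξ.N).baseChange ℝ) := by
      rw [← ξ.full, Submodule.span_le]
      intro y hy
      obtain ⟨x, hx⟩ := σ.nonempty
      have := Submodule.sub_mem _ (key x hx _ (ξ.smul_mem hy two_pos)) (key x hx y hy)
      simpa [two_smul] using this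
    rw [eq_top_iff]
    intro z _
    have hz : z = (LinearMap.inl ℤ σ.N ξ.N).baseChange ℝ ((LinearMap.fst ℤ σ.N ξ.N).baseChange ℝ z)
        + (LinearMap.inr ℤ σ.N ξ.N).baseChange ℝ ((LinearMap.snd ℤ σ.N ξ.N).baseChange ℝ z) := by
      induction z using TensorProduct.induction_on with
      | zero => simp
      | tmul a n => simp [← TensorProduct.tmul_add]
      | add x y hx hy =>
        rw [map_add, map_add, map_add, map_add]
        conv_lhs => rw [hx trivial, hy trivial]
        abel
    rw [hz]
    exact Submodule.add_mem _ (h1 (Submodule.mem_top)) (h2 (Submodule.mem_top))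

lemma fst_prodMap {N M N' M' : Type} [AddCommGroup N] [AddCommGroup M] [AddCommGroup N']
    [AddCommGroup M'] (φ : N →ₗ[ℤ] N') (ψ : M →ₗ[ℤ] M') (x : ℝ ⊗[ℤ] (N × M)) :
    (LinearMap.fst ℤ N' M').baseChange ℝ ((φ.prodMap ψ).baseChange ℝ x) =
      φ.baseChange ℝ ((LinearMap.fst ℤ N M).baseChange ℝ x) := by
  rw [← LinearMap.comp_apply, ← LinearMap.comp_apply, ← LinearMap.baseChange_comp,
    ← LinearMap.baseChange_comp]
  rfl

lemma snd_prodMap {N M N' M' : Type} [AddCommGroup N] [AddCommGroup M] [AddCommGroup N']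
    [AddCommGroup M'] (φ : N →ₗ[ℤ] N') (ψ : M →ₗ[ℤ] M') (x : ℝ ⊗[ℤ] (N × M)) :
    (LinearMap.snd ℤ N' M').baseChange ℝ ((φ.prodMap ψ).baseChange ℝ x) =
      ψ.baseChange ℝ ((LinearMap.snd ℤ N M).baseChange ℝ x) := by
  rw [← LinearMap.comp_apply, ← LinearMap.comp_apply, ← LinearMap.baseChange_comp,
    ← LinearMap.baseChange_comp]
  rfl

/-- The product of two morphisms of poics. -/
def prodMap {σ σ' ξ ξ' : Poic} (φ : σ ⟶ σ') (ψ : ξ ⟶ ξ') : prod σ ξ ⟶ prod σ' ξ' where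
  lin := φ.lin.prodMap ψ.lin
  maps x hx := by
    refine ⟨?_, ?_⟩
    · exact (fst_prodMap φ.lin ψ.lin x).symm ▸ φ.maps _ hx.1
    · exact (snd_prodMap φ.lin ψ.lin x).symm ▸ ψ.maps _ hx.2

/-- The coordinate `x_i` of a point of `(ℤ^ι)_ℝ`. -/
def coord {ι : Type} (i : ι) : (ℝ ⊗[ℤ] (ι →₀ ℤ)) →ₗ[ℝ] ℝ := realFunctional (Finsupp.lapply i)

/-- The points of the orthant `ℝ_{≥0}^ι` whose set of vanishing coordinates satisfies a
property `P` that holds for `∅` and is inherited by subsets. -/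
abbrev suborthant (ι : Type) [Finite ι] (P : Set ι → Prop) (h0 : P ∅)
    (hP : ∀ s t, s ⊆ t → P t → P s) : Poic where
  N := ι →₀ ℤ
  carrier := {x | (∀ i, 0 ≤ coord i x) ∧ P {i | coord i x = 0}}
  nonempty := by
    have := Fintype.ofFinite ι
    refine ⟨∑ i, (1 : ℝ) ⊗ₜ Finsupp.single i 1, ?_, ?_⟩
    · intro i; classical simp [coord, Finsupp.single_apply]
    · convert h0
      ext i
      classical simp [coord, Finsupp.single_apply]
  polyhedral := by
    have := Fintype.ofFinite ι
    classical
    refine ⟨Set.range fun i => Finsupp.lapply i,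
      (fun C : Finset ι => ∑ i ∈ C, Finsupp.lapply i) '' {C | ¬ P (C : Set ι)},
      Set.finite_range _, Set.toFinite _, ?_⟩
    have hsum : ∀ (C : Finset ι) (x : ℝ ⊗[ℤ] (ι →₀ ℤ)),
        realFunctional (∑ i ∈ C, Finsupp.lapply i) x = ∑ i ∈ C, coord i x := by
      intro C x
      induction x using TensorProduct.induction_on with
      | zero => simp
      | tmul a n => simp [coord, Finset.sum_mul]
      | add x y hx hy => simp [hx, hy, Finset.sum_add_distrib]
    ext x
    simp only [Set.mem_ofPred_eq, Set.forall_mem_range, Set.forall_mem_image, hsum]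
    constructor
    · rintro ⟨h1, h2⟩
      refine ⟨h1, fun C hC => lt_of_le_of_ne (Finset.sum_nonneg fun i _ => h1 i) fun h => hC ?_⟩
      refine hP _ _ (fun i hi => ?_) h2
      exact (Finset.sum_eq_zero_iff_of_nonneg fun i _ => h1 i).1 h.symm i hi
    · rintro ⟨h1, h2⟩
      refine ⟨h1, by_contra fun h => ?_⟩
      have := h2 (x := Finset.univ.filter fun i => coord i x = 0) (by simpa using h)
      rw [Finset.sum_eq_zero (by simp)] at this
      exact this.false
  full := by
    have := Fintype.ofFinite ι
    classical
    set C := {x : ℝ ⊗[ℤ] (ι →₀ ℤ) | (∀ i, 0 ≤ coord i x) ∧ P {i | coord i x = 0}} with hC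
    have hpos : ∀ x : ℝ ⊗[ℤ] (ι →₀ ℤ), (∀ i, 0 < coord i x) → x ∈ C := by
      intro x hx
      refine ⟨fun i => (hx i).le, ?_⟩
      convert h0
      ext i
      simpa using (hx i).ne'
    have hu : ∀ i : ι, ((1 : ℝ) ⊗ₜ[ℤ] (Finsupp.single i (1 : ℤ))) ∈ Submodule.span ℝ C := by
      intro i
      have h1 : (∑ j, (1 : ℝ) ⊗ₜ[ℤ] (Finsupp.single j (1 : ℤ) : ι →₀ ℤ)) ∈ C :=
        hpos _ fun j => by simp [coord, Finsupp.single_apply]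
      have h2 : (∑ j, (1 : ℝ) ⊗ₜ[ℤ] (Finsupp.single j (1 : ℤ) : ι →₀ ℤ)) +
          (1 : ℝ) ⊗ₜ[ℤ] (Finsupp.single i (1 : ℤ)) ∈ C :=
        hpos _ fun j => by
          simp only [coord, map_add, map_sum, realFunctional_tmul, Finsupp.lapply_apply,
            Finsupp.single_apply]
          simp
          split_ifs <;> norm_num
      have := Submodule.sub_mem (Submodule.span ℝ C) (Submodule.subset_span h2)
        (Submodule.subset_span h1)
      simpa using this
    rw [eq_top_iff]
    intro z _
    induction z using TensorProduct.induction_on with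
    | zero => exact Submodule.zero_mem _
    | tmul a n =>
      induction n using Finsupp.induction_linear with
      | zero => simp
      | add x y hx hy => rw [TensorProduct.tmul_add]; exact Submodule.add_mem _ (hx trivial) (hy trivial)
      | single i b =>
        have : (a ⊗ₜ[ℤ] (Finsupp.single i b) : ℝ ⊗[ℤ] (ι →₀ ℤ)) =
            (a * b) • ((1 : ℝ) ⊗ₜ[ℤ] (Finsupp.single i (1 : ℤ))) := by
          rw [TensorProduct.smul_tmul', smul_eq_mul, mul_one, mul_comm a, ← zsmul_eq_mul,
            TensorProduct.smul_tmul, Finsupp.smul_single, smul_eq_mul, mul_one]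
        rw [this]
        exact Submodule.smul_mem _ _ (hu i)
    | add x y hx hy => exact Submodule.add_mem _ (hx trivial) (hy trivial)

end Poic

universe u₁ v₁ u₂ v₂ u₃ v₃

/-! ### Poic-complexes, poic-spaces and their morphisms -/

/-- The set `[C]` of isomorphism classes of objects. -/
abbrev IsoClass (C : Type u₁) [Category.{v₁} C] : Type u₁ := Quotient (isIsomorphicSetoid C)

/-- The isomorphism class of an object. -/
abbrev isoClass {C : Type u₁} [Category.{v₁} C] (q : C) : IsoClass C :=
  Quotient.mk (isIsomorphicSetoid C) q

/-- The map on isomorphism classes induced by a functor. -/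
def mapIsoClass {C : Type u₁} [Category.{v₁} C] {D : Type u₂} [Category.{v₂} D] (F : C ⥤ D) :
    IsoClass C → IsoClass D :=
  Quotient.map F.obj fun _ _ ⟨i⟩ => ⟨F.mapIso i⟩

/-- Morphisms go to face-embeddings, and every face of every cone comes from a morphism that is
unique up to (compatible) isomorphism. -/
structure HasFaces {C : Type u₁} [Category.{v₁} C] (Φ : C ⥤ Poic) : Prop where
  faceEmbedding : ∀ {p q : C} (f : p ⟶ q), Poic.IsFaceEmbedding (Φ.map f)
  face : ∀ (q : C) (τ : Set (ℝ ⊗[ℤ] (Φ.obj q).N)), (Φ.obj q).IsFace τ →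
    ∃ (p : C) (f : p ⟶ q), Poic.real (Φ.map f) '' (Φ.obj p).carrier = τ ∧
      ∀ (p' : C) (f' : p' ⟶ q), Poic.real (Φ.map f') '' (Φ.obj p').carrier = τ →
        ∃ i : p ≅ p', i.hom ≫ f' = f

/-- A poic-complex: a functor to poics with faces as above, whose source is thin and essentially
finite. -/
structure IsPoicComplex {C : Type u₁} [Category.{v₁} C] (Φ : C ⥤ Poic) : Prop
    extends HasFaces Φ where
  thin : Quiver.IsThin C
  finite : Finite (IsoClass C)

/-- A poic-space: a functor to poics with faces as above, whose source is essentially finite with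
finite hom-sets. -/
structure IsPoicSpace {C : Type u₁} [Category.{v₁} C] (Φ : C ⥤ Poic) : Prop
    extends HasFaces Φ where
  finiteHom : ∀ p q : C, Finite (p ⟶ q)
  finite : Finite (IsoClass C)

/-- `Φ` is pure of dimension `n`. -/
def IsPure {C : Type u₁} [Category.{v₁} C] (Φ : C ⥤ Poic) (n : ℕ) : Prop :=
  ∀ p : C, ∃ q : C, Nonempty (p ⟶ q) ∧ (Φ.obj q).dim = n

/-- Morphisms of poic-complexes and of poic-spaces. -/
structure Mor {C : Type u₁} [Category.{v₁} C] {D : Type u₂} [Category.{v₂} D]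
    (Φ : C ⥤ Poic) (Ψ : D ⥤ Poic) where
  F : C ⥤ D
  η : Φ ⟶ F ⋙ Ψ
  notInFace : ∀ (p : C) (τ : Set (ℝ ⊗[ℤ] (Ψ.obj (F.obj p)).N)), (Ψ.obj (F.obj p)).IsFace τ →
    Poic.real (η.app p) '' (Φ.obj p).carrier ⊆ τ → τ = (Ψ.obj (F.obj p)).carrier

/-- Composition of morphisms. -/
def Mor.comp {C : Type u₁} [Category.{v₁} C] {D : Type u₂} [Category.{v₂} D]
    {E : Type u₃} [Category.{v₃} E] {Φ : C ⥤ Poic} {Ψ : D ⥤ Poic} {Ω : E ⥤ Poic}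
    (S : Mor Φ Ψ) (T : Mor Ψ Ω) : Mor Φ Ω where
  F := S.F ⋙ T.F
  η := { app := fun p => S.η.app p ≫ T.η.app (S.F.obj p) }
  notInFace p τ hτ h := by
    refine T.notInFace (S.F.obj p) τ hτ ?_
    obtain ⟨⟨y, hy⟩, f, hf, rfl⟩ := hτ
    have hface : (Ψ.obj (S.F.obj p)).IsFace
        {x ∈ (Ψ.obj (S.F.obj p)).carrier |
          0 ≤ realFunctional (f ∘ₗ (T.η.app (S.F.obj p)).lin) x} := by
      refine ⟨?_, _, fun x hx => ?_, rfl⟩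
      · obtain ⟨z, hz⟩ := (Φ.obj p).nonempty
        refine ⟨Poic.real (S.η.app p) z, (S.η.app p).maps z hz, ?_⟩
        rw [realFunctional_comp]
        have := (h ⟨z, hz, rfl⟩).2
        rw [Poic.real_comp_app] at this
        exact this
      · rw [realFunctional_comp]
        exact hf _ ((T.η.app (S.F.obj p)).maps x hx)
    have heq := S.notInFace p _ hface (by
      rintro _ ⟨z, hz, rfl⟩
      refine ⟨(S.η.app p).maps z hz, ?_⟩
      rw [realFunctional_comp]
      have := (h ⟨z, hz, rfl⟩).2
      rw [Poic.real_comp_app] at this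
      exact this)
    rintro _ ⟨x, hx, rfl⟩
    refine ⟨(T.η.app (S.F.obj p)).maps x hx, ?_⟩
    rw [← heq] at hx
    have := hx.2
    rw [realFunctional_comp] at this
    exact this

/-- The poic-complex `N_ℝ` given by the single cone `(N_ℝ, N)`. -/
abbrev underline (N : Type) [AddCommGroup N] [Module.Free ℤ N] [Module.Finite ℤ N] :
    Discrete PUnit.{1} ⥤ Poic :=
  (Functor.const _).obj (Poic.whole N)

section Weights

variable {C : Type u₁} [Category.{v₁} C]

/-- `[Φ](k)`: the isomorphism classes of `k`-dimensional cones. -/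
def cones (Φ : C ⥤ Poic) (k : ℕ) : Set (IsoClass C) :=
  {c | ∃ q : C, isoClass q = c ∧ (Φ.obj q).dim = k}

/-- `W_k(Φ)`: the `k`-dimensional weights. -/
abbrev Weight (Φ : C ⥤ Poic) (k : ℕ) : Type u₁ := cones Φ k → ℤ

variable {Φ : C ⥤ Poic} {N : Type} [AddCommGroup N] [Module.Free ℤ N] [Module.Finite ℤ N]

/-- A linear structure `X : Φ ⟶ N_ℝ`; this is its integral linear map `X_s` at the cone `s`. -/
def Mor.lin (X : Mor Φ (underline N)) (s : C) : (Φ.obj s).N →ₗ[ℤ] N := (X.η.app s).lin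

/-- The quotient `N_X / X_s(N^s)`. -/
abbrev Mor.Quot (X : Mor Φ (underline N)) (s : C) : Type := N ⧸ LinearMap.range (X.lin s)

/-- `v ∈ N^t ∩ Φ(t)`, and the class of `v` generates `N^t / N^s`. -/
def IsNormalLift {s t : C} (f : s ⟶ t) (v : (Φ.obj t).N) : Prop :=
  (1 : ℝ) ⊗ₜ[ℤ] v ∈ (Φ.obj t).carrier ∧
    LinearMap.range (Φ.map f).lin ⊔ Submodule.span ℤ {v} = ⊤

open Classical in
/-- The normal vector of `s ⟶ t`: the image in `N_X / X_s(N^s)` of the generator of `N^t / N^s`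
that lies in the projection of `N^t ∩ Φ(t)`. -/
def normalVector (X : Mor Φ (underline N)) {s t : C} (f : s ⟶ t) : X.Quot s :=
  if h : ∃ v, IsNormalLift (Φ := Φ) f v then Submodule.Quotient.mk (X.lin t h.choose) else 0

/-- The isomorphism classes of `k`-dimensional cones under `s`. As the category of a poic-complex
is thin, two morphisms `s ⟶ t`, `s ⟶ t'` are isomorphic under `s` exactly if `t ≅ t'`. -/
def Star (Φ : C ⥤ Poic) (k : ℕ) (s : C) : Type u₁ :=
  {c : IsoClass C // ∃ t : C, isoClass t = c ∧ (Φ.obj t).dim = k ∧ Nonempty (s ⟶ t)}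

/-- A cone representing an element of the star. -/
def Star.rep {k : ℕ} {s : C} (c : Star Φ k s) : C := c.2.choose

/-- The morphism from `s` to the representing cone. -/
def Star.hom {k : ℕ} {s : C} (c : Star Φ k s) : s ⟶ c.rep := c.2.choose_spec.2.2.some

/-- The underlying class of `k`-dimensional cones. -/
def Star.cone {k : ℕ} {s : C} (c : Star Φ k s) : cones Φ k :=
  ⟨c.1, c.2.choose, c.2.choose_spec.1, c.2.choose_spec.2.1⟩

/-- `ω` is `X`-balanced at `s`. -/
def BalancedAt (X : Mor Φ (underline N)) {k : ℕ} (ω : Weight Φ k) (s : C) : Prop :=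
  ∑ᶠ c : Star Φ k s, ω c.cone • normalVector X c.hom = 0

variable [Finite (IsoClass C)]

instance (k : ℕ) (s : C) : Finite (Star Φ k s) := by unfold Star; infer_instance

/-- `M_k(Φ_X)`: the `k`-dimensional Minkowski weights. -/
def minkowski (X : Mor Φ (underline N)) (k : ℕ) : AddSubgroup (Weight Φ k) where
  carrier := {ω | ∀ s : C, (Φ.obj s).dim + 1 = k → BalancedAt X ω s}
  zero_mem' s _ := by simp [BalancedAt]
  add_mem' {a b} ha hb s hs := by
    have h1 := ha s hs
    have h2 := hb s hs
    unfold BalancedAt at *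
    simp only [Pi.add_apply, add_smul]
    rw [finsum_add_distrib (Set.toFinite _) (Set.toFinite _), h1, h2, add_zero]
  neg_mem' {a} ha s hs := by
    have h1 := ha s hs
    unfold BalancedAt at *
    simp only [Pi.neg_apply, neg_smul]
    rw [finsum_neg_distrib, h1, neg_zero]

end Weights

section Cycles

variable {C : Type u₁} [Category.{v₁} C] {D : Type u₂} [Category.{v₂} D]

/-- The image in `Φ(s)` of a set of points of `Υ(t)`, where `S(t) ≅ s`. -/
def transport {Υ : C ⥤ Poic} {Φ : D ⥤ Poic} (S : Mor Υ Φ) {t : C} {s : D} (i : S.F.obj t ≅ s)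
    (K : Set (ℝ ⊗[ℤ] (Υ.obj t).N)) : Set (ℝ ⊗[ℤ] (Φ.obj s).N) :=
  Poic.real (Φ.map i.hom) '' (Poic.real (S.η.app t) '' K)

/-- Subdivisions of poic-complexes. -/
structure IsSubdivision {Υ : C ⥤ Poic} {Φ : D ⥤ Poic} (S : Mor Υ Φ) : Prop where
  essSurj : S.F.EssSurj
  injective : ∀ t : C, Function.Injective (S.η.app t).lin
  bijective : ∀ t : C, (Υ.obj t).dim = (Φ.obj (S.F.obj t)).dim →
    Function.Bijective (S.η.app t).lin
  /-- The relative interior of `Φ(s)` is the union of the images of the relative interiors. -/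
  cover : ∀ s : D, (Φ.obj s).relint =
    ⋃ (t : C) (i : S.F.obj t ≅ s), transport S i (Υ.obj t).relint
  /-- These images are pairwise disjoint or equal, and they are equal only for isomorphic cones. -/
  disjoint : ∀ (s : D) (t t' : C) (i : S.F.obj t ≅ s) (i' : S.F.obj t' ≅ s),
    Disjoint (transport S i (Υ.obj t).relint) (transport S i' (Υ.obj t').relint) ∨
      (transport S i (Υ.obj t).relint = transport S i' (Υ.obj t').relint ∧ Nonempty (t ≅ t'))
  lift : ∀ (t : C) (s : D) (f : s ⟶ S.F.obj t), ∃ (q : C) (h : q ⟶ t) (i : S.F.obj q ≅ s),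
    S.F.map h = i.hom ≫ f

/-- Poic-fibrations. -/
structure IsPoicFibration {Φ : C ⥤ Poic} {𝒳 : D ⥤ Poic} (π : Mor Φ 𝒳) : Prop where
  complex : IsPoicComplex Φ
  space : IsPoicSpace 𝒳
  essSurj : π.F.EssSurj
  /-- `π_p` induces an isomorphism of poics between the relative interiors. -/
  relint : ∀ p : C, Function.Bijective (π.η.app p).lin ∧
    Poic.real (π.η.app p) '' (Φ.obj p).relint = (𝒳.obj (π.F.obj p)).relint
  lift : ∀ (p : C) (x : D) (f : π.F.obj p ⟶ x), ∃ (q : C) (h : p ⟶ q) (e : π.F.obj q ≅ x),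
    π.F.map h ≫ e.hom = f ∧
      ∀ (q' : C) (h' : p ⟶ q') (e' : π.F.obj q' ≅ x), π.F.map h' ≫ e'.hom = f →
        ∃ k : q ≅ q', h ≫ k.hom = h' ∧ π.F.map k.hom ≫ e'.hom = e.hom

/-- The cone `S⁰(t) = S_t(Υ(t)) ∩ Φ(s)⁰`, for `S(t) ≅ s`. -/
def cell {Υ : C ⥤ Poic} {Φ : D ⥤ Poic} (S : Mor Υ Φ) {t : C} {s : D} (i : S.F.obj t ≅ s) :
    Set (ℝ ⊗[ℤ] (Φ.obj s).N) :=
  transport S i (Υ.obj t).carrier ∩ (Φ.obj s).relint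

/-- `S⁻¹(s)`: the set of all cones `S⁰(t)`. -/
def cells {Υ : C ⥤ Poic} {Φ : D ⥤ Poic} (S : Mor Υ Φ) (s : D) :
    Set (Set (ℝ ⊗[ℤ] (Φ.obj s).N)) :=
  {K | ∃ (t : C) (i : S.F.obj t ≅ s), cell S i = K}

variable {E : Type u₃} [Category.{v₃} E]

/-- `S` is `π`-compatible: every isomorphism `π(p) ≅ π(q)` carries `S⁻¹(p)` to `S⁻¹(q)`. -/
def IsCompatible {Υ : C ⥤ Poic} {Φ : D ⥤ Poic} {𝒳 : E ⥤ Poic} (π : Mor Φ 𝒳) (S : Mor Υ Φ) :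
    Prop :=
  ∀ (p q : D) (f : π.F.obj p ≅ π.F.obj q),
    (fun K => Poic.real (𝒳.map f.hom) '' (Poic.real (π.η.app p) '' K)) '' cells S p =
      (fun K => Poic.real (π.η.app q) '' K) '' cells S q

/-- `ω` takes equal values on cones that are identified by isomorphisms `π(p) ≅ π(q)`. -/
def IsStable {Υ : C ⥤ Poic} {Φ : D ⥤ Poic} {𝒳 : E ⥤ Poic} (π : Mor Φ 𝒳) (S : Mor Υ Φ)
    {k : ℕ} (ω : Weight Υ k) : Prop :=
  ∀ (p q : D) (f : π.F.obj p ≅ π.F.obj q) (t t' : C) (i : S.F.obj t ≅ p) (i' : S.F.obj t' ≅ q),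
    Poic.real (𝒳.map f.hom) '' (Poic.real (π.η.app p) '' cell S i) =
        Poic.real (π.η.app q) '' cell S i' →
      ∀ (ht : isoClass t ∈ cones Υ k) (ht' : isoClass t' ∈ cones Υ k),
        ω ⟨isoClass t, ht⟩ = ω ⟨isoClass t', ht'⟩

open Classical in
/-- The pullback `Q^* ω` of a weight along a subdivision. -/
def pullback {Υ : C ⥤ Poic} {Φ : D ⥤ Poic} (Q : Mor Υ Φ) {k : ℕ} (ω : Weight Φ k) :
    Weight Υ k :=
  fun c => if h : mapIsoClass Q.F c.1 ∈ cones Φ k then ω ⟨_, h⟩ else 0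

end Cycles

section Fibration

variable {C : Type 1} [Category.{0} C] {D : Type 1} [Category.{0} D]
  {Φ : C ⥤ Poic} {𝒳 : D ⥤ Poic}

/-- The objects of `π-Subd(Φ)`: the `π`-compatible subdivisions `S : Υ ⟶ Φ`. -/
structure CompatSubd (π : Mor Φ 𝒳) where
  C' : Type 1
  [cat : Category.{0} C']
  Υ : C' ⥤ Poic
  isComplex : IsPoicComplex Υ
  S : Mor Υ Φ
  isSubdivision : IsSubdivision S
  isCompatible : IsCompatible π S

attribute [instance] CompatSubd.cat

instance (π : Mor Φ 𝒳) (d : CompatSubd π) : Finite (IsoClass d.C') := d.isComplex.finite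

variable {N : Type} [AddCommGroup N] [Module.Free ℤ N] [Module.Finite ℤ N]

/-- The `π`-equivariant Minkowski weights of a `π`-compatible subdivision. -/
def equivMinkowski (X : Mor Φ (underline N)) (π : Mor Φ 𝒳) (k : ℕ) (d : CompatSubd π) :
    AddSubgroup (Weight d.Υ k) where
  carrier := {ω | ω ∈ minkowski (d.S.comp X) k ∧ IsStable π d.S ω}
  zero_mem' := ⟨zero_mem _, fun _ _ _ _ _ _ _ _ _ _ => rfl⟩
  add_mem' {a b} ha hb := ⟨add_mem ha.1 hb.1, fun p q f t t' i i' h ht ht' => by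
    simp only [Pi.add_apply, ha.2 p q f t t' i i' h ht ht', hb.2 p q f t t' i i' h ht ht']⟩
  neg_mem' {a} ha := ⟨neg_mem ha.1, fun p q f t t' i i' h ht ht' => by
    simp only [Pi.neg_apply, ha.2 p q f t t' i i' h ht ht']⟩

open Classical in
/-- The relations `ω' = ω` in the colimit, whenever `ω' = Q^* ω` for a morphism `Q` of
subdivisions. -/
def cycleRelations (X : Mor Φ (underline N)) (π : Mor Φ 𝒳) (k : ℕ) :
    AddSubgroup (⨁ d : CompatSubd π, equivMinkowski X π k d) :=
  AddSubgroup.closure {z | ∃ (d d' : CompatSubd π) (Q : Mor d'.Υ d.Υ),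
    IsSubdivision Q ∧ Q.comp d.S = d'.S ∧
    ∃ (ω : equivMinkowski X π k d) (ω' : equivMinkowski X π k d'),
      (ω' : Weight d'.Υ k) = pullback Q ω ∧
      z = DirectSum.of (fun d => equivMinkowski X π k d) d' ω' -
        DirectSum.of (fun d => equivMinkowski X π k d) d ω}

/-- `Z_k(𝒳_{π,X})`: the tropical `k`-cycles of the linear poic-fibration `π`, that is, the colimit
of the groups of `π`-equivariant Minkowski weights over `π-Subd(Φ)ᵒᵖ`. -/
abbrev Cycles (X : Mor Φ (underline N)) (π : Mor Φ 𝒳) (k : ℕ) : Type 2 :=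
  (⨁ d : CompatSubd π, equivMinkowski X π k d) ⧸ cycleRelations X π k

/-- The linear poic-fibration `π : Φ_X ⟶ 𝒳`, with `Φ` pure of dimension `n`, is irreducible. -/
def IsIrreducible (X : Mor Φ (underline N)) (π : Mor Φ 𝒳) (n : ℕ) : Prop :=
  IsPoicFibration π ∧ IsPure Φ n ∧
    Module.Free ℤ (Cycles X π n) ∧ Module.rank ℤ (Cycles X π n) = 1

end Fibration

/-! ### Discrete graphs -/

/-- A discrete graph (possibly with legs). -/
structure DGraph where
  F : Type
  [fin : Finite F]
  r : F → F
  ι : F → F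
  r_r : ∀ x, r (r x) = r x
  ι_ι : ∀ x, ι (ι x) = x
  ι_r : ∀ x, ι (r x) = r x

attribute [instance] DGraph.fin

namespace DGraph

variable (G : DGraph)

/-- The vertices. The elements of the complement are the half-edges. -/
def V : Set G.F := Set.range G.r

/-- The edges: the two-element orbits of half-edges. -/
def edgeSet : Set (Set G.F) := {e | ∃ h, G.ι h ≠ h ∧ e = {h, G.ι h}}

/-- The type of edges. -/
abbrev Edge : Type := G.edgeSet

/-- The legs, regarded as half-edges: the fixed half-edges. -/
def legs : Set G.F := {h | h ∉ G.V ∧ G.ι h = h}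

/-- `K` is (the set of flags of) a subgraph. -/
def IsSubgraph (K : Set G.F) : Prop := ∀ x ∈ K, G.r x ∈ K ∧ G.ι x ∈ K

/-- The vertices of a subgraph. -/
def vertsIn (K : Set G.F) : Set G.F := K ∩ G.V

/-- The edges of a subgraph. -/
def edgesIn (K : Set G.F) : Set (Set G.F) := {e ∈ G.edgeSet | e ⊆ K}

/-- `v` and `w` are joined by a sequence of edges in `K`. -/
def Joined (K : Set G.F) : G.F → G.F → Prop :=
  Relation.ReflTransGen fun a b => ∃ h ∈ K, G.r h = a ∧ G.r (G.ι h) = b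

/-- The subgraph `K` is non-empty and connected. -/
def IsConn (K : Set G.F) : Prop :=
  (G.vertsIn K).Nonempty ∧ ∀ v ∈ G.vertsIn K, ∀ w ∈ G.vertsIn K, G.Joined K v w

/-- `K` is a connected subgraph of genus `n`, that is, `n = #E(K) - #V(K) + 1`. -/
def IsConnOfGenus (n : ℕ) (K : Set G.F) : Prop :=
  G.IsSubgraph K ∧ G.IsConn K ∧ (G.edgesIn K).ncard + 1 = (G.vertsIn K).ncard + n

/-- `K` is a legless subgraph which is a tree, that is, connected of genus `0`. -/
def IsLeglessTree (K : Set G.F) : Prop := G.IsConnOfGenus 0 K ∧ Disjoint K G.legs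

/-- The valency of a vertex. -/
def val (v : G.F) : ℕ := (G.r ⁻¹' {v}).ncard - 1

/-- The connected components of the legless subgraph with set of edges `C` are trees; equivalently,
every connected legless subgraph with edges in `C` is a tree. -/
def IsForest (C : Set G.Edge) : Prop :=
  ∀ K : Set G.F, G.IsSubgraph K → Disjoint K G.legs → G.IsConn K →
    (∀ e : G.Edge, e.1 ⊆ K → e ∈ C) → G.IsLeglessTree K

variable {G}

lemma mem_V {x : G.F} : x ∈ G.V ↔ G.r x = x :=
  ⟨by rintro ⟨y, rfl⟩; exact G.r_r y, fun h => ⟨x, h⟩⟩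

lemma r_mem_V (x : G.F) : G.r x ∈ G.V := ⟨x, rfl⟩

lemma ι_of_mem_V {x : G.F} (h : x ∈ G.V) : G.ι x = x := by
  obtain ⟨y, rfl⟩ := h; exact G.ι_r y

lemma ι_mem_V {x : G.F} : G.ι x ∈ G.V ↔ x ∈ G.V := by
  refine ⟨fun h => ?_, fun h => by rwa [ι_of_mem_V h]⟩
  have := ι_of_mem_V h
  rw [G.ι_ι] at this
  rwa [this]

lemma Joined.mono {K L : Set G.F} (h : K ⊆ L) {v w} (hj : G.Joined K v w) : G.Joined L v w :=
  Relation.ReflTransGen.mono (fun _ _ ⟨x, hx, hy⟩ => ⟨x, h hx, hy⟩) _ _ hj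

lemma Joined.symm {K : Set G.F} (hK : ∀ x ∈ K, G.ι x ∈ K) {v w} (hj : G.Joined K v w) :
    G.Joined K w v := by
  induction hj with
  | refl => exact Relation.ReflTransGen.refl
  | tail _ hbc ih =>
    obtain ⟨h, hh, rfl, rfl⟩ := hbc
    exact Relation.ReflTransGen.head ⟨G.ι h, hK h hh, rfl, by rw [G.ι_ι]⟩ ih

lemma exit_of_joined {K T : Set G.F} {v w : G.F} (h : G.Joined T v w) (hv : v ∈ K) (hw : w ∉ K) :
    ∃ x ∈ T, G.r x ∈ K ∧ G.r (G.ι x) ∉ K := by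
  induction h with
  | refl => exact absurd hv hw
  | @tail b c hab hbc ih =>
    by_cases hb : b ∈ K
    · obtain ⟨x, hx, rfl, rfl⟩ := hbc
      exact ⟨x, hx, hb, hw⟩
    · exact ih hb

lemma card_le_of_conn {T : Set G.F} (hT : G.IsSubgraph T) (hc : G.IsConn T) (n : ℕ) :
    ∀ K : Set G.F, G.IsSubgraph K → K ⊆ T → (G.vertsIn K).Nonempty →
    (G.vertsIn T \ K).ncard = n →
    (G.vertsIn T).ncard + (G.edgesIn K).ncard ≤ (G.vertsIn K).ncard + (G.edgesIn T).ncard := by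
  induction n with
  | zero =>
    intro K hK hKT _ h0
    have h1 : G.vertsIn T ⊆ G.vertsIn K := by
      intro x hx
      by_contra hxK
      have : x ∈ G.vertsIn T \ K := ⟨hx, fun h => hxK ⟨h, hx.2⟩⟩
      rw [Set.ncard_eq_zero] at h0
      simp [h0] at this
    have h2 : G.edgesIn K ⊆ G.edgesIn T := fun e he => ⟨he.1, he.2.trans hKT⟩
    exact add_le_add (Set.ncard_le_ncard h1) (Set.ncard_le_ncard h2)
  | succ n ih =>
    intro K hK hKT hne hn
    obtain ⟨w, hw⟩ : (G.vertsIn T \ K).Nonempty := by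
      rw [← Set.ncard_pos]; omega
    obtain ⟨v, hv⟩ := hne
    obtain ⟨x, hxT, hxK, hxK'⟩ :=
      exit_of_joined (hc.2 v ⟨hKT hv.1, hv.2⟩ w hw.1) hv.1 hw.2
    have hxV : x ∉ G.V := fun h => hxK' (by rwa [ι_of_mem_V h])
    have hxι : G.ι x ≠ x := fun h => hxK' (by rwa [h])
    have hxnK : x ∉ K := fun h => hxK' (hK _ (hK x h).2).1
    set b := G.r (G.ι x) with hb
    have hbV : b ∈ G.V := r_mem_V _
    have hbT : b ∈ T := (hT _ (hT x hxT).2).1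
    set K' := K ∪ {x, G.ι x, b} with hK'
    have hsub : G.IsSubgraph K' := by
      rintro y (hy | rfl | rfl | rfl)
      · exact ⟨Or.inl (hK y hy).1, Or.inl (hK y hy).2⟩
      · exact ⟨Or.inl hxK, Or.inr (by simp)⟩
      · exact ⟨Or.inr (by simp [hb]), Or.inr (by simp [G.ι_ι])⟩
      · exact ⟨Or.inr (by simp [hb, G.r_r]), Or.inr (by simp [ι_of_mem_V hbV])⟩
    have hK'T : K' ⊆ T := by
      rintro y (hy | rfl | rfl | rfl)
      exacts [hKT hy, hxT, (hT _ hxT).2, hbT]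
    have hverts : G.vertsIn K' = insert b (G.vertsIn K) := by
      ext y
      constructor
      · rintro ⟨hy | rfl | rfl | rfl, hyV⟩
        · exact Or.inr ⟨hy, hyV⟩
        · exact absurd hyV hxV
        · exact absurd (ι_mem_V.1 hyV) hxV
        · exact Or.inl rfl
      · rintro (rfl | hy)
        · exact ⟨Or.inr (by simp), hbV⟩
        · exact ⟨Or.inl hy.1, hy.2⟩
    have hvc : (G.vertsIn K').ncard = (G.vertsIn K).ncard + 1 := by
      rw [hverts, Set.ncard_insert_of_notMem (fun h => hxK' h.1)]
    have hec : (G.edgesIn K).ncard + 1 ≤ (G.edgesIn K').ncard := by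
      rw [← Set.ncard_insert_of_notMem (a := ({x, G.ι x} : Set G.F)) (s := G.edgesIn K)
        (fun h => hxnK (h.2 (by simp)))]
      refine Set.ncard_le_ncard ?_
      rintro e (rfl | he)
      · refine ⟨⟨x, hxι, rfl⟩, ?_⟩
        rintro y (rfl | rfl)
        · exact Or.inr (by simp)
        · exact Or.inr (by simp)
      · exact ⟨he.1, he.2.trans Set.subset_union_left⟩
    have hdiff : G.vertsIn T \ K = insert b (G.vertsIn T \ K') := by
      ext y
      constructor
      · rintro ⟨hy, hyK⟩
        by_cases hyb : y = b
        · exact Or.inl hyb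
        · refine Or.inr ⟨hy, ?_⟩
          rintro (h | rfl | rfl | rfl)
          exacts [hyK h, hxV hy.2, hxV (ι_mem_V.1 hy.2), hyb rfl]
      · rintro (rfl | hy)
        · exact ⟨⟨hbT, hbV⟩, hxK'⟩
        · exact ⟨hy.1, fun h => hy.2 (Or.inl h)⟩
    rw [hdiff, Set.ncard_insert_of_notMem (fun h => h.2 (Or.inr (by simp)))] at hn
    have := ih K' hsub hK'T ⟨v, Or.inl hv.1, hv.2⟩ (by omega)
    omega

/-- A connected subgraph satisfies `#V ≤ #E + 1`. -/
lemma card_verts_le {T : Set G.F} (hT : G.IsSubgraph T) (hc : G.IsConn T) :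
    (G.vertsIn T).ncard ≤ (G.edgesIn T).ncard + 1 := by
  obtain ⟨v, hv⟩ := hc.1
  have hιv := ι_of_mem_V hv.2
  have hrv := mem_V.1 hv.2
  have h1 : G.vertsIn {v} = {v} := by
    ext x; constructor
    · rintro ⟨h, -⟩; exact h
    · rintro rfl; exact ⟨rfl, hv.2⟩
  have h := card_le_of_conn hT hc _ {v} (by rintro x rfl; simp [hιv, hrv])
    (by rintro x rfl; exact hv.1) (by rw [h1]; simp) rfl
  rw [h1, Set.ncard_singleton] at h
  omega

/-- A non-empty subgraph of a tree satisfies `#E + 1 ≤ #V`. -/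
lemma card_edges_lt {T K : Set G.F} (hT : G.IsConnOfGenus 0 T) (hK : G.IsSubgraph K) (hKT : K ⊆ T)
    (hne : (G.vertsIn K).Nonempty) : (G.edgesIn K).ncard + 1 ≤ (G.vertsIn K).ncard := by
  have h := card_le_of_conn hT.1 hT.2.1 _ K hK hKT hne rfl
  have := hT.2.2
  omega

lemma isForest_empty : G.IsForest ∅ := by
  intro K hK hL hc he
  refine ⟨⟨hK, hc, ?_⟩, hL⟩
  have h0 : G.edgesIn K = ∅ := by
    ext e
    simp only [Set.mem_empty_iff_false, iff_false]
    intro h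
    simpa using he ⟨e, h.1⟩ h.2
  have h1 := card_verts_le hK hc
  have h2 := (Set.ncard_pos (Set.toFinite _)).2 hc.1
  rw [h0, Set.ncard_empty] at *
  omega

lemma IsForest.mono {C D : Set G.Edge} (h : C ⊆ D) (hD : G.IsForest D) : G.IsForest C :=
  fun K h1 h2 h3 h4 => hD K h1 h2 h3 fun e he => h (h4 e he)

/-- A contraction: a map of graphs such that the inverse image of every vertex is a legless tree,
and the inverse image of every edge or leg is a single edge or leg. -/
structure IsContraction {G H : DGraph} (f : G.F → H.F) : Prop where
  r : ∀ x, f (G.r x) = H.r (f x)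
  ι : ∀ x, f (G.ι x) = H.ι (f x)
  tree : ∀ v ∈ H.V, G.IsLeglessTree (f ⁻¹' {v})
  unique : ∀ h ∉ H.V, ∃! x, f x = h

namespace IsContraction

variable {G H L : DGraph} {f : G.F → H.F}

lemma mem_V (hf : IsContraction f) {x : G.F} (h : x ∈ G.V) : f x ∈ H.V := by
  obtain ⟨y, rfl⟩ := h
  rw [hf.r]; exact r_mem_V _

lemma surj (hf : IsContraction f) : Function.Surjective f := by
  intro y
  by_cases hy : y ∈ H.V
  · obtain ⟨x, hx⟩ := (hf.tree y hy).1.2.1.1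
    exact ⟨x, hx.1⟩
  · exact (hf.unique y hy).exists

lemma subgraph_preimage (hf : IsContraction f) {K : Set H.F} (hK : H.IsSubgraph K) : G.IsSubgraph (f ⁻¹' K) := by
  intro x hx
  simp only [Set.mem_preimage, hf.r, hf.ι]
  exact hK _ hx

lemma subgraph_image (hf : IsContraction f) {K : Set G.F} (hK : G.IsSubgraph K) : H.IsSubgraph (f '' K) := by
  rintro _ ⟨x, hx, rfl⟩
  exact ⟨⟨_, (hK x hx).1, hf.r x⟩, ⟨_, (hK x hx).2, hf.ι x⟩⟩

lemma joined_image (hf : IsContraction f) {K : Set G.F} {v w : G.F} (h : G.Joined K v w) :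
    H.Joined (f '' K) (f v) (f w) := by
  induction h with
  | refl => exact Relation.ReflTransGen.refl
  | tail _ hbc ih =>
    obtain ⟨x, hx, rfl, rfl⟩ := hbc
    exact ih.tail ⟨f x, ⟨x, hx, rfl⟩, (hf.r x).symm, by rw [hf.r, hf.ι]⟩

lemma joined_preimage (hf : IsContraction f) {K : Set H.F} (hK : H.IsSubgraph K) {a b : H.F} (h : H.Joined K a b)
    (ha : a ∈ K) (hb : b ∈ H.V) : ∀ a' ∈ G.V, ∀ b' ∈ G.V, f a' = a → f b' = b →
      G.Joined (f ⁻¹' K) a' b' := by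
  have fib : ∀ a ∈ K, a ∈ H.V → ∀ a' ∈ G.V, ∀ b' ∈ G.V, f a' = a → f b' = a →
      G.Joined (f ⁻¹' K) a' b' := by
    intro a ha haV a' ha' b' hb' h1 h2
    refine Joined.mono ?_ ((hf.tree a haV).1.2.1.2 a' ⟨h1, ha'⟩ b' ⟨h2, hb'⟩)
    intro x hx
    have : f x = a := hx
    simpa [this] using ha
  induction h using Relation.ReflTransGen.head_induction_on with
  | refl => exact fib _ ha hb
  | @head a c hac _ ih =>
    obtain ⟨x, hx, rfl, rfl⟩ := hac
    intro a' ha' b' hb' h1 h2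
    obtain ⟨y, rfl⟩ := hf.surj x
    have hyc : f (G.r (G.ι y)) = H.r (H.ι (f y)) := by rw [hf.r, hf.ι]
    refine (fib _ ha (r_mem_V _) a' ha' (G.r y) (r_mem_V _) h1 (hf.r y)).trans ?_
    exact Relation.ReflTransGen.head ⟨y, hx, rfl, rfl⟩
      (ih (hK _ (hK _ hx).2).1 _ (r_mem_V _) b' hb' hyc h2)

lemma conn_preimage (hf : IsContraction f) {K : Set H.F} (hK : H.IsSubgraph K) (hc : H.IsConn K) :
    G.IsConn (f ⁻¹' K) := by
  constructor
  · obtain ⟨v, hv, hvV⟩ := hc.1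
    obtain ⟨x, hx⟩ := (hf.tree v hvV).1.2.1.1
    refine ⟨x, ?_, hx.2⟩
    have : f x = v := hx.1
    simpa [this] using hv
  · intro v hv w hw
    exact hf.joined_preimage hK (hc.2 _ ⟨hv.1, hf.mem_V hv.2⟩ _ ⟨hw.1, hf.mem_V hw.2⟩) hv.1
      (hf.mem_V hw.2) v hv.2 w hw.2 rfl rfl

lemma mem_vertsIn_image (hf : IsContraction f) {K : Set G.F} (hK : G.IsSubgraph K) {v : H.F}
    (hv : v ∈ H.vertsIn (f '' K)) : ∃ x ∈ G.vertsIn K, f x = v := by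
  obtain ⟨⟨x, hx, rfl⟩, hV⟩ := hv
  exact ⟨G.r x, ⟨(hK x hx).1, r_mem_V _⟩, by rw [hf.r, DGraph.mem_V.1 hV]⟩

lemma conn_image (hf : IsContraction f) {K : Set G.F} (hK : G.IsSubgraph K) (hc : G.IsConn K) : H.IsConn (f '' K) := by
  constructor
  · obtain ⟨v, hv⟩ := hc.1
    exact ⟨f v, ⟨v, hv.1, rfl⟩, hf.mem_V hv.2⟩
  · intro v hv w hw
    obtain ⟨v', hv', rfl⟩ := hf.mem_vertsIn_image hK hv
    obtain ⟨w', hw', rfl⟩ := hf.mem_vertsIn_image hK hw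
    exact hf.joined_image (hc.2 v' hv' w' hw')

lemma ι_ne (hf : IsContraction f) {x : G.F} (hx : f x ∉ H.V) (h : G.ι x ≠ x) : H.ι (f x) ≠ f x := by
  intro h'
  rw [← hf.ι] at h'
  exact h ((hf.unique _ hx).unique h' rfl)

lemma card_image (hf : IsContraction f) {K : Set G.F} (hK : G.IsSubgraph K) :
    (G.edgesIn K).ncard + (H.vertsIn (f '' K)).ncard ≤
      (H.edgesIn (f '' K)).ncard + (G.vertsIn K).ncard := by
  classical
  set VK : Finset H.F := (Set.toFinite (H.vertsIn (f '' K))).toFinset with hVK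
  have mVK : ∀ v, v ∈ VK ↔ v ∈ H.vertsIn (f '' K) := by simp [hVK]
  have hfib : ∀ v ∈ H.V, G.IsSubgraph (f ⁻¹' {v}) := fun v hv => (hf.tree v hv).1.1
  -- the fibres of `K` are forests
  have h1 : ∀ v ∈ VK, (G.edgesIn (K ∩ f ⁻¹' {v})).ncard + 1 ≤
      (G.vertsIn (K ∩ f ⁻¹' {v})).ncard := by
    intro v hv
    rw [mVK] at hv
    refine card_edges_lt (hf.tree v hv.2).1 (fun x hx => ?_) Set.inter_subset_right ?_
    · exact ⟨⟨(hK x hx.1).1, (hfib v hv.2 x hx.2).1⟩, ⟨(hK x hx.1).2, (hfib v hv.2 x hx.2).2⟩⟩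
    · obtain ⟨x, hx, hxv⟩ := hf.mem_vertsIn_image hK hv
      exact ⟨x, ⟨hx.1, hxv⟩, hx.2⟩
  -- the vertices are partitioned by the fibres
  have h2 : (G.vertsIn K).ncard = ∑ v ∈ VK, (G.vertsIn (K ∩ f ⁻¹' {v})).ncard := by
    rw [Set.ncard_eq_toFinset_card _ (Set.toFinite _),
      Finset.card_eq_sum_card_fiberwise (f := f) (t := VK)]
    · refine Finset.sum_congr rfl fun v _ => ?_
      rw [Set.ncard_eq_toFinset_card _ (Set.toFinite _)]
      congr 1
      ext x
      simp only [Finset.mem_filter, Set.Finite.mem_toFinset, vertsIn, Set.mem_inter_iff,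
        Set.mem_preimage, Set.mem_singleton_iff]
      tauto
    · intro x hx
      simp only [Set.Finite.coe_toFinset] at hx
      simp only [Finset.mem_coe, mVK]
      exact ⟨⟨x, hx.1, rfl⟩, hf.mem_V hx.2⟩
  -- the edges are contained in fibres or map injectively
  have h3 : G.edgesIn K ⊆ (⋃ v ∈ VK, G.edgesIn (K ∩ f ⁻¹' {v})) ∪
      (G.edgesIn K ∩ {e | f '' e ∈ H.edgesIn (f '' K)}) := by
    rintro _ ⟨⟨x, hx, rfl⟩, hxK⟩
    have hxK1 : x ∈ K := hxK (by simp)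
    by_cases hv : f x ∈ H.V
    · left
      simp only [Set.mem_iUnion]
      refine ⟨f x, (mVK _).2 ⟨⟨x, hxK1, rfl⟩, hv⟩, ⟨x, hx, rfl⟩, ?_⟩
      rintro y (rfl | rfl)
      · exact ⟨hxK1, rfl⟩
      · exact ⟨hxK (by simp), by simp [hf.ι, ι_of_mem_V hv]⟩
    · right
      refine ⟨⟨⟨x, hx, rfl⟩, hxK⟩, ⟨f x, hf.ι_ne hv hx, ?_⟩, Set.image_mono hxK⟩
      rw [Set.image_pair, hf.ι]
  have h4 : (G.edgesIn K ∩ {e | f '' e ∈ H.edgesIn (f '' K)}).ncard ≤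
      (H.edgesIn (f '' K)).ncard := by
    refine Set.ncard_le_ncard_of_injOn (fun e => f '' e) (fun e he => he.2) ?_ (Set.toFinite _)
    have key : ∀ e ∈ G.edgesIn K ∩ {e | f '' e ∈ H.edgesIn (f '' K)}, f ⁻¹' (f '' e) = e := by
      rintro _ ⟨⟨⟨x, hx, rfl⟩, -⟩, ⟨y, hy, hye⟩, -⟩
      have hyV : y ∉ H.V := fun h => hy (ι_of_mem_V h)
      rw [Set.image_pair, hf.ι] at hye
      have hxV : f x ∉ H.V := by
        have : y ∈ ({f x, H.ι (f x)} : Set H.F) := by rw [hye]; simp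
        rcases this with h | h
        · rwa [← h]
        · rw [h] at hyV; exact fun h' => hyV (ι_mem_V.2 h')
      ext z
      constructor
      · rintro ⟨w, hw | hw, hwz⟩
        · subst hw
          exact Or.inl ((hf.unique _ hxV).unique hwz.symm rfl)
        · rw [Set.mem_singleton_iff] at hw
          subst hw
          rw [hf.ι] at hwz
          refine Or.inr ((hf.unique (H.ι (f x)) (fun h => hxV (ι_mem_V.1 h))).unique hwz.symm ?_)
          exact hf.ι x
      · intro hz; exact ⟨z, hz, rfl⟩
    intro e he e' he' hee
    rw [← key e he, ← key e' he']
    exact congrArg _ hee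
  have h5 : (⋃ v ∈ VK, G.edgesIn (K ∩ f ⁻¹' {v})).ncard ≤
      ∑ v ∈ VK, (G.edgesIn (K ∩ f ⁻¹' {v})).ncard := by
    have : (⋃ v ∈ VK, G.edgesIn (K ∩ f ⁻¹' {v})) =
        ↑(VK.biUnion fun v => (Set.toFinite (G.edgesIn (K ∩ f ⁻¹' {v}))).toFinset) := by
      ext e; simp
    rw [this, Set.ncard_coe_finset]
    refine Finset.card_biUnion_le.trans (Finset.sum_le_sum fun v _ => ?_)
    rw [Set.ncard_eq_toFinset_card _ (Set.toFinite _)]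
  have h6 := (Set.ncard_le_ncard h3).trans (Set.ncard_union_le _ _)
  have h7 := Finset.sum_le_sum h1
  rw [Finset.sum_add_distrib, Finset.sum_const, smul_eq_mul, mul_one] at h7
  have h8 : VK.card = (H.vertsIn (f '' K)).ncard := by
    rw [Set.ncard_eq_toFinset_card _ (Set.toFinite _)]
  omega

/-- A connected subgraph whose image is a tree is a tree. -/
lemma tree_of_image (hf : IsContraction f) {K : Set G.F} (hK : G.IsSubgraph K) (hc : G.IsConn K)
    (ht : H.IsConnOfGenus 0 (f '' K)) : G.IsConnOfGenus 0 K := by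
  refine ⟨hK, hc, ?_⟩
  have h1 := hf.card_image hK
  have h2 := card_verts_le hK hc
  have h3 := ht.2.2
  omega

lemma legs_image (hf : IsContraction f) {x : G.F} : f x ∈ H.legs ↔ x ∈ G.legs := by
  constructor
  · rintro ⟨h1, h2⟩
    refine ⟨fun h => h1 (hf.mem_V h), ?_⟩
    rw [← hf.ι] at h2
    exact (hf.unique _ h1).unique h2 rfl
  · rintro ⟨h1, h2⟩
    have hV : f x ∉ H.V := fun h =>
      Set.disjoint_left.1 (hf.tree _ h).2 (show x ∈ f ⁻¹' {f x} from rfl) ⟨h1, h2⟩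
    exact ⟨hV, by rw [← hf.ι, h2]⟩

lemma tree_preimage (hf : IsContraction f) {K : Set H.F} (hK : H.IsLeglessTree K) : G.IsLeglessTree (f ⁻¹' K) := by
  refine ⟨hf.tree_of_image (hf.subgraph_preimage hK.1.1) (hf.conn_preimage hK.1.1 hK.1.2.1) ?_, ?_⟩
  · rw [Set.image_preimage_eq _ hf.surj]; exact hK.1
  · rw [Set.disjoint_left]
    intro x hx hl
    exact Set.disjoint_left.1 hK.2 hx (hf.legs_image.2 hl)

lemma comp (hf : IsContraction f) {k : H.F → L.F} (hk : IsContraction k) : IsContraction (k ∘ f) where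
  r x := by simp [hf.r, hk.r]
  ι x := by simp [hf.ι, hk.ι]
  tree v hv := hf.tree_preimage (hk.tree v hv)
  unique h hh := by
    obtain ⟨y, hy, hu⟩ := hk.unique h hh
    have hyV : y ∉ H.V := fun h' => hh (by rw [← hy]; exact hk.mem_V h')
    obtain ⟨x, hx, hu'⟩ := hf.unique y hyV
    exact ⟨x, by simp [hx, hy], fun z hz => hu' z (hu _ hz)⟩

/-- The inverse image of an edge. -/
lemma preimage_edge (hf : IsContraction f) {e : Set H.F} (he : e ∈ H.edgeSet) : f ⁻¹' e ∈ G.edgeSet := by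
  obtain ⟨y, hy, rfl⟩ := he
  have hyV : y ∉ H.V := fun h => hy (ι_of_mem_V h)
  obtain ⟨x, rfl, hu⟩ := hf.unique y hyV
  refine ⟨x, fun h => hy (by rw [← hf.ι, h]), ?_⟩
  ext z
  constructor
  · rintro (h | h)
    · exact Or.inl (hu z h)
    · right
      exact (hf.unique (H.ι (f x)) (fun h => hyV (ι_mem_V.1 h))).unique h (hf.ι x)
  · rintro (rfl | rfl)
    · exact Or.inl rfl
    · exact Or.inr (hf.ι x)

/-- The inclusion `E(H) ⟶ E(G)` induced by a contraction `G ⟶ H`. -/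
def edge (hf : IsContraction f) (e : H.Edge) : G.Edge := ⟨f ⁻¹' e.1, hf.preimage_edge e.2⟩

lemma edge_injective (hf : IsContraction f) : Function.Injective hf.edge := by
  intro e e' h
  have : f ⁻¹' e.1 = f ⁻¹' e'.1 := congrArg Subtype.val h
  exact Subtype.ext (hf.surj.preimage_injective this)

lemma forest (hf : IsContraction f) {Z : Set H.Edge} {Z' : Set G.Edge} (hZ : H.IsForest Z)
    (h : ∀ e : H.Edge, hf.edge e ∈ Z' → e ∈ Z) : G.IsForest Z' := by
  intro K hK hL hc he
  refine ⟨hf.tree_of_image hK hc (hZ (f '' K) (hf.subgraph_image hK) ?_ (hf.conn_image hK hc)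
    ?_).1, hL⟩
  · rw [Set.disjoint_left]
    rintro _ ⟨x, hx, rfl⟩ hl
    exact Set.disjoint_left.1 hL hx (hf.legs_image.1 hl)
  · intro e heK
    apply h
    apply he
    intro x hx
    have hx' : f x ∈ e.1 := hx
    obtain ⟨y, hy, hyx⟩ := heK hx'
    have hxV : f x ∉ H.V := by
      obtain ⟨z, hz, hze⟩ := e.2
      have hzV : z ∉ H.V := fun h => hz (ι_of_mem_V h)
      rw [hze] at hx'
      rcases hx' with h | h
      · rwa [h]
      · rw [Set.mem_singleton_iff.1 h]; exact fun h' => hzV (ι_mem_V.1 h')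
    rwa [(hf.unique _ hxV).unique rfl hyx]

end IsContraction

lemma isContraction_id (G : DGraph) : IsContraction (id : G.F → G.F) where
  r _ := rfl
  ι _ := rfl
  tree v hv := by
    have hιv := ι_of_mem_V hv
    have hrv := mem_V.1 hv
    have h1 : G.vertsIn {v} = {v} := by
      ext x; constructor
      · rintro ⟨h, -⟩; exact h
      · rintro rfl; exact ⟨rfl, hv⟩
    have h2 : G.edgesIn {v} = ∅ := by
      ext e
      simp only [Set.mem_empty_iff_false, iff_false]
      rintro ⟨⟨x, hx, rfl⟩, h⟩
      have h3 : x = v := h (by simp)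
      have h4 : G.ι x = v := h (by simp)
      exact hx (by rw [h4, h3])
    refine ⟨⟨?_, ⟨?_, ?_⟩, ?_⟩, ?_⟩
    · rintro x rfl
      exact ⟨hrv, hιv⟩
    · exact ⟨v, rfl, hv⟩
    · rintro x ⟨rfl, -⟩ y ⟨hy, -⟩
      rw [show y = x from hy]; exact Relation.ReflTransGen.refl
    · simp [h1, h2]
    · rw [Set.disjoint_left]
      rintro x rfl hx
      exact hx.1 hv
  unique h _ := ⟨h, rfl, fun _ hy => hy⟩

end DGraph

/-! ### Moduli spaces of tropical curves -/

/-- `σ_G`: the cone of metrics on `G`, that is, of edge lengths in `ℝ_{≥0}` such that the edges of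
length `0` form a forest. -/
abbrev cone (G : DGraph) : Poic :=
  Poic.suborthant G.Edge G.IsForest DGraph.isForest_empty fun _ _ h => DGraph.IsForest.mono h

lemma coord_mapDomain {ι κ : Type} {φ : ι → κ} (hφ : Function.Injective φ) (i : ι)
    (x : ℝ ⊗[ℤ] (ι →₀ ℤ)) :
    Poic.coord (φ i) ((Finsupp.lmapDomain ℤ ℤ φ).baseChange ℝ x) = Poic.coord i x := by
  unfold Poic.coord
  rw [← realFunctional_comp]
  congr 2
  ext j
  simp only [LinearMap.comp_apply, Finsupp.lsingle_apply, Finsupp.lmapDomain_apply,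
    Finsupp.mapDomain_single, Finsupp.lapply_apply]
  classical simp [Finsupp.single_apply, hφ.eq_iff]

lemma coord_mapDomain_of_notMem {ι κ : Type} {φ : ι → κ} (j : κ) (hj : ∀ i, φ i ≠ j)
    (x : ℝ ⊗[ℤ] (ι →₀ ℤ)) :
    Poic.coord j ((Finsupp.lmapDomain ℤ ℤ φ).baseChange ℝ x) = 0 := by
  unfold Poic.coord
  rw [← realFunctional_comp]
  have : Finsupp.lapply j ∘ₗ Finsupp.lmapDomain ℤ ℤ φ = (0 : (ι →₀ ℤ) →ₗ[ℤ] ℤ) := by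
    ext i
    simp only [LinearMap.comp_apply, Finsupp.lsingle_apply, Finsupp.lmapDomain_apply,
      Finsupp.mapDomain_single, Finsupp.lapply_apply]
    simp [hj i]
  rw [this]
  simp [realFunctional]

/-- The face embedding `σ_H ⟶ σ_G` of a contraction `G ⟶ H`: it extends a metric by `0` on the
contracted edges. -/
def faceMap {G H : DGraph} {f : G.F → H.F} (hf : DGraph.IsContraction f) : cone H ⟶ cone G :=
  ({ lin := Finsupp.lmapDomain ℤ ℤ hf.edge
     maps := by
      rintro x ⟨h1, h2⟩
      refine ⟨fun e => ?_, hf.forest h2 fun e he => ?_⟩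
      · by_cases h : ∃ e', hf.edge e' = e
        · obtain ⟨e', rfl⟩ := h
          exact (coord_mapDomain hf.edge_injective e' x).symm ▸ h1 e'
        · rw [coord_mapDomain_of_notMem e (fun i hi => h ⟨i, hi⟩)]
      · exact (coord_mapDomain hf.edge_injective e x).symm.trans he } : Poic.Hom (cone H) (cone G))

lemma faceMap_id (G : DGraph) : faceMap (DGraph.isContraction_id G) = 𝟙 (cone G) :=
  Poic.hom_ext (Finsupp.lmapDomain_id ℤ ℤ)

lemma faceMap_comp {G H L : DGraph} {f : G.F → H.F} {k : H.F → L.F}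
    (hf : DGraph.IsContraction f) (hk : DGraph.IsContraction k) :
    faceMap (hf.comp hk) = faceMap hk ≫ faceMap hf :=
  Poic.hom_ext (Finsupp.lmapDomain_comp ℤ ℤ hk.edge hf.edge)

/-- The objects of `𝔾_{g,A}`: connected stable graphs of genus `g` with legs marked by `A`. -/
structure Gr (g : ℕ) (A : Type) extends DGraph where
  leg : A → F
  leg_injective : Function.Injective leg
  leg_range : Set.range leg = toDGraph.legs
  genus : toDGraph.IsConnOfGenus g Set.univ
  stable : ∀ v ∈ toDGraph.V, 3 ≤ toDGraph.val v

namespace Gr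

variable {g : ℕ} {A : Type}

/-- The morphisms of `𝔾_{g,A}`: the contractions that preserve the markings. -/
@[ext] structure Hom (G H : Gr g A) where
  toFun : G.F → H.F
  isContraction : DGraph.IsContraction (G := G.toDGraph) (H := H.toDGraph) toFun
  leg : ∀ a, toFun (G.leg a) = H.leg a

instance : Category.{0} (Gr g A) where
  Hom := Hom
  id G := ⟨id, DGraph.isContraction_id _, fun _ => rfl⟩
  comp f h := ⟨h.toFun ∘ f.toFun, f.isContraction.comp h.isContraction, fun a => by
    simp [f.leg, h.leg]⟩

@[ext] lemma hom_ext {G H : Gr g A} {f h : G ⟶ H} (e : f.toFun = h.toFun) : f = h := Hom.ext e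

end Gr

/-- The poic-space `M^trop_{g,A}`. -/
def Mtrop (g : ℕ) (A : Type) : (Gr g A)ᵒᵖ ⥤ Poic where
  obj G := cone G.unop.toDGraph
  map f := faceMap f.unop.isContraction
  map_id G := faceMap_id G.unop.toDGraph
  map_comp f h := faceMap_comp h.unop.isContraction f.unop.isContraction

/-- The poic `ℝ_{>0}^g`. -/
abbrev openOrthant (g : ℕ) : Poic :=
  Poic.suborthant (Fin g) (fun s => s = ∅) rfl fun _ _ h ht => Set.subset_empty_iff.1 (ht ▸ h)

/-- The set of markings `A ⊔ {1, …, g, 1^*, …, g^*}`. -/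
abbrev Mark (g : ℕ) (A : Type) : Type := A ⊕ (Fin g ⊕ Fin g)

/-- The spanning-tree complex `ST_{g,A}`: the functor `T ↦ σ_T × ℝ_{>0}^g`. -/
def ST (g : ℕ) (A : Type) : (Gr 0 (Mark g A))ᵒᵖ ⥤ Poic where
  obj T := Poic.prod (cone T.unop.toDGraph) (openOrthant g)
  map f := Poic.prodMap (faceMap f.unop.isContraction) (𝟙 (openOrthant g))
  map_id T := by
    refine (congrArg (fun φ => Poic.prodMap φ (𝟙 (openOrthant g)))
      (faceMap_id T.unop.toDGraph)).trans (Poic.hom_ext ?_)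
    exact LinearMap.prodMap_id
  map_comp f h := by
    refine (congrArg (fun φ => Poic.prodMap φ (𝟙 (openOrthant g)))
      (faceMap_comp h.unop.isContraction f.unop.isContraction)).trans (Poic.hom_ext ?_)
    rfl

namespace Gr

variable {g : ℕ} {A : Type}

/-- The legs of `T` marked by `{1, …, g, 1^*, …, g^*}`. -/
def gLeg (T : Gr 0 (Mark g A)) (s : Fin g ⊕ Fin g) : T.F := T.leg (Sum.inr s)

lemma gLeg_injective (T : Gr 0 (Mark g A)) : Function.Injective T.gLeg :=
  T.leg_injective.comp Sum.inr_injective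

lemma leg_mem {T : Gr g A} (a : A) : T.leg a ∈ T.toDGraph.legs := T.leg_range ▸ ⟨a, rfl⟩

lemma gLeg_mem (T : Gr 0 (Mark g A)) (s) : T.gLeg s ∈ T.toDGraph.legs := leg_mem _

/-- The involution of `st_{g,A}(T)`: it interchanges the legs `i` and `i^*`, and agrees with the
involution of `T` elsewhere. -/
def glue (T : Gr 0 (Mark g A)) : T.F → T.F :=
  Function.extend T.gLeg (fun s => T.gLeg s.swap) T.ι

@[simp] lemma glue_gLeg (T : Gr 0 (Mark g A)) (s) : T.glue (T.gLeg s) = T.gLeg s.swap :=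
  T.gLeg_injective.extend_apply _ _ _

lemma glue_of_ne (T : Gr 0 (Mark g A)) {x : T.F} (h : ∀ s, T.gLeg s ≠ x) : T.glue x = T.ι x :=
  Function.extend_apply' _ _ _ fun ⟨s, hs⟩ => h s hs

lemma ι_gLeg (T : Gr 0 (Mark g A)) (s) : T.ι (T.gLeg s) = T.gLeg s := (T.gLeg_mem s).2

lemma glue_of_notMem_legs (T : Gr 0 (Mark g A)) {x : T.F} (h : x ∉ T.toDGraph.legs) :
    T.glue x = T.ι x :=
  T.glue_of_ne fun s hs => h (hs ▸ T.gLeg_mem s)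

/-- The graph underlying `st_{g,A}(T)`, obtained from `T` by joining the legs `i` and `i^*`. -/
def stDGraph (T : Gr 0 (Mark g A)) : DGraph where
  F := T.F
  r := T.r
  ι := T.glue
  r_r := T.r_r
  ι_ι x := by
    by_cases h : ∃ s, T.gLeg s = x
    · obtain ⟨s, rfl⟩ := h
      simp
    · push Not at h
      rw [T.glue_of_ne h, T.glue_of_ne fun s hs => h s ?_, T.ι_ι]
      rw [← T.ι_gLeg s, hs, T.ι_ι]
  ι_r x := by
    rw [T.glue_of_ne fun s hs => (T.gLeg_mem s).1 ?_, T.ι_r]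
    rw [hs]
    exact DGraph.r_mem_V x

/-- The set of flags consisting of the legs `i` and `i^*`. -/
def pair (T : Gr 0 (Mark g A)) (i : Fin g) : Set T.F := {T.gLeg (Sum.inl i), T.gLeg (Sum.inr i)}

/-- The edge `e_i` of `st_{g,A}(T)`. -/
def newEdge (T : Gr 0 (Mark g A)) (i : Fin g) : T.stDGraph.Edge :=
  ⟨T.pair i, T.gLeg (Sum.inl i), by
    change T.glue _ ≠ _ ∧ T.pair i = ({_, T.glue _} : Set T.F)
    rw [glue_gLeg]
    exact ⟨fun h => by simpa using T.gLeg_injective h, rfl⟩⟩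

lemma newEdge_injective (T : Gr 0 (Mark g A)) : Function.Injective T.newEdge := by
  intro i j h
  have h1 : T.gLeg (Sum.inl i) ∈ (T.newEdge j).1 := h ▸ Or.inl rfl
  rcases h1 with h1 | h1
  · simpa using T.gLeg_injective h1
  · simpa using T.gLeg_injective h1

/-- The inclusion `E(T) ⊆ E(st_{g,A}(T))`. -/
def oldEdge (T : Gr 0 (Mark g A)) (e : T.toDGraph.Edge) : T.stDGraph.Edge :=
  ⟨e.1, by
    obtain ⟨x, hx, he⟩ := e.2
    have := T.glue_of_notMem_legs fun h : x ∈ T.toDGraph.legs => hx h.2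
    refine ⟨x, fun h => hx (this.symm.trans h), he.trans ?_⟩
    change _ = ({x, T.glue x} : Set T.F)
    rw [this]⟩

lemma oldEdge_injective (T : Gr 0 (Mark g A)) : Function.Injective T.oldEdge :=
  fun _ _ h => Subtype.ext (congrArg Subtype.val h :)

lemma notMem_of_edge (T : Gr 0 (Mark g A)) (e : T.toDGraph.Edge) (s) : T.gLeg s ∉ e.1 := by
  intro h
  obtain ⟨x, hx, he⟩ := e.2
  rw [he] at h
  rcases h with h | h
  · exact hx (h ▸ T.ι_gLeg s)
  · have h' : T.gLeg s = T.ι x := h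
    have : T.ι (T.gLeg s) = T.gLeg s := T.ι_gLeg s
    rw [h', T.ι_ι] at this
    exact hx this.symm

lemma oldEdge_ne_newEdge (T : Gr 0 (Mark g A)) (e i) : T.oldEdge e ≠ T.newEdge i := by
  intro h
  refine T.notMem_of_edge e (Sum.inl i) ?_
  have : e.1 = (T.newEdge i).1 := congrArg Subtype.val h
  rw [this]
  exact Or.inl rfl

lemma edge_cases (T : Gr 0 (Mark g A)) (e : T.stDGraph.Edge) :
    (∃ e', T.oldEdge e' = e) ∨ ∃ i, T.newEdge i = e := by
  obtain ⟨e, x, hx, rfl⟩ := e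
  by_cases h : ∃ s, T.gLeg s = x
  · obtain ⟨s, rfl⟩ := h
    right
    rcases s with i | i
    · refine ⟨i, Subtype.ext ?_⟩
      change ({_, _} : Set T.F) = {_, T.glue _}
      rw [glue_gLeg]; rfl
    · refine ⟨i, Subtype.ext ?_⟩
      change ({_, _} : Set T.F) = {_, T.glue _}
      rw [glue_gLeg]; exact Set.pair_comm _ _
  · push Not at h
    left
    have h' := T.glue_of_ne h
    refine ⟨⟨{x, T.ι x}, x, fun h2 => hx (h'.trans h2), rfl⟩, Subtype.ext ?_⟩
    change ({_, _} : Set T.F) = {_, T.glue _}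
    rw [h']

lemma joined_st (T : Gr 0 (Mark g A)) {K : Set T.F} {v w : T.F}
    (h : T.toDGraph.Joined K v w) : T.stDGraph.Joined K v w := by
  induction h with
  | refl => exact Relation.ReflTransGen.refl
  | tail _ hbc ih =>
    obtain ⟨x, hx, rfl, rfl⟩ := hbc
    by_cases h : ∃ s, T.gLeg s = x
    · obtain ⟨s, rfl⟩ := h
      rw [T.ι_gLeg]
      exact ih
    · push Not at h
      refine ih.tail ⟨x, hx, rfl, ?_⟩
      change T.r (T.glue x) = _
      rw [T.glue_of_ne h]

lemma joined_of_st (T : Gr 0 (Mark g A)) {K : Set T.F} (hK : Disjoint K T.toDGraph.legs)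
    {v w : T.F} (h : T.stDGraph.Joined K v w) : T.toDGraph.Joined K v w := by
  induction h with
  | refl => exact Relation.ReflTransGen.refl
  | tail _ hbc ih =>
    obtain ⟨x, hx, rfl, rfl⟩ := hbc
    refine ih.tail ⟨x, hx, rfl, ?_⟩
    change _ = T.r (T.glue x)
    rw [T.glue_of_notMem_legs (Set.disjoint_left.1 hK hx)]

lemma isSubgraph_st (T : Gr 0 (Mark g A)) {K : Set T.F} (hK : Disjoint K T.toDGraph.legs) :
    T.stDGraph.IsSubgraph K ↔ T.toDGraph.IsSubgraph K := by
  refine forall₂_congr fun x hx => ?_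
  change _ ∧ T.glue x ∈ K ↔ _
  rw [T.glue_of_notMem_legs (Set.disjoint_left.1 hK hx)]
  rfl

lemma edgesIn_st (T : Gr 0 (Mark g A)) {K : Set T.F} (hK : Disjoint K T.toDGraph.legs) :
    T.stDGraph.edgesIn K = T.toDGraph.edgesIn K := by
  ext e
  constructor
  · rintro ⟨⟨x, hx, rfl⟩, h⟩
    have hx' := T.glue_of_notMem_legs (Set.disjoint_left.1 hK (h (Or.inl rfl)))
    refine ⟨⟨x, fun h2 => hx (hx'.trans h2), ?_⟩, h⟩
    change ({x, T.glue x} : Set T.F) = {x, T.ι x}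
    rw [hx']
  · rintro ⟨he, h⟩
    exact ⟨(T.oldEdge ⟨e, he⟩).2, h⟩

lemma legs_st (T : Gr 0 (Mark g A)) : T.stDGraph.legs ⊆ T.toDGraph.legs := by
  rintro x ⟨h1, h2⟩
  refine ⟨h1, ?_⟩
  by_cases h : ∃ s, T.gLeg s = x
  · obtain ⟨s, rfl⟩ := h
    exact T.ι_gLeg s
  · push Not at h
    rw [← T.glue_of_ne h]
    exact h2

lemma isLeglessTree_st (T : Gr 0 (Mark g A)) {K : Set T.F} (h : T.toDGraph.IsLeglessTree K) :
    T.stDGraph.IsLeglessTree K := by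
  refine ⟨⟨(T.isSubgraph_st h.2).2 h.1.1, ⟨h.1.2.1.1, fun v hv w hw => ?_⟩, ?_⟩, ?_⟩
  · exact T.joined_st (h.1.2.1.2 v hv w hw)
  · rw [T.edgesIn_st h.2]
    exact h.1.2.2
  · exact h.2.mono_right T.legs_st

/-- The graph `st_{g,A}(T)`, with the marking on the `A`-legs. -/
def stGraph (T : Gr 0 (Mark g A)) : Gr g A where
  toDGraph := T.stDGraph
  leg a := T.leg (Sum.inl a)
  leg_injective := T.leg_injective.comp Sum.inl_injective
  leg_range := by
    ext x
    constructor
    · rintro ⟨a, rfl⟩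
      refine ⟨(leg_mem (T := T) (Sum.inl a)).1, ?_⟩
      change T.glue _ = _
      rw [T.glue_of_ne, (leg_mem (T := T) (Sum.inl a)).2]
      exact fun s hs => by simpa using T.leg_injective hs
    · intro hx
      have := T.legs_st hx
      rw [← T.leg_range] at this
      obtain ⟨a | s, rfl⟩ := this
      · exact ⟨a, rfl⟩
      · have h2 : T.glue (T.gLeg s) = T.gLeg s := hx.2
        rw [glue_gLeg] at h2
        have := T.gLeg_injective h2
        rcases s with i | i <;> simp at this
  genus := by
    have hG := T.genus
    refine ⟨fun _ _ => ⟨trivial, trivial⟩, ⟨hG.2.1.1, fun v hv w hw => ?_⟩, ?_⟩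
    · exact T.joined_st (hG.2.1.2 v hv w hw)
    · have h1 : T.stDGraph.edgesIn Set.univ =
          T.toDGraph.edgesIn Set.univ ∪ Set.range T.pair := by
        ext e
        constructor
        · rintro ⟨he, -⟩
          rcases T.edge_cases ⟨e, he⟩ with ⟨e', h⟩ | ⟨i, h⟩
          · have h' : e'.1 = e := congrArg Subtype.val h
            exact Or.inl ⟨h' ▸ e'.2, fun _ _ => trivial⟩
          · exact Or.inr ⟨i, congrArg Subtype.val h⟩
        · rintro (⟨he, -⟩ | ⟨i, rfl⟩)
          · exact ⟨(T.oldEdge ⟨e, he⟩).2, fun _ _ => trivial⟩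
          · exact ⟨(T.newEdge i).2, fun _ _ => trivial⟩
      have h2 : Disjoint (T.toDGraph.edgesIn Set.univ) (Set.range T.pair) := by
        rw [Set.disjoint_left]
        rintro e ⟨he, -⟩ ⟨i, hi⟩
        exact T.oldEdge_ne_newEdge ⟨e, he⟩ i (Subtype.ext hi.symm)
      have h3 : (Set.range T.pair).ncard = g := by
        have hinj : Function.Injective T.pair :=
          fun i j h => T.newEdge_injective (Subtype.ext h)
        rw [← Set.image_univ, Set.ncard_image_of_injective _ hinj]
        simp
      have h4 : (T.stDGraph.edgesIn Set.univ).ncard = (T.toDGraph.edgesIn Set.univ).ncard + g := by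
        refine (congrArg Set.ncard h1).trans
          ((Set.ncard_union_eq h2 (Set.toFinite _) (Set.toFinite _)).trans ?_)
        rw [h3]
      have h5 := hG.2.2
      have h6 : (T.stDGraph.vertsIn Set.univ).ncard = (T.toDGraph.vertsIn Set.univ).ncard := rfl
      omega
  stable := T.stable

lemma glue_map {T T' : Gr 0 (Mark g A)} (f : T ⟶ T') (x : T.F) :
    f.toFun (T.glue x) = T'.glue (f.toFun x) := by
  by_cases h : ∃ s, T.gLeg s = x
  · obtain ⟨s, rfl⟩ := h
    have h1 : ∀ s, f.toFun (T.gLeg s) = T'.gLeg s := fun s => f.leg _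
    rw [glue_gLeg, h1, h1, glue_gLeg]
  · push Not at h
    rw [T.glue_of_ne h, T'.glue_of_ne, f.isContraction.ι]
    intro s hs
    refine h s ((f.isContraction.unique _ (T'.gLeg_mem s).1).unique (f.leg _) hs.symm)

lemma isContraction_st {T T' : Gr 0 (Mark g A)} (f : T ⟶ T') :
    DGraph.IsContraction (G := T.stDGraph) (H := T'.stDGraph) f.toFun where
  r := f.isContraction.r
  ι := glue_map f
  tree v hv := T.isLeglessTree_st (f.isContraction.tree v hv)
  unique := f.isContraction.unique

end Gr

/-- The functor `st_{g,A} : 𝔾_{0, A ⊔ {1, …, g, 1^*, …, g^*}} ⟶ 𝔾_{g,A}`. -/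
def stFunctor (g : ℕ) (A : Type) : Gr 0 (Mark g A) ⥤ Gr g A where
  obj T := T.stGraph
  map {T T'} f :=
    (⟨f.toFun, Gr.isContraction_st f, fun a => f.leg (Sum.inl a)⟩ : Gr.Hom T.stGraph T'.stGraph)
  map_id _ := rfl
  map_comp _ _ := rfl

namespace Gr

variable {g : ℕ} {A : Type}

/-- The integral linear map underlying `η_T`: it identifies `ℤ^{E(T)} × ℤ^g` with
`ℤ^{E(st(T))}`. -/
def stLin (T : Gr 0 (Mark g A)) :
    ((T.toDGraph.Edge →₀ ℤ) × (Fin g →₀ ℤ)) →ₗ[ℤ] (T.stDGraph.Edge →₀ ℤ) :=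
  (Finsupp.lmapDomain ℤ ℤ T.oldEdge).coprod (Finsupp.lmapDomain ℤ ℤ T.newEdge)

lemma baseChange_stLin (T : Gr 0 (Mark g A))
    (x : ℝ ⊗[ℤ] ((T.toDGraph.Edge →₀ ℤ) × (Fin g →₀ ℤ))) :
    T.stLin.baseChange ℝ x =
      (Finsupp.lmapDomain ℤ ℤ T.oldEdge).baseChange ℝ ((LinearMap.fst ℤ _ _).baseChange ℝ x) +
      (Finsupp.lmapDomain ℤ ℤ T.newEdge).baseChange ℝ ((LinearMap.snd ℤ _ _).baseChange ℝ x) := by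
  rw [← LinearMap.comp_apply, ← LinearMap.comp_apply, ← LinearMap.baseChange_comp,
    ← LinearMap.baseChange_comp, ← LinearMap.add_apply, ← LinearMap.baseChange_add]
  rfl

lemma coord_oldEdge (T : Gr 0 (Mark g A)) (e)
    (x : ℝ ⊗[ℤ] ((T.toDGraph.Edge →₀ ℤ) × (Fin g →₀ ℤ))) :
    Poic.coord (T.oldEdge e) (T.stLin.baseChange ℝ x) =
      Poic.coord e ((LinearMap.fst ℤ _ _).baseChange ℝ x) := by
  rw [T.baseChange_stLin, map_add, coord_mapDomain T.oldEdge_injective,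
    coord_mapDomain_of_notMem _ fun i => (T.oldEdge_ne_newEdge e i).symm, add_zero]

lemma coord_newEdge (T : Gr 0 (Mark g A)) (i)
    (x : ℝ ⊗[ℤ] ((T.toDGraph.Edge →₀ ℤ) × (Fin g →₀ ℤ))) :
    Poic.coord (T.newEdge i) (T.stLin.baseChange ℝ x) =
      Poic.coord i ((LinearMap.snd ℤ _ _).baseChange ℝ x) := by
  rw [T.baseChange_stLin, map_add, coord_mapDomain T.newEdge_injective,
    coord_mapDomain_of_notMem _ fun e => T.oldEdge_ne_newEdge e i, zero_add]

lemma stLin_surjective (T : Gr 0 (Mark g A)) : Function.Surjective T.stLin := by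
  rw [← LinearMap.range_eq_top, eq_top_iff]
  rintro x -
  induction x using Finsupp.induction_linear with
  | zero => exact zero_mem _
  | add x y hx hy => exact add_mem hx hy
  | single e n =>
    rcases T.edge_cases e with ⟨e, rfl⟩ | ⟨i, rfl⟩
    · exact ⟨(Finsupp.single e n, 0), by simp [stLin]⟩
    · exact ⟨(0, Finsupp.single i n), by simp [stLin]⟩

lemma isForest_st (T : Gr 0 (Mark g A)) {Z : Set T.stDGraph.Edge} (h : ∀ i, T.newEdge i ∉ Z) :
    T.stDGraph.IsForest Z := by
  intro (K : Set T.F) hK hL hc he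
  have hd : Disjoint K T.toDGraph.legs := by
    refine Set.disjoint_left.2 fun x hx hxl => ?_
    rw [← T.leg_range] at hxl
    obtain ⟨a | s, rfl⟩ := hxl
    · refine Set.disjoint_left.1 hL hx ?_
      exact T.stGraph.leg_range ▸ ⟨a, rfl⟩
    · have h1 : T.gLeg s.swap ∈ K := by
        have := (hK _ hx).2
        change T.glue (T.gLeg s) ∈ K at this
        rwa [glue_gLeg] at this
      have h2 : T.gLeg s ∈ K := hx
      rcases s with i | i
      · refine h i (he _ ?_)
        rintro y (rfl | rfl) <;> assumption
      · refine h i (he _ ?_)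
        rintro y (rfl | rfl) <;> assumption
  have hK' := (T.isSubgraph_st hd).1 hK
  have hc' : T.toDGraph.IsConn K := ⟨hc.1, fun v hv w hw => T.joined_of_st hd (hc.2 v hv w hw)⟩
  refine T.isLeglessTree_st ⟨⟨hK', hc', ?_⟩, hd⟩
  have h1 := DGraph.card_verts_le hK' hc'
  have h2 := DGraph.card_edges_lt T.genus hK' (Set.subset_univ _) hc'.1
  omega

lemma stLin_natural {T T' : Gr 0 (Mark g A)} (f : T ⟶ T') :
    Finsupp.lmapDomain ℤ ℤ (isContraction_st f).edge ∘ₗ T'.stLin =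
      T.stLin ∘ₗ (Finsupp.lmapDomain ℤ ℤ f.isContraction.edge).prodMap LinearMap.id := by
  have h1 : ∀ e, (isContraction_st f).edge (T'.oldEdge e) = T.oldEdge (f.isContraction.edge e) :=
    fun e => rfl
  have h2 : ∀ i, (isContraction_st f).edge (T'.newEdge i) = T.newEdge i := by
    intro i
    refine Subtype.ext (Set.ext fun x => ?_)
    have key : ∀ s, f.toFun x = T'.gLeg s ↔ x = T.gLeg s := fun s =>
      ⟨fun h => (f.isContraction.unique _ (T'.gLeg_mem s).1).unique h (f.leg _),
        fun h => h ▸ f.leg _⟩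
    exact or_congr (key _) (key _)
  apply LinearMap.prod_ext <;> ext e : 2
  · simp [stLin, h1]
  · simp [stLin, h2]

/-- The morphism of poics `η_T : σ_T × ℝ_{>0}^g ⟶ σ_{st(T)}`. -/
def stHom (T : Gr 0 (Mark g A)) :
    Poic.prod (cone T.toDGraph) (openOrthant g) ⟶ cone T.stDGraph :=
  ({ lin := T.stLin
     maps := by
      rintro x ⟨⟨h1, -⟩, h2, h3⟩
      refine ⟨fun e => ?_, T.isForest_st fun i hi => ?_⟩
      · rcases T.edge_cases e with ⟨e, rfl⟩ | ⟨i, rfl⟩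
        · exact (T.coord_oldEdge e x).symm ▸ h1 e
        · exact (T.coord_newEdge i x).symm ▸ h2 i
      · have : i ∈ {i | Poic.coord i ((LinearMap.snd ℤ (T.toDGraph.Edge →₀ ℤ)
            (Fin g →₀ ℤ)).baseChange ℝ x) = 0} := (T.coord_newEdge i x).symm.trans hi
        exact Set.eq_empty_iff_forall_notMem.1 h3 i this } :
    Poic.Hom (Poic.prod (cone T.toDGraph) (openOrthant g)) (cone T.stDGraph))

end Gr

lemma realFunctional_eq_zero_of_surjective {σ ξ : Poic} (φ : σ ⟶ ξ)
    (hφ : Function.Surjective φ.lin) (f : ξ.N →ₗ[ℤ] ℤ)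
    (h : ∀ x ∈ σ.carrier, realFunctional f (Poic.real φ x) = 0) (y : ℝ ⊗[ℤ] ξ.N) :
    realFunctional f y = 0 := by
  have h1 : Submodule.span ℝ σ.carrier ≤ LinearMap.ker (realFunctional f ∘ₗ Poic.real φ) :=
    Submodule.span_le.2 h
  rw [σ.full] at h1
  obtain ⟨x, rfl⟩ : ∃ x, Poic.real φ x = y := by
    induction y using TensorProduct.induction_on with
    | zero => exact ⟨0, map_zero _⟩
    | tmul a n =>
      obtain ⟨m, rfl⟩ := hφ n
      exact ⟨a ⊗ₜ m, by simp [Poic.real]⟩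
    | add x y hx hy =>
      obtain ⟨x, rfl⟩ := hx
      obtain ⟨y, rfl⟩ := hy
      exact ⟨x + y, map_add _ _ _⟩
  exact h1 (Submodule.mem_top (x := x))

/-- The spanning tree fibration `st_{g,A} : ST_{g,A} ⟶ M^trop_{g,A}`. -/
def st (g : ℕ) (A : Type) : Mor (ST g A) (Mtrop g A) where
  F := (stFunctor g A).op
  η :=
    { app := fun T => T.unop.stHom
      naturality := fun T T' f => by
        apply Poic.hom_ext
        exact (Gr.stLin_natural f.unop).symm }
  notInFace T τ hτ h := by
    obtain ⟨-, f, hf, rfl⟩ := hτ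
    have key := realFunctional_eq_zero_of_surjective (T.unop.stHom) T.unop.stLin_surjective f
      fun x hx => le_antisymm (hf _ (T.unop.stHom.maps x hx)) (h ⟨x, hx, rfl⟩).2
    ext y
    exact ⟨fun hy => hy.1, fun hy => ⟨hy, (key y).ge⟩⟩

/-! ### The distance map -/

section Distance

variable (B : Type)

/-- The two-element subsets of `B`. -/
abbrev Pair : Type := {p : Finset B // p.card = 2}

/-- The linear map `M_B : ℝ^B ⟶ ℝ^(B choose 2)`, `x ↦ (x_i + x_j)_{i,j}`. -/
def pairSum : (B → ℝ) →ₗ[ℝ] (Pair B → ℝ) where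
  toFun x p := ∑ i ∈ p.1, x i
  map_add' x y := by ext p; simp [Finset.sum_add_distrib]
  map_smul' a x := by ext p; simp [Finset.mul_sum]

/-- `Q_B`, the cokernel of `M_B`. -/
abbrev Q : Type := (Pair B → ℝ) ⧸ LinearMap.range (pairSum B)

variable {B}

open Classical in
/-- The vector whose entry at `{i, j}` is `1` if `i` and `j` are separated by the relation `R`,
and `0` otherwise. -/
def sepVec (R : B → B → Prop) : Pair B → ℝ :=
  fun p => if ∃ i ∈ p.1, ∃ j ∈ p.1, R i j then 1 else 0

/-- `v_I`: the class of the distance vector of the tree with a single edge, of length `1`, that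
separates the legs in `I` from the other legs. -/
def splitVec (I : Set B) : Q B := Submodule.Quotient.mk (sepVec fun i j => i ∈ I ∧ j ∉ I)

variable (B) in
/-- The lattice `N_dist`, generated by the vectors `v_I` with `1 < #I < #B - 1`. -/
def Ndist : Submodule ℤ (Q B) :=
  Submodule.span ℤ {v | ∃ I : Set B, 1 < I.ncard ∧ I.ncard + 1 < Nat.card B ∧ splitVec I = v}

instance [Finite B] : Module.Finite ℤ (Ndist B) := by
  refine Module.Finite.span_of_finite ℤ ((Set.finite_range (splitVec (B := B))).subset ?_)
  rintro _ ⟨I, -, -, rfl⟩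
  exact ⟨I, rfl⟩

instance [Finite B] : Module.Free ℤ (Ndist B) := by
  have : Module.IsTorsionFree ℤ (Q B) := Module.IsTorsionFree.trans ℝ
  have : Module.IsTorsionFree ℤ (Ndist B) :=
    Function.Injective.moduleIsTorsionFree (Ndist B).subtype Subtype.val_injective
      (fun _ _ => rfl)
  infer_instance

lemma sepVec_congr {R R' : B → B → Prop}
    (h : ∀ i j, (R i j ∨ R j i) ↔ (R' i j ∨ R' j i)) : sepVec R = sepVec R' := by
  have key : ∀ {R R' : B → B → Prop} (p : Pair B),
      (∀ i j, (R i j ∨ R j i) → (R' i j ∨ R' j i)) →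
      (∃ i ∈ p.1, ∃ j ∈ p.1, R i j) → ∃ i ∈ p.1, ∃ j ∈ p.1, R' i j := by
    rintro R R' p h ⟨i, hi, j, hj, hij⟩
    rcases h i j (Or.inl hij) with h | h
    exacts [⟨i, hi, j, hj, h⟩, ⟨j, hj, i, hi, h⟩]
  ext p
  have : (∃ i ∈ p.1, ∃ j ∈ p.1, R i j) ↔ ∃ i ∈ p.1, ∃ j ∈ p.1, R' i j :=
    ⟨key p fun i j => (h i j).1, key p fun i j => (h i j).2⟩
  by_cases h1 : ∃ i ∈ p.1, ∃ j ∈ p.1, R i j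
  · rw [sepVec, sepVec, if_pos h1, if_pos (this.1 h1)]
  · rw [sepVec, sepVec, if_neg h1, if_neg fun h2 => h1 (this.2 h2)]

lemma splitVec_compl (I : Set B) : splitVec Iᶜ = splitVec I := by
  refine congrArg Submodule.Quotient.mk (sepVec_congr fun i j => ?_)
  simp only [Set.mem_compl_iff]
  tauto

lemma splitVec_of_ncard_le_one [Finite B] {I : Set B} (h : I.ncard ≤ 1) : splitVec I = 0 := by
  classical
  rw [Set.ncard_le_one_iff_eq] at h
  rcases h with rfl | ⟨b, rfl⟩
  · have : sepVec (fun i j : B => i ∈ (∅ : Set B) ∧ j ∉ (∅ : Set B)) = 0 := by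
      ext p; simp [sepVec]
    rw [splitVec, this, Submodule.Quotient.mk_zero]
  · rw [splitVec, Submodule.Quotient.mk_eq_zero]
    refine ⟨Pi.single b 1, ?_⟩
    ext ⟨p, hp⟩
    obtain ⟨i, j, hij, rfl⟩ := Finset.card_eq_two.1 hp
    simp only [pairSum, LinearMap.coe_mk, AddHom.coe_mk, Finset.sum_pair hij, sepVec,
      Finset.mem_insert, Finset.mem_singleton, Set.mem_singleton_iff]
    by_cases h1 : i = b
    · subst h1
      rw [if_pos ⟨i, Or.inl rfl, j, Or.inr rfl, rfl, hij.symm⟩]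
      simp [hij.symm]
    · by_cases h2 : j = b
      · subst h2
        rw [if_pos ⟨j, Or.inr rfl, i, Or.inl rfl, rfl, hij⟩]
        simp [hij]
      · rw [if_neg]
        · simp [h1, h2]
        · rintro ⟨k, rfl | rfl, l, -, h, -⟩ <;> contradiction

lemma splitVec_mem [Finite B] (I : Set B) : splitVec I ∈ Ndist B := by
  by_cases h1 : I.ncard ≤ 1
  · rw [splitVec_of_ncard_le_one h1]; exact zero_mem _
  by_cases h2 : Iᶜ.ncard ≤ 1
  · rw [← splitVec_compl, splitVec_of_ncard_le_one h2]; exact zero_mem _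
  have := Set.ncard_add_ncard_compl I
  exact Submodule.subset_span ⟨I, by omega, by omega, rfl⟩

end Distance

namespace Gr

variable {g : ℕ} {B : Type}

/-- The distance vector of the metric of length `1` on the edge `e` of a tree and `0` elsewhere:
its entry at `{i, j}` is `1` if the path between the legs `i` and `j` passes through `e`, that is,
if the vertices at these legs are not joined in the complement of `e`, and `0` otherwise. -/
def edgeDist (T : Gr g B) (e : T.toDGraph.Edge) : Q B :=
  Submodule.Quotient.mk (sepVec fun i j =>
    ¬ T.toDGraph.Joined e.1ᶜ (T.r (T.leg i)) (T.r (T.leg j)))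

lemma isSubgraph_compl (G : DGraph) (e : G.Edge) : G.IsSubgraph e.1ᶜ := by
  obtain ⟨e, x, hx, rfl⟩ := e
  intro y hy
  constructor
  · rintro (h | h)
    · refine hx ?_
      rw [← h, G.ι_r]
    · refine hx ?_
      have h' : G.r y = G.ι x := h
      have := G.ι_r y
      rw [h', G.ι_ι] at this
      exact this.symm
  · rintro (h | h)
    · refine hy (Or.inr ?_)
      rw [← h, G.ι_ι]; rfl
    · refine hy (Or.inl ?_)
      have h' : G.ι y = G.ι x := h
      rw [← G.ι_ι y, h', G.ι_ι]

lemma edgeDist_mem [Finite B] (T : Gr g B) (e : T.toDGraph.Edge) : T.edgeDist e ∈ Ndist B := by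
  have hsub := isSubgraph_compl T.toDGraph e
  have symm : ∀ {v w}, T.toDGraph.Joined e.1ᶜ v w → T.toDGraph.Joined e.1ᶜ w v := fun h =>
    h.symm fun x hx => (hsub x hx).2
  obtain ⟨x, hx, he⟩ := e.2
  have two : ∀ w, T.toDGraph.Joined Set.univ (T.r x) w →
      T.toDGraph.Joined e.1ᶜ (T.r x) w ∨ T.toDGraph.Joined e.1ᶜ (T.r (T.ι x)) w := by
    intro w h
    induction h with
    | refl => exact Or.inl Relation.ReflTransGen.refl
    | tail _ hbc ih =>
      obtain ⟨y, -, rfl, rfl⟩ := hbc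
      by_cases hy : y ∈ e.1
      · rw [he] at hy
        rcases hy with rfl | hy
        · exact Or.inr Relation.ReflTransGen.refl
        · have hy' : y = T.ι x := hy
          subst hy'
          rw [T.ι_ι]
          exact Or.inl Relation.ReflTransGen.refl
      · exact ih.imp (fun h => h.tail ⟨y, hy, rfl, rfl⟩) (fun h => h.tail ⟨y, hy, rfl, rfl⟩)
  have two' : ∀ i, T.toDGraph.Joined e.1ᶜ (T.r x) (T.r (T.leg i)) ∨
      T.toDGraph.Joined e.1ᶜ (T.r (T.ι x)) (T.r (T.leg i)) := fun i =>
    two _ (T.genus.2.1.2 _ ⟨trivial, DGraph.r_mem_V _⟩ _ ⟨trivial, DGraph.r_mem_V _⟩)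
  convert splitVec_mem {i | T.toDGraph.Joined e.1ᶜ (T.r x) (T.r (T.leg i))} using 1
  refine congrArg Submodule.Quotient.mk (sepVec_congr fun i j => ?_)
  simp only [Set.mem_ofPred_eq]
  constructor
  · intro h
    have h' : ¬ T.toDGraph.Joined e.1ᶜ (T.r (T.leg i)) (T.r (T.leg j)) := by
      rcases h with h | h
      exacts [h, fun h1 => h (symm h1)]
    by_cases hi : T.toDGraph.Joined e.1ᶜ (T.r x) (T.r (T.leg i))
    · exact Or.inl ⟨hi, fun hj => h' ((symm hi).trans hj)⟩
    · by_cases hj : T.toDGraph.Joined e.1ᶜ (T.r x) (T.r (T.leg j))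
      · exact Or.inr ⟨hj, hi⟩
      · have hi' := (two' i).resolve_left hi
        have hj' := (two' j).resolve_left hj
        exact absurd ((symm hi').trans hj') h'
  · rintro (⟨h1, h2⟩ | ⟨h1, h2⟩)
    · exact Or.inl fun h => h2 (h1.trans h)
    · exact Or.inr fun h => h2 (h1.trans h)

/-- The integral linear map underlying the distance map `dist_T`. -/
def distLin [Finite B] (T : Gr g B) : (T.toDGraph.Edge →₀ ℤ) →ₗ[ℤ] Ndist B :=
  Finsupp.linearCombination ℤ fun e => ⟨T.edgeDist e, T.edgeDist_mem e⟩

lemma edgeDist_map {T T' : Gr g B} (f : T ⟶ T') (e : T'.toDGraph.Edge) :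
    T.edgeDist (f.isContraction.edge e) = T'.edgeDist e := by
  have hf := f.isContraction
  have key : ∀ i j, T.toDGraph.Joined (hf.edge e).1ᶜ (T.r (T.leg i)) (T.r (T.leg j)) ↔
      T'.toDGraph.Joined e.1ᶜ (T'.r (T'.leg i)) (T'.r (T'.leg j)) := by
    intro i j
    have hl : ∀ i, f.toFun (T.r (T.leg i)) = T'.r (T'.leg i) := fun i => by rw [hf.r, f.leg]
    constructor
    · intro h
      have := hf.joined_image h
      rw [hl, hl] at this
      refine this.mono ?_
      rintro _ ⟨y, hy, rfl⟩
      exact hy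
    · intro h
      have hs := isSubgraph_compl T'.toDGraph e
      refine hf.joined_preimage hs h ?_ (DGraph.r_mem_V _) _ (DGraph.r_mem_V _) _
        (DGraph.r_mem_V _) (hl i) (hl j)
      intro he
      obtain ⟨y, hy, hye⟩ := e.2
      have hyV : y ∉ T'.toDGraph.V := fun h => hy (DGraph.ι_of_mem_V h)
      rw [hye] at he
      rcases he with he | he
      · exact hyV (he ▸ DGraph.r_mem_V _)
      · exact hyV (DGraph.ι_mem_V.1 (he ▸ DGraph.r_mem_V _))
  refine congrArg Submodule.Quotient.mk (sepVec_congr fun i j => ?_)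
  rw [key, key]

lemma distLin_natural [Finite B] {T T' : Gr g B} (f : T ⟶ T') :
    T.distLin ∘ₗ Finsupp.lmapDomain ℤ ℤ f.isContraction.edge = T'.distLin := by
  ext e
  simp [distLin, edgeDist_map]

end Gr

/-- The linear structure `D_{g,A} : ST_{g,A} ⟶ (N_dist)_ℝ`: the projection to `σ_T` followed by the
distance map. -/
def distST (g : ℕ) (A : Type) [Finite A] : Mor (ST g A) (underline (Ndist (Mark g A))) where
  F := (Functor.const _).obj ⟨⟨⟩⟩
  η :=
    { app := fun T =>
        ({ lin := T.unop.distLin ∘ₗ LinearMap.fst ℤ _ _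
           maps := fun _ _ => trivial } :
          Poic.Hom (Poic.prod (cone T.unop.toDGraph) (openOrthant g))
            (Poic.whole (Ndist (Mark g A))))
      naturality := fun T T' f => by
        apply Poic.hom_ext
        apply LinearMap.ext
        rintro ⟨x, y⟩
        exact LinearMap.congr_fun (Gr.distLin_natural f.unop) x }
  notInFace T τ hτ _ := by
    obtain ⟨-, f, hf, rfl⟩ := hτ
    refine Set.eq_univ_of_forall fun x => ⟨trivial, ?_⟩
    have := hf (-x) trivial
    rw [map_neg] at this
    linarith

end Trop
end

/-!
The poics `σ_T × ℝ_{>0}^g` lie between an open and a closed orthant, so their faces are given by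
the vanishing of coordinates, that is, by the contraction of forests (`Gr.hasFaces_of_basis`).
Stable trees are rigid: a vertex is the median of any three legs on different branches at it,
hence there is at most one contraction between two trees (`Gr.thin`), and the spanning tree
complex is a poic-complex. It is pure because every tree has a trivalent refinement
(`Gr.exists_trivalent`). Cutting the edges outside of a spanning tree shows that every graph is
obtained from a tree by joining legs, and cutting the preimages of the joined legs shows that
contractions lift uniquely (`Gr.exists_lift`); so there is a poic-fibration
(`isPoicFibration_st`).

The group of cycles is a colimit over all compatible subdivisions, but every such subdivision is
trivial (`IsSubdivision.full`). For `g ≥ 2`, consider the tree with two vertices, joined by a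
bridge, and with the legs `i` at one vertex and `i*` at the other. Joining the legs gives a graph
with `g + 1` parallel edges between two vertices, the bridge being one of them. All permutations
of these edges are automorphisms of the graph and, by compatibility, permute the cells of the
subdivision. On the other hand, every cell has a face over the tree with a single vertex, and so
it recedes in a direction in which only the coordinate of the bridge vanishes, the coordinates in
`ℝ_{>0}^g` being positive. Applying the symmetries to this, every cell meets the hyperplanes on
which two coordinates agree, is therefore stable under all transpositions, and contains the
diagonal (`one_mem_of_recession`). Since different cells are disjoint, there is only one
(`IsSubdivision.full_dumbbell`). The same then holds for the face given by the tree with a single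
vertex (`IsSubdivision.full_star`), and there it is clear if `g ≤ 1`. For an arbitrary tree, each
cell contains the points with edge lengths zero and one point on each axis of an edge length,
since it has faces over the corresponding contractions of the tree; so all cells contain the
points with edge lengths `1` and large remaining coordinates (`exists_mem_ri_of_axes`), and there
is again only one cell.

It remains to determine the balanced weights on the trivalent trees. A tree of codimension one has
a vertex of valency four and three trivalent refinements. The three splits of the legs by the
additional edges add up to the sum of the four splits at the vertex (`Gr.sum_splitVec`), and
four-point functionals, which vanish on the edges of the tree (`Gr.fourPoint_edgeDist`), show that
there is no other relation up to multiples (`Gr.exists_refinements`). Hence a weight is balanced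
exactly if it takes the same value on the three refinements. As any two trivalent trees are
connected through trees of codimension one (`Gr.eq_of_codim_one`), the Minkowski weights of top
dimension are the constant ones (`IsFull.mem_minkowski_iff`). They are equivariant and are
pullbacks of the constant weights on the complex itself, so the colimit is `ℤ` (`cyclesEquiv`).
-/

noncomputable section
namespace Trop

/-! ### Relative interiors of convex cones -/

namespace Poic

section ri

variable {V W : Type*} [AddCommGroup V] [Module ℝ V] [AddCommGroup W] [Module ℝ W]

/-- The algebraic relative interior of a convex set `K`: the points from which every segment of
`K` ending there can be prolonged a little inside `K`. -/
def ri (K : Set V) : Set V := {x ∈ K | ∀ z ∈ K, ∃ ε : ℝ, 0 < ε ∧ x + ε • (x - z) ∈ K}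

lemma ri_image (L : V →ₗ[ℝ] W) (hL : Function.Injective L) (K : Set V) :
    ri (L '' K) = L '' ri K := by
  ext y
  constructor
  · rintro ⟨⟨x, hx, rfl⟩, h⟩
    refine ⟨x, ⟨hx, fun z hz => ?_⟩, rfl⟩
    obtain ⟨ε, h0, y, hy, hxy⟩ := h _ ⟨z, hz, rfl⟩
    refine ⟨ε, h0, ?_⟩
    rw [← map_sub, ← map_smul, ← map_add] at hxy
    rwa [← hL hxy]
  · rintro ⟨x, ⟨hx, h⟩, rfl⟩
    refine ⟨⟨x, hx, rfl⟩, ?_⟩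
    rintro _ ⟨z, hz, rfl⟩
    obtain ⟨ε, h0, hy⟩ := h z hz
    exact ⟨ε, h0, _, hy, by simp⟩

end ri

lemma add_mem (σ : Poic) {x y} (hx : x ∈ σ.carrier) (hy : y ∈ σ.carrier) :
    x + y ∈ σ.carrier := by
  obtain ⟨P, Q, -, -, h⟩ := σ.polyhedral
  rw [h] at hx hy ⊢
  refine ⟨fun f hf => ?_, fun f hf => ?_⟩
  · rw [map_add]; exact add_nonneg (hx.1 f hf) (hy.1 f hf)
  · rw [map_add]; exact add_pos (hx.2 f hf) (hy.2 f hf)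

lemma nonneg_of_forall_pos {a b : ℝ} (h : ∀ ε : ℝ, 0 < ε → 0 ≤ a + ε * b) : 0 ≤ a := by
  have h1 : Filter.Tendsto (fun ε : ℝ => a + ε * b) (nhdsWithin 0 (Set.Ioi 0)) (nhds a) := by
    have : Continuous fun ε : ℝ => a + ε * b := by fun_prop
    have h2 := this.tendsto 0
    simp only [zero_mul, add_zero] at h2
    exact h2.mono_left nhdsWithin_le_nhds
  exact ge_of_tendsto h1 (Filter.mem_of_superset self_mem_nhdsWithin fun ε hε => h ε hε)

/-- A poic contains the sum of one of its points and a point of its closure, the latter given as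
the end of an open segment in the poic. -/
lemma add_mem_of_closure (σ : Poic) {a u w} (ha : a ∈ σ.carrier)
    (hu : ∀ ε : ℝ, 0 < ε → u + ε • w ∈ σ.carrier) : a + u ∈ σ.carrier := by
  obtain ⟨P, Q, -, -, h⟩ := σ.polyhedral
  rw [h] at ha ⊢
  have key : ∀ f : σ.N →ₗ[ℤ] ℤ, (∀ x ∈ σ.carrier, 0 ≤ realFunctional f x) →
      0 ≤ realFunctional f u := fun f hf =>
    nonneg_of_forall_pos (b := realFunctional f w) fun ε hε => by
      simpa using hf _ (hu ε hε)
  refine ⟨fun f hf => ?_, fun f hf => ?_⟩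
  · rw [map_add]; exact add_nonneg (ha.1 f hf) (key f fun x hx => by rw [h] at hx; exact hx.1 f hf)
  · rw [map_add]
    exact add_pos_of_pos_of_nonneg (ha.2 f hf)
      (key f fun x hx => by rw [h] at hx; exact (hx.2 f hf).le)

/-- A point lies in the relative interior exactly if every closed defining inequality that is
sharp at this point is an equation on the whole cone. -/
lemma mem_relint_iff_of_eq {σ : Poic} {P Q : Set (σ.N →ₗ[ℤ] ℤ)} (hP : P.Finite) (hQ : Q.Finite)
    (h : σ.carrier = {x | (∀ f ∈ P, 0 ≤ realFunctional f x) ∧ ∀ f ∈ Q, 0 < realFunctional f x})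
    {x} : (x ∈ σ.relint ↔ x ∈ σ.carrier ∧ ∀ f ∈ P, realFunctional f x = 0 →
      ∀ z ∈ σ.carrier, realFunctional f z = 0) ∧ (x ∈ σ.relint ↔ x ∈ ri σ.carrier) := by
  -- an inequality that is sharp at `x` cuts out a face through `x`, hence the whole cone
  have h1 : x ∈ σ.relint → x ∈ σ.carrier ∧ ∀ f ∈ P, realFunctional f x = 0 →
      ∀ z ∈ σ.carrier, realFunctional f z = 0 := by
    rintro ⟨hx, hface⟩
    refine ⟨hx, fun f hf hfx z hz => ?_⟩
    have hneg : ∀ y, realFunctional (-f) y = - realFunctional f y := by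
      intro y
      induction y using TensorProduct.induction_on with
      | zero => simp
      | tmul a n => simp
      | add x y hx hy => simp only [map_add, hx, hy]; ring
    have hpos : ∀ y ∈ σ.carrier, 0 ≤ realFunctional f y := fun y hy => by
      rw [h] at hy; exact hy.1 f hf
    have := hface {y ∈ σ.carrier | 0 ≤ realFunctional (-f) y}
      ⟨⟨x, hx, by rw [hneg, hfx, neg_zero]⟩, -f, fun y hy => by
        rw [hneg]; linarith [hpos y hy], rfl⟩ ⟨hx, by rw [hneg, hfx, neg_zero]⟩
    rw [← this] at hz
    have h2 := hz.2
    rw [hneg] at h2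
    linarith [hpos z hz.1]
  -- the remaining inequalities are strict at `x` and stay strict a little beyond `x`
  have h2 : (x ∈ σ.carrier ∧ ∀ f ∈ P, realFunctional f x = 0 →
      ∀ z ∈ σ.carrier, realFunctional f z = 0) → x ∈ ri σ.carrier := by
    rintro ⟨hx, hf⟩
    refine ⟨hx, fun z hz => ?_⟩
    have ev : ∀ f : σ.N →ₗ[ℤ] ℤ, 0 < realFunctional f x → ∀ᶠ ε : ℝ in nhdsWithin 0 (Set.Ioi 0),
        0 < realFunctional f (x + ε • (x - z)) := by
      intro f hfx
      have hc : Continuous fun ε : ℝ => realFunctional f x + ε * (realFunctional f x -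
        realFunctional f z) := by fun_prop
      have := (hc.tendsto 0).eventually (lt_mem_nhds (a := 0) (by simpa using hfx))
      refine (this.filter_mono nhdsWithin_le_nhds).mono fun ε hε => ?_
      simpa using hε
    have hx' := hx
    have hz' := hz
    rw [h] at hx' hz'
    have e1 : ∀ᶠ ε : ℝ in nhdsWithin 0 (Set.Ioi 0), ∀ f ∈ P,
        0 ≤ realFunctional f (x + ε • (x - z)) := by
      rw [Filter.eventually_all_finite hP]
      intro f hfP
      rcases (hx'.1 f hfP).eq_or_lt with h0 | h0
      · have := hf f hfP h0.symm z hz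
        refine Filter.Eventually.of_forall fun ε => ?_
        simp [this, ← h0]
      · exact (ev f h0).mono fun ε hε => hε.le
    have e2 : ∀ᶠ ε : ℝ in nhdsWithin 0 (Set.Ioi 0), ∀ f ∈ Q,
        0 < realFunctional f (x + ε • (x - z)) := by
      rw [Filter.eventually_all_finite hQ]
      exact fun f hfQ => ev f (hx'.2 f hfQ)
    have e3 : ∀ᶠ ε : ℝ in nhdsWithin 0 (Set.Ioi 0), 0 < ε := self_mem_nhdsWithin
    obtain ⟨ε, h3, h4, h5⟩ := (e1.and (e2.and e3)).exists
    refine ⟨ε, h5, ?_⟩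
    rw [h]
    exact ⟨h3, h4⟩
  -- a functional that is `≤ 0` on the cone and `0` at `x` vanishes at the points `z` of the cone,
  -- as it is `≤ 0` at a prolongation of the segment from `z` to `x`
  have h3 : x ∈ ri σ.carrier → x ∈ σ.relint := by
    rintro ⟨hx, hri⟩
    refine ⟨hx, ?_⟩
    rintro _ ⟨-, f, hf, rfl⟩ hxf
    refine Set.Subset.antisymm (fun y hy => hy.1) fun z hz => ⟨hz, ?_⟩
    obtain ⟨ε, h0, hy⟩ := hri z hz
    have h4 := hf _ hy
    have h5 := hf x hx
    have h6 := hxf.2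
    simp only [map_add, map_smul, map_sub, smul_eq_mul] at h4
    have h7 : realFunctional f x = 0 := le_antisymm h5 h6
    rw [h7] at h4
    nlinarith
  exact ⟨⟨h1, fun h => h3 (h2 h)⟩, ⟨fun h => h2 (h1 h), h3⟩⟩

lemma relint_eq_ri (σ : Poic) : σ.relint = ri σ.carrier := by
  obtain ⟨P, Q, hP, hQ, h⟩ := σ.polyhedral
  ext x
  exact (mem_relint_iff_of_eq hP hQ h).2

lemma relint_nonempty (σ : Poic) : σ.relint.Nonempty := by
  classical
  obtain ⟨P, Q, hP, hQ, h⟩ := σ.polyhedral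
  have hpos : ∀ f ∈ P, ∀ y ∈ σ.carrier, 0 ≤ realFunctional f y := fun f hf y hy => by
    rw [h] at hy; exact hy.1 f hf
  -- the sum of points at which the single inequalities in `P` are strict, if such points exist
  suffices ∀ P' : Set (σ.N →ₗ[ℤ] ℤ), P'.Finite → P' ⊆ P → ∃ x ∈ σ.carrier, ∀ f ∈ P',
      realFunctional f x = 0 → ∀ z ∈ σ.carrier, realFunctional f z = 0 by
    obtain ⟨x, hx, hx'⟩ := this P hP subset_rfl
    exact ⟨x, (mem_relint_iff_of_eq hP hQ h).1.2 ⟨hx, hx'⟩⟩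
  intro P' hP'
  induction P', hP' using Set.Finite.induction_on with
  | empty => exact fun _ => ⟨_, σ.nonempty.some_mem, by simp⟩
  | @insert f P' hf hP' ih =>
    intro hsub
    obtain ⟨x, hx, hx'⟩ := ih fun y hy => hsub (Or.inr hy)
    by_cases hz : ∃ z ∈ σ.carrier, realFunctional f z ≠ 0
    · obtain ⟨z, hz, hfz⟩ := hz
      refine ⟨x + z, σ.add_mem hx hz, ?_⟩
      rintro f' (rfl | hf') h0
      · rw [map_add] at h0
        have h1 := hpos f' (hsub (Or.inl rfl)) x hx
        have h2 := hpos f' (hsub (Or.inl rfl)) z hz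
        exact absurd (by linarith) hfz
      · rw [map_add] at h0
        have h1 := hpos f' (hsub (Or.inr hf')) x hx
        have h2 := hpos f' (hsub (Or.inr hf')) z hz
        exact hx' f' hf' (by linarith)
    · push Not at hz
      refine ⟨x, hx, ?_⟩
      rintro f' (rfl | hf') h0
      · exact hz
      · exact hx' f' hf' h0

lemma real_id (σ : Poic) (x) : real (𝟙 σ) x = x := by simp [real]

/-- An isomorphism of poics identifies the cones. -/
lemma image_carrier_of_iso {σ ξ : Poic} (i : σ ≅ ξ) : real i.hom '' σ.carrier = ξ.carrier := by
  refine Set.Subset.antisymm ?_ fun y hy => ⟨real i.inv y, i.inv.maps y hy, ?_⟩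
  · rintro _ ⟨x, hx, rfl⟩
    exact i.hom.maps x hx
  · rw [← real_comp_app, i.inv_hom_id, real_id]

lemma real_iso_injective {σ ξ : Poic} (i : σ ≅ ξ) : Function.Injective (real i.hom) := by
  intro x y h
  rw [← real_id σ x, ← real_id σ y, ← i.hom_inv_id, real_comp_app, real_comp_app, h]

lemma image_relint_of_iso {σ ξ : Poic} (i : σ ≅ ξ) : real i.hom '' σ.relint = ξ.relint := by
  rw [relint_eq_ri, relint_eq_ri, ← ri_image _ (real_iso_injective i), image_carrier_of_iso]

lemma real_injective {σ ξ : Poic} (φ : σ ⟶ ξ) (h : Function.Injective φ.lin) :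
    Function.Injective (real φ) :=
  Module.Flat.lTensor_preserves_injective_linearMap (M := ℝ) φ.lin h

lemma dim_eq_finrank (σ : Poic) : σ.dim = Module.finrank ℤ σ.N := by
  rw [dim, σ.full, finrank_top, Module.finrank_baseChange]

/-! ### Poics between an open and a closed orthant -/

/-- The real coordinate of a point with respect to a basis of the lattice. -/
def crd {N κ : Type} [AddCommGroup N] (b : Module.Basis κ ℤ N) (k : κ) :
    (ℝ ⊗[ℤ] N) →ₗ[ℝ] ℝ := realFunctional (b.coord k)

section crd

variable {N κ : Type} [AddCommGroup N] (b : Module.Basis κ ℤ N)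

lemma crd_eq_repr (k : κ) (x : ℝ ⊗[ℤ] N) : crd b k x = (b.baseChange ℝ).repr x k := by
  induction x using TensorProduct.induction_on with
  | zero => simp
  | tmul a n => simp [crd, mul_comm, Module.Basis.baseChange]
  | add x y hx hy => simp [hx, hy]

lemma crd_ext {x y : ℝ ⊗[ℤ] N} (h : ∀ k, crd b k x = crd b k y) : x = y := by
  apply (b.baseChange ℝ).repr.injective
  ext k
  rw [← crd_eq_repr, ← crd_eq_repr, h]

/-- The point with given coordinates. -/
def ofCrd [Finite κ] (c : κ → ℝ) : ℝ ⊗[ℤ] N :=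
  (b.baseChange ℝ).repr.symm (Finsupp.equivFunOnFinite.symm c)

@[simp] lemma crd_ofCrd [Finite κ] (c : κ → ℝ) (k : κ) : crd b k (ofCrd b c) = c k := by
  simp [crd_eq_repr, ofCrd]

lemma realFunctional_eq_sum [Fintype κ] (f : N →ₗ[ℤ] ℤ) (x : ℝ ⊗[ℤ] N) :
    realFunctional f x = ∑ k, (f (b k) : ℝ) * crd b k x := by
  induction x using TensorProduct.induction_on with
  | zero => simp
  | tmul a n =>
    conv_lhs => rw [← b.sum_repr n]
    simp only [realFunctional_tmul, map_sum, map_smul, smul_eq_mul, crd, Module.Basis.coord_apply]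
    push_cast
    rw [Finset.sum_mul]
    exact Finset.sum_congr rfl fun k _ => by ring
  | add x y hx hy => simp only [map_add, hx, hy, mul_add, Finset.sum_add_distrib]

end crd

/-- The cone lies between the open and the closed orthant of a basis of the lattice. -/
structure IsOrthantal {κ : Type} (σ : Poic) (b : Module.Basis κ ℤ σ.N) : Prop where
  of_pos : ∀ x, (∀ k, 0 < crd b k x) → x ∈ σ.carrier
  nonneg : ∀ x ∈ σ.carrier, ∀ k, 0 ≤ crd b k x

namespace IsOrthantal

variable {κ : Type} [Finite κ] {σ : Poic} {b : Module.Basis κ ℤ σ.N} (hσ : IsOrthantal σ b)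
include hσ

lemma coeff_nonpos {f : σ.N →ₗ[ℤ] ℤ} (hf : ∀ x ∈ σ.carrier, realFunctional f x ≤ 0) (k : κ) :
    f (b k) ≤ 0 := by
  classical
  have := Fintype.ofFinite κ
  have h : 0 ≤ -(f (b k) : ℝ) := by
    -- the points with coordinate `1 + ε` at `k` and `ε` elsewhere are in the cone
    refine nonneg_of_forall_pos (b := -∑ j, (f (b j) : ℝ)) fun ε hε => ?_
    have := hf (ofCrd b fun j => (if j = k then 1 else 0) + ε) (hσ.of_pos _ fun j => by
      rw [crd_ofCrd]; split_ifs <;> linarith)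
    rw [realFunctional_eq_sum b] at this
    simp only [crd_ofCrd, mul_add, Finset.sum_add_distrib, mul_ite, mul_one, mul_zero,
      Finset.sum_ite_eq', Finset.mem_univ, if_true, ← Finset.sum_mul] at this
    linarith
  have : (f (b k) : ℝ) ≤ 0 := by linarith
  exact_mod_cast this

/-- The face cut out by a functional is given by the vanishing of the coordinates in its
support. -/
lemma face_iff {f : σ.N →ₗ[ℤ] ℤ} (hf : ∀ x ∈ σ.carrier, realFunctional f x ≤ 0) {x}
    (hx : x ∈ σ.carrier) : 0 ≤ realFunctional f x ↔ ∀ k, f (b k) ≠ 0 → crd b k x = 0 := by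
  have := Fintype.ofFinite κ
  rw [realFunctional_eq_sum b]
  have hk : ∀ k, (f (b k) : ℝ) ≤ 0 := fun k => by exact_mod_cast hσ.coeff_nonpos hf k
  have h1 : ∀ k ∈ Finset.univ, (f (b k) : ℝ) * crd b k x ≤ 0 := fun k _ =>
    mul_nonpos_of_nonpos_of_nonneg (hk k) (hσ.nonneg x hx k)
  constructor
  · intro h k hfk
    have h2 := (Finset.sum_eq_zero_iff_of_nonpos h1).1 (le_antisymm (Finset.sum_nonpos h1) h) k
      (Finset.mem_univ k)
    rcases mul_eq_zero.1 h2 with h3 | h3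
    · exact absurd (by exact_mod_cast h3) hfk
    · exact h3
  · intro h
    refine (Finset.sum_eq_zero fun k _ => ?_).ge
    by_cases hk : f (b k) = 0
    · simp [hk]
    · simp [h k hk]

lemma exists_of_isFace {τ} (h : σ.IsFace τ) :
    ∃ Z : Set κ, τ = {x ∈ σ.carrier | ∀ k ∈ Z, crd b k x = 0} := by
  obtain ⟨-, f, hf, rfl⟩ := h
  refine ⟨{k | f (b k) ≠ 0}, Set.ext fun x => ?_⟩
  exact and_congr_right fun hx => hσ.face_iff hf hx

lemma isFace (Z : Set κ) (hne : {x ∈ σ.carrier | ∀ k ∈ Z, crd b k x = 0}.Nonempty) :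
    σ.IsFace {x ∈ σ.carrier | ∀ k ∈ Z, crd b k x = 0} := by
  classical
  have := Fintype.ofFinite κ
  set f : σ.N →ₗ[ℤ] ℤ := b.constr ℤ fun k => if k ∈ Z then -1 else 0 with hfdef
  have hfb : ∀ k, f (b k) = if k ∈ Z then -1 else 0 := fun k => b.constr_basis ℤ _ k
  have hf : ∀ x ∈ σ.carrier, realFunctional f x ≤ 0 := by
    intro x hx
    rw [realFunctional_eq_sum b]
    refine Finset.sum_nonpos fun k _ => ?_
    rw [hfb]
    have := hσ.nonneg x hx k
    split_ifs <;> simp [this]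
  refine ⟨hne, f, hf, Set.ext fun x => and_congr_right fun hx => ?_⟩
  rw [hσ.face_iff hf hx]
  refine forall_congr' fun k => ?_
  rw [hfb]
  by_cases hk : k ∈ Z <;> simp [hk]

lemma mem_relint_iff {x} : x ∈ σ.relint ↔ ∀ k, 0 < crd b k x := by
  constructor
  · rintro ⟨hx, h⟩ k
    refine (hσ.nonneg x hx k).lt_of_ne fun h0 => ?_
    have h1 : x ∈ {x ∈ σ.carrier | ∀ j ∈ ({k} : Set κ), crd b j x = 0} :=
      ⟨hx, by rintro j rfl; exact h0.symm⟩
    have h2 := h _ (hσ.isFace {k} ⟨x, h1⟩) h1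
    have h3 : ofCrd b (fun _ => (1 : ℝ)) ∈ σ.carrier := hσ.of_pos _ fun j => by simp
    rw [← h2] at h3
    simpa using h3.2 k rfl
  · intro h
    refine ⟨hσ.of_pos x h, fun τ hτ hx => ?_⟩
    obtain ⟨Z, rfl⟩ := hσ.exists_of_isFace hτ
    have hZ : Z = ∅ := Set.eq_empty_iff_forall_notMem.2 fun k hk => (h k).ne' (hx.2 k hk)
    simp [hZ]

end IsOrthantal

lemma dim_eq_card {σ : Poic} {κ : Type} [Finite κ] (b : Module.Basis κ ℤ σ.N) :
    σ.dim = Nat.card κ := by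
  have := Fintype.ofFinite κ
  rw [dim_eq_finrank, Module.finrank_eq_card_basis b, Nat.card_eq_fintype_card]

/-- The coordinates of the image under a morphism that maps a basis injectively to a part of a
basis. -/
lemma crd_map_of_eq {σ ξ : Poic} {κ κ' : Type} {b : Module.Basis κ ℤ σ.N}
    {b' : Module.Basis κ' ℤ ξ.N} (φ : σ ⟶ ξ) {j : κ → κ'} (hj : Function.Injective j)
    (hφ : ∀ k, φ.lin (b k) = b' (j k)) (x) :
    (∀ k, crd b' (j k) (real φ x) = crd b k x) ∧
      ∀ k', (∀ k, j k ≠ k') → crd b' k' (real φ x) = 0 := by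
  classical
  constructor
  · intro k
    unfold crd real
    rw [← realFunctional_comp]
    congr 2
    refine b.ext fun i => ?_
    simp [hφ, Finsupp.single_apply, hj.eq_iff]
  · intro k' hk'
    unfold crd real
    rw [← realFunctional_comp, show b'.coord k' ∘ₗ φ.lin = 0 from b.ext fun i => by
      simp [hφ, hk' i]]
    simp [realFunctional]

/-- A morphism that maps a basis injectively to a part of a basis is a face-embedding if its
image is the face on which the other coordinates vanish. -/
lemma isFaceEmbedding_of_basis {σ ξ : Poic} {κ κ' : Type} [Finite κ] [Finite κ']
    {b : Module.Basis κ ℤ σ.N} {b' : Module.Basis κ' ℤ ξ.N} (hξ : IsOrthantal ξ b')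
    (φ : σ ⟶ ξ) {j : κ → κ'} (hj : Function.Injective j) (hφ : ∀ k, φ.lin (b k) = b' (j k))
    (him : real φ '' σ.carrier = {x ∈ ξ.carrier | ∀ k ∈ (Set.range j)ᶜ, crd b' k x = 0}) :
    IsFaceEmbedding φ := by
  classical
  refine ⟨fun x y hxy => crd_ext b fun k => ?_, ?_, fun n hn => ?_⟩
  · rw [← (crd_map_of_eq φ hj hφ x).1, ← (crd_map_of_eq φ hj hφ y).1, hxy]
  · rw [him]
    refine hξ.isFace _ ?_
    rw [← him]
    exact σ.nonempty.image _
  -- a lattice point in the span of the face has no coordinates outside of the range of `j`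
  · have h1 : ∀ k ∈ (Set.range j)ᶜ, b'.repr n k = 0 := by
      intro k hk
      have h2 : Submodule.span ℝ (real φ '' σ.carrier) ≤ LinearMap.ker (crd b' k) := by
        rw [Submodule.span_le, him]
        exact fun x hx => hx.2 k hk
      have h3 : crd b' k ((1 : ℝ) ⊗ₜ[ℤ] n) = 0 := h2 hn
      simpa [crd] using h3
    have := Fintype.ofFinite κ'
    rw [← b'.sum_repr n]
    refine Submodule.sum_mem _ fun k _ => ?_
    by_cases hk : k ∈ Set.range j
    · obtain ⟨i, rfl⟩ := hk
      exact Submodule.smul_mem _ _ ⟨b i, hφ i⟩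
    · rw [h1 k hk, zero_smul]
      exact zero_mem _

end Poic

/-! ### Counting in graphs -/

namespace DGraph

variable {G H : DGraph}

lemma isLeglessTree_singleton {v : G.F} (hv : v ∈ G.V) : G.IsLeglessTree {v} :=
  (isContraction_id G).tree v hv

lemma notMem_V_of_ι_ne {x : G.F} (h : G.ι x ≠ x) : x ∉ G.V := fun hx => h (ι_of_mem_V hx)

lemma eq_pair_of_mem_edge {e : Set G.F} (he : e ∈ G.edgeSet) {x : G.F} (hx : x ∈ e) :
    G.ι x ≠ x ∧ e = {x, G.ι x} := by
  obtain ⟨y, hy, rfl⟩ := he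
  rcases hx with rfl | hx
  · exact ⟨hy, rfl⟩
  · rw [Set.mem_singleton_iff] at hx
    subst hx
    rw [G.ι_ι]
    exact ⟨fun h => hy h.symm, Set.pair_comm _ _⟩

/-- The edge containing a half-edge. -/
def edgeOf (x : G.F) (hx : G.ι x ≠ x) : G.Edge := ⟨{x, G.ι x}, x, hx, rfl⟩

/-- The number of flags of a subset closed under the involution. -/
lemma ncard_flags {K : Set G.F} (hK : ∀ x ∈ K, G.ι x ∈ K) :
    K.ncard = (G.vertsIn K).ncard + (K ∩ G.legs).ncard + 2 * (G.edgesIn K).ncard := by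
  classical
  -- the half-edges, two of which make up an edge
  set Hf : Set G.F := {x ∈ K | G.ι x ≠ x} with hH
  have h1 : K = (G.vertsIn K ∪ (K ∩ G.legs)) ∪ Hf := by
    ext x
    constructor
    · intro hx
      by_cases h2 : G.ι x = x
      · by_cases h3 : x ∈ G.V
        · exact Or.inl (Or.inl ⟨hx, h3⟩)
        · exact Or.inl (Or.inr ⟨hx, h3, h2⟩)
      · exact Or.inr ⟨hx, h2⟩
    · rintro ((h | h) | h) <;> exact h.1
  have d1 : Disjoint (G.vertsIn K) (K ∩ G.legs) :=
    Set.disjoint_left.2 fun x hx hx' => hx'.2.1 hx.2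
  have d2 : Disjoint (G.vertsIn K ∪ (K ∩ G.legs)) Hf := by
    refine Set.disjoint_left.2 fun x hx hx' => hx'.2 ?_
    rcases hx with hx | hx
    · exact ι_of_mem_V hx.2
    · exact hx.2.2
  have h2 : Hf.ncard = 2 * (G.edgesIn K).ncard := by
    rw [Set.ncard_eq_toFinset_card _ (Set.toFinite Hf),
      Set.ncard_eq_toFinset_card _ (Set.toFinite (G.edgesIn K)),
      Finset.card_eq_sum_card_fiberwise (f := fun x => ({x, G.ι x} : Set G.F))
        (t := (Set.toFinite (G.edgesIn K)).toFinset)]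
    · rw [Finset.sum_const_nat (m := 2), mul_comm]
      intro e he
      rw [Set.Finite.mem_toFinset] at he
      obtain ⟨⟨x, hx, rfl⟩, hsub⟩ := he
      have : Finset.filter (fun a => ({a, G.ι a} : Set G.F) = {x, G.ι x})
          (Set.toFinite Hf).toFinset = {x, G.ι x} := by
        ext y
        simp only [Finset.mem_filter, Set.Finite.mem_toFinset, Finset.mem_insert,
          Finset.mem_singleton]
        constructor
        · rintro ⟨-, h⟩
          have : y ∈ ({x, G.ι x} : Set G.F) := h ▸ Or.inl rfl
          exact this
        · rintro (rfl | rfl)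
          · exact ⟨⟨hsub (Or.inl rfl), hx⟩, rfl⟩
          · refine ⟨⟨hsub (Or.inr rfl), ?_⟩, ?_⟩
            · rw [G.ι_ι]; exact hx.symm
            · rw [G.ι_ι]; exact Set.pair_comm _ _
      rw [this, Finset.card_pair hx.symm]
    · intro x hx
      simp only [Set.Finite.coe_toFinset] at hx ⊢
      refine ⟨⟨x, hx.2, rfl⟩, ?_⟩
      rintro y (rfl | rfl)
      · exact hx.1
      · exact hK _ hx.1
  conv_lhs => rw [h1]
  rw [Set.ncard_union_eq d2, Set.ncard_union_eq d1, h2]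

/-- The flags rooted in `K`, counted by their roots. -/
lemma ncard_r_mem (K : Set G.F) : {x | G.r x ∈ K}.ncard =
    ∑ v ∈ (Set.toFinite (G.vertsIn K)).toFinset, (G.r ⁻¹' {v}).ncard := by
  classical
  rw [Set.ncard_eq_toFinset_card _ (Set.toFinite _),
    Finset.card_eq_sum_card_fiberwise (f := G.r) (t := (Set.toFinite (G.vertsIn K)).toFinset)]
  · refine Finset.sum_congr rfl fun v hv => ?_
    rw [Set.Finite.mem_toFinset] at hv
    rw [Set.ncard_eq_toFinset_card _ (Set.toFinite _)]
    congr 1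
    ext x
    simp only [Finset.mem_filter, Set.Finite.mem_toFinset, Set.mem_ofPred_eq, Set.mem_preimage,
      Set.mem_singleton_iff, and_iff_right_iff_imp]
    rintro rfl
    exact hv.1
  · intro x hx
    simp only [Set.Finite.coe_toFinset] at hx ⊢
    exact ⟨hx, r_mem_V _⟩

lemma ncard_r_preimage (v : G.F) (h : 3 ≤ G.val v) : (G.r ⁻¹' {v}).ncard = G.val v + 1 := by
  unfold val at *
  omega

/-- In a stable graph, a legless subtree with `n` vertices is met by at least `n + 2` flags
outside of it. -/
lemma le_ncard_outgoing (hG : ∀ v ∈ G.V, 3 ≤ G.val v) {K : Set G.F} (hK : G.IsLeglessTree K) :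
    (G.vertsIn K).ncard + 2 ≤ {x | x ∉ K ∧ G.r x ∈ K}.ncard := by
  have h1 : {x | G.r x ∈ K} = K ∪ {x | x ∉ K ∧ G.r x ∈ K} := by
    ext x
    by_cases hx : x ∈ K
    · simp [hx, (hK.1.1 x hx).1]
    · simp [hx]
  have h2 := ncard_r_mem (G := G) K
  rw [h1, Set.ncard_union_eq (Set.disjoint_left.2 fun x hx hx' => hx'.1 hx),
    ncard_flags fun x hx => (hK.1.1 x hx).2, hK.2.inter_eq, Set.ncard_empty] at h2
  -- with its root, a vertex of valency at least three is the root of at least four flags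
  have h3 : (Set.toFinite (G.vertsIn K)).toFinset.card • 4 ≤
      ∑ v ∈ (Set.toFinite (G.vertsIn K)).toFinset, (G.r ⁻¹' {v}).ncard := by
    refine Finset.card_nsmul_le_sum _ _ _ fun v hv => ?_
    rw [Set.Finite.mem_toFinset] at hv
    have := hG v hv.2
    rw [ncard_r_preimage v this]
    omega
  rw [← Set.ncard_eq_toFinset_card, smul_eq_mul] at h3
  have := hK.1.2.2
  omega

/-- Counting flags by vertices. -/
lemma sum_val (hG : ∀ v ∈ G.V, 3 ≤ G.val v) :
    ∑ v ∈ (Set.toFinite G.V).toFinset, (G.val v - 3) + 3 * (G.vertsIn Set.univ).ncard =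
      G.legs.ncard + 2 * (G.edgesIn Set.univ).ncard := by
  have h1 := ncard_r_mem (G := G) Set.univ
  have h2 := ncard_flags (G := G) (K := Set.univ) fun _ _ => trivial
  have h0 : G.vertsIn Set.univ = G.V := Set.univ_inter _
  simp only [Set.mem_univ, h0] at h1 h2
  rw [show {x : G.F | True} = Set.univ from rfl, h2] at h1
  rw [h0]
  have h3 : ∑ v ∈ (Set.toFinite G.V).toFinset, (G.r ⁻¹' {v}).ncard =
      ∑ v ∈ (Set.toFinite G.V).toFinset, ((G.val v - 3) + 4) := by
    refine Finset.sum_congr rfl fun v hv => ?_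
    rw [Set.Finite.mem_toFinset] at hv
    have := hG v hv
    rw [ncard_r_preimage v this]
    omega
  rw [h3, Finset.sum_add_distrib, Finset.sum_const, smul_eq_mul,
    ← Set.ncard_eq_toFinset_card, Set.univ_inter] at h1
  omega

lemma edgesIn_univ : G.edgesIn Set.univ = G.edgeSet := by
  ext e; exact ⟨fun h => h.1, fun h => ⟨h, fun _ _ => trivial⟩⟩

lemma vertsIn_univ : G.vertsIn Set.univ = G.V := Set.univ_inter _

/-- A connected subgraph of a tree is a tree. -/
lemma tree_of_conn (hG : G.IsConnOfGenus 0 Set.univ) {K : Set G.F} (hK : G.IsSubgraph K)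
    (hc : G.IsConn K) : G.IsConnOfGenus 0 K := by
  refine ⟨hK, hc, ?_⟩
  have h1 := card_verts_le hK hc
  have h2 := card_edges_lt hG hK (Set.subset_univ _) hc.1
  omega

lemma isForest_of_tree (hG : G.IsConnOfGenus 0 Set.univ) (Z : Set G.Edge) : G.IsForest Z :=
  fun _ hK hL hc _ => ⟨tree_of_conn hG hK hc, hL⟩

/-- Every edge of a tree is a bridge. -/
lemma not_joined_compl (hG : G.IsConnOfGenus 0 Set.univ) {x : G.F} (hx : G.ι x ≠ x) :
    ¬ G.Joined ({x, G.ι x} : Set G.F)ᶜ (G.r x) (G.r (G.ι x)) := by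
  intro h
  set e : G.Edge := edgeOf x hx
  have hsub : G.IsSubgraph ({x, G.ι x} : Set G.F)ᶜ := Gr.isSubgraph_compl G e
  have hV : G.vertsIn ({x, G.ι x} : Set G.F)ᶜ = G.vertsIn Set.univ := by
    ext v
    refine ⟨fun h => ⟨trivial, h.2⟩, fun h => ⟨?_, h.2⟩⟩
    rintro (h' | h')
    · exact notMem_V_of_ι_ne hx (h' ▸ h.2)
    · rw [Set.mem_singleton_iff] at h'
      exact notMem_V_of_ι_ne hx (ι_mem_V.1 (h' ▸ h.2))
  -- otherwise the graph stays connected without this edge, but has too few edges for its vertices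
  have hj : ∀ v w, G.Joined Set.univ v w → G.Joined ({x, G.ι x} : Set G.F)ᶜ v w := by
    intro v w hvw
    induction hvw with
    | refl => exact Relation.ReflTransGen.refl
    | tail _ hbc ih =>
      obtain ⟨y, -, rfl, rfl⟩ := hbc
      by_cases hy : y ∈ ({x, G.ι x} : Set G.F)
      · rcases hy with rfl | hy
        · exact ih.trans h
        · rw [Set.mem_singleton_iff] at hy
          subst hy
          rw [G.ι_ι]
          exact ih.trans (h.symm fun y hy => (hsub y hy).2)
      · exact ih.tail ⟨y, hy, rfl, rfl⟩
  have hc : G.IsConn ({x, G.ι x} : Set G.F)ᶜ := by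
    refine ⟨hV ▸ hG.2.1.1, fun v hv w hw => hj _ _ ?_⟩
    rw [hV] at hv hw
    exact hG.2.1.2 v hv w hw
  have h1 := card_verts_le hsub hc
  rw [hV] at h1
  have h2 : (G.edgesIn ({x, G.ι x} : Set G.F)ᶜ).ncard < (G.edgesIn Set.univ).ncard := by
    refine Set.ncard_lt_ncard ⟨fun e he => ⟨he.1, Set.subset_univ _⟩, fun hle => ?_⟩
    exact (hle ⟨e.2, Set.subset_univ _⟩).2 (show x ∈ e.1 from Or.inl rfl) (Or.inl rfl)
  have := hG.2.2
  omega

/-- A tree has no loops. -/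
lemma r_ι_ne (hG : G.IsConnOfGenus 0 Set.univ) {x : G.F} (hx : G.ι x ≠ x) :
    G.r (G.ι x) ≠ G.r x := fun h =>
  not_joined_compl hG hx (h ▸ Relation.ReflTransGen.refl)

/-- A tree has no multiple edges. -/
lemma eq_of_ends_eq (hG : G.IsConnOfGenus 0 Set.univ) {x y : G.F} (hx : G.ι x ≠ x)
    (h1 : G.r x = G.r y) (h2 : G.r (G.ι x) = G.r (G.ι y)) : x = y := by
  by_contra hne
  refine not_joined_compl hG hx (Relation.ReflTransGen.single ⟨y, ?_, h1.symm, h2.symm⟩)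
  rintro (h | h)
  · exact hne h.symm
  · rw [Set.mem_singleton_iff] at h
    subst h
    exact r_ι_ne hG hx h1.symm

namespace IsContraction

variable {f : G.F → H.F}

lemma mem_V_iff_of_ι_ne (hf : IsContraction f) {x : G.F} (hx : G.ι x ≠ x) :
    f x ∉ H.V ↔ ∃ e, (hf.edge e).1 = {x, G.ι x} := by
  constructor
  · intro h
    refine ⟨edgeOf (f x) (hf.ι_ne h hx), ?_⟩
    have := hf.preimage_edge (edgeOf (f x) (hf.ι_ne h hx)).2
    exact (eq_pair_of_mem_edge this (x := x) (Or.inl rfl)).2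
  · rintro ⟨e, he⟩
    have : f x ∈ e.1 := by
      have : x ∈ (hf.edge e).1 := he ▸ Or.inl rfl
      exact this
    exact notMem_V_of_ι_ne (eq_pair_of_mem_edge e.2 this).1

/-- The edges and vertices of the inverse image of a subgraph under a contraction. The inverse image
has the edges of the fibres over the vertices and the inverse images of the edges; the fibres are
trees. -/
lemma card_preimage (hf : IsContraction f) {K : Set H.F} (hK : H.IsSubgraph K) :
    (G.edgesIn (f ⁻¹' K)).ncard + (H.vertsIn K).ncard =
      (H.edgesIn K).ncard + (G.vertsIn (f ⁻¹' K)).ncard := by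
  classical
  refine le_antisymm ?_ ?_
  · have := hf.card_image (hf.subgraph_preimage hK)
    rwa [Set.image_preimage_eq _ hf.surj] at this
  set VK : Finset H.F := (Set.toFinite (H.vertsIn K)).toFinset with hVK
  have mVK : ∀ v, v ∈ VK ↔ v ∈ H.vertsIn K := by simp [hVK]
  have h1 : ∀ v ∈ VK, (G.vertsIn (f ⁻¹' {v})).ncard = (G.edgesIn (f ⁻¹' {v})).ncard + 1 :=
    fun v hv => (hf.tree v ((mVK v).1 hv).2).1.2.2.symm
  have h2 : (G.vertsIn (f ⁻¹' K)).ncard = ∑ v ∈ VK, (G.vertsIn (f ⁻¹' {v})).ncard := by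
    rw [Set.ncard_eq_toFinset_card _ (Set.toFinite _),
      Finset.card_eq_sum_card_fiberwise (f := f) (t := VK)]
    · refine Finset.sum_congr rfl fun v hv => ?_
      rw [mVK] at hv
      rw [Set.ncard_eq_toFinset_card _ (Set.toFinite _)]
      congr 1
      ext x
      simp only [Finset.mem_filter, Set.Finite.mem_toFinset, vertsIn, Set.mem_inter_iff,
        Set.mem_preimage, Set.mem_singleton_iff]
      constructor
      · rintro ⟨⟨-, h⟩, h'⟩; exact ⟨h', h⟩
      · rintro ⟨rfl, h⟩; exact ⟨⟨hv.1, h⟩, rfl⟩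
    · intro x hx
      simp only [Set.Finite.coe_toFinset] at hx
      simp only [Finset.mem_coe, mVK]
      exact ⟨hx.1, hf.mem_V hx.2⟩
  -- the edges of the fibres
  set B : Finset (Set G.F) :=
    VK.biUnion fun v => (Set.toFinite (G.edgesIn (f ⁻¹' {v}))).toFinset with hB
  have h3 : B.card = ∑ v ∈ VK, (G.edgesIn (f ⁻¹' {v})).ncard := by
    rw [hB, Finset.card_biUnion]
    · exact Finset.sum_congr rfl fun v _ => (Set.ncard_eq_toFinset_card _ _).symm
    · intro v _ w _ hvw
      rw [Function.onFun, Finset.disjoint_left]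
      intro e he he'
      rw [Set.Finite.mem_toFinset] at he he'
      obtain ⟨x, -, hxe⟩ := he.1
      have hx : x ∈ e := hxe ▸ Or.inl rfl
      exact hvw ((he.2 hx).symm.trans (he'.2 hx))
  -- the inverse images of the edges
  set D : Finset (Set G.F) := (Set.toFinite ((fun e => f ⁻¹' e) '' H.edgesIn K)).toFinset with hD
  have h4 : D.card = (H.edgesIn K).ncard := by
    rw [hD, ← Set.ncard_eq_toFinset_card, Set.ncard_image_of_injective _ hf.surj.preimage_injective]
  have h5 : Disjoint B D := by
    rw [Finset.disjoint_left]
    intro e he he'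
    simp only [hB, Finset.mem_biUnion, Set.Finite.mem_toFinset] at he
    obtain ⟨v, hv, he⟩ := he
    rw [hD, Set.Finite.mem_toFinset] at he'
    obtain ⟨e', he', rfl⟩ := he'
    obtain ⟨x, hx, hxe⟩ := he'.1
    obtain ⟨y, rfl⟩ := hf.surj x
    have h6 : f y = v := he.2 (show f y ∈ e' from hxe ▸ Or.inl rfl)
    exact notMem_V_of_ι_ne hx (h6 ▸ ((mVK v).1 hv).2)
  have h6 : B ∪ D ⊆ (Set.toFinite (G.edgesIn (f ⁻¹' K))).toFinset := by
    intro e he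
    rw [Set.Finite.mem_toFinset]
    rcases Finset.mem_union.1 he with he | he
    · simp only [hB, Finset.mem_biUnion, Set.Finite.mem_toFinset] at he
      obtain ⟨v, hv, he⟩ := he
      refine ⟨he.1, fun x hx => ?_⟩
      have : f x = v := he.2 hx
      exact (this ▸ ((mVK v).1 hv).1 : f x ∈ K)
    · rw [hD, Set.Finite.mem_toFinset] at he
      obtain ⟨e', he', rfl⟩ := he
      exact ⟨hf.preimage_edge he'.1, Set.preimage_mono he'.2⟩
  have h7 := Finset.card_le_card h6
  rw [Finset.card_union_of_disjoint h5, h3, h4, ← Set.ncard_eq_toFinset_card] at h7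
  have h8 : VK.card = (H.vertsIn K).ncard := by rw [Set.ncard_eq_toFinset_card _ (Set.toFinite _)]
  rw [Finset.sum_congr rfl h1, Finset.sum_add_distrib, Finset.sum_const, smul_eq_mul, mul_one,
    h8] at h2
  omega

/-- The target of a contraction of a connected graph is connected of the same genus. -/
lemma genus_iff (hf : IsContraction f) (n : ℕ) :
    G.IsConnOfGenus n Set.univ ↔ H.IsConnOfGenus n Set.univ := by
  have h1 := hf.card_preimage (K := Set.univ) fun _ _ => ⟨trivial, trivial⟩
  rw [Set.preimage_univ] at h1
  constructor
  · rintro ⟨-, h2, h3⟩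
    refine ⟨fun _ _ => ⟨trivial, trivial⟩, ?_, by omega⟩
    have := hf.conn_image (K := Set.univ) (fun _ _ => ⟨trivial, trivial⟩) h2
    rwa [Set.image_univ, hf.surj.range_eq] at this
  · rintro ⟨-, h2, h3⟩
    refine ⟨fun _ _ => ⟨trivial, trivial⟩, ?_, by omega⟩
    exact hf.conn_preimage (K := Set.univ) (fun _ _ => ⟨trivial, trivial⟩) h2

/-- Contractions of stable graphs are stable. -/
lemma stable (hf : IsContraction f) (hG : ∀ v ∈ G.V, 3 ≤ G.val v) : ∀ v ∈ H.V, 3 ≤ H.val v := by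
  intro v hv
  have h1 := le_ncard_outgoing hG (hf.tree v hv)
  have h2 : 1 ≤ (G.vertsIn (f ⁻¹' {v})).ncard :=
    (Set.ncard_pos (Set.toFinite _)).2 (hf.tree v hv).1.2.1.1
  have key : ∀ x ∈ {x | x ∉ f ⁻¹' {v} ∧ G.r x ∈ f ⁻¹' {v}}, H.r (f x) = v ∧ f x ≠ v := by
    rintro x ⟨hx, hrx⟩
    exact ⟨by rw [← hf.r]; exact hrx, hx⟩
  -- the flags that lead out of the fibre over `v` are mapped injectively to the flags at `v`
  have h3 : {x | x ∉ f ⁻¹' {v} ∧ G.r x ∈ f ⁻¹' {v}}.ncard ≤ ((H.r ⁻¹' {v}) \ {v}).ncard := by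
    refine Set.ncard_le_ncard_of_injOn f (fun x hx => key x hx) ?_ (Set.toFinite _)
    intro x hx y _ hxy
    have hxV : f x ∉ H.V := fun h => (key x hx).2 ((DGraph.mem_V.1 h).symm.trans (key x hx).1)
    exact (hf.unique _ hxV).unique rfl hxy.symm
  rw [Set.ncard_sdiff_singleton_of_mem (show v ∈ H.r ⁻¹' {v} from DGraph.mem_V.1 hv)] at h3
  unfold val
  omega

lemma of_bijective (hr : ∀ x, f (G.r x) = H.r (f x)) (hι : ∀ x, f (G.ι x) = H.ι (f x))
    (hb : Function.Bijective f) : IsContraction f where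
  r := hr
  ι := hι
  tree v hv := by
    obtain ⟨w, rfl⟩ := hb.2 v
    have hw : w ∈ G.V := by
      rw [DGraph.mem_V] at hv ⊢
      exact hb.1 ((hr w).trans hv)
    have : f ⁻¹' {f w} = {w} := by
      ext x
      exact hb.1.eq_iff
    rw [this]
    exact isLeglessTree_singleton hw
  unique h _ := by
    obtain ⟨x, hx⟩ := hb.2 h
    exact ⟨x, hx, fun y hy => hb.1 (hy.trans hx.symm)⟩

/-- Contractions with the same contracted flags have the same fibres. -/
lemma eq_of_eq {H' : DGraph} {f' : G.F → H'.F} (hf : IsContraction f) (hf' : IsContraction f')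
    (h : ∀ x, f x ∈ H.V → f' x ∈ H'.V) {x y : G.F} (hxy : f x = f y) : f' x = f' y := by
  by_cases hV : f x ∈ H.V
  · have h1 := (hf.tree _ hV).1.2.1.2 (G.r x) ⟨by simp [hf.r, DGraph.mem_V.1 hV], r_mem_V _⟩
      (G.r y) ⟨by simp [hf.r, ← hxy, DGraph.mem_V.1 hV], r_mem_V _⟩
    have h2 : f' (G.r x) = f' (G.r y) := by
      revert h1
      generalize G.r x = a
      generalize G.r y = b
      intro h1
      induction h1 with
      | refl => rfl
      | tail _ hbc ih =>
        obtain ⟨z, hz, rfl, rfl⟩ := hbc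
        have hz' : f z = f x := hz
        have h3 := h z (hz' ▸ hV)
        rw [ih, hf'.r, hf'.r, hf'.ι, ι_of_mem_V h3]
    rw [hf'.r, hf'.r, DGraph.mem_V.1 (h x hV), DGraph.mem_V.1 (h y (hxy ▸ hV))] at h2
    exact h2
  · rw [(hf.unique _ hV).unique rfl hxy.symm]

end IsContraction

/-! ### Contracting a forest -/

/-- The vertices and the flags of the edges in `Z`. -/
def core (G : DGraph) (Z : Set G.Edge) : Set G.F := {x | x ∈ G.V ∨ ∃ e ∈ Z, x ∈ e.1}

lemma core_subgraph (Z : Set G.Edge) : G.IsSubgraph (G.core Z) := by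
  intro x hx
  refine ⟨Or.inl (r_mem_V x), ?_⟩
  rcases hx with hx | ⟨e, he, hx⟩
  · exact Or.inl (ι_mem_V.2 hx)
  · refine Or.inr ⟨e, he, ?_⟩
    rw [(eq_pair_of_mem_edge e.2 hx).2]
    exact Or.inr rfl

lemma notMem_legs_of_mem_core {Z : Set G.Edge} {x : G.F} (hx : x ∈ G.core Z) : x ∉ G.legs := by
  intro hl
  rcases hx with hx | ⟨e, -, hx⟩
  · exact hl.1 hx
  · exact (eq_pair_of_mem_edge e.2 hx).1 hl.2

/-- Two flags are identified if they are equal, or if they belong to the same connected component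
of the subgraph of the vertices and the edges in `Z`. -/
def contractSetoid (G : DGraph) (Z : Set G.Edge) : Setoid G.F where
  r x y := x = y ∨ (x ∈ G.core Z ∧ y ∈ G.core Z ∧ G.Joined (G.core Z) (G.r x) (G.r y))
  iseqv := by
    refine ⟨fun x => Or.inl rfl, ?_, ?_⟩
    · rintro x y (rfl | ⟨hx, hy, h⟩)
      · exact Or.inl rfl
      · exact Or.inr ⟨hy, hx, h.symm fun z hz => (core_subgraph Z z hz).2⟩
    · rintro x y z (rfl | ⟨hx, hy, h⟩) (rfl | ⟨hy', hz, h'⟩)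
      · exact Or.inl rfl
      · exact Or.inr ⟨hy', hz, h'⟩
      · exact Or.inr ⟨hx, hy, h⟩
      · exact Or.inr ⟨hx, hz, h.trans h'⟩

/-- The graph in which every connected component of the subgraph of the edges in `Z` is contracted
to a vertex. -/
def contract (G : DGraph) (Z : Set G.Edge) : DGraph where
  F := Quotient (G.contractSetoid Z)
  r := Quotient.map G.r (by
    rintro x y (rfl | ⟨hx, hy, h⟩)
    · exact Or.inl rfl
    · exact Or.inr ⟨(core_subgraph Z x hx).1, (core_subgraph Z y hy).1, by rwa [G.r_r, G.r_r]⟩)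
  ι := Quotient.map G.ι (by
    rintro x y (rfl | ⟨hx, hy, h⟩)
    · exact Or.inl rfl
    · have hx' := (core_subgraph Z x hx).2
      have hy' := (core_subgraph Z y hy).2
      refine Or.inr ⟨hx', hy', ?_⟩
      exact (Relation.ReflTransGen.head ⟨G.ι x, hx', rfl, by rw [G.ι_ι]⟩ h).tail ⟨y, hy, rfl, rfl⟩)
  r_r := by rintro ⟨x⟩; exact congrArg (Quotient.mk _) (G.r_r x)
  ι_ι := by rintro ⟨x⟩; exact congrArg (Quotient.mk _) (G.ι_ι x)
  ι_r := by rintro ⟨x⟩; exact congrArg (Quotient.mk _) (G.ι_r x)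

/-- The quotient map to the contracted graph. -/
def contractMap (G : DGraph) (Z : Set G.Edge) : G.F → (G.contract Z).F :=
  Quotient.mk (G.contractSetoid Z)

lemma contractMap_eq {Z : Set G.Edge} {x y : G.F} : G.contractMap Z x = G.contractMap Z y ↔
    x = y ∨ (x ∈ G.core Z ∧ y ∈ G.core Z ∧ G.Joined (G.core Z) (G.r x) (G.r y)) :=
  Quotient.eq (r := G.contractSetoid Z)

lemma contractMap_mem_V {Z : Set G.Edge} {x : G.F} :
    G.contractMap Z x ∈ (G.contract Z).V ↔ x ∈ G.core Z := by
  rw [mem_V]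
  change G.contractMap Z (G.r x) = G.contractMap Z x ↔ _
  rw [contractMap_eq]
  constructor
  · rintro (h | h)
    · exact Or.inl (mem_V.2 h)
    · exact h.2.1
  · intro h
    exact Or.inr ⟨(core_subgraph Z x h).1, h, by rw [G.r_r]; exact Relation.ReflTransGen.refl⟩

lemma contractMap_isContraction {Z : Set G.Edge} (hZ : G.IsForest Z) :
    IsContraction (G := G) (H := G.contract Z) (G.contractMap Z) where
  r _ := rfl
  ι _ := rfl
  tree v hv := by
    obtain ⟨v, rfl⟩ := hv
    obtain ⟨v, rfl⟩ := Quotient.exists_rep v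
    change G.IsLeglessTree (G.contractMap Z ⁻¹' {G.contractMap Z (G.r v)})
    set K : Set G.F := G.contractMap Z ⁻¹' {G.contractMap Z (G.r v)} with hK
    have mK : ∀ x, x ∈ K ↔ x ∈ G.core Z ∧ G.Joined (G.core Z) (G.r v) (G.r x) := by
      intro x
      have hv' : G.r v ∈ G.core Z := Or.inl (r_mem_V v)
      change _ = _ ↔ _
      rw [eq_comm, contractMap_eq, G.r_r]
      constructor
      · rintro (rfl | h)
        · exact ⟨hv', by rw [G.r_r]; exact Relation.ReflTransGen.refl⟩
        · exact ⟨h.2.1, h.2.2⟩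
      · exact fun h => Or.inr ⟨hv', h.1, h.2⟩
    have hsub : G.IsSubgraph K := by
      intro x hx
      rw [mK] at hx
      refine ⟨(mK _).2 ⟨(core_subgraph Z x hx.1).1, by rw [G.r_r]; exact hx.2⟩, (mK _).2
        ⟨(core_subgraph Z x hx.1).2, hx.2.tail ⟨x, hx.1, rfl, rfl⟩⟩⟩
    have hleg : Disjoint K G.legs :=
      Set.disjoint_left.2 fun x hx => notMem_legs_of_mem_core ((mK x).1 hx).1
    have hj : ∀ w, G.Joined (G.core Z) (G.r v) w → G.Joined K (G.r v) w := by
      intro w h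
      induction h with
      | refl => exact Relation.ReflTransGen.refl
      | tail h1 hbc ih =>
        obtain ⟨y, hy, rfl, rfl⟩ := hbc
        exact ih.tail ⟨y, (mK y).2 ⟨hy, h1⟩, rfl, rfl⟩
    have hc : G.IsConn K := by
      refine ⟨⟨G.r v, rfl, r_mem_V v⟩, fun a ha b hb => ?_⟩
      have h1 := hj _ ((mK a).1 ha.1).2
      have h2 := hj _ ((mK b).1 hb.1).2
      rw [mem_V.1 ha.2] at h1
      rw [mem_V.1 hb.2] at h2
      exact (h1.symm fun x hx => (hsub x hx).2).trans h2
    refine hZ K hsub hleg hc fun e he => ?_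
    obtain ⟨x, hx, hex⟩ := e.2
    have hxe : x ∈ e.1 := hex ▸ Or.inl rfl
    rcases ((mK x).1 (he hxe)).1 with h | ⟨e', he', hxe'⟩
    · exact absurd h (notMem_V_of_ι_ne hx)
    · have : e = e' := Subtype.ext
        ((eq_pair_of_mem_edge e.2 hxe).2.trans (eq_pair_of_mem_edge e'.2 hxe').2.symm)
      exact this ▸ he'
  unique h hh := by
    obtain ⟨x, rfl⟩ := Quotient.exists_rep h
    have hx : x ∉ G.core Z := fun h => hh (contractMap_mem_V.2 h)
    refine ⟨x, rfl, fun y hy => ?_⟩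
    rcases contractMap_eq.1 hy with h | h
    · exact h
    · exact absurd h.2.1 hx

end DGraph

namespace Gr

variable {g : ℕ} {A : Type}

/-- A graph obtained from a marked stable graph by a contraction is a marked stable graph. -/
def ofContraction (G : Gr g A) {H : DGraph} {f : G.F → H.F} (hf : DGraph.IsContraction f) :
    Gr g A where
  toDGraph := H
  leg a := f (G.leg a)
  leg_injective a b h := by
    have : f (G.leg a) ∉ H.V := (hf.legs_image.2 (leg_mem a)).1
    exact G.leg_injective ((hf.unique _ this).unique rfl h.symm)
  leg_range := by
    ext x
    constructor
    · rintro ⟨a, rfl⟩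
      exact hf.legs_image.2 (leg_mem a)
    · intro hx
      obtain ⟨y, rfl⟩ := hf.surj x
      have := hf.legs_image.1 hx
      rw [← G.leg_range] at this
      obtain ⟨a, rfl⟩ := this
      exact ⟨a, rfl⟩
  genus := (hf.genus_iff g).1 G.genus
  stable := hf.stable G.stable

/-- The contraction as a morphism of marked graphs. -/
def ofContractionHom (G : Gr g A) {H : DGraph} {f : G.F → H.F} (hf : DGraph.IsContraction f) :
    G ⟶ G.ofContraction hf := (⟨f, hf, fun _ => rfl⟩ : Hom G (G.ofContraction hf))

/-- A bijection that is compatible with the structure maps is an isomorphism. -/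
def isoOfEquiv {G H : Gr g A} (e : G.F ≃ H.F) (hr : ∀ x, e (G.r x) = H.r (e x))
    (hι : ∀ x, e (G.ι x) = H.ι (e x)) (hl : ∀ a, e (G.leg a) = H.leg a) : G ≅ H where
  hom := (⟨e, DGraph.IsContraction.of_bijective hr hι e.bijective, hl⟩ : Hom G H)
  inv := (⟨e.symm, DGraph.IsContraction.of_bijective
    (fun x => e.injective (by simp [hr])) (fun x => e.injective (by simp [hι]))
    e.symm.bijective, fun a => e.injective (by simp [hl])⟩ : Hom H G)
  hom_inv_id := hom_ext (funext fun x => e.symm_apply_apply x)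
  inv_hom_id := hom_ext (funext fun x => e.apply_symm_apply x)

/-- Contractions with the same contracted flags differ by an isomorphism. -/
lemma exists_iso_of_contracted {G H H' : Gr g A} (f : G ⟶ H) (f' : G ⟶ H')
    (h : ∀ x, f.toFun x ∈ H.V ↔ f'.toFun x ∈ H'.V) : ∃ i : H ≅ H', f ≫ i.hom = f' := by
  have hf := f.isContraction
  have hf' := f'.isContraction
  have h1 : ∀ {x y}, f.toFun x = f.toFun y → f'.toFun x = f'.toFun y :=
    hf.eq_of_eq hf' fun x => (h x).1
  have h2 : ∀ {x y}, f'.toFun x = f'.toFun y → f.toFun x = f.toFun y :=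
    hf'.eq_of_eq hf fun x => (h x).2
  set k : H.F → H'.F := fun y => f'.toFun (Function.surjInv hf.surj y) with hk
  have hkf : ∀ x, k (f.toFun x) = f'.toFun x := fun x => h1 (Function.surjInv_eq hf.surj _)
  have hb : Function.Bijective k := by
    constructor
    · intro y z hyz
      obtain ⟨y, rfl⟩ := hf.surj y
      obtain ⟨z, rfl⟩ := hf.surj z
      rw [hkf, hkf] at hyz
      exact h2 hyz
    · intro y
      obtain ⟨x, rfl⟩ := hf'.surj y
      exact ⟨_, hkf x⟩
  refine ⟨isoOfEquiv (Equiv.ofBijective k hb) ?_ ?_ ?_, hom_ext (funext hkf)⟩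
  · intro y
    obtain ⟨y, rfl⟩ := hf.surj y
    change k (H.r _) = H'.r (k _)
    rw [← hf.r, hkf, hkf, hf'.r]
  · intro y
    obtain ⟨y, rfl⟩ := hf.surj y
    change k (H.ι _) = H'.ι (k _)
    rw [← hf.ι, hkf, hkf, hf'.ι]
  · intro a
    change k _ = _
    rw [← f.leg, hkf, f'.leg]

end Gr

/-! ### The faces of the cones of metrics -/

namespace DGraph

variable {G H : DGraph} {f : G.F → H.F}

/-- The image under a contraction of a forest that contains all contracted edges is a forest. -/
lemma IsContraction.forest_image (hf : IsContraction f) {Z : Set H.Edge} {Z' : Set G.Edge}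
    (hZ' : G.IsForest Z') (h1 : ∀ e ∈ Z, hf.edge e ∈ Z') (h2 : ∀ e ∉ Set.range hf.edge, e ∈ Z') :
    H.IsForest Z := by
  intro K hK hL hc he
  have hl : Disjoint (f ⁻¹' K) G.legs := Set.disjoint_left.2 fun x hx hx' =>
    Set.disjoint_left.1 hL hx (hf.legs_image.2 hx')
  have h3 := hZ' (f ⁻¹' K) (hf.subgraph_preimage hK) hl (hf.conn_preimage hK hc) fun e hK' => by
    by_cases h : e ∈ Set.range hf.edge
    · obtain ⟨e', rfl⟩ := h
      refine h1 _ (he _ fun y hy => ?_)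
      obtain ⟨x, rfl⟩ := hf.surj y
      exact hK' (show f x ∈ e'.1 from hy)
    · exact h2 e h
  refine ⟨⟨hK, hc, ?_⟩, hL⟩
  have h4 := hf.card_preimage hK
  have h5 := h3.1.2.2
  omega

end DGraph

open Poic

/-- The coordinates on the cone of a graph: the lengths of the edges. -/
def coneBasis (G : DGraph) : Module.Basis G.Edge ℤ (cone G).N := Finsupp.basisSingleOne

lemma crd_coneBasis (G : DGraph) (e : G.Edge) (x) : crd (coneBasis G) e x = coord e x := by
  rfl

lemma isOrthantal_cone (G : DGraph) : IsOrthantal (cone G) (coneBasis G) where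
  of_pos x hx := by
    refine ⟨fun e => ?_, DGraph.IsForest.mono (D := ∅) ?_ DGraph.isForest_empty⟩
    · rw [← crd_coneBasis]; exact (hx e).le
    · intro e he
      have := hx e
      rw [crd_coneBasis] at this
      exact absurd he this.ne'
  nonneg x hx e := by rw [crd_coneBasis]; exact hx.1 e

lemma faceMap_lin_basis {G H : DGraph} {f : G.F → H.F} (hf : DGraph.IsContraction f)
    (e : H.Edge) : (faceMap hf).lin (coneBasis H e) = coneBasis G (hf.edge e) := by
  simp [faceMap, coneBasis]

lemma image_faceMap {G H : DGraph} {f : G.F → H.F} (hf : DGraph.IsContraction f) :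
    real (faceMap hf) '' (cone H).carrier =
      {x ∈ (cone G).carrier | ∀ e ∈ (Set.range hf.edge)ᶜ, crd (coneBasis G) e x = 0} := by
  ext x
  have key := crd_map_of_eq (faceMap hf) hf.edge_injective (faceMap_lin_basis hf)
  constructor
  · rintro ⟨y, hy, rfl⟩
    exact ⟨(faceMap hf).maps y hy, fun e he => (key y).2 e fun k hk => he ⟨k, hk⟩⟩
  · rintro ⟨hx, hx0⟩
    set y := ofCrd (coneBasis H) fun e => crd (coneBasis G) (hf.edge e) x with hy
    refine ⟨y, ⟨fun e => ?_, ?_⟩, ?_⟩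
    · rw [← crd_coneBasis, hy, crd_ofCrd]
      exact (isOrthantal_cone G).nonneg x hx _
    · refine hf.forest_image hx.2 (fun e he => ?_) fun e he => ?_
      · have he' : coord e y = 0 := he
        rw [← crd_coneBasis, hy, crd_ofCrd, crd_coneBasis] at he'
        exact he'
      · have := hx0 e he
        rw [crd_coneBasis] at this
        exact this
    · refine crd_ext (coneBasis G) fun e => ?_
      by_cases he : e ∈ Set.range hf.edge
      · obtain ⟨e, rfl⟩ := he
        rw [(key y).1, hy, crd_ofCrd]
      · rw [hx0 e he, (key y).2 e fun k hk => he ⟨k, hk⟩]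

namespace Gr

variable {g : ℕ} {A : Type}

/-- Contractions that leave the same edges uncontracted contract the same flags. -/
lemma mem_V_iff_of_range_eq {G H H' : Gr g A} (f : G ⟶ H) (f' : G ⟶ H')
    (h : Set.range f.isContraction.edge = Set.range f'.isContraction.edge) (x : G.F) :
    f.toFun x ∈ H.V ↔ f'.toFun x ∈ H'.V := by
  by_cases hV : x ∈ G.V
  · exact iff_of_true (f.isContraction.mem_V hV) (f'.isContraction.mem_V hV)
  by_cases hι : G.ι x = x
  · exact iff_of_false (f.isContraction.legs_image.2 ⟨hV, hι⟩).1
      (f'.isContraction.legs_image.2 ⟨hV, hι⟩).1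
  · have aux : ∀ {L : Gr g A} (k : G ⟶ L), k.toFun x ∉ L.V ↔
        DGraph.edgeOf x hι ∈ Set.range k.isContraction.edge := by
      intro L k
      rw [k.isContraction.mem_V_iff_of_ι_ne hι]
      exact exists_congr fun e => (Subtype.ext_iff (a2 := DGraph.edgeOf x hι)).symm
    have := (aux f).trans ((iff_of_eq (congrArg (DGraph.edgeOf x hι ∈ ·) h)).trans (aux f').symm)
    tauto

/-- The faces of a functor on marked graphs whose cones have coordinates which include the edge
lengths. Here `ε` is the inclusion of the edges into the set of all coordinates, and `j f` is the
map of coordinates that belongs to a contraction `f`. A face is given by the vanishing of the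
lengths of the edges in a forest `Z'`, and comes from the contraction of this forest. -/
lemma hasFaces_of_basis (Φ : (Gr g A)ᵒᵖ ⥤ Poic) (κ : Gr g A → Type) [∀ G, Finite (κ G)]
    (b : ∀ G, Module.Basis (κ G) ℤ (Φ.obj (.op G)).N) (ho : ∀ G, IsOrthantal _ (b G))
    (ε : ∀ G : Gr g A, G.toDGraph.Edge → κ G) (hε : ∀ G, Function.Injective (ε G))
    (j : ∀ {G H : Gr g A}, (G ⟶ H) → κ H → κ G)
    (hj : ∀ {G H : Gr g A} (f : G ⟶ H), Function.Injective (j f))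
    (hb : ∀ {G H : Gr g A} (f : G ⟶ H) (k), (Φ.map f.op).lin (b H k) = b G (j f k))
    (hr : ∀ {G H : Gr g A} (f : G ⟶ H),
      (Set.range (j f))ᶜ = ε G '' (Set.range f.isContraction.edge)ᶜ)
    (him : ∀ {G H : Gr g A} (f : G ⟶ H), real (Φ.map f.op) '' (Φ.obj (.op H)).carrier =
      {x ∈ (Φ.obj (.op G)).carrier | ∀ k ∈ (Set.range (j f))ᶜ, crd (b G) k x = 0})
    (hface : ∀ (G : Gr g A) (Z : Set (κ G)),
      {x ∈ (Φ.obj (.op G)).carrier | ∀ k ∈ Z, crd (b G) k x = 0}.Nonempty →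
      ∃ Z' : Set G.toDGraph.Edge, G.toDGraph.IsForest Z' ∧ Z = ε G '' Z') : HasFaces Φ where
  faceEmbedding {p q} f := by
    have h1 := @isFaceEmbedding_of_basis _ _ _ _ _ _ (b p.unop) (b q.unop) (ho q.unop)
      (Φ.map f) (j f.unop) (hj f.unop) (hb f.unop) (him f.unop)
    exact h1
  face q τ hτ := by
    obtain ⟨G⟩ := q
    obtain ⟨Z, rfl⟩ := (ho G).exists_of_isFace hτ
    obtain ⟨Z', hZ', rfl⟩ := hface G Z hτ.1
    have hcon := DGraph.contractMap_isContraction hZ'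
    set f : G ⟶ G.ofContraction hcon := G.ofContractionHom hcon with hf
    -- the contracted edges are those in `Z'`
    have hrange : (Set.range f.isContraction.edge)ᶜ = Z' := by
      ext e
      obtain ⟨x, hx, he⟩ := e.2
      have h1 := f.isContraction.mem_V_iff_of_ι_ne hx
      have h2 : (∃ e', (f.isContraction.edge e').1 = {x, G.ι x}) ↔
          e ∈ Set.range f.isContraction.edge := by
        rw [← he]
        exact exists_congr fun e => Subtype.ext_iff.symm
      rw [h2] at h1
      change ¬ _ ↔ _
      rw [← h1, not_not]
      refine DGraph.contractMap_mem_V.trans ?_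
      constructor
      · rintro (h | ⟨e', he', hxe⟩)
        · exact absurd h (DGraph.notMem_V_of_ι_ne hx)
        · have : e = e' := Subtype.ext (he.trans (DGraph.eq_pair_of_mem_edge e'.2 hxe).2.symm)
          exact this ▸ he'
      · intro h
        exact Or.inr ⟨e, h, he ▸ Or.inl rfl⟩
    refine ⟨.op (G.ofContraction hcon), f.op, ?_, ?_⟩
    · rw [him f, hr f, hrange]
    · rintro ⟨H'⟩ f' hf'
      obtain ⟨f', rfl⟩ : ∃ k : G ⟶ H', k.op = f' := ⟨f'.unop, rfl⟩
      rw [him f', ← hrange, ← hr f, ← him f] at hf'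
      -- the coordinates that do not vanish on a face determine the edges that are not contracted
      have aux : ∀ {L : Gr g A} (k : G ⟶ L), Set.range (j k) =
          {i | ∃ x ∈ real (Φ.map k.op) '' (Φ.obj (.op L)).carrier, crd (b G) i x ≠ 0} := by
        intro L k
        ext i
        constructor
        · rintro ⟨i, rfl⟩
          refine ⟨_, ⟨ofCrd (b L) fun _ => 1, (ho L).of_pos _ fun _ => by simp, rfl⟩, ?_⟩
          rw [(crd_map_of_eq (Φ.map k.op) (hj k) (hb k) _).1, crd_ofCrd]
          exact one_ne_zero
        · rintro ⟨x, hx, hix⟩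
          by_contra hi
          rw [him k] at hx
          exact hix (hx.2 i hi)
      have h1 : Set.range (j f) = Set.range (j f') := by
        rw [aux f, aux f', him f', hf']
      have h2 : Set.range f.isContraction.edge = Set.range f'.isContraction.edge := by
        rw [← compl_inj_iff, ← (hε G).image_injective.eq_iff, ← hr f, ← hr f', h1]
      obtain ⟨i, hi⟩ := exists_iso_of_contracted f f' (mem_V_iff_of_range_eq f f' h2)
      refine ⟨i.op.symm, ?_⟩
      apply Quiver.Hom.unop_inj
      change f' ≫ i.inv = f
      rw [← hi, Category.assoc, i.hom_inv_id, Category.comp_id]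

end Gr

lemma hasFaces_Mtrop (g : ℕ) (A : Type) : HasFaces (Mtrop g A) := by
  refine Gr.hasFaces_of_basis (Mtrop g A) (fun G => G.toDGraph.Edge)
    (fun G => coneBasis G.toDGraph) (fun G => isOrthantal_cone _) (fun G => id)
    (fun _ => Function.injective_id) (fun f => f.isContraction.edge)
    (fun f => f.isContraction.edge_injective) (fun f e => faceMap_lin_basis _ e)
    (fun f => (Set.image_id _).symm) (fun f => image_faceMap f.isContraction) ?_
  rintro G Z ⟨x, hx, hxZ⟩
  refine ⟨Z, DGraph.IsForest.mono (fun e he => ?_) hx.2, (Set.image_id _).symm⟩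
  exact (crd_coneBasis _ e x).symm.trans (hxZ e he)

section prodBasis

variable (α β : Type)

lemma prodBasis_coord_inl (a : α) : ((Finsupp.basisSingleOne (R := ℤ) (ι := α)).prod
    (Finsupp.basisSingleOne (R := ℤ) (ι := β))).coord (.inl a) =
      Finsupp.lapply a ∘ₗ LinearMap.fst ℤ (α →₀ ℤ) (β →₀ ℤ) := by
  ext <;> simp

lemma prodBasis_coord_inr (a : β) : ((Finsupp.basisSingleOne (R := ℤ) (ι := α)).prod
    (Finsupp.basisSingleOne (R := ℤ) (ι := β))).coord (.inr a) =
      Finsupp.lapply a ∘ₗ LinearMap.snd ℤ (α →₀ ℤ) (β →₀ ℤ) := by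
  ext <;> simp

lemma prodBasis_inl (a : α) : ((Finsupp.basisSingleOne (R := ℤ) (ι := α)).prod
    (Finsupp.basisSingleOne (R := ℤ) (ι := β))) (.inl a) = (Finsupp.single a 1, 0) := by
  simp [Module.Basis.prod_apply]

lemma prodBasis_inr (a : β) : ((Finsupp.basisSingleOne (R := ℤ) (ι := α)).prod
    (Finsupp.basisSingleOne (R := ℤ) (ι := β))) (.inr a) = (0, Finsupp.single a 1) := by
  simp [Module.Basis.prod_apply]

end prodBasis

/-- The coordinates on the cones of the spanning tree complex. -/
def stBasis {g : ℕ} {A : Type} (T : Gr 0 (Mark g A)) :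
    Module.Basis (T.toDGraph.Edge ⊕ Fin g) ℤ ((ST g A).obj (.op T)).N :=
  (coneBasis T.toDGraph).prod Finsupp.basisSingleOne

section ST

variable {g : ℕ} {A : Type}

lemma crd_stBasis_inl (T : Gr 0 (Mark g A)) (e : T.toDGraph.Edge) (x) :
    crd (stBasis T) (.inl e) x = coord e ((LinearMap.fst ℤ (T.toDGraph.Edge →₀ ℤ)
      (Fin g →₀ ℤ)).baseChange ℝ x) := by
  refine Eq.trans ?_ (realFunctional_comp (Finsupp.lapply e)
    (LinearMap.fst ℤ (T.toDGraph.Edge →₀ ℤ) (Fin g →₀ ℤ)) x)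
  exact congrArg (fun f => realFunctional f x) (prodBasis_coord_inl _ _ e)

lemma crd_stBasis_inr (T : Gr 0 (Mark g A)) (i : Fin g) (x) :
    crd (stBasis T) (.inr i) x = coord i ((LinearMap.snd ℤ (T.toDGraph.Edge →₀ ℤ)
      (Fin g →₀ ℤ)).baseChange ℝ x) := by
  refine Eq.trans ?_ (realFunctional_comp (Finsupp.lapply i)
    (LinearMap.snd ℤ (T.toDGraph.Edge →₀ ℤ) (Fin g →₀ ℤ)) x)
  exact congrArg (fun f => realFunctional f x) (prodBasis_coord_inr _ _ i)

lemma mem_ST_iff (T : Gr 0 (Mark g A)) (x) : x ∈ ((ST g A).obj (.op T)).carrier ↔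
    (∀ e, 0 ≤ crd (stBasis T) (.inl e) x) ∧ ∀ i, 0 < crd (stBasis T) (.inr i) x := by
  constructor
  · rintro ⟨⟨h1, -⟩, h2, h3⟩
    refine ⟨fun e => ?_, fun i => ?_⟩
    · rw [crd_stBasis_inl]; exact h1 e
    · rw [crd_stBasis_inr]
      exact (h2 i).lt_of_ne fun h => Set.eq_empty_iff_forall_notMem.1 h3 i h.symm
  · rintro ⟨h1, h2⟩
    refine ⟨⟨fun e => ?_, DGraph.isForest_of_tree T.genus _⟩, fun i => ?_, ?_⟩
    · rw [← crd_stBasis_inl]; exact h1 e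
    · rw [← crd_stBasis_inr]; exact (h2 i).le
    · refine Set.eq_empty_iff_forall_notMem.2 fun i hi => (h2 i).ne' ?_
      rw [crd_stBasis_inr]; exact hi

lemma isOrthantal_ST (T : Gr 0 (Mark g A)) :
    IsOrthantal ((ST g A).obj (.op T)) (stBasis T) where
  of_pos x hx := (mem_ST_iff T x).2 ⟨fun e => (hx _).le, fun i => hx _⟩
  nonneg x hx k := by
    rcases k with e | i
    exacts [((mem_ST_iff T x).1 hx).1 e, (((mem_ST_iff T x).1 hx).2 i).le]

lemma ST_map_basis {T T' : Gr 0 (Mark g A)} (f : T ⟶ T') (k) :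
    ((ST g A).map f.op).lin (stBasis T' k) =
      stBasis T (Sum.map f.isContraction.edge id k) := by
  have h := faceMap_lin_basis f.isContraction
  have h1 : ∀ (T : Gr 0 (Mark g A)) e, stBasis T (.inl e) = (Finsupp.single e 1, 0) :=
    fun T e => prodBasis_inl _ _ e
  have h2 : ∀ (T : Gr 0 (Mark g A)) i, stBasis T (.inr i) = (0, Finsupp.single i 1) :=
    fun T e => prodBasis_inr _ _ e
  rcases k with e | i
  · rw [Sum.map_inl, h1, h1]
    exact Prod.ext (h e) rfl
  · rw [Sum.map_inr, h2, h2]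
    exact Prod.ext (map_zero (faceMap f.isContraction).lin) rfl

lemma crd_ST_map {T T' : Gr 0 (Mark g A)} (f : T ⟶ T') (x) :
    (∀ e, crd (stBasis T) (.inl (f.isContraction.edge e)) (real ((ST g A).map f.op) x) =
      crd (stBasis T') (.inl e) x) ∧
    (∀ i, crd (stBasis T) (.inr i) (real ((ST g A).map f.op) x) = crd (stBasis T') (.inr i) x) ∧
    ∀ e ∉ Set.range f.isContraction.edge,
      crd (stBasis T) (.inl e) (real ((ST g A).map f.op) x) = 0 := by
  have key := crd_map_of_eq ((ST g A).map f.op) (b := stBasis T') (b' := stBasis T)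
    (f.isContraction.edge_injective.sumMap Function.injective_id) (ST_map_basis f) x
  refine ⟨fun e => key.1 (.inl e), fun i => key.1 (.inr i), fun e he => key.2 _ ?_⟩
  rintro (e' | i) h
  · exact he ⟨e', Sum.inl_injective h⟩
  · cases h

lemma image_ST_map {T T' : Gr 0 (Mark g A)} (f : T ⟶ T') :
    real ((ST g A).map f.op) '' ((ST g A).obj (.op T')).carrier =
      {x ∈ ((ST g A).obj (.op T)).carrier |
        ∀ k ∈ (Set.range (Sum.map f.isContraction.edge (id : Fin g → Fin g)))ᶜ,
          crd (stBasis T) k x = 0} := by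
  ext x
  have hmem : ∀ e, e ∉ Set.range f.isContraction.edge ↔ (Sum.inl e : T.toDGraph.Edge ⊕ Fin g) ∈
      (Set.range (Sum.map f.isContraction.edge (id : Fin g → Fin g)))ᶜ := by
    intro e
    refine not_congr ⟨?_, ?_⟩
    · rintro ⟨e, rfl⟩; exact ⟨.inl e, rfl⟩
    · rintro ⟨e' | i, h⟩
      · exact ⟨e', Sum.inl_injective h⟩
      · cases h
  constructor
  · rintro ⟨y, hy, rfl⟩
    refine ⟨((ST g A).map f.op).maps y hy, ?_⟩
    rintro (e | i) hk
    · exact (crd_ST_map f y).2.2 e ((hmem e).2 hk)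
    · exact absurd ⟨.inr i, rfl⟩ hk
  · rintro ⟨hx, hx0⟩
    rw [mem_ST_iff] at hx
    set y := ofCrd (stBasis T') fun k =>
      crd (stBasis T) (Sum.map f.isContraction.edge (id : Fin g → Fin g) k) x with hy
    refine ⟨y, (mem_ST_iff _ _).2 ⟨fun e => ?_, fun i => ?_⟩, ?_⟩
    · rw [hy, crd_ofCrd]; exact hx.1 _
    · rw [hy, crd_ofCrd]; exact hx.2 _
    · refine crd_ext (stBasis T) ?_
      rintro (e | i)
      · by_cases he : e ∈ Set.range f.isContraction.edge
        · obtain ⟨e, rfl⟩ := he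
          rw [(crd_ST_map f y).1, hy, crd_ofCrd]; rfl
        · rw [(crd_ST_map f y).2.2 e he, hx0 _ ((hmem e).1 he)]
      · rw [(crd_ST_map f y).2.1, hy, crd_ofCrd]; rfl

end ST

lemma hasFaces_ST (g : ℕ) (A : Type) : HasFaces (ST g A) := by
  refine Gr.hasFaces_of_basis (ST g A) (fun T => T.toDGraph.Edge ⊕ Fin g)
    (fun T => stBasis T) isOrthantal_ST (fun T => Sum.inl)
    (fun _ => Sum.inl_injective) (fun f => Sum.map f.isContraction.edge id)
    (fun f => f.isContraction.edge_injective.sumMap Function.injective_id)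
    (fun f => ST_map_basis f) (fun f => ?_) (fun f => image_ST_map f) ?_
  · ext k
    rcases k with e | i
    · simp
    · simp
  · rintro T Z ⟨x, hx, hxZ⟩
    refine ⟨Sum.inl ⁻¹' Z, DGraph.isForest_of_tree T.genus _, ?_⟩
    ext k
    rcases k with e | i
    · simp
    · simp only [Set.mem_image, Set.mem_preimage, reduceCtorEq, and_false, exists_false, iff_false]
      intro hi
      exact (((mem_ST_iff T x).1 hx).2 i).ne' (hxZ _ hi)

/-! ### Finiteness -/

namespace Gr

variable {g : ℕ} {A : Type}

lemma ncard_legs (G : Gr g A) : G.toDGraph.legs.ncard = Nat.card A := by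
  rw [← G.leg_range, ← Set.image_univ, Set.ncard_image_of_injective _ G.leg_injective,
    Set.ncard_univ]

lemma card_edge (G : Gr g A) : Nat.card G.toDGraph.Edge = (G.toDGraph.edgesIn Set.univ).ncard := by
  rw [DGraph.edgesIn_univ]; rfl

/-- The excess of the valencies over `3` is the number of edges missing to a trivalent graph. -/
lemma sum_val_add_card_edge (G : Gr g A) :
    ∑ v ∈ (Set.toFinite G.V).toFinset, (G.val v - 3) + Nat.card G.toDGraph.Edge + 3 =
      3 * g + Nat.card A := by
  have h1 := DGraph.sum_val G.stable
  have h2 := G.genus.2.2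
  rw [G.ncard_legs] at h1
  rw [G.card_edge]
  omega

/-- Stable graphs of given type have a bounded number of flags. -/
lemma card_flags_le (G : Gr g A) : Nat.card G.F ≤ 9 * (g + Nat.card A) := by
  have h1 := G.sum_val_add_card_edge
  have h2 := DGraph.ncard_flags (G := G.toDGraph) (K := Set.univ) fun _ _ => trivial
  have h3 := G.genus.2.2
  rw [Set.univ_inter, G.ncard_legs, ← G.card_edge, Set.ncard_univ] at h2
  rw [← G.card_edge] at h3
  have h4 : Nat.card G.F = Nat.card G.toDGraph.F := rfl
  omega

/-- There are finitely many stable graphs of given type: the structure maps of a graph can be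
transported to one of finitely many sets `Fin n`. -/
lemma finite_isoClass (g : ℕ) (A : Type) [Finite A] : Finite (IsoClass (Gr g A)) := by
  classical
  let Code := Σ n : Fin (9 * (g + Nat.card A) + 1), (Fin n → Fin n) × (Fin n → Fin n) × (A → Fin n)
  have key : ∀ G : Gr g A, ∃ e : G.F ≃ Fin (Nat.card G.F), True := fun G =>
    ⟨Finite.equivFin G.F, trivial⟩
  choose e _ using key
  let code : Gr g A → Code := fun G =>
    ⟨⟨Nat.card G.F, Nat.lt_succ_of_le G.card_flags_le⟩, fun x => e G (G.r ((e G).symm x)),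
      fun x => e G (G.ι ((e G).symm x)), fun a => e G (G.leg a)⟩
  have hcode : ∀ G H : Gr g A, code G = code H → Nonempty (G ≅ H) := by
    intro G H h
    have aux : ∀ (n m : Fin (9 * (g + Nat.card A) + 1)) (d : (Fin n → Fin n) × (Fin n → Fin n) ×
        (A → Fin n)) (d' : (Fin m → Fin m) × (Fin m → Fin m) × (A → Fin m)),
        (⟨n, d⟩ : Code) = ⟨m, d'⟩ → ∃ k : Fin n ≃ Fin m, (∀ x, k (d.1 x) = d'.1 (k x)) ∧
          (∀ x, k (d.2.1 x) = d'.2.1 (k x)) ∧ ∀ a, k (d.2.2 a) = d'.2.2 a := by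
      rintro n m d d' h
      cases h
      exact ⟨Equiv.refl _, fun _ => rfl, fun _ => rfl, fun _ => rfl⟩
    obtain ⟨k, h1, h2, h3⟩ := aux _ _ _ _ h
    refine ⟨isoOfEquiv (((e G).trans k).trans (e H).symm) ?_ ?_ ?_⟩
    · intro x
      have := h1 (e G x)
      simp only [Equiv.symm_apply_apply] at this
      simp [this]
    · intro x
      have := h2 (e G x)
      simp only [Equiv.symm_apply_apply] at this
      simp [this]
    · intro a
      have := h3 a
      simp [this]
  refine Finite.of_injective (fun c : IsoClass (Gr g A) => code c.out) ?_
  intro c c' h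
  rw [← c.out_eq, ← c'.out_eq]
  exact Quotient.sound (hcode _ _ h)

end Gr

lemma finite_isoClass_op (C : Type 1) [Category.{0} C] [Finite (IsoClass C)] :
    Finite (IsoClass Cᵒᵖ) := by
  refine Finite.of_injective (fun c : IsoClass Cᵒᵖ => isoClass c.out.unop) ?_
  intro c c' h
  rw [← c.out_eq, ← c'.out_eq]
  obtain ⟨i⟩ : Nonempty (c.out.unop ≅ c'.out.unop) := Quotient.exact h
  exact Quotient.sound ⟨i.op.symm⟩

lemma isPoicSpace_Mtrop (g : ℕ) (A : Type) [Finite A] : IsPoicSpace (Mtrop g A) where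
  toHasFaces := hasFaces_Mtrop g A
  finiteHom p q := by
    refine Finite.of_injective (fun f : p ⟶ q => (f.unop.toFun : q.unop.F → p.unop.F)) ?_
    intro f f' h
    exact Quiver.Hom.unop_inj (Gr.hom_ext h)
  finite := by
    have := Gr.finite_isoClass g A
    exact finite_isoClass_op _

/-! ### Branches of trees -/

namespace DGraph

variable {G : DGraph}

/-- The flags that are not incident to `v`, neither directly nor through their opposite flag. -/
def away (G : DGraph) (v : G.F) : Set G.F := {y | G.r y ≠ v ∧ G.r (G.ι y) ≠ v}

/-- The flags at a vertex. -/
def flagsAt (G : DGraph) (v : G.F) : Set G.F := {x | G.r x = v ∧ x ∉ G.V}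

lemma away_subgraph (v : G.F) : G.IsSubgraph (G.away v) := by
  rintro x ⟨h1, h2⟩
  refine ⟨⟨by rwa [G.r_r], by rwa [G.ι_r, G.r_r]⟩, h2, by rwa [G.ι_ι]⟩

lemma joined_away_symm {v a b : G.F} (h : G.Joined (G.away v) a b) : G.Joined (G.away v) b a :=
  h.symm fun x hx => (away_subgraph v x hx).2

lemma ne_of_joined_away {v a b : G.F} (h : G.Joined (G.away v) a b) (ha : a ≠ v) : b ≠ v := by
  induction h with
  | refl => exact ha
  | tail _ hbc _ =>
    obtain ⟨x, hx, rfl, rfl⟩ := hbc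
    exact hx.2

lemma ncard_flagsAt {v : G.F} (hv : v ∈ G.V) : (G.flagsAt v).ncard = G.val v := by
  have : G.flagsAt v = (G.r ⁻¹' {v}) \ {v} := by
    ext x
    constructor
    · rintro ⟨h1, h2⟩
      exact ⟨h1, fun h => h2 (h ▸ hv)⟩
    · rintro ⟨h1, h2⟩
      exact ⟨h1, fun h => h2 ((mem_V.1 h).symm.trans h1)⟩
  rw [this, Set.ncard_sdiff_singleton_of_mem (show v ∈ G.r ⁻¹' {v} from mem_V.1 hv), val]

/-- A vertex `w ≠ v` that is joined to `v` lies on a branch at `v`, given by a flag `x` at `v`. -/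
lemma exists_branch {v w : G.F} (h : G.Joined Set.univ v w) :
    w = v ∨ ∃ x ∈ G.flagsAt v, G.ι x ≠ x ∧ G.Joined (G.away v) (G.r (G.ι x)) w := by
  induction h with
  | refl => exact Or.inl rfl
  | tail _ hbc ih =>
    obtain ⟨y, -, rfl, rfl⟩ := hbc
    by_cases h1 : G.r (G.ι y) = v
    · exact Or.inl h1
    right
    by_cases h2 : G.r y = v
    · have hy : G.ι y ≠ y := fun h => h1 (by rw [h, h2])
      exact ⟨y, ⟨h2, notMem_V_of_ι_ne hy⟩, hy, Relation.ReflTransGen.refl⟩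
    · obtain ⟨x, hx, hι, hj⟩ := ih.resolve_left h2
      exact ⟨x, hx, hι, hj.tail ⟨y, ⟨h2, h1⟩, rfl, rfl⟩⟩

/-- Different flags at a vertex of a tree lead to different branches. -/
lemma branch_unique (hG : G.IsConnOfGenus 0 Set.univ) {v w x x' : G.F} (hx : G.r x = v)
    (hx' : G.r x' = v) (hι : G.ι x ≠ x) (hι' : G.ι x' ≠ x')
    (h : G.Joined (G.away v) (G.r (G.ι x)) w) (h' : G.Joined (G.away v) (G.r (G.ι x')) w) :
    x = x' := by
  by_contra hne
  refine not_joined_compl hG hι ?_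
  have hsub : G.away v ⊆ ({x, G.ι x} : Set G.F)ᶜ := by
    rintro y hy (rfl | h)
    · exact hy.1 hx
    · rw [Set.mem_singleton_iff] at h
      subst h
      exact hy.2 (by rw [G.ι_ι, hx])
  have h1 : G.Joined ({x, G.ι x} : Set G.F)ᶜ (G.r (G.ι x')) (G.r (G.ι x)) :=
    Joined.mono hsub (h'.trans (joined_away_symm h))
  -- otherwise `x'` and the branch join the ends of the edge of `x` without this edge
  refine Relation.ReflTransGen.head ⟨x', ?_, hx'.trans hx.symm, rfl⟩ h1
  rintro (h | h)
  · exact hne h.symm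
  · rw [Set.mem_singleton_iff] at h
    subst h
    exact r_ι_ne hG hι (hx'.trans hx.symm)

end DGraph

namespace Gr

variable {g : ℕ} {B : Type}

/-- The legs that are reached from the root of the flag `x` through `x`, without returning to this
vertex. -/
def beyond (T : Gr g B) (x : T.F) : Set B :=
  {b | T.leg b = x ∨
    (T.ι x ≠ x ∧ T.toDGraph.Joined (T.toDGraph.away (T.r x)) (T.r (T.ι x)) (T.r (T.leg b)))}

lemma ι_leg (T : Gr g B) (b : B) : T.ι (T.leg b) = T.leg b := (leg_mem b).2

lemma exists_beyond (T : Gr g B) {v : T.F} (hv : v ∈ T.V) (b : B) :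
    ∃ x ∈ T.toDGraph.flagsAt v, b ∈ T.beyond x := by
  rcases DGraph.exists_branch (T.genus.2.1.2 v ⟨trivial, hv⟩ (T.r (T.leg b))
    ⟨trivial, DGraph.r_mem_V _⟩) with h | ⟨x, hx, hι, hj⟩
  · exact ⟨T.leg b, ⟨h, (leg_mem b).1⟩, Or.inl rfl⟩
  · refine ⟨x, hx, Or.inr ⟨hι, ?_⟩⟩
    rw [hx.1]
    exact hj

/-- A leg is beyond at most one flag at a vertex of a tree. -/
lemma beyond_unique (T : Gr 0 B) {v x x' : T.F} (hx : T.r x = v) (hx' : T.r x' = v) {b : B}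
    (h : b ∈ T.beyond x) (h' : b ∈ T.beyond x') : x = x' := by
  have aux : ∀ {x x' : T.F}, T.r x = v → T.r x' = v → T.leg b = x →
      ¬ (T.ι x' ≠ x' ∧ T.toDGraph.Joined (T.toDGraph.away (T.r x')) (T.r (T.ι x'))
        (T.r (T.leg b))) := by
    rintro x x' hx hx' rfl ⟨hι, hj⟩
    exact DGraph.ne_of_joined_away hj (DGraph.r_ι_ne T.genus hι) (hx.trans hx'.symm)
  rcases h with h | h
  · rcases h' with h' | h'
    · exact h.symm.trans h'
    · exact absurd h' (aux hx hx' h)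
  · rcases h' with h' | h'
    · exact absurd h (aux hx' hx h')
    · rw [hx] at h
      rw [hx'] at h'
      exact DGraph.branch_unique T.genus hx hx' h.1 h'.1 h.2 h'.2

/-- Every branch of a stable tree carries a leg. For the part `K` of the branch without legs is a
tree, so that at least three flags lead out of it; only one of them leads back to the root. -/
lemma beyond_nonempty (T : Gr 0 B) {x : T.F} (hx : x ∉ T.V) : (T.beyond x).Nonempty := by
  by_cases hι : T.ι x = x
  · have : x ∈ T.toDGraph.legs := ⟨hx, hι⟩
    rw [← T.leg_range] at this
    obtain ⟨b, rfl⟩ := this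
    exact ⟨b, Or.inl rfl⟩
  set v := T.r x with hv
  set K : Set T.F := {y | y ∈ T.toDGraph.away v ∧ y ∉ T.toDGraph.legs ∧
    T.toDGraph.Joined (T.toDGraph.away v) (T.r (T.ι x)) (T.r y)} with hK
  have hιx : T.r (T.ι x) ≠ v := DGraph.r_ι_ne T.genus hι
  have hlegι : ∀ y, T.ι y ∈ T.toDGraph.legs → y ∈ T.toDGraph.legs := by
    intro y hy
    have : T.ι y = y := by
      have := hy.2
      change T.ι (T.ι y) = T.ι y at this
      rw [T.ι_ι] at this
      exact this.symm
    rwa [this] at hy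
  have hsub : T.toDGraph.IsSubgraph K := by
    rintro y ⟨h1, h2, h3⟩
    refine ⟨⟨(DGraph.away_subgraph v y h1).1, fun h => h.1 (DGraph.r_mem_V y), ?_⟩,
      (DGraph.away_subgraph v y h1).2, fun h => h2 (hlegι y h), h3.tail ⟨y, h1, rfl, rfl⟩⟩
    rw [T.r_r]; exact h3
  have hroot : ∀ w ∈ T.V, T.toDGraph.Joined (T.toDGraph.away v) (T.r (T.ι x)) w → w ∈ K := by
    intro w hw hj
    have h1 := DGraph.mem_V.1 hw
    have h2 := DGraph.ne_of_joined_away hj hιx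
    refine ⟨⟨fun h => h2 (h1.symm.trans h), fun h => h2 ?_⟩, fun h => h.1 hw, ?_⟩
    · rw [DGraph.ι_of_mem_V hw, h1] at h; exact h
    · rw [h1]; exact hj
  have hj : ∀ w, T.toDGraph.Joined (T.toDGraph.away v) (T.r (T.ι x)) w →
      T.toDGraph.Joined K (T.r (T.ι x)) w := by
    intro w h
    induction h with
    | refl => exact Relation.ReflTransGen.refl
    | tail h1 hbc ih =>
      obtain ⟨y, hy, rfl, rfl⟩ := hbc
      by_cases hl : y ∈ T.toDGraph.legs
      · rw [hl.2]; exact ih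
      · exact ih.tail ⟨y, ⟨hy, hl, h1⟩, rfl, rfl⟩
  have hc : T.toDGraph.IsConn K := by
    refine ⟨⟨T.r (T.ι x), hroot _ (DGraph.r_mem_V _) Relation.ReflTransGen.refl,
      DGraph.r_mem_V _⟩, fun a ha b hb => ?_⟩
    have h1 := ha.1.2.2
    have h2 := hb.1.2.2
    rw [DGraph.mem_V.1 ha.2] at h1
    rw [DGraph.mem_V.1 hb.2] at h2
    exact ((hj _ h1).symm fun z hz => (hsub z hz).2).trans (hj _ h2)
  have htree : T.toDGraph.IsLeglessTree K :=
    ⟨DGraph.tree_of_conn T.genus hsub hc, Set.disjoint_left.2 fun y hy => hy.2.1⟩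
  have h1 := DGraph.le_ncard_outgoing T.stable htree
  -- a flag `y` other than the one that leads back to `v`
  have h2 : 1 < {y | y ∉ K ∧ T.r y ∈ K}.ncard := by omega
  obtain ⟨y, ⟨hyK, hry⟩, hne⟩ := Set.exists_ne_of_one_lt_ncard h2 (T.ι x)
  have h3 : T.toDGraph.Joined (T.toDGraph.away v) (T.r (T.ι x)) (T.r y) := by
    have := hry.2.2
    rwa [T.r_r] at this
  have h4 : T.r y ≠ v := DGraph.ne_of_joined_away h3 hιx
  by_cases hl : y ∈ T.toDGraph.legs
  · have := hl
    rw [← T.leg_range] at this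
    obtain ⟨b, rfl⟩ := this
    exact ⟨b, Or.inr ⟨hι, h3⟩⟩
  -- if `y` is not a leg, it also leads to `v`, which contradicts the uniqueness of branches
  · exfalso
    have h5 : T.r (T.ι y) = v := by
      by_contra h
      exact hyK ⟨⟨h4, h⟩, hl, h3⟩
    have h6 : T.ι (T.ι y) ≠ T.ι y := by
      intro h
      rw [T.ι_ι] at h
      exact h4 (by rw [h, h5])
    have := DGraph.branch_unique T.genus hv.symm h5 hι h6 h3
      (by rw [T.ι_ι]; exact Relation.ReflTransGen.refl)
    exact hne (by rw [this, T.ι_ι])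

/-- Legs in different branches at a vertex stay in different branches after a contraction. -/
lemma notMem_beyond_of_contraction {T T' : Gr 0 B} (f : T ⟶ T') {x x' : T.F} {a b : B}
    (hxx' : T.r x = T.r x') (hne : x ≠ x') (ha : a ∈ T.beyond x) (hb : b ∈ T.beyond x')
    {y : T'.F} (hy : T'.r y = f.toFun (T.r x)) (hay : a ∈ T'.beyond y) : b ∉ T'.beyond y := by
  intro hby
  have hf := f.isContraction
  have hab : a ≠ b := by
    rintro rfl
    exact hne (T.beyond_unique rfl hxx'.symm ha hb)
  have hjoin : T'.ι y ≠ y ∧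
      T'.toDGraph.Joined (T'.toDGraph.away (T'.r y)) (T'.r (T'.ι y)) (T'.r (T'.leg a)) ∧
      T'.toDGraph.Joined (T'.toDGraph.away (T'.r y)) (T'.r (T'.ι y)) (T'.r (T'.leg b)) := by
    rcases hay with rfl | h1
    · rcases hby with h2 | h2
      · exact absurd (T'.leg_injective h2.symm) hab
      · exact absurd (T'.ι_leg a) h2.1
    · rcases hby with rfl | h2
      · exact absurd (T'.ι_leg b) h1.1
      · exact ⟨h1.1, h1.2, h2.2⟩
  obtain ⟨hι, h1, h2⟩ := hjoin
  have hιy := DGraph.r_ι_ne T'.genus hι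
  have h3 := (DGraph.joined_away_symm h1).trans h2
  have hne1 := DGraph.ne_of_joined_away h1 hιy
  have hne2 := DGraph.ne_of_joined_away h2 hιy
  have hleg : ∀ c, f.toFun (T.r (T.leg c)) = T'.r (T'.leg c) := fun c => by rw [hf.r, f.leg]
  have hmem : T'.r (T'.leg a) ∈ T'.toDGraph.away (T'.r y) := by
    refine ⟨by rwa [T'.r_r], ?_⟩
    rwa [T'.ι_r, T'.r_r]
  -- a path from `a` to `b` that avoids the image of the vertex lifts, as the fibres are connected
  have h4 := hf.joined_preimage (DGraph.away_subgraph _) h3 hmem (DGraph.r_mem_V _)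
    (T.r (T.leg a)) (DGraph.r_mem_V _) (T.r (T.leg b)) (DGraph.r_mem_V _) (hleg a) (hleg b)
  have hsub : f.toFun ⁻¹' T'.toDGraph.away (T'.r y) ⊆ T.toDGraph.away (T.r x) := by
    rintro z ⟨hz1, hz2⟩
    rw [hy] at hz1 hz2
    refine ⟨fun h => hz1 ?_, fun h => hz2 ?_⟩
    · rw [← hf.r, h]
    · rw [← hf.ι, ← hf.r, h]
  have h5 := DGraph.Joined.mono hsub h4
  have key : ∀ (c : B) (z : T.F), T.r z = T.r x → c ∈ T.beyond z →
      T'.r (T'.leg c) ≠ T'.r y → T.ι z ≠ z ∧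
      T.toDGraph.Joined (T.toDGraph.away (T.r x)) (T.r (T.ι z)) (T.r (T.leg c)) := by
    rintro c z hz (rfl | hc) hcy
    · exact absurd (by rw [hy, ← hleg, hz]) hcy
    · rw [hz] at hc; exact hc
  have ka := key a x rfl ha hne1
  have kb := key b x' hxx'.symm hb hne2
  exact hne (DGraph.branch_unique T.genus rfl hxx'.symm ka.1 kb.1 (ka.2.trans h5) kb.2)

/-- If `y` points from `w` to `w'` and `y'` from `w'` to `w`, every leg is beyond `y` or beyond
`y'`. -/
lemma beyond_of_notMem (T : Gr 0 B) {w w' y y' : T.F} (hw : w ∈ T.V) (hww' : w ≠ w')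
    (hy : T.r y = w) (hy' : T.r y' = w') (hι : T.ι y ≠ y) (hι' : T.ι y' ≠ y')
    (hj : T.toDGraph.Joined (T.toDGraph.away w) (T.r (T.ι y)) w')
    (hj' : T.toDGraph.Joined (T.toDGraph.away w') (T.r (T.ι y')) w) {a : B}
    (ha : a ∉ T.beyond y) : a ∈ T.beyond y' := by
  obtain ⟨z, hz, haz⟩ := T.exists_beyond hw a
  have hzy : z ≠ y := fun h => ha (h ▸ haz)
  refine Or.inr ⟨hι', ?_⟩
  rw [hy']
  refine Relation.ReflTransGen.trans hj' ?_
  rcases haz with rfl | ⟨hιz, hjz⟩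
  · rw [hz.1]
  rw [hz.1] at hjz
  have hnot : ¬ T.toDGraph.Joined (T.toDGraph.away w) (T.r (T.ι z)) w' := fun h =>
    hzy (DGraph.branch_unique T.genus hz.1 hy hιz hι h hj)
  -- the other branches at `w` avoid `w'`
  have hstep : ∀ t, T.toDGraph.Joined (T.toDGraph.away w) (T.r (T.ι z)) t →
      T.toDGraph.Joined (T.toDGraph.away w') w t := by
    intro t ht
    induction ht with
    | refl =>
      refine Relation.ReflTransGen.single ⟨z, ⟨?_, fun h => hnot ?_⟩, hz.1, rfl⟩
      · rwa [hz.1]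
      · rw [← h]; exact Relation.ReflTransGen.refl
    | tail h1 hbc ih =>
      obtain ⟨u, hu, rfl, rfl⟩ := hbc
      refine ih.tail ⟨u, ⟨fun h => hnot (h ▸ h1), fun h => hnot ?_⟩, rfl, rfl⟩
      rw [← h]
      exact h1.tail ⟨u, hu, rfl, rfl⟩
  exact hstep _ hjz

/-- A contraction of stable trees is determined on the vertices by its values on the legs: a vertex
is the median of any three legs in different branches at it. -/
lemma toFun_eq_of_mem_V {T T' : Gr 0 B} (f f' : T ⟶ T') {u : T.F} (hu : u ∈ T.V) :
    f.toFun u = f'.toFun u := by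
  by_contra hne
  set w := f.toFun u with hw
  set w' := f'.toFun u with hw'
  have hwV : w ∈ T'.V := f.isContraction.mem_V hu
  have hwV' : w' ∈ T'.V := f'.isContraction.mem_V hu
  -- the flags at `w` and `w'` that point to each other
  obtain ⟨y, hy, hι, hj⟩ := (DGraph.exists_branch (T'.genus.2.1.2 w ⟨trivial, hwV⟩ w'
    ⟨trivial, hwV'⟩)).resolve_left (Ne.symm hne)
  obtain ⟨y', hy', hι', hj'⟩ := (DGraph.exists_branch (T'.genus.2.1.2 w' ⟨trivial, hwV'⟩ w
    ⟨trivial, hwV⟩)).resolve_left hne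
  have hval := T.stable u hu
  rw [← DGraph.ncard_flagsAt hu] at hval
  -- legs on three different branches at `u`
  obtain ⟨x₁, x₂, x₃, h1, h2, h3, h12, h13, h23⟩ :=
    (Set.two_lt_ncard_iff (Set.toFinite _)).1 (show 2 < (T.toDGraph.flagsAt u).ncard by omega)
  obtain ⟨a₁, ha₁⟩ := T.beyond_nonempty h1.2
  obtain ⟨a₂, ha₂⟩ := T.beyond_nonempty h2.2
  obtain ⟨a₃, ha₃⟩ := T.beyond_nonempty h3.2
  -- each of the three legs is beyond `y` or beyond `y'`, but no two of them are beyond the same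
  -- flag
  have cover : ∀ a, a ∈ T'.beyond y ∨ a ∈ T'.beyond y' := fun a => by
    by_contra h
    push Not at h
    exact h.2 (T'.beyond_of_notMem hwV hne hy.1 hy'.1 hι hι' hj hj' h.1)
  have sep : ∀ {x x' : T.F} {a b : B}, x ∈ T.toDGraph.flagsAt u → x' ∈ T.toDGraph.flagsAt u →
      x ≠ x' → a ∈ T.beyond x → b ∈ T.beyond x' →
      (a ∈ T'.beyond y → b ∉ T'.beyond y) ∧ (a ∈ T'.beyond y' → b ∉ T'.beyond y') := by
    intro x x' a b hx hx' hxx ha hb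
    exact ⟨notMem_beyond_of_contraction f (hx.1.trans hx'.1.symm) hxx ha hb
      (by rw [hy.1, hx.1]), notMem_beyond_of_contraction f' (hx.1.trans hx'.1.symm) hxx ha hb
      (by rw [hy'.1, hx.1])⟩
  have s12 := sep h1 h2 h12 ha₁ ha₂
  have s13 := sep h1 h3 h13 ha₁ ha₃
  have s23 := sep h2 h3 h23 ha₂ ha₃
  rcases cover a₁ with c1 | c1 <;> rcases cover a₂ with c2 | c2 <;> rcases cover a₃ with c3 | c3 <;>
    first
    | exact s12.1 c1 c2
    | exact s12.2 c1 c2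
    | exact s13.1 c1 c3
    | exact s13.2 c1 c3
    | exact s23.1 c2 c3
    | exact s23.2 c2 c3

/-- Stable trees have no non-trivial automorphisms fixing the legs, and more generally there is at
most one contraction between two of them: it is determined on the vertices, and a flag of an edge is
determined by the ends of its edge. -/
instance thin (B : Type) : Quiver.IsThin (Gr 0 B) := by
  refine fun T T' => ⟨fun f f' => hom_ext (funext fun x => ?_)⟩
  have hf := f.isContraction
  have hf' := f'.isContraction
  have hr : ∀ x, T'.r (f.toFun x) = T'.r (f'.toFun x) := fun x => by
    rw [← hf.r, ← hf'.r]
    exact toFun_eq_of_mem_V f f' (DGraph.r_mem_V x)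
  have aux : ∀ (k k' : T ⟶ T') (x : T.F), (∀ x, T'.r (k.toFun x) = T'.r (k'.toFun x)) →
      T'.ι (k.toFun x) ≠ k.toFun x → k.toFun x = k'.toFun x := by
    intro k k' x hr hι
    have hk := k.isContraction
    have hk' := k'.isContraction
    refine DGraph.eq_of_ends_eq T'.genus hι (hr x) ?_
    have := hr (T.ι x)
    rwa [hk.ι, hk'.ι] at this
  by_cases h1 : T'.ι (f.toFun x) = f.toFun x
  · by_cases h2 : T'.ι (f'.toFun x) = f'.toFun x
    · by_cases hx : x ∈ T.toDGraph.legs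
      · rw [← T.leg_range] at hx
        obtain ⟨b, rfl⟩ := hx
        rw [f.leg, f'.leg]
      · have hV : ∀ k : T ⟶ T', T'.ι (k.toFun x) = k.toFun x → k.toFun x ∈ T'.V := by
          intro k hk
          by_contra h
          exact hx (k.isContraction.legs_image.1 ⟨h, hk⟩)
        rw [← DGraph.mem_V.1 (hV f h1), ← DGraph.mem_V.1 (hV f' h2)]
        exact hr x
    · exact (aux f' f x (fun x => (hr x).symm) h2).symm
  · exact aux f f' x hr h1

end Gr

lemma isPoicComplex_ST (g : ℕ) (A : Type) [Finite A] : IsPoicComplex (ST g A) where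
  toHasFaces := hasFaces_ST g A
  thin := fun _ _ => ⟨fun _ _ => Quiver.Hom.unop_inj (Subsingleton.elim _ _)⟩
  finite := by
    have := Gr.finite_isoClass 0 (Mark g A)
    exact finite_isoClass_op _

/-! ### Spanning trees and the fibration property -/

namespace DGraph

variable {G : DGraph}

/-- Adding an edge that leads out of a subtree. -/
lemma IsLeglessTree.extend {K : Set G.F} (hK : G.IsLeglessTree K) {x : G.F} (hx : G.r x ∈ K)
    (hx' : G.r (G.ι x) ∉ K) : G.IsLeglessTree (K ∪ {x, G.ι x, G.r (G.ι x)}) := by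
  have hxV : x ∉ G.V := fun h => hx' (by rwa [ι_of_mem_V h])
  have hxι : G.ι x ≠ x := fun h => hx' (by rwa [h])
  have hxnK : x ∉ K := fun h => hx' (hK.1.1 _ (hK.1.1 x h).2).1
  set b := G.r (G.ι x) with hb
  have hbV : b ∈ G.V := r_mem_V _
  set K' := K ∪ {x, G.ι x, b} with hK'
  have hsub : G.IsSubgraph K' := by
    rintro y (hy | rfl | rfl | rfl)
    · exact ⟨Or.inl (hK.1.1 y hy).1, Or.inl (hK.1.1 y hy).2⟩
    · exact ⟨Or.inl hx, Or.inr (by simp)⟩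
    · exact ⟨Or.inr (by simp [hb]), Or.inr (by simp [G.ι_ι])⟩
    · exact ⟨Or.inr (by simp [hb, G.r_r]), Or.inr (by simp [ι_of_mem_V hbV])⟩
  have hverts : G.vertsIn K' = insert b (G.vertsIn K) := by
    ext y
    constructor
    · rintro ⟨hy | rfl | rfl | rfl, hyV⟩
      · exact Or.inr ⟨hy, hyV⟩
      · exact absurd hyV hxV
      · exact absurd (ι_mem_V.1 hyV) hxV
      · exact Or.inl rfl
    · rintro (rfl | hy)
      · exact ⟨Or.inr (by simp), hbV⟩
      · exact ⟨Or.inl hy.1, hy.2⟩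
  have hedges : G.edgesIn K' = insert {x, G.ι x} (G.edgesIn K) := by
    ext e
    constructor
    · rintro ⟨⟨y, hy, rfl⟩, hsub'⟩
      have hyV := notMem_V_of_ι_ne hy
      rcases hsub' (Or.inl rfl : y ∈ ({y, G.ι y} : Set G.F)) with h | h | h | h
      · refine Or.inr ⟨⟨y, hy, rfl⟩, ?_⟩
        rintro z (rfl | rfl)
        exacts [h, (hK.1.1 y h).2]
      · exact Or.inl (by rw [h])
      · rw [h, G.ι_ι]; exact Or.inl (Set.pair_comm _ _)
      · rw [Set.mem_singleton_iff] at h; exact absurd (h ▸ hbV) hyV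
    · rintro (rfl | he)
      · refine ⟨⟨x, hxι, rfl⟩, ?_⟩
        rintro y (rfl | rfl) <;> exact Or.inr (by simp)
      · exact ⟨he.1, he.2.trans Set.subset_union_left⟩
  have hvc : (G.vertsIn K').ncard = (G.vertsIn K).ncard + 1 := by
    rw [hverts, Set.ncard_insert_of_notMem (fun h => hx' h.1)]
  have hec : (G.edgesIn K').ncard = (G.edgesIn K).ncard + 1 := by
    rw [hedges, Set.ncard_insert_of_notMem (fun h => hxnK (h.2 (Or.inl rfl)))]
  have hstep : G.Joined K' (G.r x) b :=
    Relation.ReflTransGen.single ⟨x, Or.inr (by simp), rfl, rfl⟩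
  have hroot : ∀ v ∈ G.vertsIn K', G.Joined K' (G.r x) v := by
    rw [hverts]
    rintro v (rfl | hv)
    · exact hstep
    · exact (hK.1.2.1.2 _ ⟨hx, r_mem_V _⟩ v hv).mono Set.subset_union_left
  refine ⟨⟨hsub, ⟨⟨b, Or.inr (by simp), hbV⟩, fun v hv w hw => ?_⟩, ?_⟩, ?_⟩
  · exact ((hroot v hv).symm fun y hy => (hsub y hy).2).trans (hroot w hw)
  · rw [hvc, hec]
    have := hK.1.2.2
    omega
  · refine Set.disjoint_left.2 ?_
    rintro y (hy | rfl | rfl | rfl) hl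
    · exact Set.disjoint_left.1 hK.2 hy hl
    · exact hxι hl.2
    · have := hl.2
      rw [G.ι_ι] at this
      exact hxι this.symm
    · exact hl.1 hbV

/-- A connected graph has a spanning tree. -/
lemma exists_spanning_tree (hG : G.IsConn Set.univ) : ∃ K, G.IsLeglessTree K ∧ G.V ⊆ K := by
  obtain ⟨v, hv⟩ := hG.1
  have hne : {K : Set G.F | G.IsLeglessTree K}.Nonempty := ⟨_, isLeglessTree_singleton hv.2⟩
  -- a legless subtree with as many flags as possible
  obtain ⟨K, hK, hmax⟩ := Set.exists_max_image _ Set.ncard (Set.toFinite _) hne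
  refine ⟨K, hK, fun w hw => ?_⟩
  by_contra hwK
  obtain ⟨u, hu⟩ := hK.1.2.1.1
  obtain ⟨x, -, hx, hx'⟩ := exit_of_joined (hG.2 u ⟨trivial, hu.2⟩ w ⟨trivial, hw⟩) hu.1 hwK
  have h1 := hmax _ (hK.extend hx hx')
  refine absurd h1 (not_le.2 (Set.ncard_lt_ncard ⟨Set.subset_union_left, fun h => hx' ?_⟩))
  exact h (Or.inr (by simp))

end DGraph

namespace Gr

variable {g : ℕ} {A : Type}

section cut

variable (G : Gr g A) (s : Fin g ⊕ Fin g → G.F)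

open Classical in
/-- The graph obtained from `G` by cutting the edges whose flags are the values of `s` into two
legs each. -/
def cutDGraph : DGraph where
  F := G.F
  r := G.r
  ι x := if x ∈ Set.range s ∨ G.ι x ∈ Set.range s then x else G.ι x
  r_r := G.r_r
  ι_ι x := by
    by_cases h : x ∈ Set.range s ∨ G.ι x ∈ Set.range s
    · rw [if_pos h, if_pos h]
    · rw [if_neg h, G.ι_ι, if_neg fun h' => h h'.symm]
  ι_r x := by
    rw [G.ι_r]
    split_ifs <;> rfl

variable {G s}

lemma cut_ι_s (x) : (G.cutDGraph s).ι (s x) = s x := if_pos (Or.inl ⟨x, rfl⟩)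

variable (hι : ∀ x, G.ι (s x) = s x.swap)
include hι

lemma cut_ι_of_notMem {x : G.F} (hx : x ∉ Set.range s) : (G.cutDGraph s).ι x = G.ι x := by
  refine if_neg ?_
  rintro (h | ⟨y, hy⟩)
  · exact hx h
  · refine hx ⟨y.swap, ?_⟩
    rw [← hι, hy, G.ι_ι]

variable (hs : Function.Injective s)
include hs

lemma s_ι_ne (x) : G.ι (s x) ≠ s x := by
  rw [hι]
  intro h
  have := hs h
  rcases x with x | x <;> simp at this

/-- Cutting `g` edges of a graph of genus `g` such that it stays connected yields a tree. -/
def cutGr (hc : (G.cutDGraph s).IsConn Set.univ) : Gr 0 (Mark g A) where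
  toDGraph := G.cutDGraph s
  leg := Sum.elim G.leg s
  leg_injective := by
    refine G.leg_injective.sumElim hs fun a x h => ?_
    exact s_ι_ne hι hs x (h ▸ G.ι_leg a)
  leg_range := by
    refine (Set.Sum.elim_range _ _).trans ?_
    refine (congrArg (· ∪ Set.range s) G.leg_range).trans ?_
    ext x
    constructor
    · rintro (⟨h1, h2⟩ | ⟨y, rfl⟩)
      · refine ⟨h1, ?_⟩
        by_cases hx : x ∈ Set.range s
        · obtain ⟨y, rfl⟩ := hx
          exact cut_ι_s y
        · rw [cut_ι_of_notMem hι hx, h2]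
      · refine ⟨DGraph.notMem_V_of_ι_ne (G := G.toDGraph) (s_ι_ne hι hs y), cut_ι_s y⟩
    · rintro ⟨h1, h2⟩
      by_cases hx : x ∈ Set.range s
      · exact Or.inr hx
      · rw [cut_ι_of_notMem hι hx] at h2
        exact Or.inl ⟨h1, h2⟩
  genus := by
    refine ⟨fun _ _ => ⟨trivial, trivial⟩, hc, ?_⟩
    have hmem : ∀ i, ({s (.inl i), s (.inr i)} : Set G.F) =
        {s (.inl i), G.ι (s (.inl i))} := fun i => by rw [hι]; rfl
    set P : Fin g → Set G.F := fun i => {s (.inl i), s (.inr i)} with hP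
    have h1 : G.edgesIn Set.univ = (G.cutDGraph s).edgesIn Set.univ ∪ Set.range P := by
      ext e
      constructor
      · rintro ⟨⟨x, hx, rfl⟩, -⟩
        by_cases h : x ∈ Set.range s
        · obtain ⟨i | i, rfl⟩ := h
          · exact Or.inr ⟨i, hmem i⟩
          · refine Or.inr ⟨i, ?_⟩
            rw [hι, Set.pair_comm]; rfl
        · have h' := cut_ι_of_notMem hι h
          refine Or.inl ⟨⟨x, by rwa [h'], by rw [h']; rfl⟩, fun _ _ => trivial⟩
      · rintro (⟨⟨x, hx, rfl⟩, -⟩ | ⟨i, rfl⟩)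
        · have h : x ∉ Set.range s := by
            rintro ⟨y, rfl⟩
            exact hx (cut_ι_s y)
          have h' := cut_ι_of_notMem hι h
          rw [h'] at hx ⊢
          exact ⟨⟨x, hx, rfl⟩, fun _ _ => trivial⟩
        · exact ⟨⟨_, s_ι_ne hι hs _, hmem i⟩, fun _ _ => trivial⟩
    have h2 : Disjoint ((G.cutDGraph s).edgesIn Set.univ) (Set.range P) := by
      rw [Set.disjoint_left]
      rintro _ ⟨he, -⟩ ⟨i, rfl⟩
      exact (DGraph.eq_pair_of_mem_edge he (Or.inl rfl)).1 (cut_ι_s _)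
    have h3 : (Set.range P).ncard = g := by
      have hinj : Function.Injective P := by
        intro i j h
        have : s (.inl i) ∈ P j := h ▸ Or.inl rfl
        rcases this with h | h
        · exact Sum.inl_injective (hs h)
        · cases hs h
      rw [← Set.image_univ, Set.ncard_image_of_injective _ hinj]
      simp
    have h4 := (congrArg Set.ncard h1).trans ((Set.ncard_union_eq h2 (Set.toFinite _)
      (Set.toFinite _)).trans (congrArg _ h3))
    have h5 := G.genus.2.2
    have h6 : (G.vertsIn Set.univ).ncard = ((G.cutDGraph s).vertsIn Set.univ).ncard := rfl
    omega
  stable := G.stable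

lemma glue_cutGr (hc : (G.cutDGraph s).IsConn Set.univ) (x : G.F) :
    (cutGr hι hs hc).glue x = G.ι x := by
  by_cases hx : x ∈ Set.range s
  · obtain ⟨y, rfl⟩ := hx
    exact ((cutGr hι hs hc).glue_gLeg y).trans (hι y).symm
  · rw [(cutGr hι hs hc).glue_of_ne fun y hy => hx ⟨y, hy⟩]
    exact cut_ι_of_notMem hι hx

/-- Joining the cut legs gives back the original graph. -/
def stCutIso (hc : (G.cutDGraph s).IsConn Set.univ) : (cutGr hι hs hc).stGraph ≅ G :=
  isoOfEquiv (Equiv.refl G.F) (fun _ => rfl) (fun x => glue_cutGr hι hs hc x) (fun _ => rfl)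

end cut

/-- A graph `G` is isomorphic to the graph obtained from a tree by joining the legs: the tree
results from `G` by cutting the `g` edges that are not in a spanning tree. -/
instance (g : ℕ) (A : Type) : (stFunctor g A).op.EssSurj where
  mem_essImage := by
    rintro ⟨G⟩
    obtain ⟨K, hK, hVK⟩ := DGraph.exists_spanning_tree G.genus.2.1
    set Z : Set (Set G.F) := G.edgeSet \ G.edgesIn K with hZ
    have hcard : Z.ncard = g := by
      rw [hZ, Set.ncard_sdiff (fun e he => he.1), ← DGraph.edgesIn_univ]
      have h1 := G.genus.2.2
      have h2 := hK.1.2.2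
      rw [DGraph.vertsIn_univ] at h1
      have h3 : G.vertsIn K = G.V := Set.inter_eq_right.2 hVK
      rw [h3] at h2
      omega
    have e : Fin g ≃ Z := (Finite.equivFinOfCardEq hcard).symm
    have hex : ∀ i, ∃ x : G.F, G.ι x ≠ x ∧ (e i).1 = {x, G.ι x} := fun i => (e i).2.1
    choose h hh he using hex
    set s : Fin g ⊕ Fin g → G.F := Sum.elim h fun i => G.ι (h i) with hsdef
    have hι : ∀ x, G.ι (s x) = s x.swap := by
      rintro (i | i)
      · rfl
      · exact G.ι_ι _
    -- `s` lists the half-edges of the edges outside of `K`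
    have hse : ∀ x, s x ∈ (e (x.elim id id)).1 := by
      rintro (i | i) <;> simp only [hsdef, he, Sum.elim_inl, Sum.elim_inr, id]
      · exact Or.inl rfl
      · exact Or.inr rfl
    have hs : Function.Injective s := by
      intro x y hxy
      have h1 : (e (x.elim id id)) = e (y.elim id id) := by
        have hx := DGraph.eq_pair_of_mem_edge (e (x.elim id id)).2.1 (hse x)
        have hy := DGraph.eq_pair_of_mem_edge (e (y.elim id id)).2.1 (hse y)
        exact Subtype.ext (hx.2.trans (by rw [hxy]; exact hy.2.symm))
      have h2 := e.injective h1
      rcases x with i | i <;> rcases y with j | j <;>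
        simp only [Sum.elim_inl, Sum.elim_inr, id] at h2
      · rw [h2]
      · subst h2; exact absurd hxy.symm (hh i)
      · subst h2; exact absurd hxy (hh i)
      · rw [h2]
    have hKs : ∀ x ∈ K, x ∉ Set.range s := by
      rintro _ hx ⟨y, rfl⟩
      refine (e (y.elim id id)).2.2 ⟨(e (y.elim id id)).2.1, ?_⟩
      rw [(DGraph.eq_pair_of_mem_edge (e (y.elim id id)).2.1 (hse y)).2]
      rintro z (rfl | rfl)
      exacts [hx, (hK.1.1 _ hx).2]
    -- the spanning tree still connects all vertices
    have hc : (G.cutDGraph s).IsConn Set.univ := by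
      refine ⟨G.genus.2.1.1, fun v hv w hw => ?_⟩
      have := hK.1.2.1.2 v ⟨hVK hv.2, hv.2⟩ w ⟨hVK hw.2, hw.2⟩
      clear hv hw
      induction this with
      | refl => exact Relation.ReflTransGen.refl
      | tail _ hbc ih =>
        obtain ⟨x, hx, rfl, rfl⟩ := hbc
        refine ih.tail ⟨x, trivial, rfl, ?_⟩
        rw [cut_ι_of_notMem hι (hKs x hx)]
        rfl
    exact ⟨.op (cutGr hι hs hc), ⟨(stCutIso hι hs hc).op.symm⟩⟩

/-- A contraction onto `st(T)` lifts uniquely to a contraction onto `T`: the edges that correspond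
to the joined legs have to be cut. -/
lemma exists_lift (T : Gr 0 (Mark g A)) (G : Gr g A) (c : G ⟶ T.stGraph) :
    ∃ (T₁ : Gr 0 (Mark g A)) (h : T₁ ⟶ T) (e : T₁.stGraph ≅ G), e.inv ≫ (stFunctor g A).map h = c ∧
      ∀ (T₂ : Gr 0 (Mark g A)) (h' : T₂ ⟶ T) (e' : T₂.stGraph ≅ G),
        e'.inv ≫ (stFunctor g A).map h' = c →
        ∃ k : T₁ ≅ T₂, k.inv ≫ h = h' ∧ e'.inv ≫ (stFunctor g A).map k.inv = e.inv := by
  have hf := c.isContraction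
  -- `s` lists the unique half-edges of `G` that are mapped to the joined legs
  have hfu : ∀ y, ∃! x, c.toFun x = T.gLeg y := fun y => hf.unique _ (T.gLeg_mem y).1
  choose s hs1 hs2 using fun y => (hfu y)
  have hs1 : ∀ y, c.toFun (s y) = T.gLeg y := hs1
  have hs2 : ∀ y x, c.toFun x = T.gLeg y → x = s y := hs2
  have hs : Function.Injective s := fun x y h => T.gLeg_injective (by rw [← hs1, ← hs1, h])
  have hι : ∀ x, G.ι (s x) = s x.swap := fun x => hs2 _ _ (by
    rw [hf.ι, hs1]; exact T.glue_gLeg x)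
  have hnot : ∀ x, x ∉ Set.range s → ∀ y, T.gLeg y ≠ c.toFun x := fun x hx y h =>
    hx ⟨y, (hs2 y x h.symm).symm⟩
  -- `c` is also a contraction of the cut graph, since the fibres over the vertices are not cut
  have hcon : DGraph.IsContraction (G := G.cutDGraph s) (H := T.toDGraph) c.toFun := by
    refine ⟨hf.r, fun x => ?_, fun v hv => ?_, hf.unique⟩
    · by_cases hx : x ∈ Set.range s
      · obtain ⟨y, rfl⟩ := hx
        rw [cut_ι_s, hs1, T.ι_gLeg]
      · exact (congrArg c.toFun (cut_ι_of_notMem hι hx)).trans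
          ((hf.ι x).trans (T.glue_of_ne (hnot x hx)))
    · obtain ⟨⟨h1, h2, h3⟩, h4⟩ := hf.tree v hv
      have hK : ∀ x ∈ c.toFun ⁻¹' {v}, x ∉ Set.range s := by
        rintro _ hx ⟨y, rfl⟩
        have : c.toFun (s y) = v := hx
        rw [hs1] at this
        exact (T.gLeg_mem y).1 (this ▸ hv)
      refine ⟨⟨fun x hx => ⟨(h1 x hx).1, ?_⟩, ⟨h2.1, fun a ha b hb => ?_⟩, ?_⟩, ?_⟩
      · rw [cut_ι_of_notMem hι (hK x hx)]
        exact (h1 x hx).2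
      · have := h2.2 a ha b hb
        clear ha hb
        induction this with
        | refl => exact Relation.ReflTransGen.refl
        | tail _ hbc ih =>
          obtain ⟨x, hx, rfl, rfl⟩ := hbc
          refine ih.tail ⟨x, hx, rfl, ?_⟩
          rw [cut_ι_of_notMem hι (hK x hx)]
          rfl
      · refine (congrArg (fun E : Set (Set G.F) => E.ncard + 1) ?_).trans h3
        ext e
        refine ⟨?_, ?_⟩
        · rintro ⟨⟨x, hx, rfl⟩, he⟩
          have := cut_ι_of_notMem hι (hK x (he (Or.inl rfl)))
          rw [this] at hx he ⊢
          exact ⟨⟨x, hx, rfl⟩, he⟩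
        · rintro ⟨⟨x, hx, rfl⟩, he⟩
          have := cut_ι_of_notMem hι (hK x (he (Or.inl rfl)))
          refine ⟨⟨x, by rwa [this], by rw [this]; rfl⟩, he⟩
      · refine Set.disjoint_left.2 fun x hx hl => ?_
        refine Set.disjoint_left.1 h4 hx ⟨hl.1, ?_⟩
        have := hl.2
        rwa [cut_ι_of_notMem hι (hK x hx)] at this
  have hc : (G.cutDGraph s).IsConn Set.univ :=
    hcon.conn_preimage (K := Set.univ) (fun _ _ => ⟨trivial, trivial⟩) T.genus.2.1
  refine ⟨cutGr hι hs hc, (⟨c.toFun, hcon, ?_⟩ : Hom (cutGr hι hs hc) T), stCutIso hι hs hc, rfl,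
    fun T₂ h' e' he => ?_⟩
  · rintro (a | y)
    · exact c.leg a
    · exact hs1 y
  -- any other lift is a tree on the flags of `G` in which the edges in the image of `s` are cut
  · set φ := e'.inv with hφ
    have hφi : ∀ x, e'.hom.toFun (φ.toFun x) = x := fun x =>
      congrFun (congrArg Hom.toFun e'.inv_hom_id) x
    have hφi' : ∀ x, φ.toFun (e'.hom.toFun x) = x := fun x =>
      congrFun (congrArg Hom.toFun e'.hom_inv_id) x
    let E : (cutGr hι hs hc).F ≃ T₂.F := ⟨φ.toFun, e'.hom.toFun, hφi, hφi'⟩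
    have hk : ∀ x, h'.toFun (φ.toFun x) = c.toFun x := fun x =>
      congrFun (congrArg Hom.toFun he) x
    have hg : ∀ y, φ.toFun (s y) = T₂.gLeg y := fun y =>
      (h'.isContraction.unique _ (T.gLeg_mem y).1).unique ((hk _).trans (hs1 y)) (h'.leg _)
    have hiso : ∀ x, E ((cutGr hι hs hc).ι x) = T₂.ι (E x) := by
      intro (x : G.F)
      by_cases hx : x ∈ Set.range s
      · obtain ⟨y, rfl⟩ := hx
        refine (congrArg φ.toFun (cut_ι_s y)).trans ?_
        change φ.toFun (s y) = T₂.ι (φ.toFun (s y))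
        rw [hg, T₂.ι_gLeg]
      · refine (congrArg φ.toFun (cut_ι_of_notMem hι hx)).trans ?_
        refine (φ.isContraction.ι x).trans (T₂.glue_of_ne fun y hy => hnot x hx y ?_)
        rw [← hk, ← hy]
        exact (h'.leg _).symm
    let k : cutGr hι hs hc ≅ T₂ := isoOfEquiv E φ.isContraction.r hiso (by
      rintro (a | y)
      · exact φ.leg a
      · exact hg y)
    exact ⟨k, Subsingleton.elim _ _, hom_ext (funext hφi)⟩

lemma stLin_injective (T : Gr 0 (Mark g A)) : Function.Injective T.stLin := by
  rw [injective_iff_map_eq_zero]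
  rintro ⟨x, y⟩ h
  have h1 : Finsupp.mapDomain T.oldEdge x + Finsupp.mapDomain T.newEdge y = 0 := h
  refine Prod.ext (Finsupp.ext fun e => ?_) (Finsupp.ext fun i => ?_)
  · have := DFunLike.congr_fun h1 (T.oldEdge e)
    rw [Finsupp.add_apply, Finsupp.mapDomain_apply T.oldEdge_injective,
      Finsupp.mapDomain_of_notMem_range _ _ fun ⟨i, hi⟩ => T.oldEdge_ne_newEdge e i hi.symm] at this
    simpa using this
  · have := DFunLike.congr_fun h1 (T.newEdge i)
    rw [Finsupp.add_apply, Finsupp.mapDomain_apply T.newEdge_injective,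
      Finsupp.mapDomain_of_notMem_range _ _ fun ⟨e, he⟩ => T.oldEdge_ne_newEdge e i he] at this
    simpa using this

lemma crd_st_oldEdge (T : Gr 0 (Mark g A)) (e) (x) :
    Poic.crd (coneBasis T.stDGraph) (T.oldEdge e) (Poic.real ((st g A).η.app (.op T)) x) =
      Poic.crd (stBasis T) (.inl e) x :=
  (T.coord_oldEdge e x).trans (crd_stBasis_inl T e x).symm

lemma crd_st_newEdge (T : Gr 0 (Mark g A)) (i) (x) :
    Poic.crd (coneBasis T.stDGraph) (T.newEdge i) (Poic.real ((st g A).η.app (.op T)) x) =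
      Poic.crd (stBasis T) (.inr i) x :=
  (T.coord_newEdge i x).trans (crd_stBasis_inr T i x).symm

end Gr

open Poic in
lemma isPoicFibration_st (g : ℕ) (A : Type) [Finite A] : IsPoicFibration (st g A) where
  complex := isPoicComplex_ST g A
  space := isPoicSpace_Mtrop g A
  essSurj := inferInstanceAs (stFunctor g A).op.EssSurj
  relint := by
    rintro ⟨T⟩
    refine ⟨⟨T.stLin_injective, T.stLin_surjective⟩, ?_⟩
    have h1 : ∀ y, y ∈ ((Mtrop g A).obj ((st g A).F.obj (.op T))).relint ↔
        ∀ k, 0 < crd (coneBasis T.stDGraph) k y := fun y =>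
      (isOrthantal_cone T.stDGraph).mem_relint_iff
    ext y
    rw [h1]
    constructor
    · rintro ⟨x, hx, rfl⟩ k
      rw [(isOrthantal_ST T).mem_relint_iff] at hx
      rcases T.edge_cases k with ⟨e, rfl⟩ | ⟨i, rfl⟩
      · rw [T.crd_st_oldEdge]; exact hx _
      · rw [T.crd_st_newEdge]; exact hx _
    · intro hy
      refine ⟨ofCrd (stBasis T) (Sum.elim (fun e => crd (coneBasis T.stDGraph) (T.oldEdge e) y)
        fun i => crd (coneBasis T.stDGraph) (T.newEdge i) y), ?_, ?_⟩
      · rw [(isOrthantal_ST T).mem_relint_iff]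
        rintro (e | i) <;> rw [crd_ofCrd] <;> exact hy _
      · refine crd_ext (coneBasis T.stDGraph) fun k => ?_
        rcases T.edge_cases k with ⟨e, rfl⟩ | ⟨i, rfl⟩
        · rw [T.crd_st_oldEdge, crd_ofCrd]; rfl
        · rw [T.crd_st_newEdge, crd_ofCrd]; rfl
  lift := by
    rintro ⟨T⟩ ⟨G⟩ f
    obtain ⟨T₁, h, e, he, huniq⟩ := Gr.exists_lift T G f.unop
    refine ⟨.op T₁, h.op, e.op.symm, Quiver.Hom.unop_inj he, ?_⟩
    rintro ⟨T₂⟩ h' e' he'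
    have h2 := huniq T₂ h'.unop e'.unop.symm (congrArg Quiver.Hom.unop he')
    obtain ⟨k, hk1, hk2⟩ := h2
    exact ⟨k.op.symm, Quiver.Hom.unop_inj hk1, Quiver.Hom.unop_inj hk2⟩

/-! ### Expanding a vertex of a tree -/

namespace DGraph

variable {G : DGraph}

open Classical in
/-- The graph obtained from `G` by splitting the vertex `v`: the flags in `X` are moved to a new
vertex `inr none`, which is joined to `v` by a new edge with the half-edges `inr (some true)` at the
new vertex and `inr (some false)` at `v`. -/
def expand (G : DGraph) {v : G.F} (hv : v ∈ G.V) {X : Set G.F} (hX : X ⊆ G.flagsAt v) : DGraph where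
  F := G.F ⊕ Option Bool
  r
    | .inl x => if x ∈ X then .inr none else .inl (G.r x)
    | .inr none => .inr none
    | .inr (some true) => .inr none
    | .inr (some false) => .inl v
  ι
    | .inl x => .inl (G.ι x)
    | .inr none => .inr none
    | .inr (some b) => .inr (some !b)
  r_r
    | .inl x => by
      have h : G.r x ∉ X := fun h => (hX h).2 (r_mem_V x)
      by_cases hx : x ∈ X <;> simp [hx, h, G.r_r]
    | .inr none => rfl
    | .inr (some true) => rfl
    | .inr (some false) => by
      have h : v ∉ X := fun h => (hX h).2 hv
      simp [h, mem_V.1 hv]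
  ι_ι
    | .inl x => by simp [G.ι_ι]
    | .inr none => rfl
    | .inr (some b) => by simp
  ι_r
    | .inl x => by by_cases hx : x ∈ X <;> simp [hx, G.ι_r]
    | .inr none => rfl
    | .inr (some true) => rfl
    | .inr (some false) => by simp [ι_of_mem_V hv]

section expand

variable {v : G.F} (hv : v ∈ G.V) {X : Set G.F} (hX : X ⊆ G.flagsAt v)

lemma expand_r_of_mem {x : G.F} (hx : x ∈ X) : (G.expand hv hX).r (.inl x) = .inr none :=
  if_pos hx

lemma expand_r_of_notMem {x : G.F} (hx : x ∉ X) : (G.expand hv hX).r (.inl x) = .inl (G.r x) :=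
  if_neg hx

lemma expand_ι_inl (x : G.F) : (G.expand hv hX).ι (.inl x) = .inl (G.ι x) := rfl

lemma inr_none_mem_V : .inr none ∈ (G.expand hv hX).V := ⟨.inr none, rfl⟩

lemma inl_mem_V {w : G.F} (hw : w ∈ G.V) : .inl w ∈ (G.expand hv hX).V := by
  refine ⟨.inl w, ?_⟩
  rw [expand_r_of_notMem hv hX fun h => (hX h).2 hw, mem_V.1 hw]

lemma inr_some_notMem_V (b : Bool) : .inr (some b) ∉ (G.expand hv hX).V := by
  refine notMem_V_of_ι_ne fun h => ?_
  have : (!b) = b := Option.some_injective _ (Sum.inr_injective h)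
  cases b <;> cases this

lemma inl_mem_V_iff {w : G.F} : .inl w ∈ (G.expand hv hX).V ↔ w ∈ G.V := by
  refine ⟨fun h => ?_, inl_mem_V hv hX⟩
  have h1 := mem_V.1 h
  by_cases hw : w ∈ X
  · rw [expand_r_of_mem hv hX hw] at h1; cases h1
  · rw [expand_r_of_notMem hv hX hw] at h1
    exact mem_V.2 (Sum.inl_injective h1)

/-- The contraction of the new edge. -/
def expandMap : (G.expand hv hX).F → G.F := Sum.elim id fun _ => v

lemma expandMap_isContraction :
    IsContraction (G := G.expand hv hX) (H := G) (expandMap hv hX) where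
  r
    | .inl x => by
      by_cases hx : x ∈ X
      · rw [expand_r_of_mem hv hX hx]; exact (hX hx).1.symm
      · rw [expand_r_of_notMem hv hX hx]; rfl
    | .inr none => (mem_V.1 hv).symm
    | .inr (some true) => (mem_V.1 hv).symm
    | .inr (some false) => (mem_V.1 hv).symm
  ι
    | .inl x => rfl
    | .inr none => (ι_of_mem_V hv).symm
    | .inr (some b) => (ι_of_mem_V hv).symm
  tree w hw := by
    have h0 := isLeglessTree_singleton (inl_mem_V hv hX hw)
    by_cases hwv : w = v
    · subst hwv
      convert h0.extend (x := (.inr (some false) : G.F ⊕ Option Bool)) rfl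
        (fun h : (.inr none : G.F ⊕ Option Bool) = .inl w => by cases h) using 1
      ext x
      rcases x with x | _ | _ | _
      · constructor
        · exact fun h => Or.inl (congrArg Sum.inl h)
        · rintro (h | h | h | h)
          · exact Sum.inl_injective h
          all_goals cases h
      · exact ⟨fun _ => Or.inr (Or.inr (Or.inr rfl)), fun _ => rfl⟩
      · exact ⟨fun _ => Or.inr (Or.inl rfl), fun _ => rfl⟩
      · exact ⟨fun _ => Or.inr (Or.inr (Or.inl rfl)), fun _ => rfl⟩
    · convert h0 using 1
      ext x
      rcases x with x | x
      · exact ⟨fun h => congrArg Sum.inl h, fun h => Sum.inl_injective h⟩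
      · exact ⟨fun h => absurd h.symm hwv, fun h => by cases h⟩
  unique y hy := by
    refine ⟨.inl y, rfl, ?_⟩
    rintro (x | x) hx
    · exact congrArg Sum.inl hx
    · exact absurd ((hx : v = y) ▸ hv) hy

lemma flagsAt_inr_none :
    (G.expand hv hX).flagsAt (.inr none) = insert (.inr (some true)) (Sum.inl '' X) := by
  ext x
  rcases x with x | _ | _ | _
  · constructor
    · rintro ⟨h1, -⟩
      by_cases hx : x ∈ X
      · exact Or.inr ⟨x, hx, rfl⟩
      · rw [expand_r_of_notMem hv hX hx] at h1; cases h1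
    · rintro (h | ⟨y, hy, h⟩)
      · cases h
      · cases h
        exact ⟨expand_r_of_mem hv hX hy, fun h => (hX hy).2 ((inl_mem_V_iff hv hX).1 h)⟩
  · constructor
    · exact fun h => absurd (inr_none_mem_V hv hX) h.2
    · rintro (h | ⟨y, hy, h⟩) <;> cases h
  · constructor
    · rintro ⟨h, -⟩; cases h
    · rintro (h | ⟨y, hy, h⟩) <;> cases h
  · exact ⟨fun _ => Or.inl rfl, fun _ => ⟨rfl, inr_some_notMem_V hv hX _⟩⟩

lemma flagsAt_inl_self :
    (G.expand hv hX).flagsAt (.inl v) =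
      insert (.inr (some false)) (Sum.inl '' (G.flagsAt v \ X)) := by
  ext x
  rcases x with x | _ | _ | _
  · constructor
    · rintro ⟨h1, h2⟩
      by_cases hx : x ∈ X
      · rw [expand_r_of_mem hv hX hx] at h1; cases h1
      · rw [expand_r_of_notMem hv hX hx] at h1
        rw [inl_mem_V_iff] at h2
        exact Or.inr ⟨x, ⟨⟨Sum.inl_injective h1, h2⟩, hx⟩, rfl⟩
    · rintro (h | ⟨y, ⟨hy, hyX⟩, h⟩)
      · cases h
      · cases h
        refine ⟨?_, fun h => hy.2 ((inl_mem_V_iff hv hX).1 h)⟩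
        rw [expand_r_of_notMem hv hX hyX, hy.1]
  · constructor
    · exact fun h => absurd (inr_none_mem_V hv hX) h.2
    · rintro (h | ⟨y, hy, h⟩) <;> cases h
  · exact ⟨fun _ => Or.inl rfl, fun _ => ⟨rfl, inr_some_notMem_V hv hX _⟩⟩
  · constructor
    · rintro ⟨h, -⟩; cases h
    · rintro (h | ⟨y, hy, h⟩) <;> cases h

lemma flagsAt_inl {w : G.F} (hw : w ≠ v) :
    (G.expand hv hX).flagsAt (.inl w) = Sum.inl '' G.flagsAt w := by
  ext x
  rcases x with x | _ | _ | _
  · constructor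
    · rintro ⟨h1, h2⟩
      by_cases hx : x ∈ X
      · rw [expand_r_of_mem hv hX hx] at h1; cases h1
      · rw [expand_r_of_notMem hv hX hx] at h1
        rw [inl_mem_V_iff] at h2
        exact ⟨x, ⟨Sum.inl_injective h1, h2⟩, rfl⟩
    · rintro ⟨y, hy, h⟩
      cases h
      have hyX : x ∉ X := fun h => hw (hy.1.symm.trans (hX h).1)
      refine ⟨?_, fun h => hy.2 ((inl_mem_V_iff hv hX).1 h)⟩
      rw [expand_r_of_notMem hv hX hyX, hy.1]
  · constructor
    · exact fun h => absurd (inr_none_mem_V hv hX) h.2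
    · rintro ⟨y, hy, h⟩; cases h
  · constructor
    · rintro ⟨h, -⟩; exact absurd (Sum.inl_injective h).symm hw
    · rintro ⟨y, hy, h⟩; cases h
  · constructor
    · rintro ⟨h, -⟩; cases h
    · rintro ⟨y, hy, h⟩; cases h

lemma val_inr_none : (G.expand hv hX).val (.inr none) = X.ncard + 1 := by
  rw [← ncard_flagsAt (inr_none_mem_V hv hX), flagsAt_inr_none]
  refine (Set.ncard_insert_of_notMem ?_ (Set.toFinite _)).trans ?_
  · rintro ⟨y, -, h⟩; cases h
  · exact congrArg (· + 1) (Set.ncard_image_of_injective X Sum.inl_injective)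

lemma val_inl_self : (G.expand hv hX).val (.inl v) + X.ncard = G.val v + 1 := by
  rw [← ncard_flagsAt (inl_mem_V hv hX hv), flagsAt_inl_self]
  refine (congrArg (· + X.ncard) (Set.ncard_insert_of_notMem ?_ (Set.toFinite _))).trans ?_
  · rintro ⟨y, -, h⟩; cases h
  · have h1 := Set.ncard_image_of_injective (G.flagsAt v \ X)
      (Sum.inl_injective (α := G.F) (β := Option Bool))
    have h2 := Set.ncard_sdiff_add_ncard_of_subset hX
    rw [ncard_flagsAt hv] at h2
    change (Sum.inl '' (G.flagsAt v \ X) : Set (G.F ⊕ Option Bool)).ncard + 1 + X.ncard = _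
    omega

lemma val_inl {w : G.F} (hw : w ∈ G.V) (hwv : w ≠ v) :
    (G.expand hv hX).val (.inl w) = G.val w := by
  rw [← ncard_flagsAt (inl_mem_V hv hX hw), flagsAt_inl hv hX hwv]
  exact (Set.ncard_image_of_injective _ Sum.inl_injective).trans (ncard_flagsAt hw)

end expand

/-- In a connected graph `K`, a part `S` that is connected with the rest only by the edge of `h` is
connected. -/
lemma joined_part {K S : Set G.F} {h : G.F} (hKι : ∀ x ∈ K, G.ι x ∈ K)
    (hK : ∀ x ∈ K, x ≠ h → x ≠ G.ι h → (G.r x ∈ S ↔ x ∈ S))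
    (hι : ∀ x ∈ S, G.ι x ∈ S) (hh : G.r h ∈ S) (hh' : G.r (G.ι h) ∉ S)
    (hr : ∀ x ∈ S, G.r x ∈ S) {a b : G.F} (ha : a ∈ S) (hb : b ∈ S) (hj : G.Joined K a b) :
    G.Joined S a b := by
  suffices h : ∀ w, G.Joined K a w →
      (w ∈ S → G.Joined S a w) ∧ (w ∉ S → G.Joined S a (G.r h)) from (h b hj).1 hb
  intro w hw
  induction hw with
  | refl => exact ⟨fun _ => Relation.ReflTransGen.refl, fun h => absurd ha h⟩
  | tail _ hbc ih =>
    obtain ⟨x, hx, rfl, rfl⟩ := hbc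
    by_cases hxh : x = h
    · subst hxh
      exact ⟨fun h => absurd h hh', fun _ => ih.1 hh⟩
    by_cases hxh' : x = G.ι h
    · subst hxh'
      rw [G.ι_ι]
      exact ⟨fun _ => ih.2 hh', fun h => absurd hh h⟩
    by_cases hxS : x ∈ S
    · refine ⟨fun _ => (ih.1 (hr x hxS)).tail ⟨x, hxS, rfl, rfl⟩, fun h => absurd ?_ h⟩
      exact hr _ (hι x hxS)
    · have h1 : G.r x ∉ S := fun h => hxS ((hK x hx hxh hxh').1 h)
      refine ⟨fun h2 => ?_, fun _ => ih.2 h1⟩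
      have h3 := (hK (G.ι x) (hKι x hx) (fun h => hxh' (by rw [← h, G.ι_ι]))
        fun h => hxh (by rw [← G.ι_ι x, h, G.ι_ι])).1 h2
      have h4 := hι _ h3
      rw [G.ι_ι] at h4
      exact absurd h4 hxS

section lift

variable {R T : DGraph} {f : R.F → T.F} (hf : IsContraction f) {v : T.F} (hv : v ∈ T.V)
  {X : Set T.F} (hX : X ⊆ T.flagsAt v)

/-- One side of the half-edge `h` in the inverse image of the vertex `v` under the contraction `f`,
which meets the other flags at `v` in `X`. -/
structure IsSide (f : R.F → T.F) (v : T.F) (X : Set T.F) (h : R.F) (S : Set R.F) : Prop where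
  ne : R.ι h ≠ h
  map : f h = v
  mapS : ∀ x ∈ S, f x = v
  notMem : h ∉ S
  notMem' : R.ι h ∉ S
  r : ∀ x, f x = v → x ≠ h → x ≠ R.ι h → (R.r x ∈ S ↔ x ∈ S)
  ι : ∀ x ∈ S, R.ι x ∈ S
  r_mem : R.r h ∈ S
  r_notMem : R.r (R.ι h) ∉ S
  mem : ∀ x, f x ∈ T.flagsAt v → (f x ∈ X ↔ R.r x ∈ S)

variable {h : R.F} {S : Set R.F}

open Classical in
/-- The map to the graph in which the edge of `h` is not contracted. -/
def sideMap (f : R.F → T.F) (h : R.F) (S : Set R.F) (x : R.F) : T.F ⊕ Option Bool :=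
  if x = h then .inr (some true) else if x = R.ι h then .inr (some false) else
    if x ∈ S then .inr none else .inl (f x)

lemma sideMap_self : sideMap f h S h = .inr (some true) := if_pos rfl

lemma sideMap_other {x : R.F} (h1 : x ≠ h) (h2 : x ≠ R.ι h) (hx : x ∉ S) :
    sideMap f h S x = .inl (f x) := by
  rw [sideMap, if_neg h1, if_neg h2, if_neg hx]

lemma side_cases (h : R.F) (S : Set R.F) (x : R.F) :
    x = h ∨ x = R.ι h ∨ x ∈ S ∨ (x ≠ h ∧ x ≠ R.ι h ∧ x ∉ S) := by
  tauto

namespace IsSide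

variable (hS : IsSide f v X h S)
include hS

lemma sideMap_ι : sideMap f h S (R.ι h) = .inr (some false) := by
  rw [sideMap, if_neg hS.ne, if_pos rfl]

lemma sideMap_mem {x : R.F} (hx : x ∈ S) : sideMap f h S x = .inr none := by
  have h1 : x ≠ h := fun h => hS.notMem (h ▸ hx)
  have h2 : x ≠ R.ι h := fun h => hS.notMem' (h ▸ hx)
  rw [sideMap, if_neg h1, if_neg h2, if_pos hx]

lemma isSubgraph_fibre : R.IsSubgraph S := fun x hx =>
  ⟨(hS.r x (hS.mapS x hx) (fun h => hS.notMem (h ▸ hx)) fun h => hS.notMem' (h ▸ hx)).2 hx,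
    hS.ι x hx⟩

include hf hv in
/-- The other side is a side of the opposite half-edge. -/
lemma compl : IsSide f v (T.flagsAt v \ X) (R.ι h) (f ⁻¹' {v} \ (S ∪ {h, R.ι h})) where
  ne := by rw [R.ι_ι]; exact hS.ne.symm
  map := by rw [hf.ι, hS.map, ι_of_mem_V hv]
  mapS x hx := hx.1
  notMem h := h.2 (Or.inr (Or.inr rfl))
  notMem' h := h.2 (Or.inr (Or.inl (R.ι_ι _)))
  r x hx h1 h2 := by
    rw [R.ι_ι] at h2
    have h3 := hS.r x hx h2 h1
    have h4 : R.r x ∉ ({h, R.ι h} : Set R.F) := by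
      rintro (h | h)
      · exact notMem_V_of_ι_ne hS.ne (h ▸ r_mem_V x)
      · exact notMem_V_of_ι_ne hS.ne (ι_mem_V.1 ((h : R.r x = _) ▸ r_mem_V x))
    have h5 : f (R.r x) = v := by rw [hf.r, hx, mem_V.1 hv]
    constructor
    · rintro ⟨-, h6⟩
      refine ⟨hx, ?_⟩
      rintro (h7 | h7 | h7)
      exacts [h6 (Or.inl (h3.2 h7)), h2 h7, h1 h7]
    · rintro ⟨-, h6⟩
      refine ⟨h5, ?_⟩
      rintro (h7 | h7)
      exacts [h6 (Or.inl (h3.1 h7)), h4 h7]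
  ι x hx := by
    refine ⟨?_, ?_⟩
    · have : f x = v := hx.1
      change f (R.ι x) = v
      rw [hf.ι, this, ι_of_mem_V hv]
    · rintro (h1 | h1 | h1)
      · have := hS.ι _ h1
        rw [R.ι_ι] at this
        exact hx.2 (Or.inl this)
      · exact hx.2 (Or.inr (Or.inr (by rw [← h1, R.ι_ι]; rfl)))
      · exact hx.2 (Or.inr (Or.inl (by rw [← R.ι_ι x, h1, R.ι_ι])))
  r_mem := by
    refine ⟨?_, ?_⟩
    · change f _ = v
      rw [hf.r, hf.ι, hS.map, ι_of_mem_V hv, mem_V.1 hv]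
    · rintro (h1 | h1 | h1)
      · exact hS.r_notMem h1
      · exact notMem_V_of_ι_ne hS.ne (h1 ▸ r_mem_V _)
      · exact notMem_V_of_ι_ne hS.ne (ι_mem_V.1 ((h1 : R.r (R.ι h) = _) ▸ r_mem_V _))
  r_notMem h1 := by
    rw [R.ι_ι] at h1
    exact h1.2 (Or.inl hS.r_mem)
  mem x hx := by
    have h1 := hS.mem x hx
    have h2 : R.r x ∉ ({h, R.ι h} : Set R.F) := by
      rintro (h | h)
      · exact notMem_V_of_ι_ne hS.ne (h ▸ r_mem_V x)
      · exact notMem_V_of_ι_ne hS.ne (ι_mem_V.1 ((h : R.r x = _) ▸ r_mem_V x))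
    have h5 : f (R.r x) = v := by rw [hf.r, hx.1]
    constructor
    · rintro ⟨-, h3⟩
      refine ⟨h5, ?_⟩
      rintro (h4 | h4)
      exacts [h3 (h1.2 h4), h2 h4]
    · exact fun h3 => ⟨hx, fun h4 => h3.2 (Or.inl (h1.1 h4))⟩

include hf hv in
lemma isLeglessTree (hR : R.IsConnOfGenus 0 Set.univ) : R.IsLeglessTree S := by
  have hK := hf.tree v hv
  refine ⟨tree_of_conn hR hS.isSubgraph_fibre ⟨⟨_, hS.r_mem, r_mem_V _⟩, fun a ha b hb => ?_⟩,
    Set.disjoint_left.2 fun x hx => Set.disjoint_left.1 hK.2 (hS.mapS x hx)⟩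
  refine joined_part (K := f ⁻¹' {v}) (fun x hx => (hK.1.1 x hx).2) (fun x hx => hS.r x hx) hS.ι
    hS.r_mem hS.r_notMem (fun x hx => (hS.isSubgraph_fibre x hx).1) ha.1 hb.1 ?_
  exact hK.1.2.1.2 a ⟨hS.mapS a ha.1, ha.2⟩ b ⟨hS.mapS b hb.1, hb.2⟩

include hf in
lemma sideMap_isContraction (hR : R.IsConnOfGenus 0 Set.univ) :
    IsContraction (G := R) (H := T.expand hv hX) (sideMap f h S) where
  r x := by
    have hV : ∀ x, R.r x ≠ h ∧ R.r x ≠ R.ι h := fun x =>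
      ⟨fun h => notMem_V_of_ι_ne hS.ne (h ▸ r_mem_V x),
        fun h => notMem_V_of_ι_ne hS.ne (ι_mem_V.1 (h ▸ r_mem_V x))⟩
    rcases side_cases h S x with rfl | rfl | hx | ⟨h1, h2, hx⟩
    · rw [sideMap_self, hS.sideMap_mem hS.r_mem]; rfl
    · rw [hS.sideMap_ι, sideMap_other (hV _).1 (hV _).2 hS.r_notMem, hf.r, hf.ι, hS.map,
        ι_of_mem_V hv, mem_V.1 hv]
      rfl
    · rw [hS.sideMap_mem hx, hS.sideMap_mem (hS.isSubgraph_fibre x hx).1]; rfl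
    · rw [sideMap_other h1 h2 hx]
      by_cases hxX : f x ∈ X
      · rw [expand_r_of_mem hv hX hxX, hS.sideMap_mem ((hS.mem x (hX hxX)).1 hxX)]
      · have h3 : R.r x ∉ S := by
          intro h3
          have h4 : T.r (f x) = v := by rw [← hf.r]; exact hS.mapS _ h3
          by_cases h5 : f x ∈ T.V
          · exact hx ((hS.r x ((mem_V.1 h5).symm.trans h4) h1 h2).1 h3)
          · exact hxX ((hS.mem x ⟨h4, h5⟩).2 h3)
        rw [expand_r_of_notMem hv hX hxX, sideMap_other (hV _).1 (hV _).2 h3, hf.r]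
  ι x := by
    rcases side_cases h S x with rfl | rfl | hx | ⟨h1, h2, hx⟩
    · rw [sideMap_self, hS.sideMap_ι]; rfl
    · rw [hS.sideMap_ι, R.ι_ι, sideMap_self]; rfl
    · rw [hS.sideMap_mem hx, hS.sideMap_mem (hS.ι x hx)]; rfl
    · have h3 : R.ι x ∉ S := fun h => hx (by rw [← R.ι_ι x]; exact hS.ι _ h)
      rw [sideMap_other h1 h2 hx, expand_ι_inl, ← hf.ι, sideMap_other _ _ h3]
      · exact fun h => h2 (by rw [← h, R.ι_ι])
      · exact fun h => h1 (by rw [← R.ι_ι x, h, R.ι_ι])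
  tree := by
    have hιh : f (R.ι h) = v := by rw [hf.ι, hS.map, ι_of_mem_V hv]
    rintro (w | _ | b) hw
    · rw [inl_mem_V_iff] at hw
      by_cases hwv : w = v
      · convert (hS.compl hf hv).isLeglessTree hf hv hR using 1
        ext x
        rcases side_cases h S x with rfl | rfl | hx | ⟨h1, h2, hx⟩
        · refine iff_of_false (fun h => ?_) fun h => h.2 (Or.inr (Or.inl rfl))
          cases sideMap_self.symm.trans h
        · refine iff_of_false (fun h => ?_) fun h => h.2 (Or.inr (Or.inr rfl))
          cases (hS.sideMap_ι).symm.trans h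
        · refine iff_of_false (fun h => ?_) fun h => h.2 (Or.inl hx)
          cases (hS.sideMap_mem hx).symm.trans h
        · have h3 := sideMap_other (f := f) h1 h2 hx
          refine ⟨fun h => ⟨(Sum.inl_injective (h3.symm.trans h)).trans hwv, ?_⟩,
            fun h => h3.trans (congrArg Sum.inl ((h.1 : f x = v).trans hwv.symm))⟩
          rintro (h | h | h)
          exacts [hx h, h1 h, h2 h]
      · convert hf.tree w hw using 1
        ext x
        rcases side_cases h S x with rfl | rfl | hx | ⟨h1, h2, hx⟩
        · refine iff_of_false (fun h => ?_) fun h => hwv (h.symm.trans hS.map)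
          cases sideMap_self.symm.trans h
        · refine iff_of_false (fun h => ?_) fun h => hwv (h.symm.trans hιh)
          cases (hS.sideMap_ι).symm.trans h
        · refine iff_of_false (fun h => ?_) fun h => hwv (h.symm.trans (hS.mapS x hx))
          cases (hS.sideMap_mem hx).symm.trans h
        · have h3 := sideMap_other (f := f) h1 h2 hx
          exact ⟨fun h => Sum.inl_injective (h3.symm.trans h),
            fun h => h3.trans (congrArg Sum.inl h)⟩
    · convert hS.isLeglessTree hf hv hR using 1
      ext x
      rcases side_cases h S x with rfl | rfl | hx | ⟨h1, h2, hx⟩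
      · refine iff_of_false (fun h => ?_) hS.notMem
        cases sideMap_self.symm.trans h
      · refine iff_of_false (fun h => ?_) hS.notMem'
        cases (hS.sideMap_ι).symm.trans h
      · exact iff_of_true (hS.sideMap_mem hx) hx
      · refine iff_of_false (fun h => ?_) hx
        cases (sideMap_other h1 h2 hx).symm.trans h
    · exact absurd hw (inr_some_notMem_V hv hX b)
  unique := by
    have hιh : f (R.ι h) = v := by rw [hf.ι, hS.map, ι_of_mem_V hv]
    rintro (y | _ | _ | _) hy
    · rw [inl_mem_V_iff] at hy
      obtain ⟨x, rfl, hu⟩ := hf.unique y hy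
      have hne : ∀ z, f z = v → x ≠ z := by rintro z hz rfl; exact hy (hz ▸ hv)
      refine ⟨x, sideMap_other (hne _ hS.map) (hne _ hιh) fun h => hne x (hS.mapS x h) rfl, ?_⟩
      intro z hz
      rcases side_cases h S z with rfl | rfl | hz' | ⟨h1, h2, hz'⟩
      · cases (sideMap_self).symm.trans hz
      · cases (hS.sideMap_ι).symm.trans hz
      · cases (hS.sideMap_mem hz').symm.trans hz
      · rw [sideMap_other h1 h2 hz'] at hz
        exact hu z (Sum.inl_injective hz)
    · exact absurd (inr_none_mem_V hv hX) hy
    · refine ⟨R.ι h, hS.sideMap_ι, fun z hz => ?_⟩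
      rcases side_cases h S z with rfl | rfl | hz' | ⟨h1, h2, hz'⟩
      · cases (sideMap_self).symm.trans hz
      · rfl
      · cases (hS.sideMap_mem hz').symm.trans hz
      · cases (sideMap_other h1 h2 hz').symm.trans hz
    · refine ⟨h, sideMap_self, fun z hz => ?_⟩
      rcases side_cases h S z with rfl | rfl | hz' | ⟨h1, h2, hz'⟩
      · rfl
      · cases (hS.sideMap_ι).symm.trans hz
      · cases (hS.sideMap_mem hz').symm.trans hz
      · cases (sideMap_other h1 h2 hz').symm.trans hz

end IsSide

include hf hv in
/-- Every contracted half-edge `h` over a vertex `v` divides the fibre and hence the flags at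
`v`. -/
lemma exists_isSide (hR : R.IsConnOfGenus 0 Set.univ) (hh : R.ι h ≠ h) (hfh : f h = v) :
    ∃ X ⊆ T.flagsAt v, ∃ S, IsSide f v X h S := by
  set K : Set R.F := f ⁻¹' {v} \ {h, R.ι h} with hK
  have hfι : ∀ x, f x = v → f (R.ι x) = v := fun x hx => by rw [hf.ι, hx, ι_of_mem_V hv]
  have hfr : ∀ x, f x = v → f (R.r x) = v := fun x hx => by rw [hf.r, hx, mem_V.1 hv]
  have hKsub : R.IsSubgraph K := by
    rintro x ⟨hx, hx'⟩
    have h1 := Gr.isSubgraph_compl R (edgeOf h hh) x hx'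
    exact ⟨⟨hfr x hx, h1.1⟩, ⟨hfι x hx, h1.2⟩⟩
  set S : Set R.F := {x ∈ K | R.Joined K (R.r h) (R.r x)} with hSdef
  have hrK : ∀ x, f x = v → R.r x ∈ K := fun x hx => ⟨hfr x hx, by
    rintro (h | h)
    · exact notMem_V_of_ι_ne hh (h ▸ r_mem_V x)
    · exact notMem_V_of_ι_ne hh (ι_mem_V.1 ((h : R.r x = _) ▸ r_mem_V x))⟩
  refine ⟨{y ∈ T.flagsAt v | ∃ x, f x = y ∧ R.r x ∈ S}, fun y hy => hy.1, S, hh, hfh,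
    fun x hx => hx.1.1, fun h => h.1.2 (Or.inl rfl), fun h => h.1.2 (Or.inr rfl),
    fun x hx h1 h2 => ?_, fun x hx => ?_, ?_, ?_, fun x hx => ?_⟩
  · have h3 : x ∈ K := ⟨hx, by rintro (h | h); exacts [h1 h, h2 h]⟩
    constructor
    · rintro ⟨-, h⟩
      rw [R.r_r] at h
      exact ⟨h3, h⟩
    · rintro ⟨-, h⟩
      exact ⟨hrK x hx, by rwa [R.r_r]⟩
  · exact ⟨(hKsub x hx.1).2, hx.2.tail ⟨x, hx.1, rfl, rfl⟩⟩
  · exact ⟨hrK h hfh, by rw [R.r_r]; exact Relation.ReflTransGen.refl⟩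
  · rintro ⟨-, h1⟩
    rw [R.r_r] at h1
    exact not_joined_compl hR hh (h1.mono fun x hx => hx.2)
  · constructor
    · rintro ⟨-, z, hz, hzS⟩
      rwa [← (hf.unique _ hx.2).unique hz rfl]
    · exact fun h => ⟨hx, x, rfl, h⟩

end lift

end DGraph

namespace Gr

variable {g : ℕ} {B : Type}

/-- The stable graph obtained by splitting a vertex. -/
def expand (T : Gr g B) {v : T.F} (hv : v ∈ T.V) {X : Set T.F} (hX : X ⊆ T.toDGraph.flagsAt v)
    (h2 : 2 ≤ X.ncard) (h2' : X.ncard + 2 ≤ T.val v) : Gr g B where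
  toDGraph := T.toDGraph.expand hv hX
  leg b := .inl (T.leg b)
  leg_injective := Sum.inl_injective.comp T.leg_injective
  leg_range := by
    ext x
    have hc := DGraph.expandMap_isContraction hv hX
    rw [← hc.legs_image, ← T.leg_range]
    constructor
    · rintro ⟨b, rfl⟩; exact ⟨b, rfl⟩
    · rintro ⟨b, hb⟩
      have h1 : DGraph.expandMap hv hX (.inl (T.leg b)) = T.leg b := rfl
      exact ⟨b, (hc.unique _ (leg_mem b).1).unique h1 hb.symm⟩
  genus := ((DGraph.expandMap_isContraction hv hX).genus_iff g).2 T.genus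
  stable := by
    rintro (w | _ | b) hw
    · rw [DGraph.inl_mem_V_iff] at hw
      by_cases hwv : w = v
      · subst hwv
        have := DGraph.val_inl_self hv hX
        omega
      · rw [DGraph.val_inl hv hX hw hwv]
        exact T.stable w hw
    · rw [DGraph.val_inr_none]; omega
    · exact absurd hw (DGraph.inr_some_notMem_V hv hX b)

/-- The contraction of the new edge. -/
def expandHom (T : Gr g B) {v : T.F} (hv : v ∈ T.V) {X : Set T.F} (hX : X ⊆ T.toDGraph.flagsAt v)
    (h2 : 2 ≤ X.ncard) (h2' : X.ncard + 2 ≤ T.val v) : T.expand hv hX h2 h2' ⟶ T :=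
  (⟨DGraph.expandMap hv hX, DGraph.expandMap_isContraction hv hX, fun _ => rfl⟩ :
    Hom (T.expand hv hX h2 h2') T)

/-- A contraction onto `T` under which the half-edge `h` is contracted to `v` factors through the
tree obtained by splitting off at `v` the flags that are on the side of `h`. -/
lemma IsSide.exists_hom {R T : Gr 0 B} (f : R ⟶ T) {v : T.F} (hv : v ∈ T.V) {X : Set T.F}
    (hX : X ⊆ T.toDGraph.flagsAt v) (h2 : 2 ≤ X.ncard) (h2' : X.ncard + 2 ≤ T.val v) {h : R.F}
    {S : Set R.F} (hS : DGraph.IsSide f.toFun v X h S) :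
    ∃ k : R ⟶ T.expand hv hX h2 h2', k.toFun = DGraph.sideMap f.toFun h S := by
  refine ⟨(⟨DGraph.sideMap f.toFun h S, hS.sideMap_isContraction f.isContraction hv hX R.genus,
    fun b => ?_⟩ : Hom R (T.expand hv hX h2 h2')), rfl⟩
  have h1 : R.leg b ≠ h := fun h => hS.ne (h ▸ R.ι_leg b)
  have h3 : R.leg b ≠ R.ι h := fun h => h1 (by rw [← R.ι_leg b, h, R.ι_ι])
  refine (DGraph.sideMap_other h1 h3 fun h => ?_).trans (congrArg Sum.inl (f.leg b))
  have := hS.mapS _ h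
  rw [f.leg] at this
  exact (leg_mem b).1 (this ▸ hv)

/-- The splitting of a vertex that is induced by a contracted half-edge is stable. -/
lemma IsSide.two_le {R T : Gr 0 B} (f : R ⟶ T) {v : T.F} (hv : v ∈ T.V) {X : Set T.F}
    (hX : X ⊆ T.toDGraph.flagsAt v) {h : R.F} {S : Set R.F}
    (hS : DGraph.IsSide f.toFun v X h S) : 2 ≤ X.ncard ∧ X.ncard + 2 ≤ T.val v := by
  have h1 := (hS.sideMap_isContraction f.isContraction hv hX R.genus).stable R.stable
  have h3 := h1 _ (DGraph.inr_none_mem_V hv hX)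
  have h4 := h1 _ (DGraph.inl_mem_V hv hX hv)
  rw [DGraph.val_inr_none] at h3
  have := DGraph.val_inl_self hv hX
  omega

end Gr

/-! ### The cells of a subdivision -/

namespace Poic

section IsCone

variable {V W : Type*} [AddCommGroup V] [Module ℝ V] [AddCommGroup W] [Module ℝ W]

/-- A convex cone, which need not contain the origin. -/
structure IsCone (K : Set V) : Prop where
  add : ∀ {x y}, x ∈ K → y ∈ K → x + y ∈ K
  smul : ∀ {x} {a : ℝ}, 0 < a → x ∈ K → a • x ∈ K

lemma IsCone.image {K : Set V} (hK : IsCone K) (L : V →ₗ[ℝ] W) : IsCone (L '' K) where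
  add := by
    rintro _ _ ⟨x, hx, rfl⟩ ⟨y, hy, rfl⟩
    exact ⟨x + y, hK.add hx hy, map_add _ _ _⟩
  smul := by
    rintro _ a ha ⟨x, hx, rfl⟩
    exact ⟨a • x, hK.smul ha hx, map_smul _ _ _⟩

lemma isCone_carrier (σ : Poic) : IsCone σ.carrier where
  add := σ.add_mem
  smul ha hx := σ.smul_mem hx ha

variable {K D : Set V}

/-- A direction in which `K` recedes is a direction in which its relative interior recedes. -/
lemma ri_add_recession {x v : V} (hx : x ∈ ri K)
    (hv : ∀ z ∈ K, ∀ ε : ℝ, 0 < ε → z + ε • v ∈ K) : x + v ∈ ri K := by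
  refine ⟨by simpa using hv x hx.1 1 one_pos, fun z hz => ?_⟩
  obtain ⟨ε, h0, h⟩ := hx.2 z hz
  refine ⟨ε, h0, ?_⟩
  have := hv _ h (1 + ε) (by linarith)
  convert this using 1
  module

variable (hK : IsCone K)
include hK

lemma IsCone.ri_add {x y : V} (hx : x ∈ ri K) (hy : y ∈ K) : x + y ∈ ri K :=
  ri_add_recession hx fun _ hz _ hε => hK.add hz (hK.smul hε hy)

lemma IsCone.ri_smul {x : V} {a : ℝ} (ha : 0 < a) (hx : x ∈ ri K) : a • x ∈ ri K := by
  refine ⟨hK.smul ha hx.1, fun z hz => ?_⟩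
  obtain ⟨ε, h0, h⟩ := hx.2 (a⁻¹ • z) (hK.smul (inv_pos.2 ha) hz)
  refine ⟨ε, h0, ?_⟩
  have := hK.smul ha h
  convert this using 1
  have h1 : a * a⁻¹ = 1 := mul_inv_cancel₀ ha.ne'
  have h2 : a • a⁻¹ • z = z := by rw [smul_smul, h1, one_smul]
  conv_lhs => rw [← h2]
  module

lemma IsCone.ri_isCone : IsCone (ri K) where
  add hx hy := hK.ri_add hx hy.1
  smul := hK.ri_smul

/-- The part of a subcone in the relative interior of a cone has the relative interior of the
subcone. -/
lemma IsCone.ri_inter_ri (hD : IsCone D) (hKD : K ⊆ D) (h : ri K ⊆ ri D) :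
    ri (K ∩ ri D) = ri K := by
  have half : ∀ x y : V, ∀ ε : ℝ, x + (ε / 2) • (x - y) =
      (1 / 2 : ℝ) • x + (1 / 2 : ℝ) • (x + ε • (x - y)) := fun x y ε => by module
  have half' : ∀ x y : V, ∀ ε : ℝ, x + ε • (x - ((1 / 2 : ℝ) • x + (1 / 2 : ℝ) • y)) =
      x + (ε / 2) • (x - y) := fun x y ε => by module
  have h2 : (0 : ℝ) < 1 / 2 := by norm_num
  ext x
  constructor
  · rintro ⟨⟨hx, hxD⟩, hri⟩
    refine ⟨hx, fun z hz => ?_⟩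
    obtain ⟨ε, h0, h1⟩ := hri ((1 / 2 : ℝ) • x + (1 / 2 : ℝ) • z)
      ⟨hK.add (hK.smul h2 hx) (hK.smul h2 hz),
        hD.ri_add (hD.ri_smul h2 hxD) (hD.smul h2 (hKD hz))⟩
    exact ⟨ε / 2, by linarith, by rw [← half']; exact h1.1⟩
  · intro hx
    refine ⟨⟨hx.1, h hx⟩, fun z hz => ?_⟩
    obtain ⟨ε, h0, h1⟩ := hx.2 z hz.1
    refine ⟨ε / 2, by linarith, ?_⟩
    rw [half]
    exact ⟨hK.add (hK.smul h2 hx.1) (hK.smul h2 h1),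
      hD.ri_add (hD.ri_smul h2 (h hx)) (hD.smul h2 (hKD h1))⟩

end IsCone

end Poic

section Cells

universe a₁ b₁ a₂ b₂ a₃ b₃

variable {C : Type a₁} [Category.{b₁} C] {D : Type a₂} [Category.{b₂} D]
  {Υ : C ⥤ Poic} {Φ : D ⥤ Poic}

/-- The linear map that identifies the cone `Υ(t)` with its image in `Φ(s)`, where `S(t) ≅ s`. -/
def transMap (S : Mor Υ Φ) {t : C} {s : D} (i : S.F.obj t ≅ s) :
    (ℝ ⊗[ℤ] (Υ.obj t).N) →ₗ[ℝ] (ℝ ⊗[ℤ] (Φ.obj s).N) :=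
  real (Φ.map i.hom) ∘ₗ real (S.η.app t)

variable {S : Mor Υ Φ}

lemma transport_eq {t : C} {s : D} (i : S.F.obj t ≅ s) (K : Set (ℝ ⊗[ℤ] (Υ.obj t).N)) :
    transport S i K = transMap S i '' K :=
  Set.image_image _ _ _

namespace IsSubdivision

variable (hS : IsSubdivision S)
include hS

lemma transMap_injective {t : C} {s : D} (i : S.F.obj t ≅ s) :
    Function.Injective (transMap S i) :=
  (real_iso_injective (Φ.mapIso i)).comp (real_injective _ (hS.injective t))

lemma transport_relint {t : C} {s : D} (i : S.F.obj t ≅ s) :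
    transport S i (Υ.obj t).relint = ri (transport S i (Υ.obj t).carrier) := by
  rw [transport_eq, transport_eq, ri_image _ (hS.transMap_injective i), relint_eq_ri]

omit hS in
lemma isCone_transport {t : C} {s : D} (i : S.F.obj t ≅ s) :
    IsCone (transport S i (Υ.obj t).carrier) := by
  rw [transport_eq]
  exact (isCone_carrier _).image _

omit hS in
lemma transport_subset {t : C} {s : D} (i : S.F.obj t ≅ s) :
    transport S i (Υ.obj t).carrier ⊆ (Φ.obj s).carrier := by
  rintro _ ⟨_, ⟨x, hx, rfl⟩, rfl⟩
  exact (Φ.map i.hom).maps _ ((S.η.app t).maps x hx)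

lemma transport_relint_subset {t : C} {s : D} (i : S.F.obj t ≅ s) :
    transport S i (Υ.obj t).relint ⊆ (Φ.obj s).relint := by
  rw [hS.cover s]
  exact Set.subset_iUnion₂_of_subset t i subset_rfl

omit hS in
lemma transport_relint_nonempty {t : C} {s : D} (i : S.F.obj t ≅ s) :
    (transport S i (Υ.obj t).relint).Nonempty := by
  rw [transport_eq]
  exact (relint_nonempty _).image _

/-- The cells determine the images of the relative interiors of the cones of the subdivision. -/
lemma ri_cell {t : C} {s : D} (i : S.F.obj t ≅ s) :
    ri (cell S i) = transport S i (Υ.obj t).relint := by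
  rw [cell, relint_eq_ri (Φ.obj s), (isCone_transport i).ri_inter_ri (isCone_carrier _)
    (transport_subset i), hS.transport_relint]
  rw [← hS.transport_relint, ← relint_eq_ri]
  exact hS.transport_relint_subset i

lemma exists_mem {s : D} {x} (hx : x ∈ (Φ.obj s).relint) :
    ∃ (t : C) (i : S.F.obj t ≅ s), x ∈ transport S i (Υ.obj t).relint := by
  rw [hS.cover s] at hx
  simpa using hx

lemma eq_of_mem {s : D} {t t' : C} (i : S.F.obj t ≅ s) (i' : S.F.obj t' ≅ s) {x}
    (hx : x ∈ transport S i (Υ.obj t).relint) (hx' : x ∈ transport S i' (Υ.obj t').relint) :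
    transport S i (Υ.obj t).relint = transport S i' (Υ.obj t').relint ∧ Nonempty (t ≅ t') :=
  (hS.disjoint s t t' i i').resolve_left fun h => Set.disjoint_left.1 h hx hx'

/-- If all cells over `s` have a point in common, there is only one. -/
lemma eq_relint_of_forall_mem {s : D} {x}
    (hx : ∀ (t : C) (i : S.F.obj t ≅ s), x ∈ transport S i (Υ.obj t).relint) (t : C)
    (i : S.F.obj t ≅ s) : transport S i (Υ.obj t).relint = (Φ.obj s).relint := by
  refine Set.Subset.antisymm (hS.transport_relint_subset i) fun y hy => ?_
  obtain ⟨t', i', hy'⟩ := hS.exists_mem hy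
  rwa [(hS.eq_of_mem i i' (hx t i) (hx t' i')).1]

omit hS in
lemma transMap_naturality {q t : C} {s s' : D} (i : S.F.obj q ≅ s) (i' : S.F.obj t ≅ s')
    (f : s ⟶ s') (h : q ⟶ t) (hh : S.F.map h = i.hom ≫ f ≫ i'.inv) (x) :
    transMap S i' (real (Υ.map h) x) = real (Φ.map f) (transMap S i x) := by
  have h1 : Υ.map h ≫ S.η.app t ≫ Φ.map i'.hom = S.η.app q ≫ Φ.map i.hom ≫ Φ.map f := by
    have := S.η.naturality h
    rw [← Category.assoc, this, Category.assoc]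
    change S.η.app q ≫ Φ.map (S.F.map h) ≫ _ = _
    rw [hh]
    simp [← Functor.map_comp]
  have h2 := congrArg (fun φ => real φ x) h1
  simp only [real_comp_app] at h2
  exact h2

/-- A cone over `s'` has, for every face `s` of `s'`, a face over `s`. -/
lemma exists_lift {t : C} {s s' : D} (i' : S.F.obj t ≅ s') (f : s ⟶ s') :
    ∃ (q : C) (i : S.F.obj q ≅ s) (h : q ⟶ t), ∀ x,
      transMap S i' (real (Υ.map h) x) = real (Φ.map f) (transMap S i x) := by
  obtain ⟨q, h, i, hi⟩ := hS.lift t s (f ≫ i'.inv)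
  exact ⟨q, i, h, transMap_naturality i i' f h hi⟩

/-- The image of some cone over `s` is contained in a given cone over `s'`, for every face `s` of
`s'`. -/
lemma exists_face_subset {t : C} {s s' : D} (i' : S.F.obj t ≅ s') (f : s ⟶ s') :
    ∃ (q : C) (i : S.F.obj q ≅ s),
      real (Φ.map f) '' transport S i (Υ.obj q).carrier ⊆ transport S i' (Υ.obj t).carrier := by
  obtain ⟨q, i, h, hx⟩ := hS.exists_lift i' f
  refine ⟨q, i, ?_⟩
  rw [transport_eq, transport_eq]
  rintro _ ⟨_, ⟨x, hx', rfl⟩, rfl⟩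
  exact ⟨_, (Υ.map h).maps x hx', hx x⟩

end IsSubdivision

variable {E : Type a₃} [Category.{b₃} E] {𝒳 : E ⥤ Poic}

/-- An isomorphism `π(p) ≅ π(q)` carries a cell over `p` to a cell over `q`. -/
lemma IsCompatible.exists_cell {π : Mor Φ 𝒳} (hc : IsCompatible π S) {p q : D}
    (f : π.F.obj p ≅ π.F.obj q) {t : C} (i : S.F.obj t ≅ p) :
    ∃ (t' : C) (i' : S.F.obj t' ≅ q),
      real (𝒳.map f.hom) '' (real (π.η.app p) '' cell S i) = real (π.η.app q) '' cell S i' := by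
  have h : real (𝒳.map f.hom) '' (real (π.η.app p) '' cell S i) ∈
      (fun K => real (π.η.app q) '' K) '' cells S q := by
    rw [← hc p q f]
    exact ⟨_, ⟨t, i, rfl⟩, rfl⟩
  obtain ⟨_, ⟨t', i', rfl⟩, h'⟩ := h
  exact ⟨t', i', h'.symm⟩

end Cells

/-! ### Conical subdivisions of orthants -/

section Orthant

variable {κ : Type} [Finite κ]

/-- If a family of disjoint convex cones in the positive orthant is stable under permutations of the
coordinates, and every member recedes in a direction that vanishes in the coordinate `o` only, every
member contains the diagonal. For any two coordinates such directions lead from a given point of a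
member `U` to a point at which both coordinates agree, so that `U` is fixed under the
transposition; thus `U` is fixed under all permutations, and the sum of an orbit is on the
diagonal. -/
lemma one_mem_of_recession (o : κ) (𝒰 : Set (Set (κ → ℝ)))
    (hne : ∀ U ∈ 𝒰, U.Nonempty) (hpos : ∀ U ∈ 𝒰, ∀ x ∈ U, ∀ k, 0 < x k)
    (hcone : ∀ U ∈ 𝒰, IsCone U)
    (hdisj : ∀ U ∈ 𝒰, ∀ U' ∈ 𝒰, ∀ x, x ∈ U → x ∈ U' → U = U')
    (hsymm : ∀ U ∈ 𝒰, ∀ σ : Equiv.Perm κ, {x | x ∘ σ ∈ U} ∈ 𝒰)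
    (hrec : ∀ U ∈ 𝒰, ∃ v : κ → ℝ, v o = 0 ∧ (∀ k, k ≠ o → 0 < v k) ∧
      ∀ x ∈ U, ∀ ε : ℝ, 0 < ε → x + ε • v ∈ U) :
    ∀ U ∈ 𝒰, (fun _ => 1) ∈ U := by
  classical
  have := Fintype.ofFinite κ
  -- by symmetry, `o` may be replaced by any coordinate
  have hrec' : ∀ U ∈ 𝒰, ∀ j, ∃ v : κ → ℝ, v j = 0 ∧ (∀ k, k ≠ j → 0 < v k) ∧
      ∀ x ∈ U, ∀ ε : ℝ, 0 < ε → x + ε • v ∈ U := by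
    intro U hU j
    obtain ⟨v, h1, h2, h3⟩ := hrec _ (hsymm U hU (Equiv.swap o j))
    have hs : ∀ x : κ → ℝ, (x ∘ Equiv.swap o j) ∘ Equiv.swap o j = x := fun x => by
      funext k; simp
    refine ⟨v ∘ Equiv.swap o j, by simpa using h1, fun k hk => h2 _ fun h => hk ?_,
      fun x hx ε hε => ?_⟩
    · rw [← Equiv.swap_apply_self o j k, h, Equiv.swap_apply_left]
    · have := h3 (x ∘ Equiv.swap o j) (by simpa only [Set.mem_ofPred_eq, hs]) ε hε
      have h4 : (x ∘ Equiv.swap o j + ε • v) ∘ Equiv.swap o j = x + ε • v ∘ Equiv.swap o j := by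
        funext k; simp
      rw [← h4]
      exact this
  have hswap : ∀ U ∈ 𝒰, ∀ i j, i ≠ j → ∀ x, x ∘ Equiv.swap i j ∈ U ↔ x ∈ U := by
    intro U hU i j hij
    obtain ⟨x, hx⟩ := hne U hU
    obtain ⟨v, hv, hv', hvU⟩ := hrec' U hU i
    obtain ⟨w, hw, hw', hwU⟩ := hrec' U hU j
    have h1 := hv' j hij.symm
    have h2 := hw' i hij
    -- the coefficients of `v` and `w` are chosen such that the coordinates `i` and `j` become
    -- equal: `v` does not change the former and `w` does not change the latter
    set a := (|x i - x j| + 1) / v j with ha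
    set b := (x j - x i + (|x i - x j| + 1)) / w i with hb
    have h3 := le_abs_self (x i - x j)
    have ha0 : 0 < a := by positivity
    have hb0 : 0 < b := by
      refine div_pos ?_ h2
      linarith
    have hz := hwU _ (hvU x hx a ha0) b hb0
    set z := x + a • v + b • w with hzdef
    have hzij : z i = z j := by
      simp only [hzdef, Pi.add_apply, Pi.smul_apply, smul_eq_mul, hv, hw, ha, hb]
      field_simp
      ring
    have hzs : z ∘ Equiv.swap i j = z := by
      funext k
      rcases eq_or_ne k i with rfl | hki
      · simp [hzij]
      rcases eq_or_ne k j with rfl | hkj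
      · simp [hzij]
      · simp [Equiv.swap_apply_of_ne_of_ne hki hkj]
    have := hdisj _ (hsymm U hU (Equiv.swap i j)) U hU z (by
      simpa only [Set.mem_ofPred_eq, hzs]) hz
    exact fun x => Set.ext_iff.1 this x
  intro U hU
  have hperm : ∀ σ : Equiv.Perm κ, ∀ x ∈ U, x ∘ σ ∈ U := by
    intro σ
    induction σ using Equiv.Perm.swap_induction_on with
    | one => exact fun x hx => hx
    | swap_mul σ i j hij ih =>
      intro x hx
      exact ih _ ((hswap U hU i j hij x).2 hx)
  obtain ⟨x, hx⟩ := hne U hU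
  -- the sum of the orbit of a point is on the diagonal
  have hsum : ∀ s : Finset (Equiv.Perm κ), s.Nonempty → ∑ σ ∈ s, x ∘ σ ∈ U := by
    intro s hs
    induction hs using Finset.Nonempty.cons_induction with
    | singleton σ => simpa using hperm σ x hx
    | cons σ s hσ hs ih =>
      rw [Finset.sum_cons]
      exact (hcone U hU).add (hperm σ x hx) ih
  have hz := hsum Finset.univ Finset.univ_nonempty
  set z := ∑ σ : Equiv.Perm κ, x ∘ σ with hzdef
  have hconst : ∀ k, z k = z o := by
    intro k
    simp only [hzdef, Finset.sum_apply, Function.comp_apply]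
    refine Fintype.sum_equiv (Equiv.mulRight (Equiv.swap o k)) _ _ fun σ => ?_
    simp
  have h0 := hpos U hU z hz o
  have := (hcone U hU).smul (inv_pos.2 h0) hz
  convert this using 1
  funext k
  simp [hconst k, h0.ne']

/-- A convex cone in `ℝ_{≥0}^E × ℝ_{>0}^κ` that contains `0 × ℝ_{>0}^κ` and a point on each axis of
the first factor has the points `(1, y)` with sufficiently large `y` in its relative interior. -/
lemma exists_mem_ri_of_axes {E : Type} [Finite E] {C : Set (E ⊕ κ → ℝ)} (hC : IsCone C)
    (h0 : ∀ y : κ → ℝ, (∀ i, 0 < y i) → Sum.elim (fun _ => 0) y ∈ C)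
    (h1 : ∀ e : E, ∃ x ∈ C, 0 < x (.inl e) ∧ ∀ e', e' ≠ e → x (.inl e') = 0) :
    ∃ Y : ℝ, ∀ y : κ → ℝ, (∀ i, Y < y i) → Sum.elim (fun _ => 1) y ∈ ri C := by
  classical
  have := Fintype.ofFinite κ
  have := Fintype.ofFinite E
  choose x hx hx' hx'' using h1
  -- the points on the axes, normalized
  set p : E → E ⊕ κ → ℝ := fun e => (x e (.inl e))⁻¹ • x e with hp
  have hpC : ∀ e, p e ∈ C := fun e => hC.smul (inv_pos.2 (hx' e)) (hx e)
  have hpe : ∀ e e', p e (.inl e') = if e = e' then 1 else 0 := by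
    intro e e'
    split_ifs with h
    · subst h; simp [hp, (hx' e).ne']
    · simp [hp, hx'' e e' (Ne.symm h)]
  have hsum : ∀ (s : Finset E) (c : E → ℝ) (q : E ⊕ κ → ℝ), q ∈ C → (∀ e, 0 < c e) →
      q + ∑ e ∈ s, c e • p e ∈ C := by
    intro s c q hq hc
    induction s using Finset.induction_on with
    | empty => simpa using hq
    | insert e s hes ih =>
      rw [Finset.sum_insert hes, add_comm (c e • p e), ← add_assoc]
      exact hC.add ih (hC.smul (hc e) (hpC e))
  -- a point `q` is the sum of multiples of the `p e` and a point of `0 × ℝ_{>0}^κ`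
  have hmem : ∀ q : E ⊕ κ → ℝ, (∀ e, 0 < q (.inl e)) →
      (∀ i, ∑ e, q (.inl e) * p e (.inr i) < q (.inr i)) → q ∈ C := by
    intro q h2 h3
    have := hsum Finset.univ (fun e => q (.inl e)) _
      (h0 (fun i => q (.inr i) - ∑ e, q (.inl e) * p e (.inr i)) fun i => sub_pos.2 (h3 i)) h2
    convert this using 1
    funext k
    rcases k with e | i
    · simp [hpe]
    · simp
  obtain ⟨Y, hY⟩ : ∃ Y : ℝ, ∀ i, ∑ e, p e (.inr i) ≤ Y := by
    obtain ⟨Y, hY⟩ := (Set.finite_range fun i => ∑ e, p e (.inr i)).bddAbove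
    exact ⟨Y, fun i => hY ⟨i, rfl⟩⟩
  refine ⟨Y, fun y hy => ?_⟩
  have hlt : ∀ i, ∑ e, p e (.inr i) < y i := fun i => (hY i).trans_lt (hy i)
  refine ⟨hmem _ (fun e => one_pos) fun i => by simpa using hlt i, fun z hz => ?_⟩
  -- the conditions for `q` are open, hence hold on a short prolongation of the segment from `z`
  set q : ℝ → E ⊕ κ → ℝ := fun ε => Sum.elim (fun _ => 1) y + ε • (Sum.elim (fun _ => 1) y - z)
    with hq
  have hcont : ∀ k, Continuous fun ε => q ε k := fun k => by
    simp only [hq, Pi.add_apply, Pi.smul_apply, smul_eq_mul, Pi.sub_apply]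
    fun_prop
  have e1 : ∀ᶠ ε : ℝ in nhdsWithin 0 (Set.Ioi 0), ∀ e, 0 < q ε (.inl e) := by
    rw [Filter.eventually_all]
    intro e
    refine (((hcont (.inl e)).tendsto 0).eventually (lt_mem_nhds ?_)).filter_mono
      nhdsWithin_le_nhds
    simp [hq]
  have e2 : ∀ᶠ ε : ℝ in nhdsWithin 0 (Set.Ioi 0),
      ∀ i, ∑ e, q ε (.inl e) * p e (.inr i) < q ε (.inr i) := by
    rw [Filter.eventually_all]
    intro i
    have hc : Continuous fun ε => q ε (.inr i) - ∑ e, q ε (.inl e) * p e (.inr i) :=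
      (hcont _).sub (continuous_finsetSum _ fun e _ => (hcont _).mul continuous_const)
    have h4 : 0 < q 0 (.inr i) - ∑ e, q 0 (.inl e) * p e (.inr i) := by
      have := hlt i
      simp only [hq, zero_smul, add_zero, Sum.elim_inl, Sum.elim_inr, one_mul]
      linarith
    have h5 := (hc.tendsto 0).eventually (lt_mem_nhds h4)
    exact (h5.filter_mono nhdsWithin_le_nhds).mono fun ε hε => sub_pos.1 hε
  have e3 : ∀ᶠ ε : ℝ in nhdsWithin 0 (Set.Ioi 0), 0 < ε := self_mem_nhdsWithin
  obtain ⟨ε, h2, h3, h4⟩ := (e1.and (e2.and e3)).exists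
  exact ⟨ε, h4, hmem _ h2 h3⟩

end Orthant

/-! ### Two special trees -/

namespace Gr

/-- The tree with a single vertex. -/
def star (B : Type) [Finite B] (hB : 3 ≤ Nat.card B) : Gr 0 B where
  F := Option B
  r _ := none
  ι := id
  r_r _ := rfl
  ι_ι _ := rfl
  ι_r _ := rfl
  leg := some
  leg_injective := Option.some_injective B
  leg_range := by
    ext x
    rcases x with _ | b
    · exact iff_of_false (by simp) fun h => h.1 ⟨none, rfl⟩
    · refine iff_of_true ⟨b, rfl⟩ ⟨?_, rfl⟩
      rintro ⟨_, h⟩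
      cases h
  genus := by
    have h1 := (DGraph.isLeglessTree_singleton (G := ⟨Option B, fun _ => none, id, fun _ => rfl,
      fun _ => rfl, fun _ => rfl⟩) (v := none) ⟨none, rfl⟩).1
    have hV : ∀ v, v ∈ Set.range (fun _ : Option B => (none : Option B)) → v = none := by
      rintro _ ⟨_, rfl⟩; rfl
    refine ⟨fun _ _ => ⟨trivial, trivial⟩, ⟨⟨none, trivial, none, rfl⟩, fun v hv w hw => ?_⟩, ?_⟩
    · rw [hV v hv.2, hV w hw.2]
      exact Relation.ReflTransGen.refl
    · have h2 := h1.2.2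
      convert h2 using 2
      · refine congrArg Set.ncard (Set.ext fun e => ?_)
        refine iff_of_false ?_ ?_ <;>
        · rintro ⟨⟨x, hx, -⟩, -⟩
          exact hx rfl
      · refine congrArg Set.ncard (Set.ext fun v => ?_)
        exact ⟨fun h => ⟨hV v h.2, h.2⟩, fun h => ⟨trivial, h.2⟩⟩
  stable := by
    rintro _ ⟨_, rfl⟩
    have : ((fun _ : Option B => (none : Option B)) ⁻¹' {none}).ncard = Nat.card B + 1 := by
      have h : ((fun _ : Option B => (none : Option B)) ⁻¹' {none}) = Set.univ :=
        Set.eq_univ_of_forall fun _ => rfl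
      rw [h, Set.ncard_univ, Finite.card_option]
    unfold DGraph.val
    change 3 ≤ ((fun _ : Option B => (none : Option B)) ⁻¹' {none}).ncard - 1
    omega

variable {B : Type} [Finite B] (hB : 3 ≤ Nat.card B)

lemma isEmpty_edge_star : IsEmpty (star B hB).toDGraph.Edge := by
  refine ⟨?_⟩
  rintro ⟨_, x, hx, -⟩
  exact hx rfl

/-- Every tree contracts to the tree with a single vertex. -/
def toStar (T : Gr 0 B) : T ⟶ star B hB :=
  ({ toFun := Function.extend T.leg some fun _ => none
     isContraction := by
      have h1 : ∀ b, Function.extend T.leg some (fun _ => none) (T.leg b) = some b :=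
        T.leg_injective.extend_apply _ _
      have h2 : ∀ x, x ∉ T.toDGraph.legs → Function.extend T.leg some (fun _ => none) x = none := by
        intro x hx
        refine Function.extend_apply' _ _ _ ?_
        rintro ⟨b, rfl⟩
        exact hx (leg_mem b)
      have hV : ∀ v, v ∈ (star B hB).V → v = none := by
        rintro _ ⟨_, rfl⟩; rfl
      refine ⟨fun x => h2 _ fun h => h.1 (DGraph.r_mem_V x), fun x => ?_, fun v hv => ?_,
        fun y hy => ?_⟩
      · by_cases hx : x ∈ T.toDGraph.legs
        · rw [hx.2]; rfl
        · refine (h2 _ fun h => hx ?_).trans (h2 x hx).symm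
          have : T.ι x = x := by
            have := h.2
            change T.ι (T.ι x) = T.ι x at this
            rw [T.ι_ι] at this
            exact this.symm
          rwa [this] at h
      · rw [hV v hv]
        have hpre : (Function.extend T.leg some fun _ => none) ⁻¹' {(none : Option B)} =
            T.toDGraph.legsᶜ := by
          ext x
          by_cases hx : x ∈ T.toDGraph.legs
          · refine iff_of_false (fun h => ?_) (fun h => h hx)
            rw [← T.leg_range] at hx
            obtain ⟨b, rfl⟩ := hx
            have h' := (h1 b).symm.trans h
            cases h'
          · exact iff_of_true (h2 x hx) hx
        have hVl : T.toDGraph.V ⊆ T.toDGraph.legsᶜ := fun x hx h => h.1 hx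
        have hsub : T.toDGraph.IsSubgraph T.toDGraph.legsᶜ := by
          refine fun x hx => ⟨hVl (DGraph.r_mem_V x), fun h => hx ?_⟩
          have : T.ι x = x := by
            have := h.2
            change T.ι (T.ι x) = T.ι x at this
            rw [T.ι_ι] at this
            exact this.symm
          rwa [this] at h
        have hj : ∀ {a b}, T.toDGraph.Joined Set.univ a b →
            T.toDGraph.Joined T.toDGraph.legsᶜ a b := by
          intro a b h
          induction h with
          | refl => exact Relation.ReflTransGen.refl
          | tail _ hbc ih =>
            obtain ⟨x, -, rfl, rfl⟩ := hbc
            by_cases hx : x ∈ T.toDGraph.legs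
            · rw [hx.2]; exact ih
            · exact ih.tail ⟨x, hx, rfl, rfl⟩
        have hc : T.toDGraph.IsConn T.toDGraph.legsᶜ := by
          obtain ⟨v, hv⟩ := T.genus.2.1.1
          exact ⟨⟨v, hVl hv.2, hv.2⟩, fun a ha b hb =>
            hj (T.genus.2.1.2 a ⟨trivial, ha.2⟩ b ⟨trivial, hb.2⟩)⟩
        exact hpre ▸ ⟨DGraph.tree_of_conn T.genus hsub hc, disjoint_compl_left⟩
      · rcases y with _ | b
        · exact absurd ⟨none, rfl⟩ hy
        · refine ⟨T.leg b, h1 b, fun x hx => ?_⟩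
          by_cases hx' : x ∈ T.toDGraph.legs
          · rw [← T.leg_range] at hx'
            obtain ⟨b', rfl⟩ := hx'
            rw [Option.some_injective _ ((h1 b').symm.trans hx)]
          · have h' := (h2 x hx').symm.trans hx
            cases h'
     leg := T.leg_injective.extend_apply _ _ } : Hom T (star B hB))

end Gr

section Banana

variable (g : ℕ) (A : Type) [Finite A]

/-- The graph with the two vertices `inl b`, which are joined by an edge that consists of the
half-edges `(none, b)`. The other half-edges are legs: `(some i, b)` at the vertex `b`, and those in
`A` at the vertex `true`. -/
def dumbbell : DGraph where
  F := Bool ⊕ ((Option (Fin g) × Bool) ⊕ A)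
  r
    | .inl b => .inl b
    | .inr (.inl k) => .inl k.2
    | .inr (.inr _) => .inl true
  ι
    | .inl b => .inl b
    | .inr (.inl (none, b)) => .inr (.inl (none, !b))
    | .inr (.inl (some i, b)) => .inr (.inl (some i, b))
    | .inr (.inr a) => .inr (.inr a)
  r_r := by rintro (b | k | a) <;> rfl
  ι_ι := by rintro (b | ⟨_ | i, _ | _⟩ | a) <;> rfl
  ι_r := by rintro (b | k | a) <;> rfl

/-- The tree with two vertices that are joined by one edge, such that the legs `1, …, g` are at one
vertex and the remaining legs at the other. Joining the legs `i` and `i*` gives a graph with two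
vertices and `g + 1` edges between them, which can be permuted. -/
def dumbbellTree (hg : 2 ≤ g) : Gr 0 (Mark g A) where
  toDGraph := dumbbell g A
  leg
    | .inl a => .inr (.inr a)
    | .inr (.inl i) => .inr (.inl (some i, false))
    | .inr (.inr i) => .inr (.inl (some i, true))
  leg_injective := by
    rintro (a | i | i) (b | j | j) h <;> cases h <;> rfl
  leg_range := by
    have hV : ∀ y, .inr y ∉ (dumbbell g A).V := by
      rintro _ ⟨b | k | a, h⟩ <;> cases h
    ext x
    constructor
    · rintro ⟨a | i | i, rfl⟩
      exacts [⟨hV _, rfl⟩, ⟨hV _, rfl⟩, ⟨hV _, rfl⟩]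
    · rintro ⟨h1, h2⟩
      rcases x with b | ⟨_ | i, b⟩ | a
      · exact absurd ⟨.inl b, rfl⟩ h1
      · cases b <;> cases h2
      · cases b
        · exact ⟨.inr (.inl i), rfl⟩
        · exact ⟨.inr (.inr i), rfl⟩
      · exact ⟨.inl a, rfl⟩
  genus := by
    have hV : ∀ v, v ∈ (dumbbell g A).V → ∃ b, v = .inl b := by
      rintro _ ⟨b | k | a, rfl⟩ <;> exact ⟨_, rfl⟩
    refine ⟨fun _ _ => ⟨trivial, trivial⟩, ⟨⟨.inl true, trivial, .inl true, rfl⟩,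
      fun v hv w hw => ?_⟩, ?_⟩
    · obtain ⟨b, rfl⟩ := hV v hv.2
      obtain ⟨c, rfl⟩ := hV w hw.2
      by_cases hbc : b = c
      · subst hbc; exact Relation.ReflTransGen.refl
      · refine Relation.ReflTransGen.single ⟨.inr (.inl (none, b)), trivial, rfl, ?_⟩
        have : (!b) = c := by cases b <;> cases c <;> simp_all
        exact congrArg Sum.inl this
    · have h1 : (dumbbell g A).vertsIn Set.univ = Set.range Sum.inl := by
        ext v
        refine ⟨fun h => ?_, ?_⟩
        · obtain ⟨b, rfl⟩ := hV v h.2; exact ⟨b, rfl⟩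
        · rintro ⟨b, rfl⟩; exact ⟨trivial, .inl b, rfl⟩
      have h2 : (dumbbell g A).edgesIn Set.univ =
          {{.inr (.inl (none, false)), .inr (.inl (none, true))}} := by
        ext e
        constructor
        · rintro ⟨⟨x, hx, rfl⟩, -⟩
          rcases x with b | ⟨_ | i, b⟩ | a
          · exact absurd rfl hx
          · cases b
            · rfl
            · exact Set.pair_comm _ _
          · exact absurd rfl hx
          · exact absurd rfl hx
        · rintro rfl
          refine ⟨⟨.inr (.inl (none, false)), fun h => ?_, rfl⟩, Set.subset_univ _⟩
          cases h
      rw [h1, h2, Set.ncard_singleton]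
      have h3 := Set.ncard_image_of_injective (Set.univ : Set Bool)
        (Sum.inl_injective (α := Bool) (β := (Option (Fin g) × Bool) ⊕ A))
      rw [Set.image_univ, Set.ncard_univ] at h3
      have h4 : Nat.card Bool = 2 := by simp
      exact (h3.trans h4).symm
  stable := by
    rintro v ⟨x, rfl⟩
    obtain ⟨b, hb⟩ : ∃ b, (dumbbell g A).r x = .inl b := by
      rcases x with b | k | a <;> exact ⟨_, rfl⟩
    rw [hb]
    have h1 := Set.ncard_le_ncard_of_injOn (s := (Set.univ : Set (Option (Option (Fin g)))))
      (t := (dumbbell g A).r ⁻¹' {.inl b})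
      (fun k => k.elim (.inl b) fun k => .inr (.inl (k, b))) (by
        rintro (_ | k) - <;> rfl) (by
        rintro (_ | k) - (_ | k') - h <;> cases h <;> rfl) (Set.toFinite _)
    rw [Set.ncard_univ, Finite.card_option, Finite.card_option, Nat.card_eq_fintype_card,
      Fintype.card_fin] at h1
    unfold DGraph.val
    omega

end Banana

/-! ### Compatible subdivisions of the spanning tree complex are trivial -/

section Full

universe a₁ b₁ a₂ b₂

variable {C : Type a₁} [Category.{b₁} C] {D : Type a₂} [Category.{b₂} D]
  {Υ : C ⥤ Poic} {Φ : D ⥤ Poic} {S : Mor Υ Φ}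

lemma Poic.IsCone.ri_ri {V : Type*} [AddCommGroup V] [Module ℝ V] {K : Set V} (hK : IsCone K) :
    ri (ri K) = ri K := by
  have h := hK.ri_inter_ri hK subset_rfl subset_rfl
  rwa [Set.inter_eq_right.2 fun x hx => hx.1] at h

/-- If the relative interior of `Φ(s')` is a single cell, so is the relative interior of every face
`Φ(s)` of `Φ(s')`. For every point of `Φ(s')` is a limit of points of the cell, and a face of the
cell that contains a point of `Φ(s)⁰` contains the other points of `Φ(s)⁰` as well, since any two of
them are, up to positive multiples, summands of each other. -/
lemma IsSubdivision.full_of_hom (hΥ : HasFaces Υ) (hΦ : HasFaces Φ) (hS : IsSubdivision S)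
    {s s' : D} (f : s ⟶ s') {t' : C} (i' : S.F.obj t' ≅ s')
    (hfull : transport S i' (Υ.obj t').relint = (Φ.obj s').relint) (t : C)
    (i : S.F.obj t ≅ s) : transport S i (Υ.obj t).relint = (Φ.obj s).relint := by
  -- the points of `Φ(s')` are limits of points of the cell
  have hlim : ∀ c ∈ (Φ.obj s').carrier, ∃ u w, transMap S i' u = c ∧
      ∀ ε : ℝ, 0 < ε → u + ε • w ∈ (Υ.obj t').carrier := by
    intro c hc
    rw [transport_eq] at hfull
    obtain ⟨w, hw, hw'⟩ : (Φ.obj s').relint.Nonempty := by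
      rw [← hfull]; exact (relint_nonempty _).image _
    have h1 : ∀ ε : ℝ, 0 < ε → c + ε • w ∈ transMap S i' '' (Υ.obj t').relint := by
      intro ε hε
      rw [hfull, relint_eq_ri, add_comm]
      have : w ∈ (Φ.obj s').relint := ⟨hw, hw'⟩
      rw [relint_eq_ri] at this
      exact (isCone_carrier _).ri_add ((isCone_carrier _).ri_smul hε this) hc
    obtain ⟨w₀, -, hw₀⟩ : w ∈ transMap S i' '' (Υ.obj t').relint := by rw [hfull]; exact ⟨hw, hw'⟩
    obtain ⟨u, -, hu'⟩ := h1 1 one_pos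
    refine ⟨u - w₀, w₀, by rw [map_sub, hu', hw₀]; module, fun ε hε => ?_⟩
    obtain ⟨z, hz, hz'⟩ := h1 ε hε
    have : u - w₀ + ε • w₀ = z := hS.transMap_injective i' (by
      rw [hz', map_add, map_sub, map_smul, hu', hw₀]; module)
    rw [this]
    exact hz.1
  obtain ⟨q, j, h, hq⟩ := hS.exists_lift i' f
  -- `F` cuts out the face `Υ(q)` of `Υ(t')` that lies over `s`
  obtain ⟨-, ⟨-, F, hF, hface⟩, -⟩ := hΥ.faceEmbedding h
  have hF' : ∀ u w, (∀ ε : ℝ, 0 < ε → u + ε • w ∈ (Υ.obj t').carrier) →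
      realFunctional F u ≤ 0 := by
    intro u w huw
    have := nonneg_of_forall_pos (a := -realFunctional F u) (b := -realFunctional F w)
      fun ε hε => by
      have := hF _ (huw ε hε)
      rw [map_add, map_smul, smul_eq_mul] at this
      linarith
    linarith
  obtain ⟨a, ha⟩ := relint_nonempty (Υ.obj q)
  have ha' : transMap S j a ∈ (Φ.obj s).relint :=
    hS.transport_relint_subset j (by rw [transport_eq]; exact ⟨a, ha, rfl⟩)
  have haF : 0 ≤ realFunctional F (real (Υ.map h) a) := by
    have : real (Υ.map h) a ∈ real (Υ.map h) '' (Υ.obj q).carrier := ⟨a, ha.1, rfl⟩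
    rw [hface] at this
    exact this.2
  -- a point `y` of the relative interior of `Φ(s)` is the sum of a positive multiple of the point
  -- `a` of the cell over `s` and another point of `Φ(s)`, and vice versa; the first shows that `y`
  -- comes from a point `y₀` of `Υ(t')`, and the second that `F` vanishes there
  have hsub : (Φ.obj s).relint ⊆ transport S j (Υ.obj q).carrier := by
    intro y hy
    rw [relint_eq_ri] at hy ha'
    have hdec : ∀ x ∈ ri (Φ.obj s).carrier, ∀ z ∈ (Φ.obj s).carrier, ∃ δ : ℝ, 0 < δ ∧
        ∃ b ∈ (Φ.obj s).carrier, x = δ • z + b := by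
      intro x hx z hz
      obtain ⟨ε, h0, h1⟩ := hx.2 z hz
      have h2 : (0 : ℝ) < 1 + ε := by linarith
      refine ⟨ε / (1 + ε), by positivity, _, (Φ.obj s).smul_mem h1 (inv_pos.2 h2), ?_⟩
      have h3 : (1 + ε)⁻¹ * (1 + ε) = 1 := inv_mul_cancel₀ h2.ne'
      calc x = ((1 + ε)⁻¹ * (1 + ε)) • x := by rw [h3, one_smul]
        _ = _ := by rw [div_eq_mul_inv]; module
    obtain ⟨δ, hδ, b, hb, hyb⟩ := hdec y hy _ ha'.1
    obtain ⟨δ', hδ', b', hb', hab⟩ := hdec _ ha' y hy.1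
    obtain ⟨u, w, hu, huw⟩ := hlim _ ((Φ.map f).maps b hb)
    obtain ⟨u', w', hu', huw'⟩ := hlim _ ((Φ.map f).maps b' hb')
    have hmem := (Υ.obj t').add_mem_of_closure
      ((Υ.obj t').smul_mem ((Υ.map h).maps a ha.1) hδ) huw
    set y₀ := δ • real (Υ.map h) a + u with hy₀
    have h1 : transMap S i' y₀ = real (Φ.map f) y := by
      rw [hyb, hy₀, map_add, map_smul, hq, hu, map_add, map_smul]; rfl
    have h2 : real (Υ.map h) a = δ' • y₀ + u' := hS.transMap_injective i' (by
      rw [hq, map_add, map_smul, h1, hu']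
      conv_lhs => rw [hab]
      rw [map_add, map_smul]; rfl)
    have h3 : y₀ ∈ real (Υ.map h) '' (Υ.obj q).carrier := by
      rw [hface]
      refine ⟨hmem, ?_⟩
      have h4 := hF' _ _ huw'
      rw [h2, map_add, map_smul, smul_eq_mul] at haF
      by_contra hneg
      push Not at hneg
      have := mul_neg_of_pos_of_neg hδ' hneg
      linarith
    obtain ⟨x, hx, hx'⟩ := h3
    rw [transport_eq]
    refine ⟨x, hx, (hΦ.faceEmbedding f).1 ?_⟩
    rw [← hq, hx', h1]
  -- the cell of `q` is everything, and every other cell over `s` meets it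
  have hfullq : transport S j (Υ.obj q).relint = (Φ.obj s).relint := by
    have h1 := hS.transport_relint_subset j
    rw [hS.transport_relint, relint_eq_ri] at h1
    have h2 := (isCone_transport j).ri_inter_ri (isCone_carrier _) (transport_subset j) h1
    rw [← relint_eq_ri, Set.inter_eq_right.2 hsub] at h2
    rw [hS.transport_relint, ← h2, relint_eq_ri, (isCone_carrier _).ri_ri]
  obtain ⟨x, hx⟩ := transport_relint_nonempty (S := S) i
  have hx' := hS.transport_relint_subset i hx
  rw [← hfullq] at hx'
  rw [(hS.eq_of_mem i j hx hx').1, hfullq]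

end Full

/-- A functional that is non-negative on `K` and positive somewhere is positive on the relative
interior. -/
lemma Poic.pos_of_mem_ri {V : Type*} [AddCommGroup V] [Module ℝ V] {K : Set V} {x z : V}
    (hx : x ∈ ri K) (hz : z ∈ K) {L : V →ₗ[ℝ] ℝ} (hL : ∀ y ∈ K, 0 ≤ L y) (h : 0 < L z) :
    0 < L x := by
  obtain ⟨ε, h0, h1⟩ := hx.2 z hz
  have h2 := hL _ h1
  rw [map_add, map_smul, map_sub, smul_eq_mul] at h2
  have h3 : 0 < ε * L z := mul_pos h0 h
  by_contra h4
  push Not at h4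
  nlinarith

section Dumbbell

variable (g : ℕ) (A : Type) [Finite A] (hg : 2 ≤ g)

/-- The edge of the dumbbell tree. -/
def dumbbellBridge : (dumbbellTree g A hg).toDGraph.Edge :=
  ⟨{.inr (.inl (none, false)), .inr (.inl (none, true))}, .inr (.inl (none, false)),
    (by intro h; cases h), rfl⟩

/-- The edges of the graph obtained from the dumbbell tree: they join its two vertices. -/
def dumbbellEdge (k : Option (Fin g)) : (dumbbellTree g A hg).stDGraph.Edge :=
  match k with
  | none => (dumbbellTree g A hg).oldEdge (dumbbellBridge g A hg)
  | some i => (dumbbellTree g A hg).newEdge i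

lemma dumbbellEdge_val (k : Option (Fin g)) : (dumbbellEdge g A hg k).1 =
    ({.inr (.inl (k, false)), .inr (.inl (k, true))} : Set (dumbbell g A).F) := by
  cases k <;> rfl

lemma dumbbellBridge_eq (e) : dumbbellBridge g A hg = e := by
  obtain ⟨_, x, hx, rfl⟩ := e
  refine Subtype.ext ?_
  rcases x with b | ⟨_ | i, b⟩ | a
  · exact absurd rfl hx
  · cases b
    · rfl
    · exact Set.pair_comm _ _
  · exact absurd rfl hx
  · exact absurd rfl hx

lemma glue_dumbbell (k : Option (Fin g)) (b : Bool) :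
    (dumbbellTree g A hg).glue (.inr (.inl (k, b))) = .inr (.inl (k, !b)) := by
  set T := dumbbellTree g A hg
  rcases k with _ | i
  · refine T.glue_of_ne ?_
    rintro (i | i) h <;> cases h
  · cases b
    · exact T.glue_gLeg (.inl i)
    · exact T.glue_gLeg (.inr i)

lemma glue_dumbbell_of_ne {x : (dumbbell g A).F} (hx : ∀ k, x ≠ .inr (.inl k)) :
    (dumbbellTree g A hg).glue x = x := by
  refine ((dumbbellTree g A hg).glue_of_ne ?_).trans ?_
  · rintro (i | i) h
    · exact hx _ h.symm
    · exact hx _ h.symm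
  · rcases x with b | k | a
    · rfl
    · exact absurd rfl (hx k)
    · rfl

/-- The coordinates on the cone of the dumbbell tree. -/
def dumbbellCrd : (ℝ ⊗[ℤ] ((ST g A).obj (.op (dumbbellTree g A hg))).N) →ₗ[ℝ]
    (Option (Fin g) → ℝ) :=
  LinearMap.pi fun k => crd (coneBasis (dumbbellTree g A hg).stDGraph) (dumbbellEdge g A hg k) ∘ₗ
    real ((st g A).η.app (.op (dumbbellTree g A hg)))

lemma dumbbellCrd_apply (x k) : dumbbellCrd g A hg x k =
    crd (coneBasis (dumbbellTree g A hg).stDGraph) (dumbbellEdge g A hg k)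
      (real ((st g A).η.app (.op (dumbbellTree g A hg))) x) := rfl

lemma dumbbellCrd_some (x i) : dumbbellCrd g A hg x (some i) =
    crd (stBasis (dumbbellTree g A hg)) (.inr i) x :=
  (dumbbellTree g A hg).crd_st_newEdge i x

lemma dumbbellCrd_none (x e) : dumbbellCrd g A hg x none =
    crd (stBasis (dumbbellTree g A hg)) (.inl e) x := by
  have h : dumbbellBridge g A hg = e := dumbbellBridge_eq g A hg e
  rw [← h]
  exact (dumbbellTree g A hg).crd_st_oldEdge (dumbbellBridge g A hg) x

lemma dumbbellCrd_injective : Function.Injective (dumbbellCrd g A hg) := by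
  intro x y h
  refine crd_ext (stBasis _) ?_
  rintro (e | i)
  · rw [← dumbbellCrd_none, ← dumbbellCrd_none, h]
  · rw [← dumbbellCrd_some, ← dumbbellCrd_some, h]

/-- A permutation of the edges of the graph obtained from the dumbbell tree is an automorphism of
this graph. -/
def dumbbellAut (σ : Equiv.Perm (Option (Fin g))) :
    (dumbbellTree g A hg).stGraph ≅ (dumbbellTree g A hg).stGraph :=
  Gr.isoOfEquiv (G := (dumbbellTree g A hg).stGraph) (H := (dumbbellTree g A hg).stGraph)
    (Equiv.sumCongr (Equiv.refl Bool) (Equiv.sumCongr (Equiv.prodCongr σ (Equiv.refl Bool))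
      (Equiv.refl A)))
    (by rintro (b | k | a) <;> rfl)
    (by
      have h1 : ∀ k b, (dumbbellTree g A hg).stGraph.ι (.inr (.inl (k, b))) =
        .inr (.inl (k, !b)) := glue_dumbbell g A hg
      have h2 : ∀ {x : (dumbbell g A).F}, (∀ k, x ≠ .inr (.inl k)) →
        (dumbbellTree g A hg).stGraph.ι x = x := glue_dumbbell_of_ne g A hg
      rintro (b | ⟨k, b⟩ | a)
      · exact (congrArg _ (h2 (x := .inl b) fun k h => by cases h)).trans
          (h2 (x := .inl b) fun k h => by cases h).symm
      · exact (congrArg _ (h1 k b)).trans (h1 (σ k) b).symm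
      · exact (congrArg _ (h2 (x := .inr (.inr a)) fun k h => by cases h)).trans
          (h2 (x := .inr (.inr a)) fun k h => by cases h).symm)
    fun a => rfl

lemma dumbbellAut_edge (σ : Equiv.Perm (Option (Fin g))) (k) :
    (dumbbellAut g A hg σ).hom.isContraction.edge (dumbbellEdge g A hg (σ k)) =
      dumbbellEdge g A hg k := by
  refine Subtype.ext ?_
  rw [dumbbellEdge_val]
  change (dumbbellAut g A hg σ).hom.toFun ⁻¹' (dumbbellEdge g A hg (σ k)).1 = _
  rw [dumbbellEdge_val]
  have key : ∀ b (x : (dumbbell g A).F), (dumbbellAut g A hg σ).hom.toFun x =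
      (.inr (.inl (σ k, b)) : (dumbbell g A).F) ↔ x = .inr (.inl (k, b)) := by
    intro b x
    refine ⟨fun h => ?_, by rintro rfl; rfl⟩
    exact (Equiv.sumCongr (Equiv.refl Bool) (Equiv.sumCongr (Equiv.prodCongr σ (Equiv.refl Bool))
      (Equiv.refl A))).injective h
  ext x
  exact or_congr (key _ _) (key _ _)

lemma crd_dumbbellAut (σ : Equiv.Perm (Option (Fin g))) (y k) :
    crd (coneBasis (dumbbellTree g A hg).stDGraph) (dumbbellEdge g A hg k)
      (real ((Mtrop g A).map (dumbbellAut g A hg σ).hom.op) y) =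
    crd (coneBasis (dumbbellTree g A hg).stDGraph) (dumbbellEdge g A hg (σ k)) y := by
  rw [← dumbbellAut_edge g A hg σ k]
  exact (crd_map_of_eq (faceMap (dumbbellAut g A hg σ).hom.isContraction)
    (dumbbellAut g A hg σ).hom.isContraction.edge_injective (faceMap_lin_basis _) y).1 _

end Dumbbell

section Cells

universe a₁ b₁

variable {C : Type a₁} [Category.{b₁} C] {Υ : C ⥤ Poic} {g : ℕ} {A : Type} [Finite A]
  {S : Mor Υ (ST g A)}

/-- There is only one cell over the dumbbell tree. By compatibility, the permutations of the `g + 1`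
parallel edges of the graph obtained from the tree permute the cells. A cell recedes in the
directions of a cell over the tree with a single vertex, in which only the length of the bridge
vanishes. -/
lemma IsSubdivision.full_dumbbell (hS : IsSubdivision S) (hc : IsCompatible (st g A) S)
    (hg : 2 ≤ g) (t : C) (i : S.F.obj t ≅ .op (dumbbellTree g A hg)) :
    transport S i (Υ.obj t).relint = ((ST g A).obj (.op (dumbbellTree g A hg))).relint := by
  have hB : 3 ≤ Nat.card (Mark g A) := by
    have : Nat.card (Mark g A) = Nat.card A + (g + g) := by
      rw [Nat.card_sum, Nat.card_sum]; simp
    omega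
  set L := dumbbellCrd g A hg
  have hinj := dumbbellCrd_injective g A hg
  set 𝒰 : Set (Set (Option (Fin g) → ℝ)) :=
    {U | ∃ (t : C) (i : S.F.obj t ≅ .op (dumbbellTree g A hg)),
      U = L '' transport S i (Υ.obj t).relint} with h𝒰
  have hpos : ∀ x ∈ ((ST g A).obj (.op (dumbbellTree g A hg))).relint, ∀ k, 0 < L x k := by
    intro x hx k
    rw [(isOrthantal_ST _).mem_relint_iff] at hx
    rcases k with _ | k
    · exact (hx _).trans_eq (dumbbellCrd_none g A hg x (dumbbellBridge g A hg)).symm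
    · exact (hx _).trans_eq (dumbbellCrd_some g A hg x k).symm
  have hrelcone : ∀ (t : C) (i : S.F.obj t ≅ .op (dumbbellTree g A hg)),
      IsCone (transport S i (Υ.obj t).relint) := fun t i => by
    rw [hS.transport_relint]; exact (isCone_transport i).ri_isCone
  -- it suffices that all cells contain the diagonal
  suffices key : ∀ U ∈ 𝒰, (fun _ => (1 : ℝ)) ∈ U by
    obtain ⟨x, hx, hx1⟩ := key _ ⟨t, i, rfl⟩
    refine hS.eq_relint_of_forall_mem (x := x) (fun t' i' => ?_) t i
    obtain ⟨x', hx', hx1'⟩ := key _ ⟨t', i', rfl⟩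
    rwa [hinj (hx1.trans hx1'.symm)]
  refine one_mem_of_recession none 𝒰 ?_ ?_ ?_ ?_ ?_ ?_
  · rintro _ ⟨t, i, rfl⟩
    exact (transport_relint_nonempty i).image _
  · rintro _ ⟨t, i, rfl⟩ _ ⟨x, hx, rfl⟩
    exact hpos x (hS.transport_relint_subset i hx)
  · rintro _ ⟨t, i, rfl⟩
    exact (hrelcone t i).image _
  · rintro _ ⟨t, i, rfl⟩ _ ⟨t', i', rfl⟩ _ ⟨x, hx, rfl⟩ ⟨x', hx', hxx⟩
    rw [hinj hxx] at hx'
    rw [(hS.eq_of_mem i i' hx hx').1]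
  · rintro _ ⟨t, i, rfl⟩ σ
    -- invariance under the permutations of the edges
    set f : (st g A).F.obj (.op (dumbbellTree g A hg)) ≅ (st g A).F.obj
      (.op (dumbbellTree g A hg)) := (dumbbellAut g A hg σ⁻¹).op with hf
    obtain ⟨t', i', h⟩ := hc.exists_cell f i
    have h1 := real_injective _
      (((isPoicFibration_st g A).relint (.op (dumbbellTree g A hg))).1.1)
    have h2 : Function.Injective (real ((Mtrop g A).map f.hom)) :=
      real_iso_injective ((Mtrop g A).mapIso f)
    have h3 : real ((Mtrop g A).map f.hom) '' (real ((st g A).η.app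
        (.op (dumbbellTree g A hg))) '' transport S i (Υ.obj t).relint) =
        real ((st g A).η.app (.op (dumbbellTree g A hg))) '' transport S i' (Υ.obj t').relint := by
      rw [← hS.ri_cell, ← hS.ri_cell, ← ri_image _ h1, ← ri_image _ h1, ← ri_image _ h2, h]
    refine ⟨t', i', ?_⟩
    have hcomp : ∀ x z, real ((Mtrop g A).map f.hom)
        (real ((st g A).η.app (.op (dumbbellTree g A hg))) x) =
          real ((st g A).η.app (.op (dumbbellTree g A hg))) z →
        L z = L x ∘ ⇑σ⁻¹ := by
      intro x z hxz
      funext k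
      rw [dumbbellCrd_apply, ← hxz]
      exact crd_dumbbellAut g A hg σ⁻¹ _ k
    ext y
    constructor
    · rintro ⟨x, hx, hxy⟩
      have : real ((Mtrop g A).map f.hom)
          (real ((st g A).η.app (.op (dumbbellTree g A hg))) x) ∈
          real ((st g A).η.app (.op (dumbbellTree g A hg))) ''
            transport S i' (Υ.obj t').relint := by
        rw [← h3]; exact ⟨_, ⟨x, hx, rfl⟩, rfl⟩
      obtain ⟨z, hz, hz'⟩ := this
      refine ⟨z, hz, ?_⟩
      rw [hcomp x z hz'.symm, hxy]
      funext k
      simp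
    · rintro ⟨z, hz, rfl⟩
      have : real ((st g A).η.app (.op (dumbbellTree g A hg))) z ∈
          real ((st g A).η.app (.op (dumbbellTree g A hg))) '' transport S i' (Υ.obj t').relint :=
        ⟨z, hz, rfl⟩
      rw [← h3] at this
      obtain ⟨_, ⟨x, hx, rfl⟩, hxz⟩ := this
      refine ⟨x, hx, ?_⟩
      rw [hcomp x z hxz]
      funext k
      simp
  · rintro _ ⟨t, i, rfl⟩
    -- a direction of recession from a face of the cell that lies over the tree with a single
    -- vertex
    set f := (Gr.toStar hB (dumbbellTree g A hg)).op with hf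
    obtain ⟨q, j, hq⟩ := hS.exists_face_subset i f
    obtain ⟨x, hx⟩ := transport_relint_nonempty (S := S) j
    have hx1 := hS.transport_relint_subset j hx
    rw [(isOrthantal_ST _).mem_relint_iff] at hx1
    have hmem : real ((ST g A).map f) x ∈ transport S i (Υ.obj t).carrier := by
      refine hq ⟨x, ?_, rfl⟩
      rw [hS.transport_relint] at hx
      exact hx.1
    obtain ⟨-, h2, h3⟩ := crd_ST_map (Gr.toStar hB (dumbbellTree g A hg)) x
    have := Gr.isEmpty_edge_star hB
    refine ⟨L (real ((ST g A).map f) x), ?_, ?_, ?_⟩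
    · refine (dumbbellCrd_none g A hg _ (dumbbellBridge g A hg)).trans (h3 _ ?_)
      rintro ⟨e, -⟩
      exact this.false e
    · rintro (_ | k) hk
      · exact absurd rfl hk
      · rw [dumbbellCrd_some, h2]
        exact hx1 _
    · rintro _ ⟨y, hy, rfl⟩ ε hε
      refine ⟨y + ε • real ((ST g A).map f) x, ?_, by simp [L]⟩
      rw [hS.transport_relint] at hy ⊢
      exact (isCone_transport i).ri_add hy ((isCone_transport i).smul hε hmem)

end Cells

namespace IsSubdivision

universe a₁ b₁

variable {C : Type a₁} [Category.{b₁} C] {Υ : C ⥤ Poic} {g : ℕ} {A : Type} [Finite A]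
  {S : Mor Υ (ST g A)}

/-- There is only one cell over the tree with a single vertex. For `g ≤ 1`, its cone is a point or
a ray. -/
lemma full_star (hΥ : HasFaces Υ) (hS : IsSubdivision S) (hc : IsCompatible (st g A) S)
    (hB : 3 ≤ Nat.card (Mark g A)) (t : C) (i : S.F.obj t ≅ .op (Gr.star _ hB)) :
    transport S i (Υ.obj t).relint = ((ST g A).obj (.op (Gr.star _ hB))).relint := by
  by_cases hg : 2 ≤ g
  · obtain ⟨x, hx⟩ := relint_nonempty ((ST g A).obj (.op (dumbbellTree g A hg)))
    obtain ⟨t', i', -⟩ := hS.exists_mem hx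
    exact hS.full_of_hom hΥ (hasFaces_ST g A) (Gr.toStar hB (dumbbellTree g A hg)).op i'
      (hS.full_dumbbell hc hg t' i') t i
  · have h0 := Gr.isEmpty_edge_star hB
    have h1 : Subsingleton (Fin g) := by
      rw [Fin.subsingleton_iff_le_one]; omega
    refine hS.eq_relint_of_forall_mem (x := ofCrd (stBasis _) fun _ => 1) (fun t i => ?_) t i
    obtain ⟨y, hy⟩ := transport_relint_nonempty (S := S) i
    have hy' := hS.transport_relint_subset i hy
    rw [(isOrthantal_ST _).mem_relint_iff] at hy'
    rcases isEmpty_or_nonempty (Fin g) with hF | ⟨⟨k⟩⟩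
    · convert hy
      refine crd_ext (stBasis _) ?_
      rintro (e | k)
      exacts [(h0.false e).elim, (hF.false k).elim]
    · have hk := hy' (.inr k)
      have : ofCrd (stBasis (Gr.star _ hB)) (fun _ => 1) =
          (crd (stBasis (Gr.star _ hB)) (.inr k) y)⁻¹ • y := by
        refine crd_ext (stBasis _) ?_
        rintro (e | k')
        · exact (h0.false e).elim
        · rw [Subsingleton.elim k' k, crd_ofCrd, map_smul, smul_eq_mul, inv_mul_cancel₀ hk.ne']
      rw [this, hS.transport_relint]
      rw [hS.transport_relint] at hy
      exact (isCone_transport i).ri_smul (inv_pos.2 hk) hy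

/-- The subdivision of every cone is trivial. Each cell of the cone of `T` has faces over the tree
with a single vertex and over the trees with a single edge that are contractions of `T`. The
former contains all points on which the edge lengths of `T` vanish, the latter contain points on
the axes; hence all cells contain the points with edge lengths `1` and large remaining
coordinates. -/
lemma full (hΥ : HasFaces Υ) (hS : IsSubdivision S) (hc : IsCompatible (st g A) S)
    (hB : 3 ≤ Nat.card (Mark g A)) {s : (Gr 0 (Mark g A))ᵒᵖ} (t : C) (i : S.F.obj t ≅ s) :
    transport S i (Υ.obj t).relint = ((ST g A).obj s).relint := by
  obtain ⟨T⟩ := s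
  have ho := isOrthantal_ST T
  set L : (ℝ ⊗[ℤ] ((ST g A).obj (.op T)).N) →ₗ[ℝ] (T.toDGraph.Edge ⊕ Fin g → ℝ) :=
    LinearMap.pi fun k => crd (stBasis T) k with hL
  have hinj : Function.Injective L := fun x y h => crd_ext _ fun k => congrFun h k
  have key : ∀ (t : C) (i : S.F.obj t ≅ .op T), ∃ Y : ℝ, ∀ y : Fin g → ℝ, (∀ k, Y < y k) →
      ofCrd (stBasis T) (Sum.elim (fun _ => 1) y) ∈ transport S i (Υ.obj t).relint := by
    intro t i
    have hC := (isCone_transport (S := S) i).image L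
    suffices h : _ ∧ _ by
      obtain ⟨Y, hY⟩ := exists_mem_ri_of_axes hC h.1 h.2
      refine ⟨Y, fun y hy => ?_⟩
      have := hY y hy
      rw [ri_image _ hinj, ← hS.transport_relint] at this
      obtain ⟨x, hx, hxy⟩ := this
      convert hx
      refine crd_ext (stBasis T) fun k => ?_
      rw [crd_ofCrd, ← hxy]
      rfl
    constructor
    · intro y hy
      -- the face over the tree with a single vertex
      obtain ⟨q, j, hq⟩ := hS.exists_face_subset i (Gr.toStar hB T).op
      have hy' : ofCrd (stBasis (Gr.star _ hB)) (Sum.elim (fun _ => 1) y) ∈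
          transport S j (Υ.obj q).relint := by
        rw [hS.full_star hΥ hc hB, (isOrthantal_ST _).mem_relint_iff]
        rintro (e | k)
        · exact ((Gr.isEmpty_edge_star hB).false e).elim
        · rw [crd_ofCrd]; exact hy k
      rw [hS.transport_relint] at hy'
      refine ⟨_, hq ⟨_, hy'.1, rfl⟩, ?_⟩
      obtain ⟨-, h2, h3⟩ := crd_ST_map (Gr.toStar hB T)
        (ofCrd (stBasis (Gr.star _ hB)) (Sum.elim (fun _ => 1) y))
      funext k
      rcases k with e | k
      · exact h3 e fun ⟨e', _⟩ => (Gr.isEmpty_edge_star hB).false e'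
      · exact (h2 k).trans (crd_ofCrd _ _ _)
    · intro e
      -- the face over the tree in which all edges except `e` are contracted
      have hz : ∀ k, crd (stBasis T) k (ofCrd (stBasis T)
          (Sum.elim (fun e' => if e' = e then 1 else 0) fun _ => (1 : ℝ))) =
          (Sum.elim (fun e' => if e' = e then 1 else 0) fun _ => (1 : ℝ)) k :=
        fun k => crd_ofCrd _ _ _
      set z := ofCrd (stBasis T) (Sum.elim (fun e' => if e' = e then 1 else 0) fun _ => (1 : ℝ))
      set Z : Set (T.toDGraph.Edge ⊕ Fin g) := Sum.inl '' {e}ᶜ with hZ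
      have hzZ : z ∈ {x ∈ ((ST g A).obj (.op T)).carrier | ∀ k ∈ Z, crd (stBasis T) k x = 0} := by
        refine ⟨(mem_ST_iff T z).2 ⟨fun e' => ?_, fun k => ?_⟩, ?_⟩
        · rw [hz, Sum.elim_inl]; split_ifs <;> norm_num
        · rw [hz]; exact one_pos
        · rintro _ ⟨e', he', rfl⟩
          exact (hz _).trans (if_neg he')
      obtain ⟨p, f, hf, -⟩ := (hasFaces_ST g A).face _ _ (ho.isFace Z ⟨z, hzZ⟩)
      obtain ⟨q, j, hq⟩ := hS.exists_face_subset i f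
      obtain ⟨x, hx⟩ := transport_relint_nonempty (S := S) j
      have hx1 := hS.transport_relint_subset j hx
      rw [hS.transport_relint] at hx
      have hx2 : real ((ST g A).map f) x ∈
          ri {x ∈ ((ST g A).obj (.op T)).carrier | ∀ k ∈ Z, crd (stBasis T) k x = 0} := by
        rw [← hf, ri_image _ ((hasFaces_ST g A).faceEmbedding f).1, ← relint_eq_ri]
        exact ⟨x, hx1, rfl⟩
      refine ⟨_, ⟨_, hq ⟨x, hx.1, rfl⟩, rfl⟩, ?_, fun e' he' => hx2.1.2 _ ⟨e', he', rfl⟩⟩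
      refine pos_of_mem_ri (L := crd (stBasis T) (.inl e)) hx2 hzZ (fun y hy => ho.nonneg y hy.1 _)
        ?_
      rw [hz, Sum.elim_inl, if_pos rfl]
      exact one_pos
  refine Set.Subset.antisymm (hS.transport_relint_subset i) fun x hx => ?_
  obtain ⟨t', i', hx'⟩ := hS.exists_mem hx
  -- any two cells have a point in common
  obtain ⟨Y, hY⟩ := key t i
  obtain ⟨Y', hY'⟩ := key t' i'
  have hlt : ∀ k : Fin g, max Y Y' < (fun _ => max Y Y' + 1) k := fun _ => lt_add_one _
  rwa [(hS.eq_of_mem i i' (hY _ fun k => (le_max_left _ _).trans_lt (hlt k))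
    (hY' _ fun k => (le_max_right _ _).trans_lt (hlt k))).1]

end IsSubdivision

section Trivial

universe a₁ b₁ a₂ b₂

variable {C : Type a₁} [Category.{b₁} C] {D : Type a₂} [Category.{b₂} D]
  {Υ : C ⥤ Poic} {Φ : D ⥤ Poic} {S : Mor Υ Φ}

/-- The relative interior of every cone of the subdivision is that of the cone over which it lies;
so every cone has a single cell. -/
def IsFull (S : Mor Υ Φ) : Prop :=
  ∀ (t : C), Poic.real (S.η.app t) '' (Υ.obj t).relint = (Φ.obj (S.F.obj t)).relint

namespace IsFull

variable (hS : IsSubdivision S) (hf : IsFull S)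

include hf in
lemma transport_relint {t : C} {s : D} (i : S.F.obj t ≅ s) :
    transport S i (Υ.obj t).relint = (Φ.obj s).relint := by
  rw [transport, hf t]
  exact image_relint_of_iso (Φ.mapIso i)

include hS hf

lemma nonempty_iso {t t' : C} (i : S.F.obj t ≅ S.F.obj t') : Nonempty (t ≅ t') := by
  obtain ⟨x, hx⟩ := relint_nonempty (Φ.obj (S.F.obj t'))
  refine (hS.eq_of_mem i (Iso.refl _) (x := x) ?_ ?_).2 <;> rwa [hf.transport_relint]

lemma nonempty_hom {t t' : C} (f : S.F.obj t ⟶ S.F.obj t') : Nonempty (t ⟶ t') := by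
  obtain ⟨q, h, i, -⟩ := hS.lift t' _ f
  obtain ⟨k⟩ := nonempty_iso hS hf i
  exact ⟨k.inv ≫ h⟩

/-- The span of a cone is spanned by its relative interior. -/
lemma dim_eq (t : C) : (Υ.obj t).dim = (Φ.obj (S.F.obj t)).dim := by
  have hinj := real_injective _ (hS.injective t)
  rw [dim_eq_finrank, dim_eq_finrank, ← Module.finrank_baseChange (R := ℝ) (M' := (Υ.obj t).N),
    ← Module.finrank_baseChange (R := ℝ) (M' := (Φ.obj (S.F.obj t)).N)]
  refine le_antisymm (LinearMap.finrank_le_finrank_of_injective hinj) ?_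
  refine LinearMap.finrank_le_finrank_of_surjective (f := real (S.η.app t)) ?_
  rw [← LinearMap.range_eq_top, eq_top_iff, ← (Φ.obj (S.F.obj t)).full, Submodule.span_le]
  intro x hx
  obtain ⟨w, hw⟩ := relint_nonempty (Φ.obj (S.F.obj t))
  have h1 : w ∈ LinearMap.range (real (S.η.app t)) := by
    rw [← hf t] at hw
    obtain ⟨y, -, rfl⟩ := hw
    exact ⟨y, rfl⟩
  have h2 : w + x ∈ LinearMap.range (real (S.η.app t)) := by
    have : w + x ∈ (Φ.obj (S.F.obj t)).relint := by
      rw [relint_eq_ri] at hw ⊢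
      exact (isCone_carrier _).ri_add hw hx
    rw [← hf t] at this
    obtain ⟨y, -, hy⟩ := this
    exact ⟨y, hy⟩
  have := sub_mem h2 h1
  rwa [add_sub_cancel_left] at this

lemma bijective (t : C) : Function.Bijective (S.η.app t).lin := hS.bijective t (dim_eq hS hf t)

end IsFull

end Trivial

/-! ### Refinements of trees -/

namespace Gr

variable {B : Type}

/-- A vertex of a tree together with a set of flags at this vertex, such that splitting off these
flags gives a stable tree. -/
structure Split (T : Gr 0 B) where
  v : T.F
  mem : v ∈ T.V
  X : Set T.F
  sub : X ⊆ T.toDGraph.flagsAt v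
  two_le : 2 ≤ X.ncard
  le_val : X.ncard + 2 ≤ T.val v

/-- The tree obtained by splitting a vertex. -/
abbrev split (T : Gr 0 B) (s : T.Split) : Gr 0 B := T.expand s.mem s.sub s.two_le s.le_val

/-- The contraction of the new edge. -/
abbrev splitHom (T : Gr 0 B) (s : T.Split) : T.split s ⟶ T :=
  T.expandHom s.mem s.sub s.two_le s.le_val

lemma card_V (T : Gr 0 B) : T.V.ncard = Nat.card T.toDGraph.Edge + 1 := by
  have := T.genus.2.2
  rw [← T.card_edge, DGraph.vertsIn_univ] at this
  exact this.symm

lemma card_edge_split (T : Gr 0 B) (s : T.Split) :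
    Nat.card (T.split s).toDGraph.Edge = Nat.card T.toDGraph.Edge + 1 := by
  have h1 := T.card_V
  have h2 := (T.split s).card_V
  have h3 : (T.split s).V = insert (.inr none) (Sum.inl '' T.V) := by
    ext x
    rcases x with x | _ | b
    · refine (DGraph.inl_mem_V_iff s.mem s.sub).trans ⟨fun h => Or.inr ⟨x, h, rfl⟩, ?_⟩
      rintro (h | ⟨y, hy, h⟩)
      · cases h
      · cases h; exact hy
    · exact iff_of_true (DGraph.inr_none_mem_V s.mem s.sub) (Or.inl rfl)
    · refine iff_of_false (DGraph.inr_some_notMem_V s.mem s.sub b) ?_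
      rintro (h | ⟨y, hy, h⟩) <;> cases h
  rw [h3] at h2
  have h4 : (insert (.inr none) (Sum.inl '' T.V) : Set (T.F ⊕ Option Bool)).ncard =
      T.V.ncard + 1 := by
    rw [Set.ncard_insert_of_notMem (by rintro ⟨y, -, h⟩; cases h) (Set.toFinite _),
      Set.ncard_image_of_injective _ Sum.inl_injective]
  have h5 := h4.symm.trans h2
  omega

/-- A contraction between trees with the same number of edges contracts no edge. -/
lemma nonempty_iso_of_card {R T : Gr 0 B} (f : R ⟶ T)
    (h : Nat.card R.toDGraph.Edge = Nat.card T.toDGraph.Edge) : Nonempty (R ≅ T) := by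
  have hf := f.isContraction
  have hs : Function.Surjective hf.edge :=
    ((Nat.bijective_iff_injective_and_card _).2 ⟨hf.edge_injective, h.symm⟩).2
  obtain ⟨i, -⟩ := exists_iso_of_contracted (𝟙 R) f fun x => by
    refine ⟨fun h => hf.mem_V h, fun h => by_contra fun hx => ?_⟩
    by_cases hι : R.ι x = x
    · exact (hf.legs_image.2 ⟨hx, hι⟩).1 h
    · obtain ⟨e, he⟩ := hs (DGraph.edgeOf x hι)
      exact (hf.mem_V_iff_of_ι_ne hι).2 ⟨e, congrArg Subtype.val he⟩ h
  exact ⟨i⟩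

/-- A contraction that is not an isomorphism contracts some half-edge `x`, which defines a splitting
of the vertex over which it lies. -/
lemma exists_split {R T : Gr 0 B} (f : R ⟶ T)
    (h : Nat.card T.toDGraph.Edge < Nat.card R.toDGraph.Edge) :
    ∃ (x : R.F) (s : T.Split) (S : Set R.F), R.ι x ≠ x ∧ f.toFun x = s.v ∧
      DGraph.IsSide f.toFun s.v s.X x S := by
  have hf := f.isContraction
  have hs : ¬ Function.Surjective hf.edge := fun hs =>
    h.ne (Nat.card_congr (Equiv.ofBijective _ ⟨hf.edge_injective, hs⟩))
  rw [Function.Surjective] at hs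
  push Not at hs
  obtain ⟨⟨e, x, hx, rfl⟩, he⟩ := hs
  have hV : f.toFun x ∈ T.V := by_contra fun hV => by
    obtain ⟨e', h'⟩ := (hf.mem_V_iff_of_ι_ne hx).1 hV
    exact he e' (Subtype.ext h')
  obtain ⟨X, hX, S, hS⟩ := DGraph.exists_isSide hf hV R.genus hx rfl
  obtain ⟨h2, h2'⟩ := IsSide.two_le f hV hX hS
  exact ⟨x, ⟨_, hV, X, hX, h2, h2'⟩, S, hx, rfl, hS⟩

/-- A contraction that is not an isomorphism factors through the tree obtained by splitting a
vertex. -/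
lemma nonempty_hom_split {R T : Gr 0 B} (f : R ⟶ T)
    (h : Nat.card T.toDGraph.Edge < Nat.card R.toDGraph.Edge) :
    ∃ s : T.Split, Nonempty (R ⟶ T.split s) := by
  obtain ⟨x, s, S, -, -, hS⟩ := exists_split f h
  obtain ⟨k, -⟩ := IsSide.exists_hom f s.mem s.sub s.two_le s.le_val hS
  exact ⟨s, ⟨k⟩⟩

/-- A contraction extends to the trees obtained by splitting corresponding vertices. -/
lemma Split.nonempty_hom {T₁ T : Gr 0 B} (k : T₁ ⟶ T) (s₁ : T₁.Split) (s : T.Split)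
    (hv : k.toFun s₁.v = s.v)
    (hX : ∀ x, k.toFun x ∈ T.toDGraph.flagsAt s.v → (k.toFun x ∈ s.X ↔ x ∈ s₁.X))
    (hX₁ : ∀ x ∈ s₁.X, k.toFun x ∉ T.V) : Nonempty (T₁.split s₁ ⟶ T.split s) := by
  have hS : DGraph.IsSide (T₁.splitHom s₁ ≫ k).toFun s.v s.X
      (R := (T₁.split s₁).toDGraph) (.inr (some true)) {.inr none} :=
    { ne := fun h => by cases h
      map := hv
      mapS := by rintro _ rfl; exact hv
      notMem := fun h => by cases h
      notMem' := fun h => by cases h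
      r := by
        rintro (x | _ | _ | _) hx h1 h2
        · refine iff_of_false (fun h => ?_) (fun h => by cases h)
          by_cases hxX : x ∈ s₁.X
          · exact hX₁ x hxX ((hx : k.toFun x = s.v) ▸ s.mem)
          · cases (DGraph.expand_r_of_notMem s₁.mem s₁.sub hxX).symm.trans h
        · exact Iff.rfl
        · exact absurd rfl h2
        · exact absurd rfl h1
      ι := by rintro _ rfl; rfl
      r_mem := rfl
      r_notMem := fun h => by cases h
      mem := by
        rintro (x | b) hx
        · refine (hX x hx).trans ⟨fun h => DGraph.expand_r_of_mem s₁.mem s₁.sub h, fun h => ?_⟩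
          by_contra hxX
          cases (DGraph.expand_r_of_notMem s₁.mem s₁.sub hxX).symm.trans h
        · exact absurd ((hv : _ = s.v) ▸ s.mem) hx.2 }
  obtain ⟨k', -⟩ := IsSide.exists_hom _ s.mem s.sub s.two_le s.le_val hS
  exact ⟨k'⟩

/-- The two splittings have a common refinement. -/
def Split.Compat {T : Gr 0 B} (s s' : T.Split) : Prop :=
  ∃ R : Gr 0 B, Nonempty (R ⟶ T.split s) ∧ Nonempty (R ⟶ T.split s')

/-- Splittings of different vertices can be performed one after the other. -/
lemma Split.compat_of_ne {T : Gr 0 B} (s s' : T.Split) (h : s.v ≠ s'.v) : s.Compat s' := by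
  have hn := Set.ncard_image_of_injective s'.X (Sum.inl_injective (α := T.F) (β := Option Bool))
  let s₁ : (T.split s).Split :=
    { v := .inl s'.v
      mem := DGraph.inl_mem_V s.mem s.sub s'.mem
      X := Sum.inl '' s'.X
      sub := by
        refine Set.Subset.trans ?_ (DGraph.flagsAt_inl s.mem s.sub h.symm).ge
        exact Set.image_mono s'.sub
      two_le := s'.two_le.trans hn.ge
      le_val := by
        refine (Nat.add_le_add_right hn.le 2).trans (s'.le_val.trans ?_)
        exact (DGraph.val_inl s.mem s.sub s'.mem h.symm).ge }
  refine ⟨(T.split s).split s₁, ⟨(T.split s).splitHom s₁⟩,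
    Split.nonempty_hom (T.splitHom s) s₁ s' rfl ?_ ?_⟩
  · rintro (x | b) hx
    · exact ⟨fun h => ⟨x, h, rfl⟩, fun ⟨y, hy, h⟩ => Sum.inl_injective h ▸ hy⟩
    · exact absurd s.mem hx.2
  · rintro _ ⟨x, hx, rfl⟩
    exact (s'.sub hx).2

/-- Splitting off `X` creates a vertex with the flags in `X`, from which a smaller set can be split
off. -/
lemma Split.compat_of_ssubset {T : Gr 0 B} (s s' : T.Split) (h : s.v = s'.v) (hX : s'.X ⊂ s.X) :
    s.Compat s' := by
  have hn := Set.ncard_image_of_injective s'.X (Sum.inl_injective (α := T.F) (β := Option Bool))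
  have hlt := Set.ncard_lt_ncard hX (Set.toFinite _)
  let s₁ : (T.split s).Split :=
    { v := .inr none
      mem := DGraph.inr_none_mem_V s.mem s.sub
      X := Sum.inl '' s'.X
      sub := by
        refine Set.Subset.trans ?_ (DGraph.flagsAt_inr_none s.mem s.sub).ge
        exact (Set.image_mono hX.1).trans (Set.subset_insert _ _)
      two_le := s'.two_le.trans hn.ge
      le_val := by
        refine (Nat.add_le_add_right hn.le 2).trans
          (Nat.le_trans ?_ (DGraph.val_inr_none s.mem s.sub).ge)
        omega }
  refine ⟨(T.split s).split s₁, ⟨(T.split s).splitHom s₁⟩,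
    Split.nonempty_hom (T.splitHom s) s₁ s' h ?_ ?_⟩
  · rintro (x | b) hx
    · exact ⟨fun h => ⟨x, h, rfl⟩, fun ⟨y, hy, h⟩ => Sum.inl_injective h ▸ hy⟩
    · exact absurd s.mem hx.2
  · rintro _ ⟨x, hx, rfl⟩
    exact (s'.sub hx).2

lemma exists_split_of_four_le (T : Gr 0 B) {v : T.F} (hv : v ∈ T.V) (h : 4 ≤ T.val v) :
    ∃ s : T.Split, s.v = v := by
  rw [← DGraph.ncard_flagsAt hv] at h
  obtain ⟨X, hX, h2⟩ := Set.exists_subset_card_eq (s := T.toDGraph.flagsAt v) (n := 2) (by omega)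
  exact ⟨⟨v, hv, X, hX, h2.ge, by rw [h2, ← DGraph.ncard_flagsAt hv]; exact h⟩, rfl⟩

lemma exists_four_le_val (T : Gr 0 B) (h : Nat.card T.toDGraph.Edge + 3 < Nat.card B) :
    ∃ v ∈ T.V, 4 ≤ T.val v := by
  -- the excess of the valencies over `3` is positive
  have h1 := T.sum_val_add_card_edge
  obtain ⟨v, hv, hne⟩ := Finset.exists_ne_zero_of_sum_ne_zero
    (s := (Set.toFinite T.V).toFinset) (f := fun v => T.val v - 3) (by omega)
  exact ⟨v, by simpa using hv, by omega⟩

/-- Every tree has a trivalent refinement. -/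
lemma exists_trivalent (T : Gr 0 B) :
    ∃ R : Gr 0 B, Nonempty (R ⟶ T) ∧ Nat.card R.toDGraph.Edge + 3 = Nat.card B := by
  have h1 := T.sum_val_add_card_edge
  obtain ⟨n, hn⟩ : ∃ n, Nat.card T.toDGraph.Edge + 3 + n = Nat.card B :=
    ⟨Nat.card B - (Nat.card T.toDGraph.Edge + 3), by omega⟩
  clear h1
  induction n generalizing T with
  | zero => exact ⟨T, ⟨𝟙 T⟩, hn⟩
  | succ n ih =>
    obtain ⟨v, hv, h4⟩ := T.exists_four_le_val (by omega)
    obtain ⟨s, -⟩ := T.exists_split_of_four_le hv h4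
    obtain ⟨R, ⟨f⟩, hR⟩ := ih (T.split s) (by rw [card_edge_split]; omega)
    exact ⟨R, ⟨f ≫ T.splitHom s⟩, hR⟩

/-- In codimension at least two, the splittings of a tree are connected through common
refinements. -/
lemma Split.eq_of_compat {T : Gr 0 B} (h : Nat.card T.toDGraph.Edge + 5 ≤ Nat.card B)
    (f : T.Split → ℤ) (hf : ∀ s s', s.Compat s' → f s = f s') (s s' : T.Split) : f s = f s' := by
  classical
  by_cases hv : s.v = s'.v
  swap
  · exact hf _ _ (s.compat_of_ne s' hv)
  -- if another vertex can be split, its splittings are compatible with both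
  by_cases hw : ∃ w ∈ T.V, w ≠ s.v ∧ 4 ≤ T.val w
  · obtain ⟨w, hwV, hwv, hw4⟩ := hw
    obtain ⟨s₀, rfl⟩ := T.exists_split_of_four_le hwV hw4
    exact (hf s s₀ (s.compat_of_ne s₀ hwv.symm)).trans
      (hf s' s₀ (s'.compat_of_ne s₀ fun h => hwv (h.symm.trans hv.symm))).symm
  push Not at hw
  -- otherwise the whole excess of the valencies over `3` is at the vertex `v`
  have h5 : 5 ≤ T.val s.v := by
    have h1 := T.sum_val_add_card_edge
    rw [Finset.sum_eq_single s.v (fun w hw1 hw2 => by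
      have := hw w (by simpa using hw1) hw2
      omega) (fun h => absurd (by simpa using s.mem) h)] at h1
    omega
  obtain ⟨v, hvV, X, hX, h2, h2'⟩ := s
  obtain ⟨v', hvV', Y, hY, h3, h3'⟩ := s'
  obtain rfl : v = v' := hv
  change 5 ≤ T.val v at h5
  have sub : ∀ (s s' : T.Split), s.v = v → s'.v = v → s'.X ⊆ s.X → f s = f s' := by
    intro s s' hs hs' hss
    rcases hss.eq_or_ssubset with heq | hlt
    · congr 1
      obtain ⟨v1, _, X1, _, _, _⟩ := s
      obtain ⟨v2, _, X2, _, _, _⟩ := s'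
      obtain rfl : v1 = v := hs
      obtain rfl : v2 = v1 := hs'
      obtain rfl : X2 = X1 := heq
      rfl
    · exact hf _ _ (s.compat_of_ssubset s' (hs.trans hs'.symm) hlt)
  -- two sets are connected by their union, which can be split off if two flags remain
  have union : ∀ (s s' : T.Split), s.v = v → s'.v = v → (s.X ∪ s'.X).ncard ≤ 3 → f s = f s' := by
    intro s s' hs hs' hss
    have hle := Set.ncard_le_ncard (Set.subset_union_left (s := s.X) (t := s'.X)) (Set.toFinite _)
    let s₀ : T.Split :=
      { v := v
        mem := hvV
        X := s.X ∪ s'.X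
        sub := Set.union_subset (hs ▸ s.sub) (hs' ▸ s'.sub)
        two_le := s.two_le.trans hle
        le_val := by omega }
    exact (sub s₀ s rfl hs Set.subset_union_left).symm.trans
      (sub s₀ s' rfl hs' Set.subset_union_right)
  have pair : ∀ a ∈ T.toDGraph.flagsAt v, ∀ b ∈ T.toDGraph.flagsAt v, a ≠ b →
      ∃ s : T.Split, s.v = v ∧ s.X = {a, b} := by
    intro a ha b hb hab
    have h6 := Set.ncard_pair hab
    exact ⟨⟨v, hvV, {a, b}, Set.insert_subset ha (Set.singleton_subset_iff.2 hb), h6.ge, by omega⟩,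
      rfl, rfl⟩
  -- pass to two-element subsets `{a, b}` and `{c, d}`, and connect these via `{b, c}`
  obtain ⟨a, ha, b, hb, hab⟩ := (Set.one_lt_ncard (Set.toFinite X)).1 h2
  obtain ⟨c, hc, d, hd, hcd⟩ := (Set.one_lt_ncard (Set.toFinite Y)).1 h3
  obtain ⟨s₁, hs1, hs1'⟩ := pair a (hX ha) b (hX hb) hab
  obtain ⟨s₂, hs2, hs2'⟩ := pair c (hY hc) d (hY hd) hcd
  have three : ∀ x y z : T.F, ({x, y, z} : Set T.F).ncard ≤ 3 := fun x y z => by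
    refine (Set.ncard_insert_le _ _).trans ?_
    have := Set.ncard_insert_le y {z}
    rw [Set.ncard_singleton] at this
    omega
  have e1 : f ⟨v, hvV, X, hX, h2, h2'⟩ = f s₁ := sub _ _ rfl hs1 (by
    rw [hs1']; exact Set.insert_subset ha (Set.singleton_subset_iff.2 hb))
  have e2 : f ⟨v, hvV', Y, hY, h3, h3'⟩ = f s₂ := sub _ _ rfl hs2 (by
    rw [hs2']; exact Set.insert_subset hc (Set.singleton_subset_iff.2 hd))
  rw [e1, e2]
  by_cases hbc : b = c
  · subst hbc
    refine union _ _ hs1 hs2 ?_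
    rw [hs1', hs2', show ({a, b} ∪ {b, d} : Set T.F) = {a, b, d} by ext; simp; tauto]
    exact three _ _ _
  · obtain ⟨s₃, hs3, hs3'⟩ := pair b (hX hb) c (hY hc) hbc
    refine (union _ _ hs1 hs3 ?_).trans (union _ _ hs3 hs2 ?_)
    · rw [hs1', hs3', show ({a, b} ∪ {b, c} : Set T.F) = {a, b, c} by ext; simp; tauto]
      exact three _ _ _
    · rw [hs3', hs2', show ({b, c} ∪ {c, d} : Set T.F) = {b, c, d} by ext; simp; tauto]
      exact three _ _ _

/-- The trivalent trees are connected in codimension one: a function of trees that is constant on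
the trivalent refinements of every tree with one edge less than a trivalent tree is constant on all
trivalent trees. -/
lemma eq_of_codim_one (W : Gr 0 B → ℤ) (hiso : ∀ {R R' : Gr 0 B}, (R ≅ R') → W R = W R')
    (h1 : ∀ T R R' : Gr 0 B, Nat.card T.toDGraph.Edge + 4 = Nat.card B →
      Nat.card R.toDGraph.Edge + 3 = Nat.card B → Nat.card R'.toDGraph.Edge + 3 = Nat.card B →
      (R ⟶ T) → (R' ⟶ T) → W R = W R') (T : Gr 0 B) {R R' : Gr 0 B}
    (hR : Nat.card R.toDGraph.Edge + 3 = Nat.card B)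
    (hR' : Nat.card R'.toDGraph.Edge + 3 = Nat.card B) (f : R ⟶ T) (f' : R' ⟶ T) :
    W R = W R' := by
  obtain ⟨n, hn⟩ : ∃ n, Nat.card T.toDGraph.Edge + 3 + n = Nat.card B :=
    ⟨Nat.card B - (Nat.card T.toDGraph.Edge + 3), by
      have := T.sum_val_add_card_edge
      omega⟩
  induction n generalizing T R R' with
  | zero =>
    obtain ⟨i⟩ := nonempty_iso_of_card f (by omega)
    obtain ⟨i'⟩ := nonempty_iso_of_card f' (by omega)
    exact hiso (i ≪≫ i'.symm)
  | succ n ih =>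
    rcases n with _ | n
    · exact h1 T R R' (by omega) hR hR' f f'
    -- by induction, `W` has only one value on the trivalent refinements of a splitting of `T`
    have key : ∀ s : T.Split, ∃ R₀ : Gr 0 B, Nonempty (R₀ ⟶ T.split s) ∧
        Nat.card R₀.toDGraph.Edge + 3 = Nat.card B := fun s => exists_trivalent _
    choose R₀ hR₀ hR₀' using key
    have hW : ∀ (s : T.Split) {R : Gr 0 B}, Nat.card R.toDGraph.Edge + 3 = Nat.card B →
        (R ⟶ T.split s) → W R = W (R₀ s) := by
      intro s R hR k
      exact ih (T.split s) hR (hR₀' s) k (hR₀ s).some (by rw [card_edge_split]; omega)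
    obtain ⟨s, ⟨k⟩⟩ := nonempty_hom_split f (by omega)
    obtain ⟨s', ⟨k'⟩⟩ := nonempty_hom_split f' (by omega)
    rw [hW s hR k, hW s' hR' k']
    -- compatible splittings have a common trivalent refinement
    refine Split.eq_of_compat (by omega) (fun s => W (R₀ s)) ?_ s s'
    rintro s s' ⟨L, ⟨k⟩, ⟨k'⟩⟩
    obtain ⟨R, ⟨l⟩, hR⟩ := L.exists_trivalent
    exact (hW s hR (l ≫ k)).symm.trans (hW s' hR (l ≫ k'))

end Gr

/-! ### The splits of a tree -/

namespace DGraph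

variable {G : DGraph}

lemma away_subset_compl {x : G.F} : G.away (G.r x) ⊆ ({x, G.ι x} : Set G.F)ᶜ := by
  intro y (hy : G.r y ≠ G.r x ∧ G.r (G.ι y) ≠ G.r x) hy'
  rcases hy' with h | h
  · exact hy.1 (congrArg G.r h)
  · refine hy.2 ?_
    rw [show y = G.ι x from h, G.ι_ι]

lemma joined_compl_symm {x a b : G.F} (h : G.Joined ({x, G.ι x} : Set G.F)ᶜ a b) :
    G.Joined ({x, G.ι x} : Set G.F)ᶜ b a := by
  refine Joined.symm (K := ({x, G.ι x} : Set G.F)ᶜ) (fun y hy hy' => hy ?_) h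
  rcases hy' with h | h
  · exact Or.inr (by rw [← h, G.ι_ι]; rfl)
  · exact Or.inl (by rw [← G.ι_ι y, h, G.ι_ι])

/-- Without the edge of `x`, every vertex of a connected graph is joined to one of its ends. -/
lemma joined_end (hG : G.IsConnOfGenus 0 Set.univ) (x : G.F) {w : G.F} (hw : w ∈ G.V) :
    G.Joined ({x, G.ι x} : Set G.F)ᶜ (G.r x) w ∨
      G.Joined ({x, G.ι x} : Set G.F)ᶜ (G.r (G.ι x)) w := by
  have h := hG.2.1.2 (G.r x) ⟨trivial, r_mem_V _⟩ w ⟨trivial, hw⟩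
  clear hw
  induction h with
  | refl => exact Or.inl Relation.ReflTransGen.refl
  | tail _ hbc ih =>
    obtain ⟨y, -, rfl, rfl⟩ := hbc
    by_cases hy : y ∈ ({x, G.ι x} : Set G.F)
    · rcases hy with rfl | hy
      · exact Or.inr Relation.ReflTransGen.refl
      · rw [show y = G.ι x from hy, G.ι_ι]
        exact Or.inl Relation.ReflTransGen.refl
    · exact ih.imp (fun h => h.tail ⟨y, hy, rfl, rfl⟩) (fun h => h.tail ⟨y, hy, rfl, rfl⟩)

end DGraph

namespace Gr

variable {B : Type} (T : Gr 0 B)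

lemma mem_beyond_iff {x : T.F} (hx : T.ι x ≠ x) {b : B} : b ∈ T.beyond x ↔
    T.toDGraph.Joined ({x, T.ι x} : Set T.F)ᶜ (T.r (T.ι x)) (T.r (T.leg b)) := by
  constructor
  · rintro (rfl | ⟨-, h⟩)
    · exact absurd (T.ι_leg b) hx
    · exact h.mono DGraph.away_subset_compl
  · intro h
    obtain ⟨y, hy, hby⟩ := T.exists_beyond (v := T.r x) (DGraph.r_mem_V x) b
    by_cases hyx : y = x
    · exact hyx ▸ hby
    have h1 : T.toDGraph.Joined ({x, T.ι x} : Set T.F)ᶜ (T.r x) (T.r (T.leg b)) := by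
      rcases hby with rfl | ⟨hι, hj⟩
      · rw [hy.1]; exact Relation.ReflTransGen.refl
      · rw [hy.1] at hj
        refine Relation.ReflTransGen.head ⟨y, ?_, hy.1, rfl⟩ (hj.mono DGraph.away_subset_compl)
        rintro (h | h)
        · exact hyx h
        · exact DGraph.r_ι_ne T.genus hx ((congrArg T.r h).symm.trans hy.1)
    exact absurd (h1.trans (DGraph.joined_compl_symm h)) (DGraph.not_joined_compl T.genus hx)

lemma notMem_beyond_iff {x : T.F} (hx : T.ι x ≠ x) {b : B} : b ∉ T.beyond x ↔
    T.toDGraph.Joined ({x, T.ι x} : Set T.F)ᶜ (T.r x) (T.r (T.leg b)) := by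
  rw [T.mem_beyond_iff hx]
  constructor
  · exact fun h => (DGraph.joined_end T.genus x (DGraph.r_mem_V _)).resolve_right h
  · exact fun h h' => DGraph.not_joined_compl T.genus hx (h.trans (DGraph.joined_compl_symm h'))

lemma mem_beyond_ι {x : T.F} (hx : T.ι x ≠ x) {b : B} :
    b ∈ T.beyond (T.ι x) ↔ b ∉ T.beyond x := by
  have hx' : T.ι (T.ι x) ≠ T.ι x := by rw [T.ι_ι]; exact hx.symm
  rw [T.notMem_beyond_iff hx, T.mem_beyond_iff hx', T.ι_ι, Set.pair_comm]

lemma edgeDist_edgeOf {x : T.F} (hx : T.ι x ≠ x) :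
    T.edgeDist (DGraph.edgeOf x hx) = splitVec (T.beyond x) := by
  refine congrArg Submodule.Quotient.mk (sepVec_congr fun i j => ?_)
  change (¬ T.toDGraph.Joined ({x, T.ι x} : Set T.F)ᶜ _ _ ∨
    ¬ T.toDGraph.Joined ({x, T.ι x} : Set T.F)ᶜ _ _) ↔ _
  have symm : ∀ {a b}, T.toDGraph.Joined ({x, T.ι x} : Set T.F)ᶜ a b →
      T.toDGraph.Joined ({x, T.ι x} : Set T.F)ᶜ b a := DGraph.joined_compl_symm
  by_cases hi : i ∈ T.beyond x <;> by_cases hj : j ∈ T.beyond x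
  · have h1 := (T.mem_beyond_iff hx).1 hi
    have h2 := (T.mem_beyond_iff hx).1 hj
    refine iff_of_false ?_ (by tauto)
    rintro (h | h)
    exacts [h ((symm h1).trans h2), h ((symm h2).trans h1)]
  · refine iff_of_true (Or.inl fun h => hj ?_) (by tauto)
    exact (T.mem_beyond_iff hx).2 (((T.mem_beyond_iff hx).1 hi).trans h)
  · refine iff_of_true (Or.inr fun h => hi ?_) (by tauto)
    exact (T.mem_beyond_iff hx).2 (((T.mem_beyond_iff hx).1 hj).trans h)
  · have h1 := (T.notMem_beyond_iff hx).1 hi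
    have h2 := (T.notMem_beyond_iff hx).1 hj
    refine iff_of_false ?_ (by tauto)
    rintro (h | h)
    exacts [h ((symm h1).trans h2), h ((symm h2).trans h1)]

lemma beyond_of_ι_eq {x : T.F} (hx : T.ι x = x) : T.beyond x = {b | T.leg b = x} := by
  ext b
  exact ⟨fun h => h.resolve_right fun h => h.1 hx, Or.inl⟩

/-- Flags that are not contracted have the same legs beyond them. -/
lemma beyond_map {R T : Gr 0 B} (f : R ⟶ T) {x : R.F} (hx : f.toFun x ∉ T.V) :
    T.beyond (f.toFun x) = R.beyond x := by
  have hf := f.isContraction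
  by_cases hι : R.ι x = x
  · rw [R.beyond_of_ι_eq hι, T.beyond_of_ι_eq (by rw [← hf.ι, hι])]
    ext b
    exact ⟨fun h => (hf.unique _ hx).unique ((f.leg b).trans h) rfl,
      fun h => (f.leg b).symm.trans (congrArg _ h)⟩
  have key : ∀ {x : R.F}, f.toFun x ∉ T.V → R.ι x ≠ x → R.beyond x ⊆ T.beyond (f.toFun x) := by
    intro x hx hι b hb
    have h1 := hf.joined_image ((R.mem_beyond_iff hι).1 hb)
    rw [T.mem_beyond_iff (hf.ι_ne hx hι)]
    rw [hf.r, hf.ι, hf.r, f.leg] at h1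
    refine h1.mono ?_
    rintro _ ⟨y, hy, rfl⟩ (h | h)
    · exact hy (Or.inl ((hf.unique _ hx).unique h rfl))
    · refine hy (Or.inr ((hf.unique (T.ι (f.toFun x)) fun h => hx (DGraph.ι_mem_V.1 h)).unique h
        (hf.ι x)))
  refine Set.Subset.antisymm (fun b hb => ?_) (key hx hι)
  by_contra hb'
  rw [← R.mem_beyond_ι hι] at hb'
  have h2 := key (x := R.ι x) (fun h => hx (DGraph.ι_mem_V.1 (by rwa [← hf.ι])))
    (by rw [R.ι_ι]; exact Ne.symm hι) hb'
  rw [hf.ι, T.mem_beyond_ι (hf.ι_ne hx hι)] at h2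
  exact h2 hb

/-- The legs beyond a flag that points away from the vertex `v` are on a single branch at `v`. -/
lemma branch_eq_of_mem_beyond {v x y y' : T.F} (hx : T.ι x ≠ x) (hv : v ∈ T.V)
    (hxv : T.toDGraph.Joined ({x, T.ι x} : Set T.F)ᶜ (T.r x) v) (hy : T.r y = v)
    (hy' : T.r y' = v) {a c : B} (ha : a ∈ T.beyond y) (hc : c ∈ T.beyond y')
    (hax : a ∈ T.beyond x) (hcx : c ∈ T.beyond x) : y = y' := by
  by_cases hxr : T.r x = v
  · exact (T.beyond_unique hy hxr ha hax).trans (T.beyond_unique hxr hy' hcx hc)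
  obtain ⟨y₀, h0, hι0, hj0⟩ := (DGraph.exists_branch (T.genus.2.1.2 v ⟨trivial, hv⟩ (T.r x)
    ⟨trivial, DGraph.r_mem_V _⟩)).resolve_left hxr
  obtain ⟨y₁, h1, hι1, hj1⟩ := (DGraph.exists_branch (T.genus.2.1.2 (T.r x)
    ⟨trivial, DGraph.r_mem_V _⟩ v ⟨trivial, hv⟩)).resolve_left (Ne.symm hxr)
  have hne : x ≠ y₁ := by
    rintro rfl
    exact DGraph.not_joined_compl T.genus hx
      (hxv.trans (DGraph.joined_compl_symm (hj1.mono DGraph.away_subset_compl)))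
  have key : ∀ {b : B}, b ∈ T.beyond x → b ∈ T.beyond y₀ := by
    intro b hb
    by_contra hb'
    have := T.beyond_of_notMem hv (Ne.symm hxr) h0.1 h1.1 hι0 hι1 hj0
      (by exact hj1) hb'
    exact hne (T.beyond_unique rfl h1.1 hb this)
  exact (T.beyond_unique hy h0.1 ha (key hax)).trans (T.beyond_unique h0.1 hy' (key hcx) hc)

/-- Beyond the new edge are the legs beyond the flags that are split off. -/
lemma mem_beyond_split (s : T.Split) {b : B} :
    b ∈ (T.split s).beyond (.inr (some false)) ↔ ∃ x ∈ s.X, b ∈ T.beyond x := by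
  have hι : (T.split s).ι (.inr (some true)) ≠ .inr (some true) := fun h => by cases h
  have hb : ∀ x ∈ s.X, T.beyond x = (T.split s).beyond (.inl x) := fun x hx =>
    beyond_map (T.splitHom s) (x := .inl x) (s.sub hx).2
  have hc : b ∈ (T.split s).beyond (.inr (some false)) ↔
      b ∉ (T.split s).beyond (.inr (some true)) := (T.split s).mem_beyond_ι hι
  rw [hc]
  constructor
  · intro h
    obtain ⟨y, hy, hby⟩ := (T.split s).exists_beyond (DGraph.inr_none_mem_V s.mem s.sub) b
    rcases (DGraph.flagsAt_inr_none s.mem s.sub).le hy with rfl | ⟨x, hx, rfl⟩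
    · exact absurd hby h
    · exact ⟨x, hx, by rw [hb x hx]; exact hby⟩
  · rintro ⟨x, hx, hbx⟩ h
    rw [hb x hx] at hbx
    have := (T.split s).beyond_unique (v := .inr none) (DGraph.expand_r_of_mem s.mem s.sub hx) rfl
      hbx h
    cases this

end Gr

/-! ### The trivalent refinements of a tree of codimension one -/

section FourPoint

variable {B : Type}

open Classical in
/-- The pair of two different elements. -/
def pairOf {i j : B} (h : i ≠ j) : Pair B := ⟨{i, j}, Finset.card_pair h⟩

open Classical in
lemma sepVec_pairOf (I : Set B) {i j : B} (h : i ≠ j) :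
    sepVec (fun i j => i ∈ I ∧ j ∉ I) (pairOf h) = if i ∈ I ↔ j ∈ I then 0 else 1 := by
  have : (∃ k ∈ (pairOf h).1, ∃ l ∈ (pairOf h).1, k ∈ I ∧ l ∉ I) ↔ ¬ (i ∈ I ↔ j ∈ I) := by
    simp only [pairOf, Finset.mem_insert, Finset.mem_singleton]
    constructor
    · rintro ⟨k, rfl | rfl, l, rfl | rfl, h1, h2⟩ <;> tauto
    · intro h
      by_cases hi : i ∈ I
      · exact ⟨i, Or.inl rfl, j, Or.inr rfl, hi, fun hj => h (iff_of_true hi hj)⟩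
      · exact ⟨j, Or.inr rfl, i, Or.inl rfl, by tauto, hi⟩
  unfold sepVec
  by_cases h1 : i ∈ I ↔ j ∈ I
  · rw [if_neg (fun h => this.1 h h1), if_pos h1]
  · rw [if_pos (this.2 h1), if_neg h1]

variable {a b c d : B} (hac : a ≠ c) (hbd : b ≠ d) (had : a ≠ d) (hbc : b ≠ c)

/-- The functional `x ↦ x_{ac} + x_{bd} - x_{ad} - x_{bc}` on distance vectors, which vanishes if
there is an edge that separates `a` and `b` from `c` and `d`. -/
def fourPoint : Q B →ₗ[ℝ] ℝ :=
  Submodule.liftQ (LinearMap.range (pairSum B))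
    ({ toFun := fun x => x (pairOf hac) + x (pairOf hbd) - x (pairOf had) - x (pairOf hbc)
       map_add' := fun x y => by simp only [Pi.add_apply]; ring
       map_smul' := fun r x => by
        simp only [Pi.smul_apply, smul_eq_mul, RingHom.id_apply]; ring } :
      (Pair B → ℝ) →ₗ[ℝ] ℝ) (by
      rintro _ ⟨x, rfl⟩
      classical
      have h : ∀ {i j : B} (h : i ≠ j), pairSum B x (pairOf h) = x i + x j := fun h =>
        Finset.sum_pair h
      simp only [LinearMap.mem_ker, LinearMap.coe_mk, AddHom.coe_mk, h]
      ring)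

lemma fourPoint_mk (x : Pair B → ℝ) : fourPoint hac hbd had hbc (Submodule.Quotient.mk x) =
    x (pairOf hac) + x (pairOf hbd) - x (pairOf had) - x (pairOf hbc) := rfl

open Classical in
lemma fourPoint_splitVec (I : Set B) : fourPoint hac hbd had hbc (splitVec I) =
    (if a ∈ I ↔ c ∈ I then 0 else 1) + (if b ∈ I ↔ d ∈ I then 0 else 1) -
      (if a ∈ I ↔ d ∈ I then 0 else 1) - (if b ∈ I ↔ c ∈ I then 0 else 1) := by
  rw [← sepVec_pairOf I hac, ← sepVec_pairOf I hbd, ← sepVec_pairOf I had, ← sepVec_pairOf I hbc]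
  exact fourPoint_mk ..

end FourPoint

namespace Gr

variable {B : Type} (T : Gr 0 B)

/-- In codimension one, a single vertex can be split, and it has valency four. -/
lemma exists_val_eq_four [Finite B] (h : Nat.card T.toDGraph.Edge + 4 = Nat.card B) :
    ∃ v ∈ T.V, T.val v = 4 ∧ ∀ s : T.Split, s.v = v := by
  classical
  have h1 := T.sum_val_add_card_edge
  have hmem : ∀ w, w ∈ (Set.toFinite T.V).toFinset ↔ w ∈ T.V := by simp
  obtain ⟨v, hv, h4⟩ := T.exists_four_le_val (by omega)
  have h2 := Finset.single_le_sum (f := fun v => T.val v - 3) (fun _ _ => Nat.zero_le _)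
    ((hmem v).2 hv)
  refine ⟨v, hv, by omega, fun s => ?_⟩
  by_contra hne
  have h3 := Finset.sum_le_sum_of_subset (f := fun v => T.val v - 3)
    (Finset.insert_subset ((hmem v).2 hv) (Finset.singleton_subset_iff.2 ((hmem _).2 s.mem)))
  rw [Finset.sum_pair (Ne.symm hne)] at h3
  have := s.le_val
  have := s.two_le
  omega

lemma beyond_disjoint {v : T.F} {φ : Fin 4 → T.F} (hφ : Function.Injective φ)
    (hr : Set.range φ = T.toDGraph.flagsAt v) {m m' : Fin 4} {b : B} (h : b ∈ T.beyond (φ m))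
    (h' : b ∈ T.beyond (φ m')) : m = m' := by
  have hv : ∀ m, T.r (φ m) = v := fun m => (hr.le ⟨m, rfl⟩ : φ m ∈ T.toDGraph.flagsAt v).1
  exact hφ (T.beyond_unique (hv m) (hv m') h h')

/-- At a vertex of valency four, the three splits that refine the tree add up to the four splits at
the vertex. -/
lemma sum_splitVec {v : T.F} (hv : v ∈ T.V) {φ : Fin 4 → T.F} (hφ : Function.Injective φ)
    (hr : Set.range φ = T.toDGraph.flagsAt v) :
    ∑ i : Fin 3, splitVec (T.beyond (φ 0) ∪ T.beyond (φ i.succ)) =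
      ∑ m : Fin 4, splitVec (T.beyond (φ m)) := by
  classical
  -- `l b` is the number of the branch that carries the leg `b`
  have key : ∀ b, ∃ m, b ∈ T.beyond (φ m) := by
    intro b
    obtain ⟨x, hx, hb⟩ := T.exists_beyond hv b
    rw [← hr] at hx
    obtain ⟨m, rfl⟩ := hx
    exact ⟨m, hb⟩
  choose l hl using key
  have hl' : ∀ b m, b ∈ T.beyond (φ m) ↔ l b = m := fun b m =>
    ⟨fun h => T.beyond_disjoint hφ hr (hl b) h, fun h => h ▸ hl b⟩
  -- for two legs on branches `s ≠ t`, both sides are equal to `2`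
  have hfin : ∀ s t : Fin 4, ∑ i : Fin 3, (if (s = 0 ∨ s = i.succ) ↔ (t = 0 ∨ t = i.succ) then 0
      else 1) = ∑ m : Fin 4, if s = m ↔ t = m then 0 else 1 := by decide
  have hvec : ∑ i : Fin 3, sepVec (fun i' j => i' ∈ T.beyond (φ 0) ∪ T.beyond (φ i.succ) ∧
      j ∉ T.beyond (φ 0) ∪ T.beyond (φ i.succ)) =
      ∑ m : Fin 4, sepVec (fun i j => i ∈ T.beyond (φ m) ∧ j ∉ T.beyond (φ m)) := by
    funext p
    obtain ⟨i, j, hij, hp⟩ : ∃ i j, ∃ h : i ≠ j, p = pairOf h := by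
      obtain ⟨i, j, hij, hp⟩ := Finset.card_eq_two.1 p.2
      refine ⟨i, j, hij, Subtype.ext ?_⟩
      rw [hp]
      unfold pairOf
      ext; simp
    subst hp
    rw [Finset.sum_apply, Finset.sum_apply]
    have := hfin (l i) (l j)
    refine (Finset.sum_congr rfl fun m _ => sepVec_pairOf _ hij).trans (Eq.trans ?_
      (Finset.sum_congr rfl fun m _ => (sepVec_pairOf (T.beyond (φ m)) hij).symm))
    simp only [Set.mem_union, hl']
    have h2 := congrArg (Nat.cast (R := ℝ)) this
    push_cast at h2
    convert h2
  have := congrArg (Submodule.mkQ (LinearMap.range (pairSum B))) hvec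
  rw [map_sum, map_sum] at this
  exact this

/-- The split of a flag is the distance vector of its edge; it is zero for a leg. -/
lemma splitVec_beyond_mem [Finite B] (x : T.F) :
    ∃ n, (T.distLin n : Q B) = splitVec (T.beyond x) := by
  by_cases hι : T.ι x = x
  · refine ⟨0, ?_⟩
    rw [splitVec_of_ncard_le_one]
    · simp
    · rw [T.beyond_of_ι_eq hι, Set.ncard_le_one_iff]
      exact fun h h' => T.leg_injective (h.trans h'.symm)
  · refine ⟨Finsupp.single (DGraph.edgeOf x hι) 1, ?_⟩
    rw [← T.edgeDist_edgeOf hι]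
    simp [distLin]

/-- The four-point functional for legs on four branches at a vertex vanishes on the edges of the
tree, as an edge separates the legs of at most one of these branches from the other branches. -/
lemma fourPoint_edgeDist {v : T.F} (hv : v ∈ T.V) {φ : Fin 4 → T.F} (hφ : Function.Injective φ)
    (hr : Set.range φ = T.toDGraph.flagsAt v) {l : Fin 4 → B} (hl : ∀ m, l m ∈ T.beyond (φ m))
    {a b c d : Fin 4} (hac : l a ≠ l c) (hbd : l b ≠ l d) (had : l a ≠ l d) (hbc : l b ≠ l c)
    (hab : a ≠ b) (hcd : c ≠ d) (e : T.toDGraph.Edge) :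
    fourPoint hac hbd had hbc (T.edgeDist e) = 0 := by
  classical
  -- the half-edge `x` of `e` that points away from `v`
  obtain ⟨x, hx, hxv, rfl⟩ : ∃ x, ∃ hx : T.ι x ≠ x,
      T.toDGraph.Joined ({x, T.ι x} : Set T.F)ᶜ (T.r x) v ∧ DGraph.edgeOf x hx = e := by
    obtain ⟨_, x, hx, rfl⟩ := e
    have hx' : T.ι (T.ι x) ≠ T.ι x := by rw [T.ι_ι]; exact hx.symm
    rcases DGraph.joined_end T.genus x hv with h | h
    · exact ⟨x, hx, h, rfl⟩
    · refine ⟨T.ι x, hx', by rwa [T.ι_ι, Set.pair_comm], Subtype.ext ?_⟩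
      change ({T.ι x, T.ι (T.ι x)} : Set T.F) = {x, T.ι x}
      rw [T.ι_ι, Set.pair_comm]
  have hvφ : ∀ m, T.r (φ m) = v := fun m => (hr.le ⟨m, rfl⟩ : φ m ∈ T.toDGraph.flagsAt v).1
  have key : ∀ {m m' : Fin 4}, m ≠ m' → l m ∈ T.beyond x → l m' ∉ T.beyond x := by
    intro m m' hmm h h'
    exact hmm (hφ (T.branch_eq_of_mem_beyond hx hv hxv (hvφ m) (hvφ m') (hl m) (hl m') h h'))
  have hne : ∀ {m m'}, l m ≠ l m' → m ≠ m' := by rintro m _ h rfl; exact h rfl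
  rw [T.edgeDist_edgeOf hx, fourPoint_splitVec]
  have h1 := key (hne hac)
  have h2 := key (hne hbd)
  have h3 := key (hne had)
  have h4 := key (hne hbc)
  have h5 := key hab
  have h6 := key hcd
  by_cases ha : l a ∈ T.beyond x <;> by_cases hb : l b ∈ T.beyond x <;>
    by_cases hc : l c ∈ T.beyond x <;> by_cases hd : l d ∈ T.beyond x <;>
    simp_all

/-- A tree of codimension one has three trivalent refinements, which correspond to the partitions of
the flags at its vertex of valency four into two pairs, and the weights for which the directions of
their additional edges are balanced are the constant ones. -/
lemma exists_refinements [Finite B] (h : Nat.card T.toDGraph.Edge + 4 = Nat.card B) :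
    ∃ (R : Fin 3 → Gr 0 B) (k : ∀ i, R i ⟶ T) (e : ∀ i, (R i).toDGraph.Edge),
      (∀ i, e i ∉ Set.range (k i).isContraction.edge) ∧
      (∀ i, Nat.card (R i).toDGraph.Edge = Nat.card T.toDGraph.Edge + 1) ∧
      (∀ i j, (R i ≅ R j) → i = j) ∧
      (∀ R' : Gr 0 B, (R' ⟶ T) → Nat.card R'.toDGraph.Edge = Nat.card T.toDGraph.Edge + 1 →
        ∃ i, Nonempty (R' ≅ R i)) ∧
      ∀ c : Fin 3 → ℤ, (∑ i, c i • (⟨(R i).edgeDist (e i), (R i).edgeDist_mem (e i)⟩ : Ndist B) ∈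
        LinearMap.range T.distLin ↔ ∀ i j, c i = c j) := by
  classical
  obtain ⟨v, hv, hval, hs⟩ := T.exists_val_eq_four h
  have hncard := DGraph.ncard_flagsAt hv
  rw [hval] at hncard
  obtain ⟨φ, hφ, hr⟩ : ∃ φ : Fin 4 → T.F, Function.Injective φ ∧
      Set.range φ = T.toDGraph.flagsAt v := by
    let e := (Finite.equivFinOfCardEq (α := T.toDGraph.flagsAt v) hncard).symm
    refine ⟨fun i => (e i).1, fun i j h => e.injective (Subtype.ext h), ?_⟩
    ext x
    exact ⟨by rintro ⟨i, rfl⟩; exact (e i).2, fun h => ⟨e.symm ⟨x, h⟩, by simp⟩⟩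
  have hmem : ∀ m, φ m ∈ T.toDGraph.flagsAt v := fun m => hr.le ⟨m, rfl⟩
  have h0 : ∀ i : Fin 3, φ 0 ≠ φ i.succ := fun i h => by
    have := hφ h
    exact (Fin.succ_ne_zero i) this.symm
  -- a partition into two pairs is given by the partner of the flag `φ 0`
  let s : Fin 3 → T.Split := fun i =>
    { v := v
      mem := hv
      X := {φ 0, φ i.succ}
      sub := Set.insert_subset (hmem _) (Set.singleton_subset_iff.2 (hmem _))
      two_le := (Set.ncard_pair (h0 i)).ge
      le_val := by rw [Set.ncard_pair (h0 i), hval] }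
  have hι : ∀ i, (T.split (s i)).ι (.inr (some false)) ≠ .inr (some false) := fun i h => by
    cases h
  refine ⟨fun i => T.split (s i), fun i => T.splitHom (s i), fun i => DGraph.edgeOf _ (hι i),
    fun i => ?_, fun i => T.card_edge_split _, fun i j f => ?_, fun R' f hR' => ?_, fun c => ?_⟩
  · rintro ⟨e, he⟩
    exact ((T.splitHom (s i)).isContraction.mem_V_iff_of_ι_ne (hι i)).2
      ⟨e, congrArg Subtype.val he⟩ hv
  · -- the isomorphism maps the flags that are split off in one tree to those in the other
    have hf : f.hom ≫ T.splitHom (s j) = T.splitHom (s i) := Subsingleton.elim _ _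
    have hfix : ∀ m, f.hom.toFun (.inl (φ m)) = .inl (φ m) := by
      intro m
      refine ((T.splitHom (s j)).isContraction.unique _ (hmem m).2).unique ?_ rfl
      exact congrArg (fun f : T.split (s i) ⟶ T => f.toFun (.inl (φ m))) hf
    have hri : ∀ m, φ m ∈ (s i).X → (T.split (s j)).r (.inl (φ m)) = f.hom.toFun (.inr none) := by
      intro m hm
      exact (congrArg _ (hfix m).symm).trans ((f.hom.isContraction.r _).symm.trans
        (congrArg _ (DGraph.expand_r_of_mem (s i).mem (s i).sub hm)))
    have h1 := (hri 0 (Or.inl rfl)).trans (hri i.succ (Or.inr rfl)).symm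
    have h2 : φ i.succ ∈ (s j).X := by
      by_contra h
      have h3 := DGraph.expand_r_of_mem (s j).mem (s j).sub (x := φ 0) (Or.inl rfl)
      have h4 := DGraph.expand_r_of_notMem (s j).mem (s j).sub h
      cases h3.symm.trans (h1.trans h4)
    rcases h2 with h2 | h2
    · exact absurd h2.symm (h0 i)
    · exact Fin.succ_injective _ (hφ h2)
  -- passing to the opposite half-edge if necessary, `φ 0` is among the flags that are split off
  · obtain ⟨x, s', S, hx, hxv, hS⟩ := exists_split f (by omega)
    rw [hs s'] at hS
    obtain ⟨X, hX, hX0, x', S', hS'⟩ : ∃ X ⊆ T.toDGraph.flagsAt v, φ 0 ∈ X ∧ ∃ x' S',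
        DGraph.IsSide f.toFun v X x' S' := by
      by_cases h1 : φ 0 ∈ s'.X
      · exact ⟨s'.X, hs s' ▸ s'.sub, h1, _, _, hS⟩
      · exact ⟨_, Set.sdiff_subset, ⟨hmem 0, h1⟩, _, _, hS.compl f.isContraction hv⟩
    obtain ⟨h2, h2'⟩ := IsSide.two_le f hv hX hS'
    obtain ⟨y, hy⟩ : ∃ y, X = {φ 0, y} := by
      obtain ⟨y, z, hyz, rfl⟩ := Set.ncard_eq_two.1 (show X.ncard = 2 by omega)
      rcases hX0 with h | h
      · exact ⟨z, by rw [h]⟩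
      · exact ⟨y, by rw [show φ 0 = z from h, Set.pair_comm]⟩
    have hyf : y ∈ Set.range φ := hr ▸ hX (hy ▸ Or.inr rfl)
    obtain ⟨m, rfl⟩ := hyf
    have hm : m ≠ 0 := by
      rintro rfl
      rw [hy, Set.pair_eq_singleton, Set.ncard_singleton] at h2
      omega
    obtain ⟨i, rfl⟩ := Fin.exists_succ_eq.2 hm
    subst hy
    obtain ⟨k, -⟩ := IsSide.exists_hom f hv (s i).sub (s i).two_le (s i).le_val hS'
    exact ⟨i, nonempty_iso_of_card k (by rw [hR']; exact (T.card_edge_split (s i)).symm)⟩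
  · have hI : ∀ i, (T.split (s i)).beyond (.inr (some false)) =
        T.beyond (φ 0) ∪ T.beyond (φ i.succ) := by
      intro i
      ext b
      rw [T.mem_beyond_split]
      constructor
      · rintro ⟨x, rfl | rfl, hb⟩
        exacts [Or.inl hb, Or.inr hb]
      · rintro (hb | hb)
        exacts [⟨_, Or.inl rfl, hb⟩, ⟨_, Or.inr rfl, hb⟩]
    have hdist : ∀ i, (T.split (s i)).edgeDist (DGraph.edgeOf _ (hι i)) =
        splitVec (T.beyond (φ 0) ∪ T.beyond (φ i.succ)) := fun i =>
      ((T.split (s i)).edgeDist_edgeOf (hι i)).trans (congrArg splitVec (hI i))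
    constructor
    · rintro ⟨n, hn⟩ i j
      have hn' := congrArg Subtype.val hn
      rw [AddSubmonoidClass.coe_finsetSum] at hn'
      simp only [Submodule.coe_smul, hdist] at hn'
      by_contra hij
      have hij' : i ≠ j := fun h => hij (h ▸ rfl)
      -- let `k` be the third index; the four-point functional for the branches `0, k + 1` against
      -- `i + 1, j + 1` vanishes on the refinement `k` and has opposite values on `i` and `j`
      obtain ⟨k, hki, hkj, huniv⟩ : ∃ k, k ≠ i ∧ k ≠ j ∧ (Finset.univ : Finset (Fin 3)) =
          {i, j, k} := by
        clear hij hn' hn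
        revert i j
        decide
      choose l hl using fun m => T.beyond_nonempty (hmem m).2
      have hdis : ∀ {m m'}, l m ∈ T.beyond (φ m') → m = m' := fun h =>
        T.beyond_disjoint hφ hr (hl _) h
      have hmm : ∀ {m m'}, m ≠ m' → l m ≠ l m' := fun h h' => h (hdis (h' ▸ hl _))
      have hs0 : ∀ i : Fin 3, (0 : Fin 4) ≠ i.succ := fun i => (Fin.succ_ne_zero i).symm
      have hss : ∀ {i j : Fin 3}, i ≠ j → i.succ ≠ j.succ := fun h h' =>
        h (Fin.succ_injective _ h')
      set ψ := fourPoint (hmm (hs0 i)) (hmm (hss hkj)) (hmm (hs0 j)) (hmm (hss hki)) with hψ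
      have h1 : ψ (T.distLin n) = 0 := by
        clear hn hn'
        induction n using Finsupp.induction_linear with
        | zero => simp
        | add x y hx hy => rw [map_add, Submodule.coe_add, map_add, hx, hy, add_zero]
        | single e a =>
          simp only [distLin, Finsupp.linearCombination_single, Submodule.coe_smul, map_zsmul]
          rw [T.fourPoint_edgeDist hv hφ hr hl _ _ _ _ (hs0 k) (hss hij'), smul_zero]
      have hmemI : ∀ (m : Fin 4) (i : Fin 3), l m ∈ T.beyond (φ 0) ∪ T.beyond (φ i.succ) ↔
          m = 0 ∨ m = i.succ := fun m i => or_congr ⟨hdis, fun h => h ▸ hl m⟩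
            ⟨hdis, fun h => h ▸ hl m⟩
      rw [hn', huniv, Finset.sum_insert (by simp [hij', hki.symm]), Finset.sum_pair hkj.symm] at h1
      simp only [map_add, map_zsmul, hψ, fourPoint_splitVec, hmemI] at h1
      simp [Fin.succ_ne_zero, hij', hij'.symm, hki, hki.symm, hkj, hkj.symm] at h1
      refine hij (Int.cast_injective (α := ℝ) ?_)
      linarith
    · intro hc
      -- the sum of the three directions is the sum of the splits at the vertex
      choose n hn using fun m => T.splitVec_beyond_mem (φ m)
      refine ⟨c 0 • ∑ m, n m, Subtype.ext ?_⟩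
      rw [map_zsmul, map_sum, AddSubmonoidClass.coe_finsetSum]
      simp only [Submodule.coe_smul, AddSubmonoidClass.coe_finsetSum, hn, hdist, hc _ 0]
      rw [← Finset.smul_sum, T.sum_splitVec hv hφ hr]

end Gr

/-! ### Minkowski weights on compatible subdivisions of the spanning tree complex -/

section Minkowski

universe u v

section Normal

variable {C : Type u} [Category.{v} C] {Φ : C ⥤ Poic} {N : Type} [AddCommGroup N]
  [Module.Free ℤ N] [Module.Finite ℤ N]

lemma Mor.lin_map (X : Mor Φ (underline N)) {s t : C} (f : s ⟶ t) (n : (Φ.obj s).N) :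
    X.lin t ((Φ.map f).lin n) = X.lin s n :=
  LinearMap.congr_fun (congrArg Poic.Hom.lin (X.η.naturality f)) n

/-- If the lattice of `s` is the kernel of a functional that is non-negative on the cone `t` and
equal to `1` at some lattice point of the cone, then the normal vector of `s ⟶ t` is the class of
any lattice point at which the functional is `1`. -/
lemma normalVector_eq (X : Mor Φ (underline N)) {s t : C} (f : s ⟶ t) (ℓ : (Φ.obj t).N →ₗ[ℤ] ℤ)
    (hker : LinearMap.ker ℓ = LinearMap.range (Φ.map f).lin)
    (hpos : ∀ x ∈ (Φ.obj t).carrier, 0 ≤ realFunctional ℓ x) {w : (Φ.obj t).N}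
    (hw : (1 : ℝ) ⊗ₜ[ℤ] w ∈ (Φ.obj t).carrier) (hw1 : ℓ w = 1) {u : (Φ.obj t).N} (hu : ℓ u = 1) :
    normalVector X f = Submodule.Quotient.mk (X.lin t u) := by
  have hex : ∃ v, IsNormalLift (Φ := Φ) f v := by
    refine ⟨w, hw, eq_top_iff.2 fun n _ => ?_⟩
    have h1 : n - ℓ n • w ∈ LinearMap.ker ℓ := by
      rw [LinearMap.mem_ker, map_sub, map_smul, hw1, smul_eq_mul, mul_one, sub_self]
    rw [hker] at h1
    rw [← sub_add_cancel n (ℓ n • w)]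
    exact Submodule.add_mem_sup h1
      (Submodule.smul_mem _ _ (Submodule.mem_span_singleton_self w))
  rw [normalVector, dif_pos hex]
  obtain ⟨hv, hv'⟩ := hex.choose_spec
  set v := hex.choose
  -- `ℓ v` divides `1` and is non-negative
  have h1 : ℓ v = 1 := by
    obtain ⟨a, ha, b, hb, hab⟩ := Submodule.mem_sup.1 (hv'.ge (Submodule.mem_top (x := w)))
    obtain ⟨m, rfl⟩ := Submodule.mem_span_singleton.1 hb
    rw [← hker, LinearMap.mem_ker] at ha
    rw [← hab, map_add, ha, zero_add, map_smul, smul_eq_mul] at hw1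
    have h0 := hpos _ hv
    rw [realFunctional_tmul, mul_one] at h0
    have h0' : 0 ≤ ℓ v := by exact_mod_cast h0
    rcases Int.eq_one_or_neg_one_of_mul_eq_one' hw1 with h | h <;> omega
  have h2 : v - u ∈ LinearMap.ker ℓ := by
    rw [LinearMap.mem_ker, map_sub, h1, hu, sub_self]
  rw [hker] at h2
  obtain ⟨n, hn⟩ := h2
  refine (Submodule.Quotient.eq _).2 ⟨n, ?_⟩
  rw [← map_sub, ← hn, X.lin_map]

end Normal

lemma Poic.dim_eq_of_iso {σ ξ : Poic} (i : σ ≅ ξ) : σ.dim = ξ.dim := by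
  rw [dim_eq_finrank, dim_eq_finrank]
  refine LinearEquiv.finrank_eq (LinearEquiv.ofLinearMap i.hom.lin i.inv.lin ?_ ?_)
  · exact congrArg Poic.Hom.lin i.inv_hom_id
  · exact congrArg Poic.Hom.lin i.hom_inv_id

lemma isoClass_mem_cones {C : Type u} [Category.{v} C] {Φ : C ⥤ Poic} {k : ℕ} {t : C} :
    isoClass t ∈ cones Φ k ↔ (Φ.obj t).dim = k := by
  refine ⟨?_, fun h => ⟨t, rfl, h⟩⟩
  rintro ⟨q, hq, rfl⟩
  obtain ⟨i⟩ := Quotient.exact hq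
  exact (dim_eq_of_iso (Φ.mapIso i)).symm

section ST

variable {g : ℕ} {A : Type} [Finite A]

lemma card_mark (g : ℕ) (A : Type) [Finite A] : Nat.card (Mark g A) = 2 * g + Nat.card A := by
  rw [Nat.card_sum, Nat.card_sum, Nat.card_fin]
  omega

omit [Finite A] in
lemma dim_ST (s : (Gr 0 (Mark g A))ᵒᵖ) :
    ((ST g A).obj s).dim = Nat.card s.unop.toDGraph.Edge + g := by
  refine (dim_eq_card (stBasis s.unop)).trans ?_
  rw [Nat.card_sum, Nat.card_fin]

/-- Every tree has a trivalent refinement. -/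
lemma isPure_ST (h : 2 < 2 * g + Nat.card A) : IsPure (ST g A) (3 * g + Nat.card A - 3) := by
  intro T
  obtain ⟨R, ⟨f⟩, hR⟩ := Gr.exists_trivalent T.unop
  refine ⟨.op R, ⟨f.op⟩, (dim_ST _).trans ?_⟩
  rw [card_mark] at hR
  change Nat.card R.toDGraph.Edge + g = _
  omega

variable {C : Type u} [Category.{v} C] {Υ : C ⥤ Poic} {S : Mor Υ (ST g A)}

lemma IsSubdivision.isFull (hΥ : HasFaces Υ) (hS : IsSubdivision S)
    (hc : IsCompatible (st g A) S) (h : 2 < 2 * g + Nat.card A) : IsFull S := by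
  intro t
  have := hS.full hΥ hc (by rw [card_mark]; omega) t (Iso.refl _)
  rw [← this, transport]
  have h1 : (ST g A).map (Iso.refl (S.F.obj t)).hom = 𝟙 _ := (ST g A).map_id _
  rw [h1]
  exact (Set.image_congr fun x _ => real_id _ x).trans (Set.image_id _) |>.symm

lemma distST_lin_inl (s : (Gr 0 (Mark g A))ᵒᵖ) (e : s.unop.toDGraph.Edge) :
    (distST g A).lin s (stBasis s.unop (.inl e)) = ⟨_, s.unop.edgeDist_mem e⟩ := by
  have h : stBasis s.unop (.inl e) = (Finsupp.single e 1, 0) := prodBasis_inl _ _ e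
  refine (congrArg ((distST g A).lin s) h).trans ?_
  change s.unop.distLin (Finsupp.single e 1) = _
  rw [Gr.distLin, Finsupp.linearCombination_single, one_smul]

/-- The lattice of a cone of the subdivision has the same image as that of the cone over which it
lies. -/
lemma IsFull.range_lin (hS : IsSubdivision S) (hf : IsFull S) (s : C) :
    LinearMap.range ((S.comp (distST g A)).lin s) = LinearMap.range (S.F.obj s).unop.distLin := by
  ext n
  constructor
  · rintro ⟨m, rfl⟩
    exact ⟨((S.η.app s).lin m).1, rfl⟩
  · rintro ⟨m, rfl⟩
    obtain ⟨u, hu⟩ := (hf.bijective hS s).2 ((m, 0) : (_ →₀ ℤ) × (Fin g →₀ ℤ))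
    exact ⟨u, congrArg (distST g A |>.lin (S.F.obj s)) hu⟩

/-- The normal vector of a facet is the distance vector of the additional edge. -/
lemma IsFull.normalVector_eq (hS : IsSubdivision S) (hf : IsFull S) {s t : C} (f : s ⟶ t)
    (hcard : Nat.card (S.F.obj t).unop.toDGraph.Edge =
      Nat.card (S.F.obj s).unop.toDGraph.Edge + 1)
    {e : (S.F.obj t).unop.toDGraph.Edge}
    (he : e ∉ Set.range (S.F.map f).unop.isContraction.edge) :
    normalVector (S.comp (distST g A)) f =
      Submodule.Quotient.mk ⟨_, (S.F.obj t).unop.edgeDist_mem e⟩ := by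
  classical
  have hbij := hf.bijective hS
  have := Fintype.ofFinite ((S.F.obj t).unop.toDGraph.Edge ⊕ Fin g)
  let L : (Υ.obj t).N →ₗ[ℤ] ((ST g A).obj (S.F.obj t)).N := (S.η.app t).lin
  set b := stBasis (S.F.obj t).unop with hb
  set b' := stBasis (S.F.obj s).unop with hb'
  have hmap : ∀ k, ((ST g A).map (S.F.map f)).lin (b' k) =
      b (Sum.map (S.F.map f).unop.isContraction.edge id k) :=
    ST_map_basis (S.F.map f).unop
  have hnat : ∀ n, (S.η.app t).lin ((Υ.map f).lin n) =
      ((ST g A).map (S.F.map f)).lin ((S.η.app s).lin n) := fun n =>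
    LinearMap.congr_fun (congrArg Poic.Hom.lin (S.η.naturality f)) n
  -- all edges except `e` come from `s`, by counting
  have hrange : ∀ e', e' ≠ e → e' ∈ Set.range (S.F.map f).unop.isContraction.edge := by
    intro e' he'
    by_contra h
    have h1 := Set.ncard_le_card (insert e' (insert e
      (Set.range (S.F.map f).unop.isContraction.edge)))
    rw [Set.ncard_insert_of_notMem (by
        rintro (h' | h')
        exacts [he' h', h h']), Set.ncard_insert_of_notMem he, ← Nat.card_coe_set_eq,
      Nat.card_range_of_injective (S.F.map f).unop.isContraction.edge_injective, hcard] at h1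
    omega
  have hker : LinearMap.ker (b.coord (.inl e)) =
      LinearMap.range ((ST g A).map (S.F.map f)).lin := by
    apply le_antisymm
    · intro n hn
      rw [LinearMap.mem_ker, Module.Basis.coord_apply] at hn
      rw [← b.sum_repr n]
      refine Submodule.sum_mem _ fun k _ => ?_
      by_cases hk : k = .inl e
      · rw [hk, hn, zero_smul]
        exact zero_mem _
      · refine Submodule.smul_mem _ _ ?_
        rcases k with e' | i
        · obtain ⟨e'', rfl⟩ := hrange e' fun h => hk (congrArg _ h)
          exact ⟨_, hmap (.inl e'')⟩
        · exact ⟨_, hmap (.inr i)⟩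
    · rintro _ ⟨n, rfl⟩
      have : b.coord (.inl e) ∘ₗ ((ST g A).map (S.F.map f)).lin = 0 := by
        refine b'.ext fun k => ?_
        rw [LinearMap.comp_apply, hmap, Module.Basis.coord_apply, Module.Basis.repr_self,
          Finsupp.single_eq_of_ne]
        · rfl
        · rcases k with e' | i
          · intro h
            exact he ⟨e', (Sum.inl_injective h).symm⟩
          · rintro ⟨⟩
      exact LinearMap.congr_fun this n
  -- `u` is the basis vector of `e`, and `w` the sum of all basis vectors, a lattice point in the
  -- relative interior of the cone
  obtain ⟨u, hu⟩ := (hbij t).2 (b (.inl e))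
  obtain ⟨w, hw⟩ := (hbij t).2 (∑ k, b k : ((ST g A).obj (S.F.obj t)).N)
  have hcoord : ∀ k, b.coord k (∑ k, b k) = 1 := fun k => by
    simp [Module.Basis.coord_apply, map_sum, Finsupp.single_apply]
  refine (Trop.normalVector_eq _ f (b.coord (.inl e) ∘ₗ L) ?_ (fun x hx => ?_) (w := w) ?_ ?_
    (u := u) ?_).trans ?_
  · ext n
    rw [LinearMap.ker_comp, hker]
    constructor
    · rintro ⟨m, hm⟩
      obtain ⟨m, rfl⟩ := (hbij s).2 m
      exact ⟨m, (hbij t).1 ((hnat m).trans hm)⟩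
    · rintro ⟨m, rfl⟩
      exact ⟨_, (hnat m).symm⟩
  · rw [realFunctional_comp]
    exact (isOrthantal_ST (S.F.obj t).unop).nonneg _ ((S.η.app t).maps x hx) (.inl e)
  · have h1 : real (S.η.app t) (1 ⊗ₜ[ℤ] w) = 1 ⊗ₜ[ℤ] (∑ k, b k) :=
      congrArg (fun n => (1 : ℝ) ⊗ₜ[ℤ] n) hw
    have h2 : real (S.η.app t) (1 ⊗ₜ[ℤ] w) ∈ ((ST g A).obj (S.F.obj t)).relint := by
      rw [h1]
      refine (isOrthantal_ST (S.F.obj t).unop).mem_relint_iff.2 fun k => ?_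
      rw [crd, realFunctional_tmul, hcoord]
      norm_num
    rw [← hf t] at h2
    obtain ⟨y, hy, hyw⟩ := h2
    exact real_injective _ (hbij t).1 hyw ▸ hy.1
  · exact (congrArg (b.coord (.inl e)) hw).trans (hcoord _)
  · refine (congrArg (b.coord (.inl e)) hu).trans ?_
    simp [Module.Basis.coord_apply]
  · refine congrArg Submodule.Quotient.mk ?_
    exact (congrArg ((distST g A).lin (S.F.obj t)) hu).trans (distST_lin_inl _ e)

/-- At a cone of codimension one, there are three maximal cones, and a weight is balanced exactly
if it takes the same value on them. -/
lemma IsFull.exists_star [Finite (IsoClass C)] (hS : IsSubdivision S) (hf : IsFull S) {s : C}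
    {n : ℕ} (hs : (Υ.obj s).dim + 1 = n)
    (hcard : Nat.card (S.F.obj s).unop.toDGraph.Edge + 4 = Nat.card (Mark g A)) :
    ∃ c : Fin 3 → Star Υ n s, Function.Bijective c ∧ ∀ ω : Weight Υ n,
      BalancedAt (S.comp (distST g A)) ω s ↔ ∀ i j, ω (c i).cone = ω (c j).cone := by
  obtain ⟨R, k, e, he, hR, hinj, hsurj, hbal⟩ := (S.F.obj s).unop.exists_refinements hcard
  have hess := hS.essSurj
  have hdim : ∀ t : C, (Υ.obj t).dim = n ↔ Nat.card (S.F.obj t).unop.toDGraph.Edge =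
      Nat.card (S.F.obj s).unop.toDGraph.Edge + 1 := by
    intro t
    rw [hf.dim_eq hS, dim_ST, ← hs, hf.dim_eq hS, dim_ST]
    omega
  -- the cones over the three refinements of the tree
  let t : Fin 3 → C := fun i => S.F.objPreimage (.op (R i))
  let φ : ∀ i, S.F.obj (t i) ≅ .op (R i) := fun i => S.F.objObjPreimageIso _
  have hcardt : ∀ i, Nat.card (S.F.obj (t i)).unop.toDGraph.Edge =
      Nat.card (S.F.obj s).unop.toDGraph.Edge + 1 := fun i => by
    have h1 := dim_eq_of_iso ((ST g A).mapIso (φ i))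
    rw [dim_ST, dim_ST] at h1
    rw [← hR i]
    exact Nat.add_right_cancel h1
  let c : Fin 3 → Star Υ n s := fun i => ⟨isoClass (t i), t i, rfl, (hdim _).2 (hcardt i),
    hf.nonempty_hom hS ((k i).op ≫ (φ i).inv)⟩
  have hc : Function.Bijective c := by
    constructor
    · intro i j hij
      obtain ⟨ψ⟩ := Quotient.exact (congrArg Subtype.val hij)
      exact (hinj j i ((φ i).symm ≪≫ S.F.mapIso ψ ≪≫ φ j).unop).symm
    · intro d
      have hd : (Υ.obj d.rep).dim = n := d.2.choose_spec.2.1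
      obtain ⟨i, ⟨ψ⟩⟩ := hsurj (S.F.obj d.rep).unop (S.F.map d.hom).unop ((hdim _).1 hd)
      refine ⟨i, Subtype.ext (Eq.trans ?_ d.2.choose_spec.1)⟩
      exact Quotient.sound (hf.nonempty_iso hS (φ i ≪≫ ψ.op))
  refine ⟨c, hc, fun ω => ?_⟩
  have hnormal : ∀ i, normalVector (S.comp (distST g A)) (c i).hom =
      Submodule.Quotient.mk ⟨_, (R i).edgeDist_mem (e i)⟩ := by
    intro i
    obtain ⟨ψ⟩ : Nonempty ((c i).rep ≅ t i) := Quotient.exact (c i).2.choose_spec.1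
    let θ : (S.F.obj (c i).rep).unop ⟶ R i := ((φ i).inv ≫ S.F.map ψ.inv).unop
    have hθ : (S.F.map (c i).hom).unop = θ ≫ k i := Subsingleton.elim _ _
    refine (hf.normalVector_eq hS (c i).hom ((hdim _).1 (c i).2.choose_spec.2.1)
      (e := θ.isContraction.edge (e i)) ?_).trans ?_
    · rintro ⟨e', he'⟩
      refine he i ⟨e', θ.isContraction.edge_injective (Eq.trans ?_ he')⟩
      rw! [hθ]
      rfl
    · exact congrArg Submodule.Quotient.mk (Subtype.ext (Gr.edgeDist_map θ (e i)))
  rw [← hbal fun i => ω (c i).cone, BalancedAt,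
    ← finsum_comp_equiv (Equiv.ofBijective c hc), finsum_eq_sum_of_fintype,
    ← hf.range_lin hS, ← Submodule.Quotient.mk_eq_zero, ← Submodule.mkQ_apply, map_sum]
  simp only [Equiv.ofBijective_apply, map_zsmul, Submodule.mkQ_apply]
  exact Eq.congr_left (Finset.sum_congr rfl fun i _ => congrArg _ (hnormal i))

/-- The Minkowski weights of top dimension are the constant ones: a balanced weight takes the same
value on the refinements of a tree of codimension one, and trivalent trees are connected through
these. -/
lemma IsFull.mem_minkowski_iff [Finite (IsoClass C)] (hS : IsSubdivision S) (hf : IsFull S)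
    (h : 2 < 2 * g + Nat.card A) (ω : Weight Υ (3 * g + Nat.card A - 3)) :
    ω ∈ minkowski (S.comp (distST g A)) (3 * g + Nat.card A - 3) ↔ ∀ c c', ω c = ω c' := by
  classical
  have hess := hS.essSurj
  have hB := card_mark g A
  constructor
  · intro hω
    have hmem : ∀ {R : Gr 0 (Mark g A)} (t : C), (S.F.obj t ≅ .op R) →
        Nat.card R.toDGraph.Edge + 3 = Nat.card (Mark g A) →
        isoClass t ∈ cones Υ (3 * g + Nat.card A - 3) := by
      intro R t i hR
      have h1 := dim_eq_of_iso ((ST g A).mapIso i)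
      rw [dim_ST, dim_ST] at h1
      change _ = Nat.card R.toDGraph.Edge + g at h1
      rw [isoClass_mem_cones, hf.dim_eq hS, dim_ST]
      omega
    -- the weight as a function on trees
    let W : Gr 0 (Mark g A) → ℤ := fun R =>
      if hR : isoClass (S.F.objPreimage (.op R)) ∈ cones Υ (3 * g + Nat.card A - 3) then ω ⟨_, hR⟩
      else 0
    have hW : ∀ {R : Gr 0 (Mark g A)} (t : C) (i : S.F.obj t ≅ .op R)
        (ht : isoClass t ∈ cones Υ (3 * g + Nat.card A - 3)), W R = ω ⟨isoClass t, ht⟩ := by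
      intro R t i ht
      have h1 : isoClass (S.F.objPreimage (.op R)) = isoClass t :=
        Quotient.sound (hf.nonempty_iso hS (S.F.objObjPreimageIso (.op R) ≪≫ i.symm))
      exact (dif_pos (h1 ▸ ht)).trans (congrArg ω (Subtype.ext h1))
    have hiso : ∀ {R R' : Gr 0 (Mark g A)}, (R ≅ R') → W R = W R' := by
      intro R R' i
      have h1 : isoClass (S.F.objPreimage (.op R)) = isoClass (S.F.objPreimage (.op R')) :=
        Quotient.sound (hf.nonempty_iso hS
          (S.F.objObjPreimageIso (.op R) ≪≫ i.symm.op ≪≫ (S.F.objObjPreimageIso (.op R')).symm))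
      simp only [W, h1]
    have key : ∀ T R R' : Gr 0 (Mark g A), Nat.card T.toDGraph.Edge + 4 = Nat.card (Mark g A) →
        Nat.card R.toDGraph.Edge + 3 = Nat.card (Mark g A) →
        Nat.card R'.toDGraph.Edge + 3 = Nat.card (Mark g A) →
        (R ⟶ T) → (R' ⟶ T) → W R = W R' := by
      intro T R R' hT hR hR' f f'
      obtain ⟨s, ⟨i⟩⟩ := hess.mem_essImage (.op T)
      have h1 := dim_eq_of_iso ((ST g A).mapIso i)
      rw [dim_ST, dim_ST] at h1
      change _ = Nat.card T.toDGraph.Edge + g at h1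
      have hs : (Υ.obj s).dim + 1 = 3 * g + Nat.card A - 3 := by
        rw [hf.dim_eq hS, dim_ST]
        omega
      obtain ⟨c, hc, hbal⟩ := hf.exists_star hS hs (by omega)
      have h2 := (hbal ω).1 (hω s hs)
      have h3 : ∀ {R : Gr 0 (Mark g A)}, Nat.card R.toDGraph.Edge + 3 = Nat.card (Mark g A) →
          (R ⟶ T) → ∃ j, W R = ω (c j).cone := by
        intro R hR f
        obtain ⟨t, ⟨k⟩⟩ := hess.mem_essImage (.op R)
        obtain ⟨j, hj⟩ := hc.2 ⟨isoClass t, t, rfl, isoClass_mem_cones.1 (hmem t k hR),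
          hf.nonempty_hom hS (i.hom ≫ f.op ≫ k.inv)⟩
        exact ⟨j, (hW t k (hmem t k hR)).trans (congrArg ω (Subtype.ext
          (congrArg Subtype.val hj).symm))⟩
      obtain ⟨j, hj⟩ := h3 hR f
      obtain ⟨j', hj'⟩ := h3 hR' f'
      rw [hj, hj', h2]
    rintro ⟨c, t, rfl, ht⟩ ⟨c', t', rfl, ht'⟩
    have hcard : ∀ t : C, (Υ.obj t).dim = 3 * g + Nat.card A - 3 →
        Nat.card (S.F.obj t).unop.toDGraph.Edge + 3 = Nat.card (Mark g A) := by
      intro t ht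
      rw [hf.dim_eq hS, dim_ST] at ht
      omega
    have hB' : 3 ≤ Nat.card (Mark g A) := by omega
    exact ((hW (R := (S.F.obj t).unop) t (Iso.refl _) _).symm.trans
      (Gr.eq_of_codim_one W hiso key (Gr.star _ hB') (hcard t ht) (hcard t' ht')
        (Gr.toStar hB' _) (Gr.toStar hB' _))).trans
      (hW (R := (S.F.obj t').unop) t' (Iso.refl _) _)
  · intro hω s hs
    have h1 := hs
    rw [hf.dim_eq hS, dim_ST] at h1
    obtain ⟨c, -, hbal⟩ := hf.exists_star hS hs (by omega)
    exact (hbal ω).2 fun i j => hω _ _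

end ST

end Minkowski

/-! ### The group of top-dimensional tropical cycles -/

section Identity

universe u v u' v'

variable {C : Type u} [Category.{v} C] {D : Type u'} [Category.{v'} D]

/-- The identity of a poic-complex. -/
def Mor.id (Φ : C ⥤ Poic) : Mor Φ Φ where
  F := 𝟭 C
  η := { app := fun p => 𝟙 (Φ.obj p) }
  notInFace p τ hτ h := by
    obtain ⟨-, f, -, rfl⟩ := hτ
    refine Set.Subset.antisymm (fun x hx => hx.1) fun x hx => h ⟨x, hx, real_id _ x⟩

lemma transport_id {Φ : C ⥤ Poic} {t s : C} (i : (Mor.id Φ).F.obj t ≅ s) (K) :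
    transport (Mor.id Φ) i K = real (Φ.map i.hom) '' K := by
  rw [transport]
  exact congrArg _ ((Set.image_congr fun x _ => real_id _ x).trans (Set.image_id _))

lemma transport_id_relint {Φ : C ⥤ Poic} {t s : C} (i : (Mor.id Φ).F.obj t ≅ s) :
    transport (Mor.id Φ) i (Φ.obj t).relint = (Φ.obj s).relint :=
  (transport_id i _).trans (image_relint_of_iso (Φ.mapIso i))

lemma cell_id {Φ : C ⥤ Poic} {t s : C} (i : (Mor.id Φ).F.obj t ≅ s) :
    cell (Mor.id Φ) i = (Φ.obj s).relint := by
  rw [cell, transport_id]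
  refine (congrArg (· ∩ (Φ.obj s).relint) (image_carrier_of_iso (Φ.mapIso i))).trans ?_
  exact Set.inter_eq_right.2 fun x hx => hx.1

lemma isSubdivision_id (Φ : C ⥤ Poic) : IsSubdivision (Mor.id Φ) where
  essSurj := inferInstanceAs (𝟭 C).EssSurj
  injective t := Function.injective_id
  bijective t _ := Function.bijective_id
  cover s := by
    ext x
    simp only [Set.mem_iUnion, transport_id_relint, exists_const_iff]
    exact ⟨fun h => ⟨s, ⟨Iso.refl s⟩, h⟩, fun ⟨_, _, h⟩ => h⟩
  disjoint s t t' i i' := Or.inr ⟨by rw [transport_id_relint, transport_id_relint],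
    ⟨i ≪≫ i'.symm⟩⟩
  lift t s f := ⟨s, f, Iso.refl s, (Category.id_comp f).symm⟩

lemma cells_id (Φ : C ⥤ Poic) (s : C) : cells (Mor.id Φ) s = {(Φ.obj s).relint} := by
  ext K
  constructor
  · rintro ⟨t, i, rfl⟩
    exact cell_id i
  · rintro rfl
    exact ⟨s, Iso.refl s, cell_id _⟩

lemma IsPoicFibration.isCompatible_id {Φ : C ⥤ Poic} {𝒳 : D ⥤ Poic} {π : Mor Φ 𝒳}
    (hπ : IsPoicFibration π) : IsCompatible π (Mor.id Φ) := by
  intro p q f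
  rw [cells_id, cells_id, Set.image_singleton, Set.image_singleton, (hπ.relint p).2,
    (hπ.relint q).2]
  exact congrArg _ (image_relint_of_iso (𝒳.mapIso f))

lemma pullback_of_mem {Υ : C ⥤ Poic} {Φ : D ⥤ Poic} (Q : Mor Υ Φ) {k : ℕ} (ω : Weight Φ k)
    {c : cones Υ k} (h : mapIsoClass Q.F c.1 ∈ cones Φ k) : pullback Q ω c = ω ⟨_, h⟩ :=
  dif_pos h

end Identity

variable (g : ℕ) (A : Type) [Finite A]

/-- The identity of the spanning tree complex, as a compatible subdivision. -/
def idSubd : CompatSubd (st g A) where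
  C' := (Gr 0 (Mark g A))ᵒᵖ
  Υ := ST g A
  isComplex := isPoicComplex_ST g A
  S := Mor.id _
  isSubdivision := isSubdivision_id _
  isCompatible := (isPoicFibration_st g A).isCompatible_id

variable {g A} (h : 2 < 2 * g + Nat.card A)

namespace CompatSubd

variable (d : CompatSubd (st g A))

include h in
lemma isFull : IsFull d.S := d.isSubdivision.isFull d.isComplex.toHasFaces d.isCompatible h

include h in
lemma nonempty_cones : Nonempty (cones d.Υ (3 * g + Nat.card A - 3)) := by
  have hess := d.isSubdivision.essSurj
  obtain ⟨q, -, hq⟩ := isPure_ST h (.op (Gr.star (Mark g A) (by rw [card_mark]; omega)))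
  obtain ⟨t, ⟨i⟩⟩ := hess.mem_essImage q
  refine ⟨isoClass t, isoClass_mem_cones.2 ?_⟩
  rw [(d.isFull h).dim_eq d.isSubdivision, Poic.dim_eq_of_iso ((ST g A).mapIso i), hq]

include h in
lemma eq_of_mem (ω : equivMinkowski (distST g A) (st g A) (3 * g + Nat.card A - 3) d) (c c') :
    ω.1 c = ω.1 c' :=
  ((d.isFull h).mem_minkowski_iff d.isSubdivision h ω.1).1 ω.2.1 c c'

/-- The common value of a weight. -/
def value : equivMinkowski (distST g A) (st g A) (3 * g + Nat.card A - 3) d →+ ℤ where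
  toFun ω := ω.1 (d.nonempty_cones h).some
  map_zero' := rfl
  map_add' _ _ := rfl

/-- The constant weights. -/
def const : ℤ →+ equivMinkowski (distST g A) (st g A) (3 * g + Nat.card A - 3) d where
  toFun m := ⟨fun _ => m, ((d.isFull h).mem_minkowski_iff d.isSubdivision h _).2 fun _ _ => rfl,
    fun _ _ _ _ _ _ _ _ _ _ => rfl⟩
  map_zero' := rfl
  map_add' _ _ := rfl

end CompatSubd

include h in
/-- A subdivision between compatible subdivisions preserves dimensions, as both are trivial. -/
lemma mapIsoClass_mem_cones {d d' : CompatSubd (st g A)} (Q : Mor d'.Υ d.Υ)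
    (hQ : Q.comp d.S = d'.S) {n : ℕ} {c : IsoClass d'.C'} (hc : c ∈ cones d'.Υ n) :
    mapIsoClass Q.F c ∈ cones d.Υ n := by
  obtain ⟨t, rfl, rfl⟩ := hc
  refine (isoClass_mem_cones (t := Q.F.obj t)).2 ?_
  rw [(d.isFull h).dim_eq d.isSubdivision, (d'.isFull h).dim_eq d'.isSubdivision, ← hQ]
  rfl

open Classical in
/-- The common value of the weights that represent a cycle. -/
def cycleValue : Cycles (distST g A) (st g A) (3 * g + Nat.card A - 3) →+ ℤ :=
  QuotientAddGroup.lift _ (DirectSum.toAddMonoid fun d => d.value h) (by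
    rw [cycleRelations, AddSubgroup.closure_le]
    rintro _ ⟨d, d', Q, -, hQ, ω, ω', hω, rfl⟩
    change DirectSum.toAddMonoid _ _ = _
    rw [map_sub, DirectSum.toAddMonoid_of, DirectSum.toAddMonoid_of, sub_eq_zero]
    refine (congrFun hω _).trans ?_
    exact (pullback_of_mem Q ω.1 (mapIsoClass_mem_cones h Q hQ (Subtype.property _))).trans
      (d.eq_of_mem h ω _ _))

open Classical in
/-- The cycle represented by a constant weight on the spanning tree complex itself. -/
def constCycle : ℤ →+ Cycles (distST g A) (st g A) (3 * g + Nat.card A - 3) :=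
  (QuotientAddGroup.mk' _).comp ((DirectSum.of (fun d : CompatSubd (st g A) =>
    equivMinkowski (distST g A) (st g A) (3 * g + Nat.card A - 3) d) (idSubd g A)).comp
      ((idSubd g A).const h))

/-- The group of top-dimensional cycles is isomorphic to `ℤ`. -/
def cyclesEquiv : Cycles (distST g A) (st g A) (3 * g + Nat.card A - 3) ≃+ ℤ :=
  AddMonoidHom.toAddEquiv (cycleValue h) (constCycle h) (by
    classical
    refine QuotientAddGroup.addMonoidHom_ext _ (DirectSum.addHom_ext' fun d => ?_)
    ext ω
    -- the weight is the pullback of a constant weight on the spanning tree complex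
    refine QuotientAddGroup.eq.2 (AddSubgroup.subset_closure ⟨idSubd g A, d, d.S, d.isSubdivision,
      rfl, (idSubd g A).const h (d.value h ω), ω, ?_, ?_⟩)
    · funext c
      refine Eq.symm ((pullback_of_mem (Υ := d.Υ) (Φ := ST g A) d.S _
        (mapIsoClass_mem_cones h (d := idSubd g A) d.S rfl c.2)).trans ?_)
      exact d.eq_of_mem h ω _ _
    · rw [neg_add_eq_sub]
      refine congrArg (_ - ·) (congrArg (DirectSum.of _ (idSubd g A)) ?_)
      exact congrArg ((idSubd g A).const h) (DirectSum.toAddMonoid_of _ _ _)) (by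
    classical
    ext
    exact DirectSum.toAddMonoid_of _ _ _)

include h in
lemma isIrreducible_st : IsIrreducible (distST g A) (st g A) (3 * g + Nat.card A - 3) := by
  have e : Cycles (distST g A) (st g A) (3 * g + Nat.card A - 3) ≃ₗ[ℤ] ℤ :=
    (cyclesEquiv h).toIntLinearEquiv
  refine ⟨isPoicFibration_st g A, isPure_ST h, Module.Free.of_equiv e.symm, ?_⟩
  have := e.lift_rank_eq
  simpa using this

end Trop
end

theorem mainTheorem6 (g : ℕ) (A : Type) [Finite A] (h : 2 < 2 * g + Nat.card A) :
    Trop.IsPoicComplex (Trop.ST g A) ∧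
      Trop.IsPure (Trop.ST g A) (3 * g + Nat.card A - 3) ∧
      Trop.IsIrreducible (Trop.distST g A) (Trop.st g A) (3 * g + Nat.card A - 3) :=
  ⟨Trop.isPoicComplex_ST g A, Trop.isPure_ST h, Trop.isIrreducible_st h⟩
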